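/- Let $M$ be a nonempty connected real algebraic (in the sense of Nash) or real analytic generic submanifold of $\mathbb C^n$ of codimension $d\ge 1$ and CR dimension $m=n-d\ge 1$. Near $p\in M$, choose complex affine coordinates $(z,w)\in\mathbb C^m\times\mathbb C^d$ centred at $p$ in which $M$ is given by $\bar w=\Theta(\bar z,z,w)$ with $\Theta$ holomorphic near $0$. Write $\overline\Theta$ for the series with conjugated coefficients, and on $\mathbb C^{2n}\ni(z,w,\zeta,\xi)$ put $$\mathcal L_{s}(z,w,\zeta,\xi)=(z+s,\overline\Theta(z+s,\zeta,\xi),\zeta,\xi),\qquad \underline{\mathcal L}_{s}(z,w,\zeta,\xi)=(z,w,\zeta+s,\Theta(\zeta+s,z,w)).$$ Let $\Gamma_k(z_1,\dots,z_k)=\cdots\underline{\mathcal L}_{z_2}(\mathcal L_{z_1}(0))$ ($k$ alternating factors, $z_i\in\mathbb C^m$) be the Segre chains, and let $\psi^k$ be the $(z,w)$-component of $\Gamma_k$ if $k$ is odd and its $(\zeta,\xi)$-component if $k$ is even. The Segre multitype at $p$ of the complexification $\mathcal M$ of $M$ is the tuple $(m,m,e_3,\dots,e_\mu)$ of the jumps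 of the generic ranks (at $0$) of the $\Gamma_k$, where $\mu\ge 2$, $e_k>0$ for $3\le k\le\mu$, and the generic rank of $\Gamma_k$ is constant for $k\ge\mu$; $\mu$ is the Segre type of $\mathcal M$ at $p$. The Segre type $\nu$ of $M$ at $p$ is the least integer at which the generic ranks of $\psi^{\nu}$ and $\psi^{\nu+1}$ agree, and the Segre multitype of $M$ at $p$ is the tuple of the jumps of the generic ranks of $\psi^1,\dots,\psi^\nu$. These do not depend on the choice of coordinates. The CR orbit of a point is the set of endpoints of piecewise $C^1$ curves in $M$ starting at that point with velocity in $T^cM=TM\cap iTM$; the local CR orbit is the germ obtained by doing this in arbitrarily small neighbourhoods of the point. Then there are a proper real algebraic, respectively real analytic, subvariety $E$ of $M$ (locally in $M$ the set of common zeros of finitely many Nash, respectively real analytic, functions) and integers $\nu_M\le d+1$, $\mu_M=\nu_M+1$, $e_{3,M},\dots,e_{\mu_M,M}\ge1$ such that, with $d_M=e_{3,M}+\cdots+e_{\mu_M,M}\le d$ and $d_{2,M}=d-d_M$, the following holds at every $p\in M\setminus E$. (a) The complexification of $M$ has Segre type $\mu_M$ and Segre multitype $(m,m,e_{3,M},\dots,e_{\mu_M,M})$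 at $p$; $M$ has Segre type $\nu_M$ and Segre multitype $(m,e_{3,M},\dots,e_{\mu_M,M})$ at $p$; and the local CR orbit of $M$ at $p$ is a submanifold of real dimension $2m+d_M$. (b) A neighbourhood of $p$ in $M$ is foliated by CR orbits: there are an open neighbourhood $U$ of $p$ in $\mathbb C^n$ and complex algebraic, respectively complex analytic, functions $h_1,\dots,h_{d_{2,M}}$ on $U$ with $\partial h_1\wedge\cdots\wedge\partial h_{d_{2,M}}\ne0$ on $U$ such that (1) $M\cap U\subset\{h_1=\bar h_1,\dots,h_{d_{2,M}}=\bar h_{d_{2,M}}\}$; (2) for every $c\in\mathbb R^{d_{2,M}}$ for which it is nonempty, $M_c=M\cap U\cap\{h_1=c_1,\dots,h_{d_{2,M}}=c_{d_{2,M}}\}$ is a CR orbit of $M\cap U$, and it represents the local CR orbit of $M$ at each of its points. -/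

import Mathlib

open Set Filter Topology

noncomputable section

namespace SegreCR

/-- The two regularity classes: (real or complex) analytic, and algebraic in the sense of Nash. -/
inductive Regularity where
  | analytic : Regularity
  | algebraic : Regularity

/-- `f` is real analytic at `x`; in the algebraic class it satisfies in addition, near `x`, a
nonzero polynomial equation `P (Re y, Im y, f y) = 0` with real coefficients. -/
def IsRealRegularAt (κ : Regularity) {n : ℕ} (f : (Fin n → ℂ) → ℝ) (x : Fin n → ℂ) : Prop :=
  AnalyticAt ℝ f x ∧
    (κ = Regularity.algebraic →
      ∃ P : MvPolynomial ((Fin n ⊕ Fin n) ⊕ Unit) ℝ, P ≠ 0 ∧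
        ∀ᶠ y in 𝓝 x,
          MvPolynomial.eval
            (Sum.elim (Sum.elim (fun i => (y i).re) (fun i => (y i).im)) (fun _ => f y)) P = 0)

/-- `h` is complex analytic at `x`; in the algebraic class it satisfies in addition, near `x`, a
nonzero polynomial equation `P (y, h y) = 0` with complex coefficients. -/
def IsComplexRegularAt (κ : Regularity) {n : ℕ} (h : (Fin n → ℂ) → ℂ) (x : Fin n → ℂ) : Prop :=
  AnalyticAt ℂ h x ∧
    (κ = Regularity.algebraic →
      ∃ P : MvPolynomial (Fin n ⊕ Unit) ℂ, P ≠ 0 ∧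
        ∀ᶠ y in 𝓝 x, MvPolynomial.eval (Sum.elim y (fun _ => h y)) P = 0)

/-- Near its point `x`, the set `M` is a real submanifold of `ℂⁿ` of real codimension `c`: the
zero set of `c` regular real functions whose real differentials at `x` are independent. -/
def IsSubmanifoldAt (κ : Regularity) {n : ℕ} (M : Set (Fin n → ℂ)) (c : ℕ) (x : Fin n → ℂ) :
    Prop :=
  ∃ r : Fin c → (Fin n → ℂ) → ℝ,
    (∀ j, IsRealRegularAt κ (r j) x) ∧
    LinearIndependent ℝ (fun j => fderiv ℝ (r j) x) ∧
    ∀ᶠ y in 𝓝 x, (y ∈ M ↔ ∀ j, r j y = 0)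

/-- `M` is an (embedded) real submanifold of `ℂⁿ` of real codimension `c`. -/
def IsSubmanifold (κ : Regularity) {n : ℕ} (M : Set (Fin n → ℂ)) (c : ℕ) : Prop :=
  ∀ x ∈ M, IsSubmanifoldAt κ M c x

/-- The real tangent space of `M` at `x`: the vectors killed by the differential of every real
analytic function near `x` that vanishes on `M`. -/
def tangentSpace {n : ℕ} (M : Set (Fin n → ℂ)) (x : Fin n → ℂ) : Submodule ℝ (Fin n → ℂ) where
  carrier := {v | ∀ f : (Fin n → ℂ) → ℝ, AnalyticAt ℝ f x → (∀ᶠ y in 𝓝[M] x, f y = 0) →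
    fderiv ℝ f x v = 0}
  add_mem' := by
    intro a b ha hb f hf hM
    rw [map_add, ha f hf hM, hb f hf hM, add_zero]
  zero_mem' := by
    intro f _ _
    exact map_zero _
  smul_mem' := by
    intro c v hv f hf hM
    rw [map_smul, hv f hf hM, smul_zero]

/-- The complex tangent space `T_x M ∩ i T_x M`. -/
def complexTangentSpace {n : ℕ} (M : Set (Fin n → ℂ)) (x : Fin n → ℂ) : Set (Fin n → ℂ) :=
  {v | v ∈ tangentSpace M x ∧ Complex.I • v ∈ tangentSpace M x}

/-- `M` is a generic submanifold of real codimension `d`: `T_x M + i T_x M = ℂⁿ` at every point. -/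
def IsGenericSubmanifold (κ : Regularity) {n : ℕ} (M : Set (Fin n → ℂ)) (d : ℕ) : Prop :=
  IsSubmanifold κ M d ∧
    ∀ x ∈ M, ∀ v : Fin n → ℂ,
      ∃ a ∈ tangentSpace M x, ∃ b ∈ tangentSpace M x, v = a + Complex.I • b

/-- `E` is a proper real analytic (algebraic) subvariety of `M`: a proper subset which near every
point of `M` is the set of common zeros in `M` of finitely many regular real functions. -/
def IsProperSubvariety (κ : Regularity) {n : ℕ} (M E : Set (Fin n → ℂ)) : Prop :=
  E ⊂ M ∧
    ∀ x ∈ M, ∃ (N : ℕ) (f : Fin N → (Fin n → ℂ) → ℝ),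
      (∀ i, IsRealRegularAt κ (f i) x) ∧
      ∀ᶠ y in 𝓝 x, (y ∈ E ↔ y ∈ M ∧ ∀ i, f i y = 0)

/-! ### CR orbits -/

/-- `x` is joined to `y` by a `C¹` curve in `M` whose velocity is everywhere complex tangent. -/
def CRStep {n : ℕ} (M : Set (Fin n → ℂ)) (x y : Fin n → ℂ) : Prop :=
  ∃ γ : ℝ → (Fin n → ℂ), ContDiffOn ℝ 1 γ (Icc 0 1) ∧ γ 0 = x ∧ γ 1 = y ∧
    ∀ t ∈ Icc (0 : ℝ) 1, γ t ∈ M ∧ derivWithin γ (Icc 0 1) t ∈ complexTangentSpace M (γ t)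

/-- The CR orbit of `x` in `M`: the endpoints of piecewise `C¹` complex tangent curves in `M`
starting at `x`. -/
def crOrbit {n : ℕ} (M : Set (Fin n → ℂ)) (x : Fin n → ℂ) : Set (Fin n → ℂ) :=
  {y | Relation.ReflTransGen (CRStep M) x y}

/-- `N` represents the local CR orbit of `M` at `x`: in arbitrarily small open neighbourhoods `U`
of `x`, it coincides with the CR orbit of `x` in `M ∩ U`. -/
def IsLocalCROrbit {n : ℕ} (M : Set (Fin n → ℂ)) (x : Fin n → ℂ) (N : Set (Fin n → ℂ)) : Prop :=
  ∀ V ∈ 𝓝 x, ∃ U : Set (Fin n → ℂ), IsOpen U ∧ x ∈ U ∧ U ⊆ V ∧ N ∩ U = crOrbit (M ∩ U) x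

/-- The local CR orbit of `M` at `x` is a submanifold of real dimension `k`. -/
def HasCROrbitDim (κ : Regularity) {n : ℕ} (M : Set (Fin n → ℂ)) (x : Fin n → ℂ) (k : ℕ) : Prop :=
  ∃ (N : Set (Fin n → ℂ)) (c : ℕ), c + k = 2 * n ∧ IsSubmanifold κ N c ∧ IsLocalCROrbit M x N

/-! ### Segre chains -/

/-- The space of the variables `(z, w, ζ, ξ)`, where `ζ, ξ` complexify the conjugates of `z, w`. -/
abbrev ComplexifiedSpace (m d : ℕ) : Type :=
  (Fin m → ℂ) × (Fin d → ℂ) × (Fin m → ℂ) × (Fin d → ℂ)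

/-- Complex affine coordinates `(z, w) = coord (t - p)` centred at `p`, and complex defining
equations `w̄ = Θ (z̄, z, w)` of `M` near `p`, with `Θ = Θ (ζ, z, w)` complex analytic at `0`. -/
structure SegreChart {n : ℕ} (M : Set (Fin n → ℂ)) (p : Fin n → ℂ) (m d : ℕ) where
  coord : (Fin n → ℂ) ≃L[ℂ] (Fin m → ℂ) × (Fin d → ℂ)
  Θ : (Fin m → ℂ) × (Fin m → ℂ) × (Fin d → ℂ) → (Fin d → ℂ)
  analytic : AnalyticAt ℂ Θ 0
  mem_iff : ∀ᶠ t in 𝓝 p, (t ∈ M ↔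
    star (coord (t - p)).2 = Θ (star (coord (t - p)).1, (coord (t - p)).1, (coord (t - p)).2))

variable {m d : ℕ}

/-- `Θ̄ (z, ζ, ξ)`: the function `Θ` with conjugated Taylor coefficients. -/
def conjTheta (Θ : (Fin m → ℂ) × (Fin m → ℂ) × (Fin d → ℂ) → (Fin d → ℂ))
    (a : (Fin m → ℂ) × (Fin m → ℂ) × (Fin d → ℂ)) : Fin d → ℂ :=
  star (Θ (star a.1, star a.2.1, star a.2.2))

/-- The multiple flow of the complexified `(1,0)` vector fields
`∂/∂z_k + ∑_j (∂Θ̄_j/∂z_k)(z, ζ, ξ) ∂/∂w_j` on the complexification of `M`. -/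
def flow (Θ : (Fin m → ℂ) × (Fin m → ℂ) × (Fin d → ℂ) → (Fin d → ℂ)) (s : Fin m → ℂ)
    (q : ComplexifiedSpace m d) : ComplexifiedSpace m d :=
  (q.1 + s, conjTheta Θ (q.1 + s, q.2.2.1, q.2.2.2), q.2.2.1, q.2.2.2)

/-- The multiple flow of the complexified `(0,1)` vector fields
`∂/∂ζ_k + ∑_j (∂Θ_j/∂ζ_k)(ζ, z, w) ∂/∂ξ_j` on the complexification of `M`. -/
def conjFlow (Θ : (Fin m → ℂ) × (Fin m → ℂ) × (Fin d → ℂ) → (Fin d → ℂ)) (s : Fin m → ℂ)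
    (q : ComplexifiedSpace m d) : ComplexifiedSpace m d :=
  (q.1, q.2.1, q.2.2.1 + s, Θ (q.2.2.1 + s, q.1, q.2.1))

/-- The `k`-th Segre chain `Γ_k (z_1, …, z_k)`: starting at the origin, follow alternately the
two flows, beginning with `flow`. -/
def segreChain (Θ : (Fin m → ℂ) × (Fin m → ℂ) × (Fin d → ℂ) → (Fin d → ℂ)) :
    (k : ℕ) → (Fin k → Fin m → ℂ) → ComplexifiedSpace m d
  | 0, _ => 0
  | k + 1, u =>
    if Even k then flow Θ (u (Fin.last k)) (segreChain Θ k (fun i => u i.castSucc))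
    else conjFlow Θ (u (Fin.last k)) (segreChain Θ k (fun i => u i.castSucc))

/-- The projected chain `ψ^k`: the `(ζ, ξ)` component of `Γ_k` for `k` even, and the `(z, w)`
component for `k` odd. -/
def segreMap (Θ : (Fin m → ℂ) × (Fin m → ℂ) × (Fin d → ℂ) → (Fin d → ℂ)) (k : ℕ)
    (u : Fin k → Fin m → ℂ) : (Fin m → ℂ) × (Fin d → ℂ) :=
  if Even k then ((segreChain Θ k u).2.2.1, (segreChain Θ k u).2.2.2)
  else ((segreChain Θ k u).1, (segreChain Θ k u).2.1)

/-- The generic rank of (the germ at `x₀` of) an analytic map: the largest `r` such that the rank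
of the differential is at least `r` at points arbitrarily close to `x₀`. -/
def genericRank {V W : Type*} [NormedAddCommGroup V] [NormedSpace ℂ V] [NormedAddCommGroup W]
    [NormedSpace ℂ W] (F : V → W) (x₀ : V) : ℕ :=
  sSup {r : ℕ | ∃ᶠ x in 𝓝 x₀, r ≤ Module.finrank ℂ (LinearMap.range (fderiv ℂ F x).toLinearMap)}

/-- The complexification of `M` has at `p` Segre type `μ` and Segre multitype
`(e 1, e 2, e 3, …, e μ) = (m, m, e 3, …, e μ)`: the jumps of the generic ranks of the Segre
chains. The entries of `e` after `μ` are zero. -/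
def HasComplexifiedSegreMultitype {n : ℕ} (M : Set (Fin n → ℂ)) (p : Fin n → ℂ) (m d : ℕ)
    (μ : ℕ) (e : ℕ → ℕ) : Prop :=
  Nonempty (SegreChart M p m d) ∧
    2 ≤ μ ∧ e 1 = m ∧ e 2 = m ∧ (∀ k, 3 ≤ k → k ≤ μ → 0 < e k) ∧ (∀ k, μ < k → e k = 0) ∧
    ∀ (C : SegreChart M p m d) (k : ℕ),
      genericRank (segreChain C.Θ k) 0 = ∑ i ∈ Finset.Icc 1 k, e i

/-- `M` has at `p` Segre type `ν`, the least integer at which the generic ranks of the maps `ψ^k`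
stop growing, and Segre multitype `(ε 1, …, ε ν)`, the jumps of these generic ranks. The entries
of `ε` after `ν` are zero. -/
def HasSegreMultitype {n : ℕ} (M : Set (Fin n → ℂ)) (p : Fin n → ℂ) (m d : ℕ)
    (ν : ℕ) (ε : ℕ → ℕ) : Prop :=
  Nonempty (SegreChart M p m d) ∧ (∀ k, ν < k → ε k = 0) ∧
    ∀ C : SegreChart M p m d,
      IsLeast {k : ℕ | genericRank (segreMap C.Θ k) 0 = genericRank (segreMap C.Θ (k + 1)) 0} ν ∧
      ∀ k : ℕ, genericRank (segreMap C.Θ k) 0 = ∑ i ∈ Finset.Icc 1 k, ε i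

end SegreCR

end

noncomputable section

set_option linter.unusedSectionVars false

namespace SegreCR

open Function (Surjective Injective Bijective)
open Module (finBasis finBasisOfFinrankEq finrank finrank_fin_fun)
open Polynomial (eval₂ eval₂RingHom eval₂_C eval₂_X eval₂_add eval₂_at_zero eval₂_eq_sum_range eval₂_map eval₂_monomial eval₂_mul eval₂_zero)
open Metric (ball ball_mem_nhds mem_ball eventually_nhds_iff_ball isOpen_ball)
open Complex (reCLM imCLM ofRealCLM conj_eq_iff_im)
open LinearMap (toContinuousLinearMap)
open ContinuousLinearMap (fst snd inl inr)

local notation:max "ℂ^" n:max => Fin n → ℂ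

local notation "Tendsto₀ " f:max => Tendsto f (𝓝 0) (𝓝 0)

section CoordinateProjections

open ContinuousLinearMap (proj)

/-! On the complexification of `M`, with coordinates `(z, w, ζ)`, the two multiple flows are local
group actions `actA` and `actB`, and the Segre chains are orbit maps of their alternating iterates.
The proof studies the generic ranks `a k` of these orbit maps.

Stabilization. If two consecutive chains have the same generic rank, the longer one locally takes
its values in the image of the shorter one. The last flow of the shorter one absorbs the next flow
of the same kind, so all later ranks agree (`genericRank_chain_stall`). The ranks start with `m, 2m`
and are bounded by `2m + d`, so they are constant from some `μ ≤ d + 2` on. A chain of length `k +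
1` adds `m` free parameters to the projected chain `ψ^k` (`genericRank_segreChain_succ`), which
gives `ν = μ - 1`.

The exceptional set. A drop of generic rank means that all minors of some size vanish identically, a
priori infinitely many equations in the base point. At a point `p₀` where the sum of the first `d +
3` ranks is maximal, the minors of the right size fail to vanish to some finite order `N`. The set
`E` consists of the points where, for some chain, these minors vanish beyond order `N`. It is given
locally by regular equations because flatness does not depend on the chart (`exists_chain_change`)
and the chains at nearby points form one analytic family. Outside `E` no rank is smaller than at
`p₀`, so by maximality all are equal.

Invariants. Near `p` outside `E` the ranks are constant along `M`, and `M` is maximal totally real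
in its complexification, so the bound `a μ` on the ranks holds for all base points near `p`. Then
`exists_first_integrals` yields `2m + d - a μ = d - d_M` independent functions invariant under both
flows. Invariance under one flow makes them holomorphic functions of `(z, w)`, and invariance under
the other relates them on `M` to conjugates of holomorphic functions; sums and differences are real
on `M` (`exists_real_invariants`). Such functions are constant along CR curves.

Level sets are orbits. An analytic family of curves with directions `(a, b)` contains `actA` for `b
= 0`, `actB` for `a = 0`, and CR curves in `M` for `b` conjugate to `a` (`exists_crFlow`). The pairs
of conjugate directions are a real form, on which the generic rank is still attained. The endpoint
map of piecewise CR curves therefore covers an open piece of a level set of the invariants.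
Returning along the reversed curves covers a neighbourhood of the starting point
(`eventually_mem_crOrbit`), and connected level sets are single orbits.

The Nash case is carried along by `RegAt`: composition, differentiation, inversion and
complexification preserve algebraicity of germs over the polynomial functions. -/

lemma tendsto_cont {X Y : Type} [TopologicalSpace X] [TopologicalSpace Y] {f : X → Y} {a : X}
    {b : Y} (h : f a = b := by simp) (hf : Continuous f := by fun_prop) :
    Tendsto f (𝓝 a) (𝓝 b) :=
  hf.tendsto' a b h

instance {Y : Type} [NormedAddCommGroup Y] [NormedSpace ℂ Y] [FiniteDimensional ℂ Y] :
    CompleteSpace Y :=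
  FiniteDimensional.complete ℂ Y

lemma _root_.ContinuousLinearMap.tendsto_zero {X Y : Type} [NormedAddCommGroup X] [NormedSpace ℂ X]
    [NormedAddCommGroup Y] [NormedSpace ℂ Y] (L : X →L[ℂ] Y) : Tendsto₀ L :=
  L.continuous.tendsto' _ _ (map_zero L)

section Analytic

variable {𝕜 X Y : Type} [NontriviallyNormedField 𝕜] [NormedAddCommGroup X] [NormedSpace 𝕜 X]
  [NormedAddCommGroup Y] [NormedSpace 𝕜 Y] {f : X → Y} {x : X}

lemma _root_.AnalyticAt.tendsto {y : Y} (h : AnalyticAt 𝕜 f x) (e : f x = y) :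
    Tendsto f (𝓝 x) (𝓝 y) :=
  e ▸ h.continuousAt

lemma _root_.AnalyticAt.hasFDerivAt (h : AnalyticAt 𝕜 f x) : HasFDerivAt f (fderiv 𝕜 f x) x :=
  h.differentiableAt.hasFDerivAt

end Analytic

/-! ### Nash functions as germs algebraic over the polynomial functions. -/

section Algebraic

variable {E F : Type} [NormedAddCommGroup E] [NormedSpace ℝ E] [NormedAddCommGroup F]
  [NormedSpace ℝ F]

/-- Near a point, a product of analytic functions vanishes only if one of the factors does. -/
lemma eventually_zero_or_of_mul {f g : E → ℂ} {x : E} (hf : AnalyticAt ℝ f x)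
    (hg : AnalyticAt ℝ g x) (h : ∀ᶠ y in 𝓝 x, f y * g y = 0) :
    (∀ᶠ y in 𝓝 x, f y = 0) ∨ (∀ᶠ y in 𝓝 x, g y = 0) := by
  obtain ⟨ε, hε, hb⟩ := eventually_nhds_iff_ball.1
    ((hf.eventually_analyticAt.and hg.eventually_analyticAt).and h)
  by_cases hz : ∀ y ∈ ball x ε, f y = 0
  · exact Or.inl (Filter.eventually_of_mem (ball_mem_nhds x hε) hz)
  · right
    push Not at hz
    obtain ⟨y, hy, hfy⟩ := hz
    have h1 : g =ᶠ[𝓝 y] 0 := by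
      filter_upwards [(hb y hy).1.1.continuousAt.eventually_ne hfy,
        isOpen_ball.mem_nhds hy] with z hz hzb
      exact (mul_eq_zero.1 (hb z hzb).2).resolve_left hz
    have h2 : EqOn g 0 (ball x ε) :=
      AnalyticOnNhd.eqOn_zero_of_preconnected_of_eventuallyEq_zero (𝕜 := ℝ)
        (fun z hz => (hb z hz).1.2) (convex_ball x ε).isPreconnected hy h1
    exact Filter.eventually_of_mem (ball_mem_nhds x hε) h2

variable (E) in
/-- The algebra of complex valued polynomial functions on the real vector space `E`. -/
def polyFun : Subalgebra ℂ (E → ℂ) :=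
  Algebra.adjoin ℂ (Set.range fun (ℓ : E →L[ℝ] ℝ) (y : E) => ((ℓ y : ℝ) : ℂ))

lemma ofReal_clm_mem_polyFun (ℓ : E →L[ℝ] ℝ) : (fun y => ((ℓ y : ℝ) : ℂ)) ∈ polyFun E :=
  Algebra.subset_adjoin ⟨ℓ, rfl⟩

lemma const_mem_polyFun (a : ℂ) : (fun _ : E => a) ∈ polyFun E :=
  (polyFun E).algebraMap_mem a

lemma polyFun_analyticAt {c : E → ℂ} (hc : c ∈ polyFun E) (x : E) : AnalyticAt ℝ c x := by
  induction hc using Algebra.adjoin_induction with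
  | mem c hc =>
    obtain ⟨ℓ, rfl⟩ := hc
    exact (ofRealCLM.comp ℓ).analyticAt x
  | algebraMap r => exact analyticAt_const
  | add a b _ _ ha hb => exact ha.add hb
  | mul a b _ _ ha hb => exact ha.mul hb

lemma polyFun_comp_affine {c : E → ℂ} (hc : c ∈ polyFun E) (L : F →L[ℝ] E) (b : E) :
    (fun y => c (L y + b)) ∈ polyFun F := by
  induction hc using Algebra.adjoin_induction with
  | mem c hc =>
    obtain ⟨ℓ, rfl⟩ := hc
    have : (fun y => ((ℓ (L y + b) : ℝ) : ℂ)) =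
        (fun y => (((ℓ.comp L) y : ℝ) : ℂ)) + fun _ => ((ℓ b : ℝ) : ℂ) := by
      ext y; simp
    rw [this]
    exact add_mem (ofReal_clm_mem_polyFun _) (const_mem_polyFun _)
  | algebraMap r => exact const_mem_polyFun r
  | add a b _ _ ha hb => exact add_mem ha hb
  | mul a b _ _ ha hb => exact mul_mem ha hb

lemma polyFun_conj {c : E → ℂ} (hc : c ∈ polyFun E) : (fun y => star (c y)) ∈ polyFun E := by
  induction hc using Algebra.adjoin_induction with
  | mem c hc =>
    obtain ⟨ℓ, rfl⟩ := hc
    have : (fun y => star ((ℓ y : ℝ) : ℂ)) = fun y => ((ℓ y : ℝ) : ℂ) := by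
      ext y; simp
    rw [this]
    exact ofReal_clm_mem_polyFun ℓ
  | algebraMap r => exact const_mem_polyFun (star r)
  | add a b _ _ ha hb =>
    have : (fun y => star ((a + b) y)) = (fun y => star (a y)) + fun y => star (b y) := by
      ext y; simp
    rw [this]; exact add_mem ha hb
  | mul a b _ _ ha hb =>
    have : (fun y => star ((a * b) y)) = (fun y => star (a y)) * fun y => star (b y) := by
      ext y; simp
    rw [this]; exact mul_mem ha hb

lemma polyFun_fderiv {c : E → ℂ} (hc : c ∈ polyFun E) (v : E) :
    (fun y => fderiv ℝ c y v) ∈ polyFun E := by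
  induction hc using Algebra.adjoin_induction with
  | mem c hc =>
    obtain ⟨ℓ, rfl⟩ := hc
    have : (fun y => fderiv ℝ (fun y => ((ℓ y : ℝ) : ℂ)) y v) = fun _ => ((ℓ v : ℝ) : ℂ) := by
      ext y
      have := (ofRealCLM.comp ℓ).hasFDerivAt (x := y)
      exact DFunLike.congr_fun this.fderiv v
    rw [this]
    exact const_mem_polyFun _
  | algebraMap r =>
    have : (fun y => fderiv ℝ (algebraMap ℂ (E → ℂ) r) y v) = fun _ => 0 := by
      ext y
      exact DFunLike.congr_fun (hasFDerivAt_const r y).fderiv v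
    rw [this]; exact const_mem_polyFun 0
  | add a b ha' hb' ha hb =>
    have : (fun y => fderiv ℝ (a + b) y v) =
        (fun y => fderiv ℝ a y v) + fun y => fderiv ℝ b y v := by
      ext y
      rw [fderiv_add (polyFun_analyticAt ha' y).differentiableAt
        (polyFun_analyticAt hb' y).differentiableAt]
      simp
    rw [this]; exact add_mem ha hb
  | mul a b ha' hb' ha hb =>
    have : (fun y => fderiv ℝ (a * b) y v) =
        a * (fun y => fderiv ℝ b y v) + b * fun y => fderiv ℝ a y v := by
      ext y
      rw [fderiv_mul (polyFun_analyticAt ha' y).differentiableAt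
        (polyFun_analyticAt hb' y).differentiableAt]
      simp
    rw [this]; exact add_mem (mul_mem ha' hb) (mul_mem hb' ha)

lemma polyFun_eq_zero {c : E → ℂ} (hc : c ∈ polyFun E) {x : E} (h : ∀ᶠ y in 𝓝 x, c y = 0) :
    c = 0 := by
  have := AnalyticOnNhd.eqOn_zero_of_preconnected_of_eventuallyEq_zero (𝕜 := ℝ)
    (f := c) (U := univ) (fun z _ => polyFun_analyticAt hc z) isPreconnected_univ (mem_univ x) h
  exact funext fun y => this (mem_univ y)

/-- Zero divisors are excluded by the identity theorem: a product vanishing near a point has a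
factor vanishing near it, hence everywhere. The domain property is what makes algebraic germs closed
under ring operations. -/
instance : IsDomain (polyFun E) := by
  have : NoZeroDivisors (polyFun E) := by
    refine ⟨fun {a b} h => ?_⟩
    have h' : ∀ᶠ y in 𝓝 (0 : E), a.1 y * b.1 y = 0 :=
      Eventually.of_forall fun y => congrFun (congrArg Subtype.val h) y
    rcases eventually_zero_or_of_mul (polyFun_analyticAt a.2 0) (polyFun_analyticAt b.2 0) h' with
      h | h
    · exact Or.inl (Subtype.ext (polyFun_eq_zero a.2 h))
    · exact Or.inr (Subtype.ext (polyFun_eq_zero b.2 h))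
  exact NoZeroDivisors.to_isDomain _

/-- Evaluation of polynomial functions at a point. -/
def polyEval (y : E) : polyFun E →+* ℂ := (Pi.evalRingHom _ y).comp (polyFun E).val.toRingHom

@[simp] lemma polyEval_apply (y : E) (c : polyFun E) : polyEval y c = c.1 y := rfl

/-- The ring of germs at `x` of complex valued real analytic functions. -/
def analyticGerms (x : E) : Subring (Germ (𝓝 x) ℂ) where
  carrier := {g | ∃ f : E → ℂ, AnalyticAt ℝ f x ∧ g = (f : Germ (𝓝 x) ℂ)}
  mul_mem' := by
    rintro _ _ ⟨f, hf, rfl⟩ ⟨g, hg, rfl⟩; exact ⟨_, hf.mul hg, rfl⟩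
  add_mem' := by
    rintro _ _ ⟨f, hf, rfl⟩ ⟨g, hg, rfl⟩; exact ⟨_, hf.add hg, rfl⟩
  one_mem' := ⟨fun _ => 1, analyticAt_const, rfl⟩
  zero_mem' := ⟨fun _ => 0, analyticAt_const, rfl⟩
  neg_mem' := by
    rintro _ ⟨f, hf, rfl⟩; exact ⟨_, hf.neg, rfl⟩

/-- The germ of an analytic function. -/
def germ {x : E} (f : E → ℂ) (hf : AnalyticAt ℝ f x) : analyticGerms x := ⟨f, f, hf, rfl⟩

lemma germ_eq_zero {x : E} {f : E → ℂ} {hf : AnalyticAt ℝ f x} :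
    germ f hf = 0 ↔ ∀ᶠ y in 𝓝 x, f y = 0 := by
  rw [Subtype.ext_iff]
  exact Germ.coe_eq

lemma exists_germ {x : E} (g : analyticGerms x) :
    ∃ (f : E → ℂ) (hf : AnalyticAt ℝ f x), g = germ f hf := by
  obtain ⟨_, f, hf, rfl⟩ := g
  exact ⟨f, hf, rfl⟩

instance (x : E) : IsDomain (analyticGerms x) := by
  have : NoZeroDivisors (analyticGerms x) := by
    refine ⟨fun {a b} h => ?_⟩
    obtain ⟨f, hf, rfl⟩ := exists_germ a
    obtain ⟨g, hg, rfl⟩ := exists_germ b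
    have : germ (f * g) (hf.mul hg) = 0 := h
    rw [germ_eq_zero] at this ⊢
    rw [germ_eq_zero]
    exact eventually_zero_or_of_mul hf hg this
  have : Nontrivial (analyticGerms x) :=
    ⟨⟨germ (fun _ => 1) analyticAt_const, 0, fun h => by
      simpa using (germ_eq_zero.1 h).self_of_nhds⟩⟩
  exact NoZeroDivisors.to_isDomain _

/-- Pull back of polynomial functions to germs of analytic functions. -/
def pullGerm {x : E} (s : E → F) (hs : AnalyticAt ℝ s x) : polyFun F →+* analyticGerms x where
  toFun c := germ (fun y => c.1 (s y)) ((polyFun_analyticAt c.2 (s x)).comp hs)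
  map_one' := rfl
  map_mul' _ _ := rfl
  map_zero' := rfl
  map_add' _ _ := rfl

instance (x : E) : Algebra (polyFun E) (analyticGerms x) := (pullGerm id analyticAt_id).toAlgebra

lemma analyticAt_eval₂ {x : E} {s : E → F} (hs : AnalyticAt ℝ s x) {g : E → ℂ}
    (hg : AnalyticAt ℝ g x) (P : Polynomial (polyFun F)) :
    AnalyticAt ℝ (fun y => P.eval₂ (polyEval (s y)) (g y)) x := by
  simp only [eval₂_eq_sum_range]
  refine Finset.analyticAt_fun_sum _ fun i _ => ?_
  exact AnalyticAt.mul ((polyFun_analyticAt (P.coeff i).2 (s x)).comp hs) (hg.pow i)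

lemma germ_eval₂ {x : E} {s : E → F} (hs : AnalyticAt ℝ s x) {g : E → ℂ}
    (hg : AnalyticAt ℝ g x) (P : Polynomial (polyFun F)) :
    P.eval₂ (pullGerm s hs) (germ g hg) =
      germ (fun y => P.eval₂ (polyEval (s y)) (g y)) (analyticAt_eval₂ hs hg P) := by
  induction P using Polynomial.induction_on' with
  | add p q hp hq =>
    rw [eval₂_add, hp, hq]
    apply Subtype.ext
    simp only [eval₂_add]
    rfl
  | monomial n a =>
    apply Subtype.ext
    simp only [eval₂_monomial]
    rfl

/-- `g` is analytic at `x`, and its germ is algebraic over the polynomial functions. -/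
def AlgAt (g : E → ℂ) (x : E) : Prop :=
  ∃ h : AnalyticAt ℝ g x, IsAlgebraic (polyFun E) (germ g h)

/-- Evaluating a polynomial at a germ is the germ of the pointwise evaluation. The abstract form
gives closure under ring operations, while the concrete equation can be moved to nearby points. -/
lemma algAt_iff {g : E → ℂ} {x : E} : AlgAt g x ↔ AnalyticAt ℝ g x ∧
    ∃ P : Polynomial (polyFun E), P ≠ 0 ∧ ∀ᶠ y in 𝓝 x, P.eval₂ (polyEval y) (g y) = 0 := by
  have key : ∀ (h : AnalyticAt ℝ g x) (P : Polynomial (polyFun E)),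
      Polynomial.aeval (germ g h) P = 0 ↔ ∀ᶠ y in 𝓝 x, P.eval₂ (polyEval y) (g y) = 0 := by
    intro h P
    have := germ_eval₂ (s := id) analyticAt_id h P
    rw [Polynomial.aeval_def]
    change eval₂ (pullGerm id analyticAt_id) (germ g h) P = 0 ↔ _
    rw [this, germ_eq_zero]
    rfl
  constructor
  · rintro ⟨h, P, hP, h0⟩
    exact ⟨h, P, hP, (key h P).1 h0⟩
  · rintro ⟨h, P, hP, h0⟩
    exact ⟨h, P, hP, (key h P).2 h0⟩

lemma AlgAt.congr {g g' : E → ℂ} {x : E} (h : AlgAt g x) (hg : g =ᶠ[𝓝 x] g') : AlgAt g' x := by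
  rw [algAt_iff] at h ⊢
  obtain ⟨ha, P, hP, h0⟩ := h
  refine ⟨ha.congr hg, P, hP, ?_⟩
  filter_upwards [h0, hg] with y hy hgy
  rw [← hgy, hy]

lemma AlgAt.eventually {g : E → ℂ} {x : E} (h : AlgAt g x) : ∀ᶠ y in 𝓝 x, AlgAt g y := by
  simp only [algAt_iff] at h ⊢
  obtain ⟨ha, P, hP, h0⟩ := h
  filter_upwards [ha.eventually_analyticAt, h0.eventually_nhds] with y hy hy0
  exact ⟨hy, P, hP, hy0⟩

lemma algAt_of_mem {c : E → ℂ} (hc : c ∈ polyFun E) (x : E) : AlgAt c x :=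
  ⟨polyFun_analyticAt hc x, isAlgebraic_algebraMap (R := polyFun E) (A := analyticGerms x) ⟨c, hc⟩⟩

lemma AlgAt.add {f g : E → ℂ} {x : E} (hf : AlgAt f x) (hg : AlgAt g x) :
    AlgAt (fun y => f y + g y) x := by
  obtain ⟨hf, hf'⟩ := hf
  obtain ⟨hg, hg'⟩ := hg
  exact ⟨hf.add hg, hf'.add hg'⟩

lemma AlgAt.mul {f g : E → ℂ} {x : E} (hf : AlgAt f x) (hg : AlgAt g x) :
    AlgAt (fun y => f y * g y) x := by
  obtain ⟨hf, hf'⟩ := hf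
  obtain ⟨hg, hg'⟩ := hg
  exact ⟨hf.mul hg, hf'.mul hg'⟩

lemma AlgAt.conj {f : E → ℂ} {x : E} (hf : AlgAt f x) : AlgAt (fun y => star (f y)) x := by
  rw [algAt_iff] at hf ⊢
  obtain ⟨ha, P, hP, h0⟩ := hf
  let σ : polyFun E →+* polyFun E :=
    { toFun := fun c => ⟨_, polyFun_conj c.2⟩
      map_one' := by ext y; exact star_one _
      map_mul' := fun a b => by ext y; exact star_mul' _ _
      map_zero' := by ext y; exact star_zero _
      map_add' := fun a b => by ext y; exact star_add _ _ }
  have hσ : Injective σ := by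
    intro a b h
    ext y
    exact star_injective (congrFun (congrArg Subtype.val h) y)
  refine ⟨(Complex.conjCLE.toContinuousLinearMap.analyticAt _).comp ha, P.map σ,
    (Polynomial.map_ne_zero_iff hσ).2 hP, ?_⟩
  filter_upwards [h0] with y hy
  have h1 : star (P.eval₂ (polyEval y) (f y)) = 0 := by rw [hy, star_zero]
  rw [eval₂_map]
  have h2 := Polynomial.hom_eval₂ P (polyEval y) (starRingEnd ℂ) (f y)
  rw [starRingEnd_apply] at h2
  rw [h1] at h2
  exact h2.symm

set_option synthInstance.maxHeartbeats 200000 in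
/-- Algebraic functions pull back to algebraic functions along maps with algebraic components
whose image is not contained in a proper algebraic subset. -/
lemma AlgAt.pullback {x : E} {s : E → F} {g : F → ℂ} (hs : AnalyticAt ℝ s x)
    (hsa : ∀ ℓ : F →L[ℝ] ℝ, AlgAt (fun y => ((ℓ (s y) : ℝ) : ℂ)) x)
    (hinj : ∀ c ∈ polyFun F, (∀ᶠ y in 𝓝 x, c (s y) = 0) → c = 0) (hg : AlgAt g (s x)) :
    AlgAt (fun y => g (s y)) x := by
  rw [algAt_iff] at hg
  obtain ⟨hga, P, hP, h0⟩ := hg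
  -- Pulling back sends polynomial functions on `F` injectively into the algebra `A` of algebraic
  -- germs, so the relation for `g` becomes a nontrivial relation over `A`; transitivity of
  -- algebraicity finishes.
  set A := Subalgebra.algebraicClosure (polyFun E) (analyticGerms x)
  have hmem : ∀ c : polyFun F, pullGerm s hs c ∈ A := by
    rintro ⟨c, hc⟩
    have : AlgAt (fun y => c (s y)) x := by
      induction hc using Algebra.adjoin_induction with
      | mem c hc => obtain ⟨ℓ, rfl⟩ := hc; exact hsa ℓ
      | algebraMap r => exact algAt_of_mem (const_mem_polyFun r) x
      | add a b _ _ ha hb => exact ha.add hb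
      | mul a b _ _ ha hb => exact ha.mul hb
    exact this.2
  let ψ : polyFun F →+* A := (pullGerm s hs).codRestrict A hmem
  have hψ : Injective ψ := by
    rw [injective_iff_map_eq_zero]
    intro c h
    have h1 : pullGerm s hs c = 0 := congrArg Subtype.val h
    exact Subtype.ext (hinj c.1 c.2
      ((germ_eq_zero (hf := (polyFun_analyticAt c.2 (s x)).comp hs)).1 h1))
  refine ⟨hga.comp hs, IsAlgebraic.restrictScalars (polyFun E) (S := A) ?_⟩
  refine ⟨P.map ψ, (Polynomial.map_ne_zero_iff hψ).2 hP, ?_⟩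
  rw [Polynomial.aeval_def, eval₂_map]
  change P.eval₂ (pullGerm s hs) (germ (fun y => g (s y)) (hga.comp hs)) = 0
  rw [germ_eval₂, germ_eq_zero]
  exact hs.continuousAt.eventually h0

/-- Separating the real variable `t` is what allows a relation over `E × ℝ` to be divided by powers
of `t`. -/
lemma polyFun_prod_real {c : E × ℝ → ℂ} (hc : c ∈ polyFun (E × ℝ)) :
    ∃ q : Polynomial (polyFun E), ∀ y t, c (y, t) = q.eval₂ (polyEval y) (t : ℂ) := by
  induction hc using Algebra.adjoin_induction with
  | mem c hc =>
    obtain ⟨ℓ, rfl⟩ := hc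
    refine ⟨Polynomial.C ⟨_, ofReal_clm_mem_polyFun (ℓ.comp (inl ℝ E ℝ))⟩ +
      Polynomial.C ⟨_, const_mem_polyFun ((ℓ (0, 1) : ℝ) : ℂ)⟩ * Polynomial.X, fun y t => ?_⟩
    have h1 : ((y, t) : E × ℝ) = (y, 0) + t • (0, 1) := by simp
    have h2 : ℓ (y, t) = ℓ (y, 0) + t * ℓ (0, 1) := by
      rw [h1, map_add, map_smul, smul_eq_mul]
    simp only [h2, eval₂_add, eval₂_mul, eval₂_C,
      eval₂_X, polyEval_apply, ContinuousLinearMap.comp_apply,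
      ContinuousLinearMap.inl_apply]
    push_cast
    ring
  | algebraMap r => exact ⟨Polynomial.C ⟨_, const_mem_polyFun r⟩, fun y t => by simp⟩
  | add a b _ _ ha hb =>
    obtain ⟨p, hp⟩ := ha
    obtain ⟨q, hq⟩ := hb
    exact ⟨p + q, fun y t => by simp [eval₂_add, hp, hq]⟩
  | mul a b _ _ ha hb =>
    obtain ⟨p, hp⟩ := ha
    obtain ⟨q, hq⟩ := hb
    exact ⟨p * q, fun y t => by simp [eval₂_mul, hp, hq]⟩

lemma exists_polyEval_ne_zero {P : Polynomial (polyFun E)} (hP : P ≠ 0) {x : E} {U : Set E}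
    (hU : U ∈ 𝓝 x) : ∃ y ∈ U, P.map (polyEval y) ≠ 0 := by
  obtain ⟨i, hi⟩ : ∃ i, P.coeff i ≠ 0 := by
    by_contra! h
    exact hP (Polynomial.ext fun i => by simp [h i])
  by_contra! h
  refine hi (Subtype.ext (polyFun_eq_zero (P.coeff i).2 (x := x) ?_))
  filter_upwards [hU] with y hy
  have := congrArg (fun Q : Polynomial ℂ => Q.coeff i) (h y hy)
  simpa using this

/-- The restriction of an algebraic function to a hyperplane is algebraic. -/
lemma AlgAt.restrict_zero {g : E × ℝ → ℂ} {x : E} (hg : AlgAt g (x, 0)) :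
    AlgAt (fun y => g (y, 0)) x := by
  rw [algAt_iff] at hg ⊢
  obtain ⟨ha, P, hP, h0⟩ := hg
  have hι : AnalyticAt ℝ (fun y : E => (y, (0 : ℝ))) x := analyticAt_id.prod analyticAt_const
  refine ⟨AnalyticAt.fun_comp (f := fun y : E => (y, (0 : ℝ))) ha hι, ?_⟩
  let ev : E → ℝ → ℂ → Polynomial (Polynomial (polyFun E)) → ℂ := fun y t v Q =>
    Q.eval₂ (eval₂RingHom (polyEval y) v) (t : ℂ)
  obtain ⟨Q, hQ⟩ : ∃ Q : Polynomial (Polynomial (polyFun E)),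
      ∀ y t v, ev y t v Q = P.eval₂ (polyEval (y, t)) v := by
    clear h0 hP
    induction P using Polynomial.induction_on' with
    | add p q hp hq =>
      obtain ⟨Q₁, h₁⟩ := hp
      obtain ⟨Q₂, h₂⟩ := hq
      refine ⟨Q₁ + Q₂, fun y t v => ?_⟩
      rw [eval₂_add, ← h₁, ← h₂]
      exact eval₂_add _ _
    | monomial n a =>
      obtain ⟨q, hq⟩ := polyFun_prod_real a.2
      refine ⟨q.map Polynomial.C * Polynomial.C (Polynomial.X ^ n), fun y t v => ?_⟩
      simp only [ev, eval₂_mul, eval₂_C, eval₂_monomial,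
        polyEval_apply, hq, eval₂_map]
      congr 1
      · congr 1
        ext c
        simp
      · simp
  have hQ0 : Q ≠ 0 := by
    rintro rfl
    obtain ⟨⟨y, t⟩, -, hy⟩ := exists_polyEval_ne_zero hP (x := (x, 0)) univ_mem
    refine hy (Polynomial.funext fun v => ?_)
    have := hQ y t v
    simp only [ev, eval₂_zero] at this
    rw [Polynomial.eval_map, ← this, Polynomial.eval_zero]
  -- Setting `t = 0` in `Q` may give the zero polynomial. The maximal power of `t` is removed first,
  -- so that the constant term of `R` in `t` is nonzero.
  obtain ⟨R, hR, hR0⟩ := Polynomial.exists_eq_pow_rootMultiplicity_mul_and_not_dvd Q hQ0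
    (0 : Polynomial (polyFun E))
  rw [Polynomial.C_0, sub_zero] at hR hR0
  rw [Polynomial.X_dvd_iff] at hR0
  set k := Polynomial.rootMultiplicity (0 : Polynomial (polyFun E)) Q
  refine ⟨R.coeff 0, hR0, ?_⟩
  have hfst : AnalyticAt ℝ (fun p : E × ℝ => p.1) (x, 0) := analyticAt_fst
  have hsnd : AnalyticAt ℝ (fun p : E × ℝ => (p.2 : ℂ)) (x, 0) :=
    (ofRealCLM.comp (snd ℝ E ℝ)).analyticAt _
  have hRa : AnalyticAt ℝ (fun p : E × ℝ => ev p.1 p.2 (g p) R) (x, 0) := by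
    simp only [ev, eval₂_eq_sum_range (p := R)]
    exact Finset.analyticAt_fun_sum _ fun i _ =>
      (analyticAt_eval₂ hfst ha _).mul (hsnd.pow i)
  have hprod : ∀ᶠ p : E × ℝ in 𝓝 (x, 0), (p.2 : ℂ) ^ k * ev p.1 p.2 (g p) R = 0 := by
    filter_upwards [h0] with p hp
    have := hQ p.1 p.2 (g p)
    rw [hp, hR] at this
    simpa [ev, eval₂_mul] using this
  -- Analytic germs have no zero divisors and `t ^ k` is not the zero germ, so the relation `R`
  -- holds near the point, in particular on `t = 0`.
  rcases eventually_zero_or_of_mul (hsnd.pow k) hRa hprod with h | h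
  · exfalso
    have h1 : ∀ᶠ t : ℝ in 𝓝 0, (t : ℂ) ^ k = 0 :=
      (Continuous.tendsto' (by fun_prop : Continuous fun t : ℝ => (x, t)) 0 (x, 0) rfl).eventually h
    have h2 : ∀ᶠ t : ℝ in 𝓝[≠] 0, False := by
      filter_upwards [h1.filter_mono nhdsWithin_le_nhds, self_mem_nhdsWithin] with t ht ht0
      exact ht0 (Complex.ofReal_eq_zero.1 (by by_contra h; exact pow_ne_zero k h ht))
    exact h2.exists.elim fun _ h => h
  · filter_upwards [hι.continuousAt.eventually h] with y hy
    simp only [ev, Complex.ofReal_zero, eval₂_at_zero] at hy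
    exact hy

end Algebraic

/-! ### Derivatives, compositions and coordinate descriptions of Nash functions. -/

section Algebraic

variable {E F : Type} [NormedAddCommGroup E] [NormedSpace ℝ E] [NormedAddCommGroup F]
  [NormedSpace ℝ F]

lemma AlgAt.pow {f : E → ℂ} {x : E} (hf : AlgAt f x) (n : ℕ) : AlgAt (fun y => f y ^ n) x := by
  induction n with
  | zero => simpa using algAt_of_mem (const_mem_polyFun 1) x
  | succ n ih => simpa [pow_succ] using ih.mul hf

/-- This is the division step for derivatives: a nonzero germ is not a zero divisor, so algebraicity
descends to the other factor. -/
lemma AlgAt.of_mul {f g : E → ℂ} {x : E} (hf : AlgAt f x) (hg : AnalyticAt ℝ g x)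
    (hne : ¬ ∀ᶠ y in 𝓝 x, f y = 0) (hfg : AlgAt (fun y => f y * g y) x) : AlgAt g x := by
  obtain ⟨hfa, hf⟩ := hf
  obtain ⟨hfga, hfg⟩ := hfg
  refine ⟨hg, IsAlgebraic.of_mul (y := germ f hfa) ?_ hf hfg⟩
  exact mem_nonZeroDivisors_of_ne_zero fun h => hne (germ_eq_zero.1 h)

lemma AlgAt.eval₂ {g : E → ℂ} {x : E} (hg : AlgAt g x) (P : Polynomial (polyFun E)) :
    AlgAt (fun y => P.eval₂ (polyEval y) (g y)) x := by
  induction P using Polynomial.induction_on' with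
  | add p q hp hq => simpa only [eval₂_add] using hp.add hq
  | monomial n a =>
    simpa only [eval₂_monomial, polyEval_apply] using (algAt_of_mem a.2 x).mul (hg.pow n)

/-- Chain rule for a relation `P (y, g y)`: `Q` is `P` with its coefficients differentiated along
`v`. Differentiability is carried along so that the induction can add derivatives. -/
lemma fderiv_eval₂ {g : E → ℂ} (v : E) (P : Polynomial (polyFun E)) :
    ∃ Q : Polynomial (polyFun E), ∀ y, DifferentiableAt ℝ g y →
      HasFDerivAt (fun y => P.eval₂ (polyEval y) (g y))
        (fderiv ℝ (fun y => P.eval₂ (polyEval y) (g y)) y) y ∧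
      fderiv ℝ (fun y => P.eval₂ (polyEval y) (g y)) y v =
        Q.eval₂ (polyEval y) (g y) + P.derivative.eval₂ (polyEval y) (g y) * fderiv ℝ g y v := by
  induction P using Polynomial.induction_on' with
  | add p q hp hq =>
    obtain ⟨Q₁, h₁⟩ := hp
    obtain ⟨Q₂, h₂⟩ := hq
    refine ⟨Q₁ + Q₂, fun y hy => ?_⟩
    have h := (h₁ y hy).1.add (h₂ y hy).1
    simp only [eval₂_add, Polynomial.derivative_add]
    have h' : HasFDerivAt (fun y => p.eval₂ (polyEval y) (g y) + q.eval₂ (polyEval y) (g y)) _ y := h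
    refine ⟨h'.differentiableAt.hasFDerivAt, ?_⟩
    rw [h'.fderiv, add_apply, (h₁ y hy).2, (h₂ y hy).2]
    ring
  | monomial n a =>
    refine ⟨Polynomial.monomial n ⟨_, polyFun_fderiv a.2 v⟩, fun y hy => ?_⟩
    have ha := (polyFun_analyticAt a.2 y).hasFDerivAt
    have h := ha.mul (hy.hasFDerivAt.pow n)
    simp only [eval₂_monomial, polyEval_apply, Polynomial.derivative_monomial]
    have h' : HasFDerivAt (fun y => a.1 y * g y ^ n) _ y := h
    refine ⟨h'.differentiableAt.hasFDerivAt, ?_⟩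
    rw [h'.fderiv]
    simp
    ring

/-- Directional derivatives of algebraic functions are algebraic. -/
lemma AlgAt.fderiv {g : E → ℂ} {x : E} (hg : AlgAt g x) (v : E) :
    AlgAt (fun y => fderiv ℝ g y v) x := by
  obtain ⟨ha, hP⟩ := algAt_iff.1 hg
  -- With minimal degree, the derivative of `P` in the unknown does not vanish identically along
  -- `g`. Differentiating the relation then exhibits the derivative of `g` as a quotient of
  -- algebraic functions.
  obtain ⟨P, ⟨hP0, hP⟩, hmin⟩ := (measure (fun P : Polynomial (polyFun E) => P.natDegree)).wf.has_min
    {P | P ≠ 0 ∧ ∀ᶠ y in 𝓝 x, P.eval₂ (polyEval y) (g y) = 0} hP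
  obtain ⟨Q, hQ⟩ := fderiv_eval₂ (g := g) v P
  have hdeg : P.natDegree ≠ 0 := by
    intro h
    obtain ⟨c, rfl⟩ := Polynomial.natDegree_eq_zero.1 h
    simp only [eval₂_C] at hP
    exact hP0 (by rw [show c = 0 from Subtype.ext (polyFun_eq_zero c.2 hP), Polynomial.C_0])
  have hchar : CharZero (polyFun E) := algebraRat.charZero _
  have hd : ¬ ∀ᶠ y in 𝓝 x, P.derivative.eval₂ (polyEval y) (g y) = 0 := by
    intro h
    refine hmin P.derivative ⟨?_, h⟩ (Polynomial.natDegree_derivative_lt hdeg)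
    intro h0
    exact hdeg (Polynomial.derivative_eq_zero.1 h0)
  refine (hg.eval₂ P.derivative).of_mul ?_ hd ?_
  · exact ((ContinuousLinearMap.apply ℝ ℂ v).analyticAt _).comp ha.fderiv
  · refine ((algAt_of_mem (const_mem_polyFun (-1)) x).mul (hg.eval₂ Q)).congr ?_
    filter_upwards [hP.eventually_nhds, ha.eventually_analyticAt] with y hy hya
    have h1 := (hQ y hya.differentiableAt).2
    have h2 : (fun y => P.eval₂ (polyEval y) (g y)) =ᶠ[𝓝 y] fun _ => 0 := hy
    rw [h2.fderiv_eq] at h1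
    simp only [fderiv_fun_const, Pi.zero_apply, zero_apply] at h1
    linear_combination h1

lemma polyFun_comp_clm {c : E → ℂ} (hc : c ∈ polyFun E) (L : F →L[ℝ] E) :
    (fun y => c (L y)) ∈ polyFun F := by
  simpa using polyFun_comp_affine hc L 0

/-- The relation is frozen at a value `w₁` of the second variable, close to `0` and chosen so that
not all coefficients vanish there. -/
lemma algAt_of_fst {g : E → ℂ} {x : E} (h : AlgAt (fun p : E × F => g p.1) (x, 0)) :
    AlgAt g x := by
  rw [algAt_iff] at h ⊢
  obtain ⟨ha, P, hP, h0⟩ := h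
  refine ⟨AnalyticAt.fun_comp (f := fun y : E => (y, (0 : F))) ha
    (analyticAt_id.prod analyticAt_const), ?_⟩
  obtain ⟨ε, hε, hb⟩ := eventually_nhds_iff_ball.1 h0
  obtain ⟨⟨y₁, w₁⟩, hy₁, hne⟩ := exists_polyEval_ne_zero hP
    (ball_mem_nhds (x, (0 : F)) hε)
  let ψ : polyFun (E × F) →+* polyFun E :=
    { toFun := fun c => ⟨fun y => c.1 (y, w₁), by
        have := polyFun_comp_affine c.2 (inl ℝ E F) (0, w₁)
        simpa using this⟩
      map_one' := rfl
      map_mul' := fun _ _ => rfl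
      map_zero' := rfl
      map_add' := fun _ _ => rfl }
  refine ⟨P.map ψ, ?_, ?_⟩
  · intro h
    apply hne
    have : (P.map ψ).map (polyEval y₁) = 0 := by rw [h, Polynomial.map_zero]
    rw [Polynomial.map_map] at this
    exact this
  · filter_upwards [ball_mem_nhds x hε] with y hy
    rw [eval₂_map]
    refine hb (y, w₁) ?_
    rw [← ball_prod_same] at hy₁ ⊢
    exact ⟨hy, hy₁.2⟩

/-- A composition of algebraic maps is algebraic. -/
lemma AlgAt.comp_map {x : E} {f : E → F} {g : F → ℂ} (hf : AnalyticAt ℝ f x)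
    (hfa : ∀ ℓ : F →L[ℝ] ℝ, AlgAt (fun y => ((ℓ (f y) : ℝ) : ℂ)) x) (hg : AlgAt g (f x)) :
    AlgAt (fun y => g (f y)) x := by
  -- The image of `f` may lie in the common zeros of the coefficients of the relation for `g`, so
  -- the relation cannot be composed directly. An extra translation variable makes the map dominant,
  -- and `AlgAt.pullback` applies.
  have h1 : AlgAt (fun p : E × F => g (f p.1 + p.2)) (x, 0) := by
    refine AlgAt.pullback (s := fun p : E × F => f p.1 + p.2) ?_ ?_ ?_ (by simpa using hg)
    · exact (AnalyticAt.fun_comp (f := fun p : E × F => p.1) (by exact hf) analyticAt_fst).add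
        analyticAt_snd
    · intro ℓ
      have : AlgAt (fun p : E × F => ((ℓ (f p.1) : ℝ) : ℂ)) (x, 0) := by
        refine AlgAt.pullback (s := fun p : E × F => p.1)
          (g := fun y => ((ℓ (f y) : ℝ) : ℂ)) analyticAt_fst (fun ℓ' => ?_) ?_ (hfa ℓ)
        · exact algAt_of_mem (ofReal_clm_mem_polyFun (ℓ'.comp (fst ℝ E F))) _
        · intro c hc h
          exact polyFun_eq_zero hc (x := x) ((Continuous.tendsto'
            (by fun_prop : Continuous fun y : E => (y, (0 : F))) x (x, 0) rfl).eventually h)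
      refine (this.add (algAt_of_mem (ofReal_clm_mem_polyFun
        (ℓ.comp (snd ℝ E F))) _)).congr (.of_forall ?_)
      intro p
      simp
    · intro c hc h
      have h' : ∀ᶠ w in 𝓝 (0 : F), c (f x + w) = 0 := (Continuous.tendsto'
            (by fun_prop : Continuous fun w : F => (x, w)) 0 (x, 0) rfl).eventually h
      refine polyFun_eq_zero hc (x := f x) ?_
      have h2 : Tendsto (fun y => y - f x) (𝓝 (f x)) (𝓝 0) := tendsto_cont (sub_self _)
      filter_upwards [h2.eventually h'] with y hy
      simpa using hy
  -- Scaling the translation by a real parameter puts the wanted composite on the hyperplane where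
  -- the parameter is `0`, so that `AlgAt.restrict_zero` recovers it.
  have h2 : AlgAt (fun q : (E × F) × ℝ => g (f q.1.1 + q.2 • q.1.2)) ((x, 0), 0) := by
    refine AlgAt.pullback (s := fun q : (E × F) × ℝ => (q.1.1, q.2 • q.1.2))
      (g := fun p : E × F => g (f p.1 + p.2)) ?_ ?_ ?_ (by simpa using h1)
    · exact (analyticAt_fst.fun_comp analyticAt_fst).prod
        (analyticAt_snd.smul (analyticAt_snd.fun_comp analyticAt_fst))
    · intro ℓ
      have e : (fun q : (E × F) × ℝ => ((ℓ (q.1.1, q.2 • q.1.2) : ℝ) : ℂ)) =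
          (fun q => ((((ℓ.comp (inl ℝ E F)).comp
            ((fst ℝ E F).comp (fst ℝ (E × F) ℝ))) q : ℝ) : ℂ)) +
          (fun q => ((snd ℝ (E × F) ℝ q : ℝ) : ℂ)) *
          fun q => ((((ℓ.comp (inr ℝ E F)).comp
            ((snd ℝ E F).comp (fst ℝ (E × F) ℝ))) q : ℝ) : ℂ) := by
        ext q
        have h1 : ((q.1.1, q.2 • q.1.2) : E × F) = (q.1.1, 0) + q.2 • (0, q.1.2) := by simp
        have h2 : ℓ (q.1.1, q.2 • q.1.2) = ℓ (q.1.1, 0) + q.2 * ℓ (0, q.1.2) := by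
          rw [h1, map_add, map_smul, smul_eq_mul]
        simp only [h2, Pi.add_apply, Pi.mul_apply, ContinuousLinearMap.comp_apply,
          ContinuousLinearMap.inl_apply, ContinuousLinearMap.inr_apply,
          ContinuousLinearMap.coe_fst', ContinuousLinearMap.coe_snd']
        push_cast
        ring
      rw [e]
      exact algAt_of_mem (add_mem (ofReal_clm_mem_polyFun _)
        (mul_mem (ofReal_clm_mem_polyFun _) (ofReal_clm_mem_polyFun _))) _
    · intro c hc h
      obtain ⟨ε, hε, hb⟩ := eventually_nhds_iff_ball.1 h
      let L : E × F →L[ℝ] E × F := (ContinuousLinearMap.id ℝ E).prodMap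
        ((ε / 2) • ContinuousLinearMap.id ℝ F)
      have h1 : (fun p => c (L p)) = 0 := by
        refine polyFun_eq_zero (polyFun_comp_clm hc L) (x := (x, 0)) ?_
        filter_upwards [ball_mem_nhds _ hε] with p hp
        refine hb (p, ε / 2) ?_
        rw [← ball_prod_same]
        refine ⟨hp, ?_⟩
        rw [mem_ball, Real.dist_eq, sub_zero, abs_of_pos (by positivity)]
        linarith
      ext p
      have := congrFun h1 (p.1, (ε / 2)⁻¹ • p.2)
      have hne : ε / 2 ≠ 0 := by positivity
      have h2 : L (p.1, (ε / 2)⁻¹ • p.2) = p := Prod.ext rfl (by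
        change (ε / 2) • (ε / 2)⁻¹ • p.2 = p.2
        rw [smul_smul, mul_inv_cancel₀ hne, one_smul])
      have h3 : c (L (p.1, (ε / 2)⁻¹ • p.2)) = 0 := this
      rw [h2] at h3
      exact h3
  have h3 : AlgAt (fun p : E × F => g (f p.1)) (x, 0) := by
    have := AlgAt.restrict_zero (g := fun q : (E × F) × ℝ => g (f q.1.1 + q.2 • q.1.2)) h2
    simpa using this
  exact algAt_of_fst (g := fun y => g (f y)) h3

section Coordinates

variable {ι : Type} [Finite ι] (X : E ≃L[ℝ] (ι → ℝ))

/-- Polynomial functions in terms of polynomials in linear coordinates. -/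
def polyFunOfMv : MvPolynomial ι ℂ →ₐ[ℂ] polyFun E :=
  MvPolynomial.aeval fun i => ⟨_, ofReal_clm_mem_polyFun ((proj i).comp (X : E →L[ℝ] (ι → ℝ)))⟩

omit [Finite ι] in
lemma polyFunOfMv_apply (p : MvPolynomial ι ℂ) (y : E) :
    (polyFunOfMv X p).1 y = MvPolynomial.eval (fun i => ((X y i : ℝ) : ℂ)) p := by
  induction p using MvPolynomial.induction_on with
  | C a => simp [polyFunOfMv]
  | add p q hp hq =>
    rw [map_add, map_add, ← hp, ← hq]; rfl
  | mul_X p i hp =>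
    rw [map_mul, map_mul, ← hp]
    simp only [polyFunOfMv, MvPolynomial.aeval_X, MvPolynomial.eval_X]
    rfl

/-- A complex polynomial vanishing at all real points is zero because `ℝ` is infinite; conversely
the real functionals generating `polyFun` are combinations of the coordinates. -/
lemma polyFunOfMv_bijective : Bijective (polyFunOfMv X) := by
  constructor
  · rw [injective_iff_map_eq_zero]
    intro p hp
    refine MvPolynomial.funext_set (fun _ => Set.range ((↑) : ℝ → ℂ))
      (fun i => Set.infinite_range_of_injective Complex.ofReal_injective) fun v hv => ?_
    choose r hr using fun i => hv i (mem_univ i)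
    have := polyFunOfMv_apply X p (X.symm r)
    rw [hp] at this
    simp only [ContinuousLinearEquiv.apply_symm_apply, hr] at this
    rw [map_zero]
    exact this.symm
  · rintro ⟨c, hc⟩
    induction hc using Algebra.adjoin_induction with
    | mem c hc =>
      obtain ⟨ℓ, rfl⟩ := hc
      have := Fintype.ofFinite ι
      classical
      refine ⟨∑ i, MvPolynomial.C ((ℓ (X.symm (Pi.single i 1)) : ℝ) : ℂ) * MvPolynomial.X i, ?_⟩
      ext y
      rw [polyFunOfMv_apply]
      have h1 : ℓ y = ∑ i, ℓ (X.symm (Pi.single i 1)) * X y i := by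
        conv_lhs => rw [← X.symm_apply_apply y, ← Finset.univ_sum_single (X y)]
        rw [map_sum, map_sum]
        refine Finset.sum_congr rfl fun i _ => ?_
        have : Pi.single i (X y i) = X y i • (Pi.single i (1 : ℝ) : ι → ℝ) := by
          ext j; by_cases h : j = i
          · subst h; simp
          · simp [h]
        rw [this, map_smul, map_smul, smul_eq_mul, mul_comm]
      simp [h1]
    | algebraMap r => exact ⟨MvPolynomial.C r, by ext y; rw [polyFunOfMv_apply]; simp⟩
    | add a b _ _ ha hb =>
      obtain ⟨p, hp⟩ := ha
      obtain ⟨q, hq⟩ := hb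
      exact ⟨p + q, by rw [map_add, hp, hq]; rfl⟩
    | mul a b _ _ ha hb =>
      obtain ⟨p, hp⟩ := ha
      obtain ⟨q, hq⟩ := hb
      exact ⟨p * q, by rw [map_mul, hp, hq]; rfl⟩

/-- Algebraic functions in terms of polynomial equations in linear coordinates. -/
lemma algAt_iff_mv {g : E → ℂ} {x : E} : AlgAt g x ↔ AnalyticAt ℝ g x ∧
    ∃ p : MvPolynomial (Option ι) ℂ, p ≠ 0 ∧ ∀ᶠ y in 𝓝 x,
      MvPolynomial.eval (fun o => o.elim (g y) fun i => ((X y i : ℝ) : ℂ)) p = 0 := by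
  rw [algAt_iff]
  refine and_congr_right fun _ => ?_
  let Φ : MvPolynomial ι ℂ ≃+* polyFun E :=
    (AlgEquiv.ofBijective (polyFunOfMv X) (polyFunOfMv_bijective X)).toRingEquiv
  let Ψ : MvPolynomial (Option ι) ℂ ≃+* Polynomial (polyFun E) :=
    (MvPolynomial.optionEquivLeft ℂ ι).toRingEquiv.trans (Polynomial.mapEquiv Φ)
  have key : ∀ p y v, (Ψ p).eval₂ (polyEval y) v =
      MvPolynomial.eval (fun o => o.elim v fun i => ((X y i : ℝ) : ℂ)) p := by
    intro p y v
    have : (Ψ p) = (MvPolynomial.optionEquivLeft ℂ ι p).map (Φ : _ →+* _) := rfl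
    rw [this, eval₂_map]
    have h2 : (polyEval y).comp (Φ : MvPolynomial ι ℂ →+* polyFun E) =
        MvPolynomial.eval (fun i => ((X y i : ℝ) : ℂ)) :=
      RingHom.ext fun q => polyFunOfMv_apply X q y
    rw [h2]
    induction p using MvPolynomial.induction_on with
    | C a => simp [MvPolynomial.optionEquivLeft_C]
    | add p q hp hq => rw [map_add, eval₂_add, hp rfl, hq rfl, map_add]
    | mul_X p i hp =>
      rw [map_mul, eval₂_mul, hp rfl, map_mul]
      congr 1
      cases i with
      | none => simp [MvPolynomial.optionEquivLeft_X_none]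
      | some i => simp [MvPolynomial.optionEquivLeft_X_some]
  constructor
  · rintro ⟨P, hP, h0⟩
    refine ⟨Ψ.symm P, (map_ne_zero_iff _ Ψ.symm.injective).2 hP, ?_⟩
    filter_upwards [h0] with y hy
    rw [← key, Ψ.apply_symm_apply, hy]
  · rintro ⟨p, hp, h0⟩
    refine ⟨Ψ p, (map_ne_zero_iff _ Ψ.injective).2 hp, ?_⟩
    filter_upwards [h0] with y hy
    rw [key, hy]

end Coordinates

end Algebraic

/-! ### Inverses of algebraic local diffeomorphisms, by transcendence degree. -/

section Inverse

variable {E F : Type} [NormedAddCommGroup E] [NormedSpace ℝ E] [NormedAddCommGroup F]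
  [NormedSpace ℝ F]

instance (x : E) : Algebra ℂ (analyticGerms x) :=
  ((pullGerm id analyticAt_id).comp (algebraMap ℂ (polyFun E))).toAlgebra

instance (x : E) : IsScalarTower ℂ (polyFun E) (analyticGerms x) :=
  IsScalarTower.of_algebraMap_eq' rfl

lemma aeval_germ {ι : Type} {x : E} {f : ι → E → ℂ} (hf : ∀ i, AnalyticAt ℝ (f i) x)
    (p : MvPolynomial ι ℂ) : ∃ h : AnalyticAt ℝ (fun y => MvPolynomial.eval (fun i => f i y) p) x,
      MvPolynomial.aeval (fun i => germ (f i) (hf i)) p = germ _ h := by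
  induction p using MvPolynomial.induction_on with
  | C a =>
    simp only [MvPolynomial.eval_C, MvPolynomial.aeval_C]
    exact ⟨analyticAt_const, rfl⟩
  | add p q hp hq =>
    obtain ⟨h₁, hp⟩ := hp
    obtain ⟨h₂, hq⟩ := hq
    simp only [map_add, hp, hq]
    exact ⟨h₁.add h₂, rfl⟩
  | mul_X p i hp =>
    obtain ⟨h₁, hp⟩ := hp
    simp only [map_mul, hp, MvPolynomial.aeval_X, MvPolynomial.eval_X]
    exact ⟨h₁.mul (hf i), rfl⟩

/-- The inverse of an algebraic local diffeomorphism is algebraic. -/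
lemma algAt_inverse {ι : Type} [Finite ι] (X : E ≃L[ℝ] (ι → ℝ)) (X' : F ≃L[ℝ] (ι → ℝ))
    {f : E → F} {e : F → E} {x : E}
    (hfa : ∀ ℓ : F →L[ℝ] ℝ, AlgAt (fun y => ((ℓ (f y) : ℝ) : ℂ)) x)
    (he : AnalyticAt ℝ e (f x)) (hex : e (f x) = x) (hfe : ∀ᶠ y in 𝓝 (f x), f (e y) = y)
    (ℓ : E →L[ℝ] ℝ) : AlgAt (fun y => ((ℓ (e y) : ℝ) : ℂ)) (f x) := by
  classical
  -- The coordinates of `E` form a transcendence basis of the algebra `A` of algebraic germs. The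
  -- coordinates of `F` composed with `f` are algebraically independent because `e` is a right
  -- inverse of `f`.
  set A : Subalgebra ℂ (analyticGerms x) :=
    (Subalgebra.algebraicClosure (polyFun E) (analyticGerms x)).restrictScalars ℂ
  have hA : ∀ {g : E → ℂ} (h : AlgAt g x), germ g h.1 ∈ A := fun h => h.2
  let cE : ι → E → ℂ := fun i y => ((X y i : ℝ) : ℂ)
  let cF : ι → E → ℂ := fun i y => ((X' (f y) i : ℝ) : ℂ)
  have hcE : ∀ i, AlgAt (cE i) x := fun i => algAt_of_mem (ofReal_clm_mem_polyFun
    ((proj i).comp (X : E →L[ℝ] (ι → ℝ)))) x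
  have hcF : ∀ i, AlgAt (cF i) x := fun i => hfa
    ((proj i).comp (X' : F →L[ℝ] (ι → ℝ)))
  let yv : ι → A := fun i => ⟨germ (cE i) (hcE i).1, hA (hcE i)⟩
  let u : ι → A := fun i => ⟨germ (cF i) (hcF i).1, hA (hcF i)⟩
  have hyv : AlgebraicIndependent ℂ yv := by
    rw [← AlgHom.algebraicIndependent_iff A.val Subtype.val_injective, algebraicIndependent_iff]
    intro p hp
    obtain ⟨h, hp'⟩ := aeval_germ (fun i => (hcE i).1) p
    have hp0 : germ _ h = 0 := hp'.symm.trans hp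
    rw [germ_eq_zero] at hp0
    have : polyFunOfMv X p = 0 := by
      refine Subtype.ext (polyFun_eq_zero (polyFunOfMv X p).2 (x := x) ?_)
      filter_upwards [hp0] with y hy
      rw [polyFunOfMv_apply, hy]
    exact (map_eq_zero_iff _ (polyFunOfMv_bijective X).1).1 this
  have hu : AlgebraicIndependent ℂ u := by
    rw [← AlgHom.algebraicIndependent_iff A.val Subtype.val_injective, algebraicIndependent_iff]
    intro p hp
    obtain ⟨h, hp'⟩ := aeval_germ (fun i => (hcF i).1) p
    have hp0 : germ _ h = 0 := hp'.symm.trans hp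
    rw [germ_eq_zero] at hp0
    have : polyFunOfMv X' p = 0 := by
      refine Subtype.ext (polyFun_eq_zero (polyFunOfMv X' p).2 (x := f x) ?_)
      have h1 : Tendsto e (𝓝 (f x)) (𝓝 x) := he.tendsto hex
      filter_upwards [h1.eventually hp0, hfe] with y hy hy'
      rw [polyFunOfMv_apply, ← hy]
      simp only [cF, hy']
    exact (map_eq_zero_iff _ (polyFunOfMv_bijective X').1).1 this
  have hyB : IsTranscendenceBasis ℂ yv := by
    rw [hyv.isTranscendenceBasis_iff_isAlgebraic]
    refine ⟨fun a => ?_⟩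
    by_contra ha
    have hi := (hyv.option_iff_transcendental a).2 ha
    obtain ⟨a, ha'⟩ := a
    obtain ⟨g, hg, rfl⟩ := exists_germ a
    obtain ⟨-, p, hp, h0⟩ := (algAt_iff_mv X).1 (⟨hg, ha'⟩ : AlgAt g x)
    rw [← AlgHom.algebraicIndependent_iff A.val Subtype.val_injective,
      algebraicIndependent_iff] at hi
    refine hp (hi p ?_)
    have hana : ∀ o : Option ι, AnalyticAt ℝ (fun y => o.elim (g y) fun i => cE i y) x := by
      rintro (_ | i)
      · exact hg
      · exact (hcE i).1
    obtain ⟨h, hp'⟩ := aeval_germ hana p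
    have e1 : (A.val ∘ fun o : Option ι => o.elim (⟨germ g hg, ha'⟩ : A) yv) =
        fun o => germ _ (hana o) := by
      ext o; cases o <;> rfl
    rw [e1, hp', germ_eq_zero]
    exact h0
  -- Both families have the same finite index type, so `u` is a transcendence basis too. Hence `ℓ`
  -- satisfies an algebraic relation over the components of `f`, and substituting `e` gives the
  -- relation for `ℓ ∘ e`.
  have huB : IsTranscendenceBasis ℂ u :=
    hu.isTranscendenceBasis_of_trdeg_le_of_finite hyB.cardinalMk_eq_trdeg.ge
  have hℓ : AlgAt (fun y => ((ℓ y : ℝ) : ℂ)) x := algAt_of_mem (ofReal_clm_mem_polyFun ℓ) x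
  have hni : ¬ AlgebraicIndependent ℂ
      (fun o : Option ι => o.elim (⟨germ _ hℓ.1, hA hℓ⟩ : A) u) := fun h =>
    (hu.option_iff_transcendental _).1 h (huB.isAlgebraic.isAlgebraic _)
  rw [← AlgHom.algebraicIndependent_iff A.val Subtype.val_injective,
    algebraicIndependent_iff] at hni
  push Not at hni
  obtain ⟨p, hp0, hp⟩ := hni
  have hana : ∀ o : Option ι, AnalyticAt ℝ (fun y => o.elim ((ℓ y : ℝ) : ℂ) fun i => cF i y) x := by
    rintro (_ | i)
    · exact hℓ.1
    · exact (hcF i).1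
  obtain ⟨h, hp'⟩ := aeval_germ hana p
  have e1 : (A.val ∘ fun o : Option ι => o.elim (⟨germ _ hℓ.1, hA hℓ⟩ : A) u) =
      fun o => germ _ (hana o) := by
    ext o; cases o <;> rfl
  rw [e1, hp', germ_eq_zero] at hp0
  rw [algAt_iff_mv X']
  refine ⟨((ofRealCLM.comp ℓ).analyticAt _).comp he, p, hp, ?_⟩
  have h1 : Tendsto e (𝓝 (f x)) (𝓝 x) := he.tendsto hex
  filter_upwards [h1.eventually hp0, hfe] with y hy hy'
  simpa only [cF, hy'] using hy

end Inverse

/-! ### A common calculus of real analytic and Nash maps. -/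

section Regular

variable {κ : Regularity} {E F G : Type} [NormedAddCommGroup E] [NormedSpace ℝ E]
  [NormedAddCommGroup F] [NormedSpace ℝ F] [NormedAddCommGroup G] [NormedSpace ℝ G]

/-- A map between real normed spaces is regular at `x`: it is real analytic and, in the algebraic
class, its components are algebraic over the polynomial functions. -/
def RegAt (κ : Regularity) (f : E → F) (x : E) : Prop :=
  AnalyticAt ℝ f x ∧
    (κ = Regularity.algebraic → ∀ ℓ : F →L[ℝ] ℝ, AlgAt (fun y => ((ℓ (f y) : ℝ) : ℂ)) x)

lemma RegAt.congr {f g : E → F} {x : E} (hf : RegAt κ f x) (h : f =ᶠ[𝓝 x] g) : RegAt κ g x :=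
  ⟨hf.1.congr h, fun hκ ℓ => (hf.2 hκ ℓ).congr (h.fun_comp fun z => ((ℓ z : ℝ) : ℂ))⟩

lemma RegAt.comp {g : F → G} {f : E → F} {x : E} (hg : RegAt κ g (f x)) (hf : RegAt κ f x) :
    RegAt κ (fun y => g (f y)) x :=
  ⟨hg.1.comp hf.1, fun hκ ℓ => AlgAt.comp_map (g := fun z => ((ℓ (g z) : ℝ) : ℂ)) hf.1
    (hf.2 hκ) (hg.2 hκ ℓ)⟩

lemma RegAt.comp_of_eq {g : F → G} {f : E → F} {x : E} {y : F} (hg : RegAt κ g y)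
    (hf : RegAt κ f x) (h : f x = y) : RegAt κ (fun y => g (f y)) x := by
  subst h; exact hg.comp hf

lemma regAt_clm (L : E →L[ℝ] F) (x : E) : RegAt κ L x :=
  ⟨L.analyticAt x, fun _ ℓ => algAt_of_mem (ofReal_clm_mem_polyFun (ℓ.comp L)) x⟩

lemma regAt_id (x : E) : RegAt κ (fun y : E => y) x := regAt_clm (ContinuousLinearMap.id ℝ E) x

lemma regAt_const (a : F) (x : E) : RegAt κ (fun _ : E => a) x :=
  ⟨analyticAt_const, fun _ ℓ => algAt_of_mem (const_mem_polyFun _) x⟩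

lemma regAt_fst (p : E × F) : RegAt κ (fun q : E × F => q.1) p :=
  regAt_clm (fst ℝ E F) p

lemma regAt_snd (p : E × F) : RegAt κ (fun q : E × F => q.2) p :=
  regAt_clm (snd ℝ E F) p

lemma RegAt.clm_comp {f : E → F} {x : E} (hf : RegAt κ f x) (L : F →L[ℝ] G) :
    RegAt κ (fun y => L (f y)) x := (regAt_clm L (f x)).comp hf

lemma RegAt.prodMk {f : E → F} {g : E → G} {x : E} (hf : RegAt κ f x) (hg : RegAt κ g x) :
    RegAt κ (fun y => (f y, g y)) x := by
  refine ⟨hf.1.prod hg.1, fun hκ ℓ => ?_⟩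
  refine ((hf.2 hκ (ℓ.comp (inl ℝ F G))).add (hg.2 hκ (ℓ.comp (inr ℝ F G)))).congr (.of_forall ?_)
  intro y
  simp [← Complex.ofReal_add, ← map_add]

lemma AlgAt.sum {ι : Type} (s : Finset ι) {f : ι → E → ℂ} {x : E}
    (hf : ∀ i ∈ s, AlgAt (f i) x) : AlgAt (fun y => ∑ i ∈ s, f i y) x := by
  classical
  induction s using Finset.induction_on with
  | empty => simpa using algAt_of_mem (const_mem_polyFun 0) x
  | insert a s ha ih =>
    simp only [Finset.sum_insert ha]
    exact (hf a (by simp)).add (ih fun i hi => hf i (by simp [hi]))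

lemma RegAt.pi {ι : Type} [Fintype ι] {H : ι → Type} [∀ i, NormedAddCommGroup (H i)]
    [∀ i, NormedSpace ℝ (H i)] {f : E → ∀ i, H i} {x : E}
    (hf : ∀ i, RegAt κ (fun y => f y i) x) : RegAt κ f x := by
  classical
  refine ⟨AnalyticAt.pi fun i => (hf i).1, fun hκ ℓ => ?_⟩
  refine (AlgAt.sum Finset.univ fun i _ =>
    (hf i).2 hκ (ℓ.comp (ContinuousLinearMap.single ℝ H i))).congr (.of_forall ?_)
  intro y
  have : ℓ (f y) = ∑ i, ℓ (Pi.single i (f y i)) := by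
    conv_lhs => rw [← Finset.univ_sum_single (f y)]
    rw [map_sum]
  simp [this]

lemma RegAt.apply {ι : Type} [Fintype ι] {H : ι → Type} [∀ i, NormedAddCommGroup (H i)]
    [∀ i, NormedSpace ℝ (H i)] {f : E → ∀ i, H i} {x : E} (hf : RegAt κ f x) (i : ι) :
    RegAt κ (fun y => f y i) x := hf.clm_comp (proj i)

lemma RegAt.add {f g : E → F} {x : E} (hf : RegAt κ f x) (hg : RegAt κ g x) :
    RegAt κ (fun y => f y + g y) x :=
  (hf.prodMk hg).clm_comp (fst ℝ F F + snd ℝ F F)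

lemma RegAt.sub {f g : E → F} {x : E} (hf : RegAt κ f x) (hg : RegAt κ g x) :
    RegAt κ (fun y => f y - g y) x :=
  (hf.prodMk hg).clm_comp (fst ℝ F F - snd ℝ F F)

lemma RegAt.sum {ι : Type} (s : Finset ι) {f : ι → E → F} {x : E}
    (hf : ∀ i ∈ s, RegAt κ (f i) x) : RegAt κ (fun y => ∑ i ∈ s, f i y) x := by
  classical
  induction s using Finset.induction_on with
  | empty => simpa using regAt_const (0 : F) x
  | insert a s ha ih =>
    simp only [Finset.sum_insert ha]
    exact (hf a (by simp)).add (ih fun i hi => hf i (by simp [hi]))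

/-- In a basis of `F` a bilinear expression is a finite sum of products of scalar regular functions.
-/
lemma RegAt.bilin [FiniteDimensional ℝ F] {H : Type} [NormedAddCommGroup H] [NormedSpace ℝ H]
    (B : F →L[ℝ] G →L[ℝ] H) {f : E → F} {g : E → G} {x : E}
    (hf : RegAt κ f x) (hg : RegAt κ g x) : RegAt κ (fun y => B (f y) (g y)) x := by
  refine ⟨AnalyticAt.fun_comp (g := fun p : F × G => B p.1 p.2) (f := fun y => (f y, g y))
    (B.analyticAt_bilinear (f x, g x)) (hf.1.prod hg.1), fun hκ ℓ => ?_⟩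
  let b := finBasis ℝ F
  refine (AlgAt.sum Finset.univ fun i _ => (hf.2 hκ (toContinuousLinearMap
    (b.coord i))).mul (hg.2 hκ (ℓ.comp (B (b i))))).congr (.of_forall ?_)
  intro y
  have : ℓ (B (f y) (g y)) = ∑ i, b.repr (f y) i * ℓ (B (b i) (g y)) := by
    conv_lhs => rw [← b.sum_repr (f y)]
    simp only [map_sum, map_smul, sum_apply, smul_apply, smul_eq_mul]
  simp [this]

lemma RegAt.mul {f g : E → ℂ} {x : E} (hf : RegAt κ f x) (hg : RegAt κ g x) :
    RegAt κ (fun y => f y * g y) x := RegAt.bilin (ContinuousLinearMap.mul ℝ ℂ) hf hg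

lemma RegAt.mul_real {f g : E → ℝ} {x : E} (hf : RegAt κ f x) (hg : RegAt κ g x) :
    RegAt κ (fun y => f y * g y) x := RegAt.bilin (ContinuousLinearMap.mul ℝ ℝ) hf hg

lemma RegAt.prod {ι : Type} (s : Finset ι) {f : ι → E → ℂ} {x : E}
    (hf : ∀ i ∈ s, RegAt κ (f i) x) : RegAt κ (fun y => ∏ i ∈ s, f i y) x := by
  classical
  induction s using Finset.induction_on with
  | empty => simpa using regAt_const (1 : ℂ) x
  | insert a s ha ih =>
    simp only [Finset.prod_insert ha]
    exact (hf a (by simp)).mul (ih fun i hi => hf i (by simp [hi]))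

lemma RegAt.prod_real {ι : Type} (s : Finset ι) {f : ι → E → ℝ} {x : E}
    (hf : ∀ i ∈ s, RegAt κ (f i) x) : RegAt κ (fun y => ∏ i ∈ s, f i y) x := by
  classical
  induction s using Finset.induction_on with
  | empty => simpa using regAt_const (1 : ℝ) x
  | insert a s ha ih =>
    simp only [Finset.prod_insert ha]
    exact (hf a (by simp)).mul_real (ih fun i hi => hf i (by simp [hi]))

lemma RegAt.det {r : ℕ} {T : E → Matrix (Fin r) (Fin r) ℂ} {x : E}
    (hT : ∀ i j, RegAt κ (fun y => T y i j) x) : RegAt κ (fun y => (T y).det) x := by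
  simp only [Matrix.det_apply']
  exact RegAt.sum _ fun σ _ => (regAt_const _ x).mul (RegAt.prod _ fun i _ => hT _ _)

lemma RegAt.fderiv_apply {f : E → F} [CompleteSpace F] {x : E} (hf : RegAt κ f x) (v : E) :
    RegAt κ (fun y => fderiv ℝ f y v) x := by
  refine ⟨((ContinuousLinearMap.apply ℝ F v).analyticAt _).comp hf.1.fderiv, fun hκ ℓ => ?_⟩
  refine ((hf.2 hκ ℓ).fderiv v).congr ?_
  filter_upwards [hf.1.eventually_analyticAt] with y hy
  have := ((ofRealCLM.comp ℓ).hasFDerivAt).comp y hy.hasFDerivAt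
  exact DFunLike.congr_fun this.fderiv v

/-- Algebraicity of each functional spreads to a neighbourhood that depends on the functional; a
basis of `F` leaves only finitely many neighbourhoods to intersect. -/
lemma RegAt.eventually [FiniteDimensional ℝ F] {f : E → F} {x : E} (hf : RegAt κ f x) :
    ∀ᶠ y in 𝓝 x, RegAt κ f y := by
  have := FiniteDimensional.complete ℝ F
  by_cases hκ : κ = Regularity.algebraic
  · let b := finBasis ℝ F
    have h := Filter.eventually_all.2 fun i => (hf.2 hκ (toContinuousLinearMap
      (b.coord i))).eventually
    filter_upwards [h, hf.1.eventually_analyticAt] with y hy hya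
    refine ⟨hya, fun _ ℓ => ?_⟩
    refine (AlgAt.sum Finset.univ fun i _ => (hy i).mul
      (algAt_of_mem (const_mem_polyFun ((ℓ (b i) : ℝ) : ℂ)) y)).congr
      (.of_forall ?_)
    intro z
    have : ℓ (f z) = ∑ i, b.repr (f z) i * ℓ (b i) := by
      conv_lhs => rw [← b.sum_repr (f z)]
      simp only [map_sum, map_smul, smul_eq_mul]
    simp [this]
  · filter_upwards [hf.1.eventually_analyticAt] with y hya
    exact ⟨hya, fun h => absurd h hκ⟩

lemma RegAt.inverse [FiniteDimensional ℝ E] [FiniteDimensional ℝ F]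
    (hdim : finrank ℝ E = finrank ℝ F) {f : E → F} {e : F → E} {x : E}
    (hf : RegAt κ f x) (he : AnalyticAt ℝ e (f x)) (hex : e (f x) = x)
    (hfe : ∀ᶠ y in 𝓝 (f x), f (e y) = y) : RegAt κ e (f x) :=
  ⟨he, fun hκ ℓ => algAt_inverse ((finBasis ℝ E).equivFun.toContinuousLinearEquiv)
    ((finBasisOfFinrankEq ℝ F hdim.symm).equivFun.toContinuousLinearEquiv) (hf.2 hκ)
    he hex hfe ℓ⟩

/-- A real functional on `ℂ` is a combination of the identity and conjugation with constant complex
coefficients, and conjugation preserves `AlgAt`. -/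
lemma regAt_of_algAt {f : E → ℂ} {x : E} (hf : AnalyticAt ℝ f x)
    (h : κ = Regularity.algebraic → AlgAt f x) : RegAt κ f x := by
  refine ⟨hf, fun hκ ℓ => ?_⟩
  have h1 := h hκ
  have h2 := h1.conj
  refine ((h1.mul (algAt_of_mem (const_mem_polyFun ((ℓ 1 : ℂ) / 2 - (ℓ Complex.I : ℂ) / 2 * Complex.I)) x)).add
    (h2.mul (algAt_of_mem (const_mem_polyFun ((ℓ 1 : ℂ) / 2 + (ℓ Complex.I : ℂ) / 2 * Complex.I)) x))).congr
    (.of_forall fun y => ?_)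
  have e1 : ℓ (f y) = (f y).re * ℓ 1 + (f y).im * ℓ Complex.I := by
    have : f y = (f y).re • (1 : ℂ) + (f y).im • Complex.I := by
      simp [Complex.re_add_im]
    conv_lhs => rw [this]
    rw [map_add, map_smul, map_smul, smul_eq_mul, smul_eq_mul]
  simp only [e1]
  apply Complex.ext <;> simp <;> ring

lemma RegAt.algAt {f : E → ℂ} {x : E} (hf : RegAt κ f x) (hκ : κ = Regularity.algebraic) :
    AlgAt f x := by
  refine ((hf.2 hκ reCLM).add ((hf.2 hκ imCLM).mul
    (algAt_of_mem (const_mem_polyFun Complex.I) x))).congr (.of_forall fun y => ?_)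
  simp [Complex.re_add_im]

end Regular

/-! ### Uniqueness for holomorphic functions on maximal totally real sets. -/

section TotallyReal

variable {E : Type} [NormedAddCommGroup E] [NormedSpace ℂ E]

/-- `S` is totally real of maximal dimension at `x`, in the sense of first order uniqueness:
the differential at `x` of an analytic function vanishes if the function vanishes on `S`. -/
def IsUniquenessPoint (S : Set E) (x : E) : Prop :=
  ∀ g : E → ℂ, AnalyticAt ℂ g x → (∀ᶠ y in 𝓝 x, y ∈ S → g y = 0) → fderiv ℂ g x = 0

lemma IsUniquenessPoint.fderiv_eq_zero {S : Set E} {x : E} (h : IsUniquenessPoint S x) {F : Type}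
    [NormedAddCommGroup F] [NormedSpace ℂ F] {g : E → F} (hg : AnalyticAt ℂ g x)
    (h0 : ∀ᶠ y in 𝓝 x, y ∈ S → g y = 0) : fderiv ℂ g x = 0 := by
  ext v
  refine (SeparatingDual.eq_zero_iff_forall_dual_eq_zero (R := ℂ) _).2 fun ℓ => ?_
  have h1 := h (fun y => ℓ (g y)) ((ℓ.analyticAt _).comp hg) (by
    filter_upwards [h0] with y hy hyS
    rw [hy hyS, map_zero])
  have h2 := (ℓ.hasFDerivAt.comp x hg.hasFDerivAt).fderiv
  have h3 := DFunLike.congr_fun (h2.symm.trans h1) v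
  exact h3

/-- The derivative is again analytic and vanishes on `S` near `x`, so vanishing climbs one order at
a time. The target varies in the induction because derivatives take values in spaces of linear maps.
-/
lemma iteratedFDeriv_eq_zero_of_uniqueness {S : Set E} {x : E} (hx : x ∈ S)
    (hS : ∀ᶠ y in 𝓝 x, y ∈ S → IsUniquenessPoint S y) (n : ℕ) :
    ∀ (F : Type) [NormedAddCommGroup F] [NormedSpace ℂ F] [CompleteSpace F] (g : E → F),
      AnalyticAt ℂ g x → (∀ᶠ y in 𝓝 x, y ∈ S → g y = 0) → iteratedFDeriv ℂ n g x = 0 := by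
  induction n with
  | zero =>
    intro F _ _ _ g hg h0
    ext v
    simpa using h0.self_of_nhds hx
  | succ n ih =>
    intro F _ _ _ g hg h0
    have h1 : ∀ᶠ y in 𝓝 x, y ∈ S → fderiv ℂ g y = 0 := by
      filter_upwards [hS, hg.eventually_analyticAt, h0.eventually_nhds] with y h1 h2 h3 hy
      exact (h1 hy).fderiv_eq_zero h2 h3
    have h2 := ih (E →L[ℂ] F) (fderiv ℂ g) hg.fderiv h1
    rw [iteratedFDeriv_succ_eq_comp_right, Function.comp_apply, h2]
    exact LinearIsometryEquiv.map_zero _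

/-- Uniqueness for analytic functions on a maximal totally real set. -/
lemma eventually_eq_zero_of_uniqueness {S : Set E} {x : E} (hx : x ∈ S)
    (hS : ∀ᶠ y in 𝓝 x, y ∈ S → IsUniquenessPoint S y) {F : Type} [NormedAddCommGroup F]
    [NormedSpace ℂ F] [CompleteSpace F] {g : E → F} (hg : AnalyticAt ℂ g x)
    (h0 : ∀ᶠ y in 𝓝 x, y ∈ S → g y = 0) : ∀ᶠ y in 𝓝 x, g y = 0 := by
  obtain ⟨p, r, hp⟩ := hg
  have hp0 : ∀ n y, (p n fun _ => y) = 0 := by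
    intro n y
    have h1 := hp.factorial_smul y n
    rw [iteratedFDeriv_eq_zero_of_uniqueness hx hS n F g ⟨p, r, hp⟩ h0] at h1
    have h2 : ((n.factorial : ℂ)) • (p n fun _ => y) = 0 := by
      rw [Nat.cast_smul_eq_nsmul, h1]; rfl
    exact (smul_eq_zero.1 h2).resolve_left (Nat.cast_ne_zero.2 n.factorial_ne_zero)
  filter_upwards [Metric.eball_mem_nhds x hp.r_pos] with y hy
  have h1 := hp.hasSum_sub hy
  simp only [hp0] at h1
  exact h1.unique hasSum_zero

lemma fderiv_apply_eq_zero_of_curve {S : Set E} {x v : E} {c : ℝ → E}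
    (hc : HasDerivAt c v 0) (hc0 : c 0 = x) (hcS : ∀ᶠ t in 𝓝 0, c t ∈ S) {F : Type}
    [NormedAddCommGroup F] [NormedSpace ℂ F] {g : E → F} (hg : DifferentiableAt ℂ g x)
    (h0 : ∀ᶠ y in 𝓝 x, y ∈ S → g y = 0) : fderiv ℂ g x v = 0 := by
  subst hc0
  have h1 : HasDerivAt (fun t => g (c t)) (fderiv ℂ g (c 0) v) 0 :=
    (hg.hasFDerivAt.restrictScalars ℝ).comp_hasDerivAt 0 hc
  have h2 : (fun t => g (c t)) =ᶠ[𝓝 0] fun _ => 0 := by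
    filter_upwards [hcS, hc.continuousAt.eventually h0] with t h1 h2
    exact h2 h1
  exact h1.unique ((hasDerivAt_const (0 : ℝ) (0 : F)).congr_of_eventuallyEq h2)

/-- Uniqueness for analytic functions on a maximal totally real affine subspace. -/
lemma eventually_eq_zero_of_realForm {V : Type} [NormedAddCommGroup V] [NormedSpace ℝ V]
    (j : V →L[ℝ] E) (hj : ∀ e, ∃ u u', e = j u + Complex.I • j u') {F : Type}
    [NormedAddCommGroup F] [NormedSpace ℂ F] [CompleteSpace F] {g : E → F} {b : E} {v : V}
    (hg : AnalyticAt ℂ g (b + j v)) (h0 : ∀ᶠ u in 𝓝 v, g (b + j u) = 0) :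
    ∀ᶠ y in 𝓝 (b + j v), g y = 0 := by
  obtain ⟨U, hU, hUo, hvU⟩ := eventually_nhds_iff.1 h0
  refine eventually_eq_zero_of_uniqueness (S := (fun u => b + j u) '' U) ⟨v, hvU, rfl⟩
    (.of_forall ?_) hg (.of_forall ?_)
  · rintro _ ⟨u, hu, rfl⟩ f hf hf0
    have key : ∀ w, fderiv ℂ f (b + j u) (j w) = 0 := by
      intro w
      refine fderiv_apply_eq_zero_of_curve (c := fun t => b + j (u + t • w)) ?_ (by simp) ?_
        hf.differentiableAt hf0
      · have : HasDerivAt (fun t : ℝ => b + j (u + t • w)) (j ((1 : ℝ) • w)) 0 :=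
          (j.hasFDerivAt.comp_hasDerivAt 0
            (((hasDerivAt_id (0 : ℝ)).smul_const w).const_add u)).const_add b
        simpa using this
      · have : Tendsto (fun t : ℝ => u + t • w) (𝓝 0) (𝓝 u) :=
          tendsto_cont
        filter_upwards [this.eventually (hUo.mem_nhds hu)] with t ht
        exact ⟨_, ht, rfl⟩
    ext e
    obtain ⟨w, w', rfl⟩ := hj e
    simp [key]
  · rintro _ ⟨u, hu, rfl⟩
    exact hU u hu

end TotallyReal

/-! ### Holomorphic extension of real analytic and Nash functions. -/

section Complexification

/-- The inclusion of `ℝ^ι` in `ℂ^ι`. -/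
def ofRealPi (ι : Type) [Fintype ι] : (ι → ℝ) →L[ℝ] (ι → ℂ) :=
  ContinuousLinearMap.pi fun i => ofRealCLM.comp (proj i)

@[simp] lemma ofRealPi_apply {ι : Type} [Fintype ι] (x : ι → ℝ) (i : ι) :
    ofRealPi ι x i = (x i : ℂ) := rfl

lemma ofRealPi_span {ι : Type} [Fintype ι] (e : ι → ℂ) :
    ∃ u u', e = ofRealPi ι u + Complex.I • ofRealPi ι u' :=
  ⟨fun i => (e i).re, fun i => (e i).im, by
    ext i; simp [mul_comm Complex.I, Complex.re_add_im]⟩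

variable {ι : Type} [Fintype ι]

/-- The complexification of a real multilinear form on `ℝ^ι`. -/
def complexifyForm [DecidableEq ι] {n : ℕ} (p : (ι → ℝ) [×n]→L[ℝ] ℝ) : (ι → ℂ) [×n]→L[ℂ] ℂ :=
  ∑ i : Fin n → ι, ((p fun k => Pi.single (i k) 1 : ℝ) : ℂ) •
    (ContinuousMultilinearMap.mkPiAlgebra ℂ (Fin n) ℂ).compContinuousLinearMap
      (fun k => proj (i k))

lemma complexifyForm_ofReal [DecidableEq ι] {n : ℕ} (p : (ι → ℝ) [×n]→L[ℝ] ℝ) (x : ι → ℝ) :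
    (complexifyForm p fun _ => ofRealPi ι x) = ((p fun _ => x : ℝ) : ℂ) := by
  have h1 : (p fun _ => x) = ∑ i : Fin n → ι, (∏ k, x (i k)) * p fun k => Pi.single (i k) 1 := by
    have hx : x = ∑ j, x j • (Pi.single j (1 : ℝ) : ι → ℝ) := by
      ext i; simp [Finset.sum_apply, Pi.single_apply]
    conv_lhs => rw [hx]
    rw [p.map_sum]
    refine Finset.sum_congr rfl fun i _ => ?_
    rw [p.map_smul_univ, smul_eq_mul]
  rw [h1]
  simp [complexifyForm, mul_comm]

/-- A crude count of multi-indices suffices: it costs a geometric factor, which only shrinks the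
radius of convergence. -/
lemma norm_complexifyForm_le [DecidableEq ι] {n : ℕ} (p : (ι → ℝ) [×n]→L[ℝ] ℝ) :
    ‖complexifyForm p‖ ≤ (Fintype.card ι : ℝ) ^ n * ‖p‖ := by
  refine (norm_sum_le _ _).trans ?_
  have : ∀ i ∈ (Finset.univ : Finset (Fin n → ι)), ‖((p fun k => Pi.single (i k) 1 : ℝ) : ℂ) •
    (ContinuousMultilinearMap.mkPiAlgebra ℂ (Fin n) ℂ).compContinuousLinearMap
      (fun k => (proj (i k) : (ι → ℂ) →L[ℂ] ℂ))‖ ≤ ‖p‖ := by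
    intro i _
    rw [norm_smul]
    have h1 : ‖((p fun k => Pi.single (i k) 1 : ℝ) : ℂ)‖ ≤ ‖p‖ := by
      rw [Complex.norm_real]
      refine (p.le_opNorm _).trans ?_
      have : ∏ k : Fin n, ‖(Pi.single (i k) 1 : ι → ℝ)‖ = 1 :=
        Finset.prod_eq_one fun k _ => by simp [Pi.norm_single]
      rw [this, mul_one]
    have h2 : ‖(ContinuousMultilinearMap.mkPiAlgebra ℂ (Fin n) ℂ).compContinuousLinearMap
      (fun k => (proj (i k) : (ι → ℂ) →L[ℂ] ℂ))‖ ≤ 1 := by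
      refine ContinuousMultilinearMap.opNorm_le_bound zero_le_one fun v => ?_
      rw [one_mul]
      simp only [ContinuousMultilinearMap.compContinuousLinearMap_apply,
        ContinuousMultilinearMap.mkPiAlgebra_apply, ContinuousLinearMap.proj_apply, norm_prod]
      exact Finset.prod_le_prod (fun _ _ => norm_nonneg _) fun k _ => norm_le_pi_norm _ _
    calc _ ≤ ‖p‖ * 1 := mul_le_mul h1 h2 (norm_nonneg _) (norm_nonneg _)
      _ = ‖p‖ := mul_one _
  refine (Finset.sum_le_sum this).trans ?_
  simp

/-- A real analytic function on `ℝ^ι` extends to a complex analytic function on `ℂ^ι`. -/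
lemma exists_complexification {f : (ι → ℝ) → ℝ} {a : ι → ℝ} (hf : AnalyticAt ℝ f a) :
    ∃ g : (ι → ℂ) → ℂ, AnalyticAt ℂ g (ofRealPi ι a) ∧
      ∀ᶠ x in 𝓝 a, g (ofRealPi ι x) = ((f x : ℝ) : ℂ) := by
  classical
  obtain ⟨p, R, hp⟩ := hf
  let q : FormalMultilinearSeries ℂ (ι → ℂ) ℂ := fun n => complexifyForm (p n)
  obtain ⟨r, hr0, hr⟩ := ENNReal.lt_iff_exists_nnreal_btwn.1 (hp.r_pos.trans_le hp.r_le)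
  have hr0' : 0 < r := by exact_mod_cast hr0
  obtain ⟨C, hC, hCb⟩ := p.norm_mul_pow_le_of_lt_radius hr
  -- The radius is divided by `c`; the summand `1` keeps `c` positive when `ι` is empty.
  set c : NNReal := Fintype.card ι + 1
  have hc : 0 < c := by positivity
  have hq : ((r / c : NNReal) : ENNReal) ≤ q.radius := by
    refine q.le_radius_of_bound C fun n => ?_
    have h1 := norm_complexifyForm_le (p n)
    have h2 : (Fintype.card ι : ℝ) ^ n ≤ (c : ℝ) ^ n :=
      pow_le_pow_left₀ (by positivity) (by simp [c]) n
    calc ‖q n‖ * ((r / c : NNReal) : ℝ) ^ n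
        ≤ ((c : ℝ) ^ n * ‖p n‖) * ((r / c : NNReal) : ℝ) ^ n := by
          refine mul_le_mul_of_nonneg_right (h1.trans ?_) (by positivity)
          exact mul_le_mul_of_nonneg_right h2 (norm_nonneg _)
      _ = ‖p n‖ * (r : ℝ) ^ n := by
          rw [NNReal.coe_div, div_pow]
          have : (c : ℝ) ^ n ≠ 0 := pow_ne_zero _ (by exact_mod_cast hc.ne')
          field_simp
      _ ≤ C := hCb n
  have hq0 : 0 < q.radius := lt_of_lt_of_le (by exact_mod_cast div_pos hr0' hc) hq
  have hqs := q.hasFPowerSeriesOnBall hq0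
  refine ⟨fun z => q.sum (z - ofRealPi ι a), ?_, ?_⟩
  · have h1 : AnalyticAt ℂ q.sum (ofRealPi ι a - ofRealPi ι a) := by
      rw [sub_self]; exact hqs.analyticAt
    exact AnalyticAt.fun_comp (f := fun z => z - ofRealPi ι a) h1 (analyticAt_id.sub analyticAt_const)
  · have ht : Tendsto (fun x => ofRealPi ι (x - a)) (𝓝 a) (𝓝 0) :=
      tendsto_cont
    filter_upwards [ht.eventually (Metric.eball_mem_nhds 0 hq0),
      Metric.eball_mem_nhds a hp.r_pos] with x hx hx'
    have h1 := hqs.hasSum hx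
    have h2 := hp.hasSum_sub hx'
    simp only [q, complexifyForm_ofReal, zero_add] at h1
    have h3 := Complex.hasSum_ofReal.2 h2
    rw [← map_sub]
    exact h1.unique h3

variable {E : Type} [NormedAddCommGroup E] [NormedSpace ℝ E]

/-- A coordinate criterion for complex coordinates: surjectivity of `X` keeps a nonzero polynomial
nonzero as a function on `E`. -/
lemma algAt_of_complex_mv {σ : Type} [Finite σ] {X : E → σ → ℂ}
    (hX : ∀ i, (fun y => X y i) ∈ polyFun E) (hs : Surjective X) {g : E → ℂ} {x : E}
    (hg : AnalyticAt ℝ g x) {p : MvPolynomial (Option σ) ℂ} (hp : p ≠ 0)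
    (h0 : ∀ᶠ y in 𝓝 x, MvPolynomial.eval (fun o => o.elim (g y) (X y)) p = 0) : AlgAt g x := by
  let φ : MvPolynomial σ ℂ →ₐ[ℂ] polyFun E := MvPolynomial.aeval fun i => ⟨_, hX i⟩
  have hφ : ∀ c y, (φ c).1 y = MvPolynomial.eval (X y) c := by
    intro c y
    induction c using MvPolynomial.induction_on with
    | C a => simp [φ]
    | add p q hp hq => rw [map_add, map_add, ← hp, ← hq]; rfl
    | mul_X p i hp =>
      rw [map_mul, map_mul, ← hp]
      simp only [φ, MvPolynomial.aeval_X, MvPolynomial.eval_X]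
      rfl
  have hinj : Injective φ := by
    rw [injective_iff_map_eq_zero]
    intro c hc
    refine MvPolynomial.funext fun v => ?_
    obtain ⟨y, rfl⟩ := hs v
    rw [← hφ, hc, map_zero]
    rfl
  refine algAt_iff.2 ⟨hg, (MvPolynomial.optionEquivLeft ℂ σ p).map φ.toRingHom, ?_, ?_⟩
  · rw [Polynomial.map_ne_zero_iff (f := φ.toRingHom) hinj]
    exact (map_ne_zero_iff _ (MvPolynomial.optionEquivLeft ℂ σ).injective).2 hp
  · filter_upwards [h0] with y hy
    rw [← hy, eval₂_map]
    have h2 : (polyEval y).comp φ.toRingHom = MvPolynomial.eval (X y) := RingHom.ext fun c => hφ c y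
    rw [h2]
    generalize g y = v
    clear hp h0 hy
    induction p using MvPolynomial.induction_on with
    | C a => simp [MvPolynomial.optionEquivLeft_C]
    | add p q hp hq => rw [map_add, eval₂_add, hp, hq, map_add]
    | mul_X p i hp =>
      rw [map_mul, eval₂_mul, hp, map_mul]
      congr 1
      cases i with
      | none => simp [MvPolynomial.optionEquivLeft_X_none]
      | some i => simp [MvPolynomial.optionEquivLeft_X_some]

lemma analyticAt_eval_mv {𝕜 : Type} [NontriviallyNormedField 𝕜] {V : Type}
    [NormedAddCommGroup V] [NormedSpace 𝕜 V] {σ : Type} {R : Type} [NormedCommRing R] [NormedAlgebra 𝕜 R]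
    {X : V → σ → R} {x : V}
    (hX : ∀ i, AnalyticAt 𝕜 (fun y => X y i) x) (p : MvPolynomial σ R) :
    AnalyticAt 𝕜 (fun y => MvPolynomial.eval (X y) p) x := by
  induction p using MvPolynomial.induction_on with
  | C a => simpa using analyticAt_const
  | add p q hp hq => simpa using hp.fun_add hq
  | mul_X p i hp => simpa using hp.fun_mul (hX i)

lemma coord_mem_polyFun (i : ι) : (fun y : ι → ℂ => y i) ∈ polyFun (ι → ℂ) := by
  have : (fun y : ι → ℂ => y i) = (fun y => (((reCLM.comp
      (proj (R := ℝ) (φ := fun _ : ι => ℂ) i)) y : ℝ) : ℂ)) +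
      (fun y => (((imCLM.comp
      (proj (R := ℝ) (φ := fun _ : ι => ℂ) i)) y : ℝ) : ℂ)) *
      fun _ => Complex.I := by
    ext y; simp [Complex.re_add_im]
  rw [this]
  exact add_mem (ofReal_clm_mem_polyFun _) (mul_mem (ofReal_clm_mem_polyFun _)
    (const_mem_polyFun _))

/-- The complexification of a regular function is regular. -/
lemma exists_regular_complexification {κ : Regularity} {f : (ι → ℝ) → ℝ} {a : ι → ℝ}
    (hf : RegAt κ f a) : ∃ g : (ι → ℂ) → ℂ, AnalyticAt ℂ g (ofRealPi ι a) ∧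
      RegAt κ g (ofRealPi ι a) ∧ ∀ᶠ x in 𝓝 a, g (ofRealPi ι x) = ((f x : ℝ) : ℂ) := by
  obtain ⟨g, hg, hgf⟩ := exists_complexification hf.1
  refine ⟨g, hg, regAt_of_algAt hg.restrictScalars fun hκ => ?_, hgf⟩
  obtain ⟨-, p, hp, h0⟩ := (algAt_iff_mv (ContinuousLinearEquiv.refl ℝ (ι → ℝ))).1
    (hf.2 hκ (ContinuousLinearMap.id ℝ ℝ))
  refine algAt_of_complex_mv (X := fun y => y) coord_mem_polyFun Function.surjective_id
    hg.restrictScalars hp ?_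
  have hX : ∀ o : Option ι, AnalyticAt ℂ (fun y : ι → ℂ => o.elim (g y) y) (ofRealPi ι a) := by
    rintro (_ | i)
    · exact hg
    · exact (proj (R := ℂ) (φ := fun _ : ι => ℂ) i).analyticAt _
  -- The relation is holomorphic in the complex variable and holds at real points, so it holds near
  -- them.
  have := eventually_eq_zero_of_realForm (ofRealPi ι) ofRealPi_span (b := 0) (v := a)
    (g := fun y => MvPolynomial.eval (fun o : Option ι => o.elim (g y) y) p)
    (by simpa using analyticAt_eval_mv hX p) (by
      filter_upwards [h0, hgf] with x hx hx'
      rw [zero_add, hx']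
      exact hx)
  simpa using this

end Complexification

/-! ### Comparison with the regularity notions of the statement. -/

section Conversion

variable {n : ℕ}

/-- The real coordinates of `ℂⁿ`. -/
def reImEquiv (n : ℕ) : ℂ^n ≃L[ℝ] (Fin n ⊕ Fin n → ℝ) :=
  LinearEquiv.toContinuousLinearEquiv
    { toFun := fun y => Sum.elim (fun i => (y i).re) (fun i => (y i).im)
      map_add' := fun a b => by ext (i | i) <;> simp
      map_smul' := fun a b => by ext (i | i) <;> simp
      invFun := fun v i => ⟨v (Sum.inl i), v (Sum.inr i)⟩
      left_inv := fun y => by ext i; simp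
      right_inv := fun v => by ext (i | i) <;> simp }

lemma reImEquiv_apply (y : ℂ^n) :
    reImEquiv n y = Sum.elim (fun i => (y i).re) (fun i => (y i).im) := rfl

lemma eval_map_ofReal {σ : Type} (v : σ → ℝ) (P : MvPolynomial σ ℝ) :
    MvPolynomial.eval (fun i => (v i : ℂ)) (MvPolynomial.map Complex.ofRealHom P) =
      (MvPolynomial.eval v P : ℝ) := by
  rw [MvPolynomial.eval_map]
  exact (MvPolynomial.eval₂_comp_left Complex.ofRealHom (RingHom.id ℝ) v P).symm

lemma exists_re_im_mvPolynomial {σ : Type} (p : MvPolynomial σ ℂ) :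
    ∃ a b : MvPolynomial σ ℝ, p = MvPolynomial.map Complex.ofRealHom a +
      MvPolynomial.C Complex.I * MvPolynomial.map Complex.ofRealHom b := by
  induction p using MvPolynomial.induction_on with
  | C c =>
    refine ⟨MvPolynomial.C c.re, MvPolynomial.C c.im, ?_⟩
    rw [MvPolynomial.map_C, MvPolynomial.map_C, ← MvPolynomial.C_mul, ← MvPolynomial.C_add]
    congr 1
    simp [mul_comm Complex.I, Complex.re_add_im]
  | add p q hp hq =>
    obtain ⟨a, b, rfl⟩ := hp
    obtain ⟨a', b', rfl⟩ := hq
    exact ⟨a + a', b + b', by simp only [map_add]; ring⟩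
  | mul_X p i hp =>
    obtain ⟨a, b, rfl⟩ := hp
    exact ⟨a * MvPolynomial.X i, b * MvPolynomial.X i, by
      simp only [map_mul, MvPolynomial.map_X]; ring⟩

/-- A complex relation between real quantities splits into its real and imaginary parts, and at
least one of these is a nonzero real polynomial. -/
lemma isRealRegularAt_iff {κ : Regularity} {f : ℂ^n → ℝ} {x : ℂ^n} :
    IsRealRegularAt κ f x ↔ RegAt κ f x := by
  constructor
  · rintro ⟨hf, h⟩
    refine ⟨hf, fun hκ ℓ => ?_⟩
    obtain ⟨P, hP, h0⟩ := h hκ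
    have key : AlgAt (fun y => ((f y : ℝ) : ℂ)) x := by
      refine (algAt_iff_mv (reImEquiv n)).2
        ⟨(ofRealCLM.analyticAt _).comp hf, MvPolynomial.rename (Sum.elim some fun _ => none)
            (MvPolynomial.map Complex.ofRealHom P), ?_, ?_⟩
      · refine (map_ne_zero_iff _ (MvPolynomial.rename_injective _ ?_)).2
          ((map_ne_zero_iff _ (MvPolynomial.map_injective _ Complex.ofReal_injective)).2 hP)
        rintro (i | i) (j | j) hij <;> simp_all
      · filter_upwards [h0] with y hy
        have h1 := eval_map_ofReal (Sum.elim (reImEquiv n y) fun _ : Unit => f y) P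
        rw [reImEquiv_apply, hy] at h1
        rw [MvPolynomial.eval_rename]
        refine Eq.trans ?_ (h1.trans Complex.ofReal_zero)
        congr 2
        funext o
        rcases o with (i | i) <;> rfl
    have hℓ : (fun y => ((ℓ (f y) : ℝ) : ℂ)) = (fun y => ((f y : ℝ) : ℂ)) *
        fun _ => ((ℓ 1 : ℝ) : ℂ) := by
      funext y
      have : ℓ (f y) = f y * ℓ 1 := by
        rw [← smul_eq_mul, ← map_smul, smul_eq_mul, mul_one]
      simp [this]
    rw [hℓ]
    exact key.mul (algAt_of_mem (const_mem_polyFun _) x)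
  · rintro ⟨hf, h⟩
    refine ⟨hf, fun hκ => ?_⟩
    obtain ⟨-, p, hp, h0⟩ := (algAt_iff_mv (reImEquiv n)).1 (h hκ (ContinuousLinearMap.id ℝ ℝ))
    obtain ⟨a, b, rfl⟩ := exists_re_im_mvPolynomial p
    let e : Option (Fin n ⊕ Fin n) → (Fin n ⊕ Fin n) ⊕ Unit := fun o => o.elim (Sum.inr ()) Sum.inl
    have he : Injective e := by
      rintro (_ | i) (_ | j) hij <;> simp_all [e]
    have hev : ∀ᶠ y in 𝓝 x,
        MvPolynomial.eval (Sum.elim (Sum.elim (fun i => (y i).re) (fun i => (y i).im))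
          (fun _ => f y)) (MvPolynomial.rename e a) = 0 ∧
        MvPolynomial.eval (Sum.elim (Sum.elim (fun i => (y i).re) (fun i => (y i).im))
          (fun _ => f y)) (MvPolynomial.rename e b) = 0 := by
      filter_upwards [h0] with y hy
      have h1 : (fun o : Option (Fin n ⊕ Fin n) => o.elim
          (((ContinuousLinearMap.id ℝ ℝ) (f y) : ℝ) : ℂ) fun i => ((reImEquiv n y i : ℝ) : ℂ)) =
          fun o => (((Sum.elim (Sum.elim (fun i => (y i).re) (fun i => (y i).im))
          (fun _ => f y)) (e o) : ℝ) : ℂ) := by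
        funext o
        rcases o with (_ | i) <;> rfl
      rw [h1, map_add, map_mul, MvPolynomial.eval_C, eval_map_ofReal, eval_map_ofReal] at hy
      have h2 := congrArg Complex.re hy
      have h3 := congrArg Complex.im hy
      simp at h2 h3
      rw [MvPolynomial.eval_rename, MvPolynomial.eval_rename]
      exact ⟨h2, h3⟩
    by_cases ha : a = 0
    · have hb : b ≠ 0 := by
        rintro rfl
        exact hp (by simp [ha])
      exact ⟨_, (map_ne_zero_iff _ (MvPolynomial.rename_injective e he)).2 hb,
        hev.mono fun _ h => h.2⟩
    · exact ⟨_, (map_ne_zero_iff _ (MvPolynomial.rename_injective e he)).2 ha,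
        hev.mono fun _ h => h.1⟩

/-- A holomorphic function which is regular as a function of the real coordinates is regular. -/
lemma isComplexRegularAt_of_regAt {κ : Regularity} {h : ℂ^n → ℂ} {x : ℂ^n}
    (ha : AnalyticAt ℂ h x) (hr : RegAt κ h x) : IsComplexRegularAt κ h x := by
  refine ⟨ha, fun hκ => ?_⟩
  obtain ⟨-, q, hq, h0⟩ := (algAt_iff_mv (reImEquiv n)).1 (hr.algAt hκ)
  -- Real and imaginary parts are written as `(y + τ) / 2` and `(y - τ) / 2i`, where `τ` stands for
  -- the conjugate of `y` but is treated as an independent variable.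
  let X : ℂ^n → ℂ → ℂ^n → Option (Fin n ⊕ Fin n) → ℂ := fun τ v y o =>
    o.elim v (Sum.elim (fun i => 2⁻¹ * (y i + τ i)) fun i => (2 * Complex.I)⁻¹ * (y i - τ i))
  let Q : ℂ^n → MvPolynomial (Fin n ⊕ Unit) ℂ := fun τ => MvPolynomial.bind₁
    (fun o => o.elim (MvPolynomial.X (Sum.inr ())) (Sum.elim (fun i => MvPolynomial.C 2⁻¹ *
          (MvPolynomial.X (Sum.inl i) + MvPolynomial.C (τ i)))
        fun i => MvPolynomial.C (2 * Complex.I)⁻¹ *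
          (MvPolynomial.X (Sum.inl i) - MvPolynomial.C (τ i)))) q
  have hQ : ∀ τ v y, MvPolynomial.eval (Sum.elim y fun _ => v) (Q τ) =
      MvPolynomial.eval (X τ v y) q := by
    intro τ v y
    have := MvPolynomial.eval₂Hom_bind₁ (RingHom.id ℂ) (Sum.elim y fun _ : Unit => v)
      (fun o : Option (Fin n ⊕ Fin n) => o.elim (MvPolynomial.X (Sum.inr ()))
      (Sum.elim (fun i => MvPolynomial.C 2⁻¹ * (MvPolynomial.X (Sum.inl i) + MvPolynomial.C (τ i)))
        fun i => MvPolynomial.C (2 * Complex.I)⁻¹ *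
          (MvPolynomial.X (Sum.inl i) - MvPolynomial.C (τ i)))) q
    refine this.trans ?_
    change MvPolynomial.eval _ q = _
    congr 2
    funext o
    rcases o with (_ | i | i) <;> simp [X]
  have hXan : ∀ (o : Option (Fin n ⊕ Fin n)) (w : ℂ^n × ℂ^n),
      AnalyticAt ℂ h w.2 → AnalyticAt ℂ (fun w : ℂ^n × ℂ^n =>
        X w.1 (h w.2) w.2 o) w := by
    intro o w hw
    have e1 : ∀ i, AnalyticAt ℂ (fun w : ℂ^n × ℂ^n => w.1 i) w := fun i =>
      ((proj (R := ℂ) (φ := fun _ : Fin n => ℂ) i).comp (fst ℂ ℂ^n ℂ^n)).analyticAt _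
    have e2 : ∀ i, AnalyticAt ℂ (fun w : ℂ^n × ℂ^n => w.2 i) w := fun i =>
      ((proj (R := ℂ) (φ := fun _ : Fin n => ℂ) i).comp (snd ℂ ℂ^n ℂ^n)).analyticAt _
    rcases o with (_ | i | i)
    · exact AnalyticAt.fun_comp hw analyticAt_snd
    · exact analyticAt_const.fun_mul ((e2 i).fun_add (e1 i))
    · exact analyticAt_const.fun_mul ((e2 i).fun_sub (e1 i))
  let j : ℂ^n →L[ℝ] ℂ^n × ℂ^n := (ContinuousLinearMap.pi fun i =>
      Complex.conjCLE.toContinuousLinearMap.comp (proj i)).prod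
      (ContinuousLinearMap.id ℝ _)
  have hjs : ∀ e, ∃ u u', e = j u + Complex.I • j u' := by
    rintro ⟨a, b⟩
    refine ⟨fun i => 2⁻¹ * (b i + star (a i)), fun i => 2⁻¹ * Complex.I * (star (a i) - b i), ?_⟩
    have hI := Complex.I_mul_I
    have h2 : (starRingEnd ℂ) 2 = 2 := Complex.conj_ofNat 2
    ext i
    · simp [j, h2]
      linear_combination (2⁻¹ * (a i - (starRingEnd ℂ) (b i))) * hI
    · simp [j, h2]
      linear_combination (-2⁻¹ * ((starRingEnd ℂ) (a i) - b i)) * hI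
  -- Since `h` is holomorphic, the polarized relation is holomorphic in `(τ, y)`. It holds on the
  -- totally real set where `τ` is the conjugate of `y`, hence near the point.
  have hz := eventually_eq_zero_of_realForm j hjs (b := 0) (v := x)
    (g := fun w => MvPolynomial.eval (X w.1 (h w.2) w.2) q)
    (analyticAt_eval_mv (fun o => hXan o _ (by simpa [j] using ha)) q) (by
      filter_upwards [h0] with y hy
      rw [← hy]
      congr 2
      funext o
      have e1 : ∀ i, (2 : ℂ)⁻¹ * (y i + (starRingEnd ℂ) (y i)) = (((y i).re : ℝ) : ℂ) := by
        intro i; rw [Complex.add_conj]; push_cast; ring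
      have e2 : ∀ i, (2 * Complex.I)⁻¹ * (y i - (starRingEnd ℂ) (y i)) = (((y i).im : ℝ) : ℂ) := by
        intro i; rw [Complex.sub_conj]; field_simp; push_cast; ring
      rcases o with (_ | i | i)
      · simp [X, j]
      · simpa [X, j, reImEquiv_apply] using e1 i
      · simpa [X, j, reImEquiv_apply] using e2 i)
  rw [zero_add] at hz
  obtain ⟨v0, hv0⟩ : ∃ v, MvPolynomial.eval v q ≠ 0 := by
    by_contra hcon
    push Not at hcon
    exact hq (MvPolynomial.funext fun v => by rw [hcon v, map_zero])
  let y0 : Fin n → ℂ := fun i => v0 (some (Sum.inl i)) + Complex.I * v0 (some (Sum.inr i))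
  let τ0 : Fin n → ℂ := fun i => v0 (some (Sum.inl i)) - Complex.I * v0 (some (Sum.inr i))
  have hX0 : X τ0 (v0 none) y0 = v0 := by
    funext o
    have hI := Complex.I_ne_zero
    rcases o with (_ | i | i)
    · rfl
    · simp [X, τ0, y0]; ring
    · simp [X, τ0, y0]; field_simp; ring_nf; simp
  have hG : AnalyticOnNhd ℂ (fun τ => MvPolynomial.eval (X τ (v0 none) y0) q) univ := by
    intro τ _
    refine analyticAt_eval_mv (fun o => ?_) q
    have e1 : ∀ i, AnalyticAt ℂ (fun w : ℂ^n => w i) τ := fun i =>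
      (proj (R := ℂ) (φ := fun _ : Fin n => ℂ) i).analyticAt _
    rcases o with (_ | i | i)
    · exact analyticAt_const
    · exact analyticAt_const.fun_mul (analyticAt_const.fun_add (e1 i))
    · exact analyticAt_const.fun_mul (analyticAt_const.fun_sub (e1 i))
  -- Freezing `τ` must not kill the polynomial. It survives at `τ0`, hence by the identity theorem
  -- at values arbitrarily close to the conjugate of `x`.
  have hfr : ∃ᶠ τ in 𝓝 (j x).1, MvPolynomial.eval (X τ (v0 none) y0) q ≠ 0 := by
    intro hcon
    push Not at hcon
    have := hG.eqOn_zero_of_preconnected_of_eventuallyEq_zero isPreconnected_univ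
      (mem_univ (j x).1) hcon (mem_univ τ0)
    refine hv0 ?_
    rw [← hX0]
    exact this
  have hz' : ∀ᶠ w in 𝓝 ((j x).1, (j x).2), MvPolynomial.eval (X w.1 (h w.2) w.2) q = 0 := hz
  obtain ⟨τ, h1, h2⟩ := (hfr.and_eventually hz'.curry_nhds).exists
  refine ⟨Q τ, fun h3 => h1 ?_, ?_⟩
  · rw [← hQ, h3, map_zero]
  · filter_upwards [h2] with y hy
    rw [hQ]
    exact hy

end Conversion

/-! ### Ranks and minors of linear maps. -/

section Rank

variable {V W Z : Type} [NormedAddCommGroup V] [NormedSpace ℂ V] [NormedAddCommGroup W]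
  [NormedSpace ℂ W] [NormedAddCommGroup Z] [NormedSpace ℂ Z]

/-- The rank of a continuous linear map. -/
def rk (T : V →L[ℂ] W) : ℕ := finrank ℂ (LinearMap.range T.toLinearMap)

/-- The minors of a linear map. -/
def minor (T : V →L[ℂ] W) {r : ℕ} (v : Fin r → V) (l : Fin r → W →L[ℂ] ℂ) : ℂ :=
  Matrix.det (Matrix.of fun i j => l i (T (v j)))

lemma minor_comp' (S : W →L[ℂ] Z) (T : V →L[ℂ] W) {r : ℕ} (v : Fin r → V)
    (l : Fin r → Z →L[ℂ] ℂ) : minor (S.comp T) v l = minor S (fun j => T (v j)) l := rfl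

lemma rk_comp_le_left [FiniteDimensional ℂ W] (S : W →L[ℂ] Z) (T : V →L[ℂ] W) :
    rk (S.comp T) ≤ rk S := by
  refine Submodule.finrank_mono ?_
  rintro _ ⟨x, rfl⟩
  exact ⟨T x, rfl⟩

lemma rk_comp_le_right [FiniteDimensional ℂ V] (S : W →L[ℂ] Z) (T : V →L[ℂ] W) :
    rk (S.comp T) ≤ rk T := by
  have h : LinearMap.range (S.comp T).toLinearMap =
      (LinearMap.range T.toLinearMap).map S.toLinearMap := by
    rw [← LinearMap.range_comp]; rfl
  rw [rk, rk, h]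
  exact Submodule.finrank_map_le _ _

lemma rk_comp_of_injective (S : W →L[ℂ] Z) (T : V →L[ℂ] W) (hS : Injective S) :
    rk (S.comp T) = rk T := by
  have h : LinearMap.range (S.comp T).toLinearMap =
      (LinearMap.range T.toLinearMap).map S.toLinearMap := by
    rw [← LinearMap.range_comp]; rfl
  rw [rk, rk, h]
  exact (Submodule.equivMapOfInjective S.toLinearMap hS _).finrank_eq.symm

lemma rk_le_finrank [FiniteDimensional ℂ V] (T : V →L[ℂ] W) : rk T ≤ finrank ℂ V :=
  LinearMap.finrank_range_le _

lemma rk_le_finrank' [FiniteDimensional ℂ W] (T : V →L[ℂ] W) : rk T ≤ finrank ℂ W :=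
  Submodule.finrank_le _

lemma rk_eq_finrank_of_injective (T : V →L[ℂ] W) (hT : Injective T) :
    rk T = finrank ℂ V :=
  LinearMap.finrank_range_of_inj hT

lemma le_rk_of_minor_ne_zero [FiniteDimensional ℂ V] {T : V →L[ℂ] W} {r : ℕ} {v : Fin r → V}
    {l : Fin r → W →L[ℂ] ℂ} (h : minor T v l ≠ 0) : r ≤ rk T := by
  have h1 : LinearIndependent ℂ fun j => (⟨T (v j), v j, rfl⟩ : LinearMap.range T.toLinearMap) := by
    rw [Fintype.linearIndependent_iff]
    intro g hg
    have h2 : (Matrix.of fun i j => l i (T (v j))).mulVec g = 0 := by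
      ext i
      have h3 := congrArg (fun w : LinearMap.range T.toLinearMap => l i (w : W)) hg
      simp only [Submodule.coe_sum, Submodule.coe_smul, map_sum, map_smul, smul_eq_mul,
        Submodule.coe_zero, map_zero] at h3
      rw [Pi.zero_apply, ← h3, Matrix.mulVec, dotProduct]
      exact Finset.sum_congr rfl fun j _ => mul_comm _ _
    have h4 := Matrix.eq_zero_of_mulVec_eq_zero h h2
    intro i; rw [h4]; rfl
  simpa [rk] using h1.fintype_card_le_finrank

lemma exists_minor_ne_zero [FiniteDimensional ℂ W] {T : V →L[ℂ] W} {r : ℕ}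
    (h : r ≤ rk T) : ∃ (v : Fin r → V) (l : Fin r → W →L[ℂ] ℂ), minor T v l ≠ 0 := by
  obtain ⟨b, hb⟩ := exists_linearIndependent_of_le_finrank h
  choose v hv using fun j => (b j).2
  have hb' : LinearIndependent ℂ fun j => ((b j : LinearMap.range T.toLinearMap) : W) :=
    hb.map' (LinearMap.range T.toLinearMap).subtype (Submodule.ker_subtype _)
  obtain ⟨g, hg⟩ := LinearMap.exists_leftInverse_of_injective
    (Fintype.linearCombination ℂ fun j => ((b j : LinearMap.range T.toLinearMap) : W))
    (LinearMap.ker_eq_bot.2 hb'.fintypeLinearCombination_injective)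
  refine ⟨v, fun i => toContinuousLinearMap (LinearMap.proj i ∘ₗ g), ?_⟩
  have : (Matrix.of fun i j => (toContinuousLinearMap
      (LinearMap.proj i ∘ₗ g) : W →L[ℂ] ℂ) (T (v j))) = (1 : Matrix (Fin r) (Fin r) ℂ) := by
    ext i j
    have h1 : T (v j) = (b j : W) := hv j
    have h2 := congrArg (fun f => f (Pi.single j (1 : ℂ)) i) hg
    simp only [LinearMap.comp_apply, Fintype.linearCombination_apply_single, one_smul,
      LinearMap.id_apply] at h2
    rw [Matrix.of_apply, h1, Matrix.one_apply]
    simpa [Pi.single_apply] using h2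
  rw [minor, this, Matrix.det_one]
  exact one_ne_zero

lemma rk_le_of_minor_eq_zero [FiniteDimensional ℂ W] {T : V →L[ℂ] W} {r : ℕ}
    (h : ∀ (v : Fin (r + 1) → V) (l : Fin (r + 1) → W →L[ℂ] ℂ), minor T v l = 0) : rk T ≤ r := by
  by_contra hcon
  obtain ⟨v, l, hvl⟩ := exists_minor_ne_zero (T := T) (r := r + 1) (by omega)
  exact hvl (h v l)

lemma minor_eq_zero_of_rk_le [FiniteDimensional ℂ V] {T : V →L[ℂ] W} {r : ℕ} (h : rk T ≤ r)
    (v : Fin (r + 1) → V) (l : Fin (r + 1) → W →L[ℂ] ℂ) : minor T v l = 0 := by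
  by_contra hcon
  have := le_rk_of_minor_ne_zero hcon
  omega

lemma analyticAt_minor {X : Type} [NormedAddCommGroup X] [NormedSpace ℂ X]
    {T : X → V →L[ℂ] W} {x : X} {r : ℕ} (v : Fin r → V) (l : Fin r → W →L[ℂ] ℂ)
    (hT : ∀ j, AnalyticAt ℂ (fun y => T y (v j)) x) :
    AnalyticAt ℂ (fun y => minor (T y) v l) x := by
  simp only [minor, Matrix.det_apply]
  refine Finset.analyticAt_fun_sum _ fun σ _ => ?_
  simp only [Units.smul_def, zsmul_eq_mul]
  refine analyticAt_const.fun_mul ?_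
  refine Finset.analyticAt_fun_prod _ fun i _ => ?_
  exact ((l (σ i)).analyticAt _).fun_comp (hT i)

lemma analyticAt_fderiv_apply {F : V → W} [CompleteSpace W] {x : V} (hF : AnalyticAt ℂ F x)
    (v : V) : AnalyticAt ℂ (fun y => fderiv ℂ F y v) x :=
  ((ContinuousLinearMap.apply ℂ W v).analyticAt _).fun_comp hF.fderiv

/-- The partial derivative in the second variable. -/
lemma analyticAt_fderiv_snd_apply {X : Type} [NormedAddCommGroup X] [NormedSpace ℂ X]
    [CompleteSpace W] {F : X × V → W} {x : X × V} (hF : AnalyticAt ℂ F x) (v : V) :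
    AnalyticAt ℂ (fun y : X × V => fderiv ℂ (fun u => F (y.1, u)) y.2 v) x := by
  refine (analyticAt_fderiv_apply hF (0, v)).congr ?_
  filter_upwards [hF.eventually_analyticAt] with y hy
  have h1 : HasFDerivAt (fun u : V => (y.1, u)) (inr ℂ X V) y.2 := hasFDerivAt_prodMk_right y.1 y.2
  have h2 : HasFDerivAt (fun u => F (y.1, u)) _ y.2 :=
    HasFDerivAt.comp (g := F) y.2 hy.hasFDerivAt h1
  rw [h2.fderiv]
  rfl

/-- The rank of an analytic map on a connected open set is nowhere larger than generically. -/
lemma rk_le_of_isPreconnected [FiniteDimensional ℂ V] [FiniteDimensional ℂ W] [CompleteSpace W]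
    {F : V → W} {U : Set V} (hF : AnalyticOnNhd ℂ F U) (hU : IsPreconnected U) {r : ℕ} {x₁ : V}
    (hx₁ : x₁ ∈ U) (h : ∀ᶠ x in 𝓝 x₁, rk (fderiv ℂ F x) ≤ r) :
    ∀ x ∈ U, rk (fderiv ℂ F x) ≤ r := by
  intro x hx
  refine rk_le_of_minor_eq_zero fun v l => ?_
  have h1 : AnalyticOnNhd ℂ (fun y => minor (fderiv ℂ F y) v l) U := fun y hy =>
    analyticAt_minor v l fun j => analyticAt_fderiv_apply (hF y hy) (v j)
  exact h1.eqOn_zero_of_preconnected_of_eventuallyEq_zero hU hx₁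
    (h.mono fun y hy => minor_eq_zero_of_rk_le hy v l) hx

lemma eventually_le_rk [FiniteDimensional ℂ V] [FiniteDimensional ℂ W] {X : Type}
    [TopologicalSpace X] {T : X → V →L[ℂ] W} {x : X} (hT : ContinuousAt T x) {r : ℕ}
    (h : r ≤ rk (T x)) : ∀ᶠ y in 𝓝 x, r ≤ rk (T y) := by
  obtain ⟨v, l, hvl⟩ := exists_minor_ne_zero h
  have : ContinuousAt (fun y => minor (T y) v l) x := by
    unfold minor
    have h2 : ContinuousAt (fun y => (Matrix.of fun i j => l i (T y (v j)))) x := by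
      refine continuousAt_pi.2 fun i => continuousAt_pi.2 fun j => ?_
      exact (l i).continuous.continuousAt.comp (hT.clm_apply continuousAt_const)
    exact (continuous_id.matrix_det).continuousAt.comp h2
  filter_upwards [this.eventually_ne hvl] with y hy
  exact le_rk_of_minor_ne_zero hy

end Rank

/-! ### Generic ranks of analytic maps. -/

section GenericRank

variable {V W Z : Type} [NormedAddCommGroup V] [NormedSpace ℂ V] [NormedAddCommGroup W]
  [NormedSpace ℂ W] [NormedAddCommGroup Z] [NormedSpace ℂ Z]

/-- Ranks are bounded by the dimension of the source, so the supremum is attained; `sSup` of an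
unbounded set of naturals would be the default value `0`. -/
lemma le_genericRank_iff [FiniteDimensional ℂ V] {F : V → W} {x₀ : V} {r : ℕ} :
    r ≤ genericRank F x₀ ↔ ∃ᶠ x in 𝓝 x₀, r ≤ rk (fderiv ℂ F x) := by
  have hb : BddAbove {r : ℕ | ∃ᶠ x in 𝓝 x₀, r ≤ rk (fderiv ℂ F x)} :=
    ⟨finrank ℂ V, fun r hr => by
      obtain ⟨x, hx⟩ := hr.exists
      exact hx.trans (rk_le_finrank _)⟩
  have hne : {r : ℕ | ∃ᶠ x in 𝓝 x₀, r ≤ rk (fderiv ℂ F x)}.Nonempty :=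
    ⟨0, (Eventually.of_forall fun _ => Nat.zero_le _).frequently⟩
  constructor
  · intro h
    have h1 : genericRank F x₀ ∈ {r : ℕ | ∃ᶠ x in 𝓝 x₀, r ≤ rk (fderiv ℂ F x)} :=
      Nat.sSup_mem hne hb
    exact h1.mono fun x hx => h.trans hx
  · intro h
    exact le_csSup hb h

lemma eventually_rk_le_genericRank [FiniteDimensional ℂ V] (F : V → W) (x₀ : V) :
    ∀ᶠ x in 𝓝 x₀, rk (fderiv ℂ F x) ≤ genericRank F x₀ := by
  have h : ¬ (genericRank F x₀ + 1 ≤ genericRank F x₀) := by omega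
  rw [le_genericRank_iff, not_frequently] at h
  filter_upwards [h] with x hx
  omega

lemma genericRank_le_iff [FiniteDimensional ℂ V] {F : V → W} {x₀ : V} {r : ℕ} :
    genericRank F x₀ ≤ r ↔ ∀ᶠ x in 𝓝 x₀, rk (fderiv ℂ F x) ≤ r := by
  constructor
  · intro h
    exact (eventually_rk_le_genericRank F x₀).mono fun x hx => hx.trans h
  · intro h
    by_contra hcon
    have h1 : r + 1 ≤ genericRank F x₀ := by omega
    obtain ⟨x, hx, hx'⟩ := ((le_genericRank_iff.1 h1).and_eventually h).exists
    omega

lemma genericRank_congr_rk [FiniteDimensional ℂ V] {F : V → W} {G : V → Z} {x₀ : V}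
    (h : ∀ᶠ x in 𝓝 x₀, rk (fderiv ℂ F x) = rk (fderiv ℂ G x)) :
    genericRank F x₀ = genericRank G x₀ :=
  le_antisymm
    (genericRank_le_iff.2 (by
      filter_upwards [h, eventually_rk_le_genericRank G x₀] with x h1 h2
      rwa [h1]))
    (genericRank_le_iff.2 (by
      filter_upwards [h, eventually_rk_le_genericRank F x₀] with x h1 h2
      rwa [← h1]))

/-- The generic rank of an analytic map on a connected open set does not depend on the point. -/
lemma genericRank_le_of_isPreconnected [FiniteDimensional ℂ V] [FiniteDimensional ℂ W]
    [CompleteSpace W] {F : V → W} {U : Set V} (hF : AnalyticOnNhd ℂ F U) (hU : IsPreconnected U)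
    (hUo : IsOpen U) {r : ℕ} {x₀ x₁ : V} (hx₀ : x₀ ∈ U)
    (hx₁ : x₁ ∈ U) (h : ∀ᶠ x in 𝓝 x₁, rk (fderiv ℂ F x) ≤ r) : genericRank F x₀ ≤ r :=
  genericRank_le_iff.2 (by
    filter_upwards [hUo.mem_nhds hx₀] with x hx
    exact rk_le_of_isPreconnected hF hU hx₁ h x hx)

end GenericRank

/-! ### The inverse function theorem and functional dependence. -/

section LocalInverse

variable {𝕜 : Type} [RCLike 𝕜] {E F : Type} [NormedAddCommGroup E] [NormedSpace 𝕜 E]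
  [NormedAddCommGroup F] [NormedSpace 𝕜 F] [CompleteSpace E] [CompleteSpace F]

/-- The analytic inverse function theorem. -/
lemma exists_localInverse {f : E → F} {x : E} (hf : AnalyticAt 𝕜 f x)
    (hb : Bijective (fderiv 𝕜 f x)) :
    ∃ g : F → E, AnalyticAt 𝕜 g (f x) ∧ g (f x) = x ∧ (∀ᶠ y in 𝓝 (f x), f (g y) = y) ∧
      ∀ᶠ y in 𝓝 x, g (f y) = y := by
  let i : E ≃L[𝕜] F := ContinuousLinearEquiv.ofBijective (fderiv 𝕜 f x)
    (LinearMap.ker_eq_bot.2 hb.1) (LinearMap.range_eq_top.2 hb.2)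
  have hi : (i : E →L[𝕜] F) = fderiv 𝕜 f x := ContinuousLinearEquiv.coe_ofBijective _ _ _
  have hs : HasStrictFDerivAt f (i : E →L[𝕜] F) x := by
    rw [hi]; exact hf.hasStrictFDerivAt
  refine ⟨(hs.toOpenPartialHomeomorph f).symm, ?_, hs.localInverse_apply_image,
    hs.eventually_right_inverse, hs.eventually_left_inverse⟩
  exact (hs.toOpenPartialHomeomorph f).analyticAt_symm' hs.mem_toOpenPartialHomeomorph_source
    hf hi.symm

end LocalInverse

section Factor

variable {𝕜 : Type} [RCLike 𝕜] {P Q Z : Type} [NormedAddCommGroup P] [NormedSpace 𝕜 P]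
  [NormedAddCommGroup Q] [NormedSpace 𝕜 Q] [NormedAddCommGroup Z] [NormedSpace 𝕜 Z]

lemma eventually_fderiv_prodMk_comp {f : P × Q → Z} {x : P × Q} (hf : AnalyticAt 𝕜 f x)
    [CompleteSpace Z] :
    ∀ᶠ y in 𝓝 x, HasFDerivAt (fun v => f (y.1, v))
      ((fderiv 𝕜 f y).comp (inr 𝕜 P Q)) y.2 := by
  filter_upwards [hf.eventually_analyticAt] with y hy
  exact HasFDerivAt.comp (g := f) y.2 hy.hasFDerivAt
    (hasFDerivAt_prodMk_right y.1 y.2)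

/-- Functional dependence: a map whose differential vanishes on the fibres of a submersion is
constant on the fibres. -/
lemma exists_factor_of_ker_le [FiniteDimensional 𝕜 Q] [FiniteDimensional 𝕜 P] {K₁ : Q → Z}
    {K₂ : Q → P} {q₀ : Q} (h₁ : ∀ᶠ q in 𝓝 q₀, DifferentiableAt 𝕜 K₁ q)
    (h₂ : AnalyticAt 𝕜 K₂ q₀) (hs : Surjective (fderiv 𝕜 K₂ q₀))
    (hk : ∀ᶠ q in 𝓝 q₀, ∀ v, fderiv 𝕜 K₂ q v = 0 → fderiv 𝕜 K₁ q v = 0) :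
    ∃ φ : P → Z, ∀ᶠ q in 𝓝 q₀, K₁ q = φ (K₂ q) := by
  have : CompleteSpace P := FiniteDimensional.complete 𝕜 P
  have : CompleteSpace Q := FiniteDimensional.complete 𝕜 Q
  let N := LinearMap.ker (fderiv 𝕜 K₂ q₀).toLinearMap
  have : CompleteSpace N := FiniteDimensional.complete 𝕜 N
  obtain ⟨π, hπ⟩ := N.exists_isCompl
  -- A projection onto the kernel completes `K₂` to a local coordinate system, in which the fibres
  -- of `K₂` become convex slices along which `K₁` has zero derivative.
  obtain ⟨κ, hκ⟩ := LinearMap.exists_leftInverse_of_injective N.subtype (Submodule.ker_subtype _)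
  let κ' : Q →L[𝕜] N := toContinuousLinearMap κ
  have hκ' : ∀ v : N, κ' (v : Q) = v := fun v => LinearMap.congr_fun hκ v
  let f : Q → P × N := fun q => (K₂ q, κ' q)
  have hf : AnalyticAt 𝕜 f q₀ := h₂.prod (κ'.analyticAt _)
  have hfd : ∀ v, fderiv 𝕜 f q₀ v = (fderiv 𝕜 K₂ q₀ v, κ' v) := by
    intro v
    rw [(h₂.hasFDerivAt.prodMk κ'.hasFDerivAt).fderiv]
    rfl
  have hb : Bijective (fderiv 𝕜 f q₀) := by
    constructor
    · rw [injective_iff_map_eq_zero]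
      intro v hv
      rw [hfd] at hv
      have h1 : v ∈ N := (Prod.mk.inj hv).1
      have h2 := hκ' ⟨v, h1⟩
      rw [(Prod.mk.inj hv).2] at h2
      exact (congrArg Subtype.val h2).symm
    · rintro ⟨p, s⟩
      obtain ⟨v, rfl⟩ := hs p
      refine ⟨v - (κ' v : Q) + (s : Q), ?_⟩
      have hN : ∀ s : N, fderiv 𝕜 K₂ q₀ (s : Q) = 0 := fun s => s.2
      rw [hfd, map_add, map_sub, map_add, map_sub, hN, hN, hκ', hκ']
      simp
  obtain ⟨g, hg, hg0, hfg, hgf⟩ := exists_localInverse hf hb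
  have hg' : Tendsto g (𝓝 (f q₀)) (𝓝 q₀) := hg.tendsto hg0
  have hev : ∀ᶠ y in 𝓝 (f q₀), HasFDerivAt (fun s => K₁ (g (y.1, s))) (0 : N →L[𝕜] Z) y.2 := by
    filter_upwards [hfg.eventually_nhds, hg'.eventually h₁, hg'.eventually hk,
      hg'.eventually h₂.eventually_analyticAt, eventually_fderiv_prodMk_comp hg] with
      y hy1 hy2 hy3 hy4 hy5
    set T := (fderiv 𝕜 g y).comp (inr 𝕜 P N)
    have e1 : HasFDerivAt (fun s => K₁ (g (y.1, s))) ((fderiv 𝕜 K₁ (g y)).comp T) y.2 :=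
      HasFDerivAt.comp (g := K₁) (f := fun s => g (y.1, s)) y.2 hy2.hasFDerivAt hy5
    have e2 : HasFDerivAt (fun s => K₂ (g (y.1, s))) ((fderiv 𝕜 K₂ (g y)).comp T) y.2 :=
      HasFDerivAt.comp (g := K₂) (f := fun s => g (y.1, s)) y.2
        hy4.hasFDerivAt hy5
    have e3 : (fun s => K₂ (g (y.1, s))) =ᶠ[𝓝 y.2] fun _ => y.1 := by
      have : Tendsto (fun s : N => (y.1, s)) (𝓝 y.2) (𝓝 y) := tendsto_cont rfl
      filter_upwards [this.eventually hy1] with s hs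
      exact congrArg Prod.fst hs
    have e4 := e2.unique ((hasFDerivAt_const y.1 y.2).congr_of_eventuallyEq e3)
    convert e1
    ext s
    exact (hy3 _ (DFunLike.congr_fun e4 s)).symm
  obtain ⟨ε, hε, hball⟩ := eventually_nhds_iff_ball.1 hev
  refine ⟨fun p => K₁ (g (p, (f q₀).2)), ?_⟩
  filter_upwards [hgf, hf.continuousAt.eventually (ball_mem_nhds _ hε)] with q hq hq'
  have hq2 : dist (f q).1 (f q₀).1 < ε ∧ dist (f q).2 (f q₀).2 < ε := by
    have : dist (f q) (f q₀) < ε := hq'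
    rwa [Prod.dist_eq, max_lt_iff] at this
  have hmem : ∀ s ∈ ball (f q₀).2 ε, ((f q).1, s) ∈ ball (f q₀) ε := fun s hs => by
    rw [mem_ball, Prod.dist_eq, max_lt_iff]
    exact ⟨hq2.1, hs⟩
  let _ : NormedSpace ℝ N := NormedSpace.restrictScalars ℝ 𝕜 N
  have := (isOpen_ball (x := (f q₀).2) (ε := ε)).is_const_of_fderiv_eq_zero (𝕜 := 𝕜)
    (f := fun s => K₁ (g ((f q).1, s))) (convex_ball (f q₀).2 ε).isPreconnected
    (fun s hs => (hball _ (hmem s hs)).differentiableAt.differentiableWithinAt)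
    (fun s hs => (hball _ (hmem s hs)).fderiv) hq2.2 (Metric.mem_ball_self hε)
  have e : g (f q) = q := hq
  conv_lhs => rw [← e]
  exact this

/-- If an immersion `F` factors through a map `G` of rank at most the dimension of the source of
`F`, then `G` takes values in the image of `F`. -/
lemma exists_factor_through_immersion {P Q Z : Type} [NormedAddCommGroup P] [NormedSpace ℂ P]
    [NormedAddCommGroup Q] [NormedSpace ℂ Q] [NormedAddCommGroup Z] [NormedSpace ℂ Z]
    [FiniteDimensional ℂ P] [FiniteDimensional ℂ Q] [FiniteDimensional ℂ Z]
    {F : P → Z} {G : Q → Z} {j : P → Q} {u₀ : P}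
    (hF : AnalyticAt ℂ F u₀) (hF' : Injective (fderiv ℂ F u₀))
    (hG : AnalyticAt ℂ G (j u₀)) (hj : AnalyticAt ℂ j u₀)
    (hFG : ∀ᶠ u in 𝓝 u₀, F u = G (j u))
    (hr : ∀ᶠ q in 𝓝 (j u₀), rk (fderiv ℂ G q) ≤ finrank ℂ P) :
    ∃ φ : Q → P, AnalyticAt ℂ φ (j u₀) ∧ φ (j u₀) = u₀ ∧ ∀ᶠ q in 𝓝 (j u₀), G q = F (φ q) := by
  -- Composition with a left inverse of the differential turns `F` into a local diffeomorphism and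
  -- `G` into a submersion. The rank bound forces the differentials of `G` and `π ∘ G` to have equal
  -- kernels, so `G` is a function of `π ∘ G`; along `j` this function is read off from `F`.
  obtain ⟨π, hπ⟩ := LinearMap.exists_leftInverse_of_injective (fderiv ℂ F u₀).toLinearMap
    (LinearMap.ker_eq_bot.2 hF')
  let π' : Z →L[ℂ] P := toContinuousLinearMap π
  have hπ' : ∀ v, π' (fderiv ℂ F u₀ v) = v := fun v => LinearMap.congr_fun hπ v
  have hFu := hFG.self_of_nhds
  have hd : ∀ {q : Q}, AnalyticAt ℂ G q → fderiv ℂ (fun q => π' (G q)) q =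
      π'.comp (fderiv ℂ G q) := fun hq =>
    (π'.hasFDerivAt.comp _ hq.hasFDerivAt).fderiv
  have hdF : fderiv ℂ (fun u => π' (F u)) u₀ = ContinuousLinearMap.id ℂ P := by
    have h1 : HasFDerivAt (fun u => π' (F u)) _ u₀ :=
      π'.hasFDerivAt.comp (g := π') u₀ hF.hasFDerivAt
    rw [h1.fderiv]
    ext v
    exact hπ' v
  have hGa : AnalyticAt ℂ (fun q => π' (G q)) (j u₀) := (π'.analyticAt _).fun_comp hG
  have hFa : AnalyticAt ℂ (fun u => π' (F u)) u₀ := (π'.analyticAt _).fun_comp hF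
  have hdG : (fderiv ℂ F u₀) = (fderiv ℂ G (j u₀)).comp (fderiv ℂ j u₀) := by
    have h1 : HasFDerivAt (fun u => G (j u)) _ u₀ := HasFDerivAt.comp (g := G) u₀ hG.hasFDerivAt
        hj.hasFDerivAt
    exact (h1.congr_of_eventuallyEq hFG).fderiv
  have hs : Surjective (fderiv ℂ (fun q => π' (G q)) (j u₀)) := by
    intro v
    refine ⟨fderiv ℂ j u₀ v, ?_⟩
    rw [hd hG, ContinuousLinearMap.comp_apply]
    have := hπ' v
    rw [hdG] at this
    exact this
  have hsurj : ∀ᶠ q in 𝓝 (j u₀), finrank ℂ P ≤ rk (fderiv ℂ (fun q => π' (G q)) q) := by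
    refine eventually_le_rk hGa.fderiv.continuousAt ?_
    rw [rk, LinearMap.range_eq_top.2 hs, finrank_top]
  obtain ⟨φ, hφ⟩ := exists_factor_of_ker_le (K₁ := G) (K₂ := fun q => π' (G q)) (q₀ := j u₀)
    (hG.eventually_analyticAt.mono fun q hq => hq.differentiableAt) hGa hs (by
      filter_upwards [hr, hsurj, hG.eventually_analyticAt] with q h1 h2 h3 v hv
      rw [hd h3] at h2 hv
      have e1 := LinearMap.finrank_range_add_finrank_ker (fderiv ℂ G q).toLinearMap
      have e2 := LinearMap.finrank_range_add_finrank_ker (π'.comp (fderiv ℂ G q)).toLinearMap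
      have e3 : LinearMap.ker (fderiv ℂ G q).toLinearMap ≤
          LinearMap.ker (π'.comp (fderiv ℂ G q)).toLinearMap := fun w hw => by
        have hw' : fderiv ℂ G q w = 0 := hw
        change π' (fderiv ℂ G q w) = 0
        rw [hw', map_zero]
      have e4 := Submodule.eq_of_le_of_finrank_le e3 (by unfold rk at h1 h2; omega)
      have : v ∈ LinearMap.ker (fderiv ℂ G q).toLinearMap := by
        rw [e4]; exact hv
      exact this)
  obtain ⟨g, hg, hg0, hfg, hgf⟩ := exists_localInverse hFa (by
    rw [hdF]; exact Function.bijective_id)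
  have hφ' : ∀ᶠ u in 𝓝 u₀, F u = φ (π' (F u)) := by
    filter_upwards [hFG, hj.continuousAt.eventually hφ] with u h1 h2
    rw [h1, ← h2]
  have hGF : π' (G (j u₀)) = π' (F u₀) := by rw [hFu]
  have hga : AnalyticAt ℂ (fun q => g (π' (G q))) (j u₀) := by
    refine AnalyticAt.fun_comp ?_ hGa
    rw [hGF]; exact hg
  have ht : Tendsto (fun q => π' (G q)) (𝓝 (j u₀)) (𝓝 (π' (F u₀))) := hGa.tendsto hGF
  have h0 : g (π' (G (j u₀))) = u₀ := by rw [hGF]; exact hg0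
  refine ⟨fun q => g (π' (G q)), hga, h0, ?_⟩
  have ht2 : Tendsto (fun q => g (π' (G q))) (𝓝 (j u₀)) (𝓝 u₀) := hga.tendsto h0
  filter_upwards [hφ, ht.eventually hfg, ht2.eventually hφ'] with q h1 h2 h3
  rw [h3, h2, ← h1]

end Factor

/-! ### Iterated local actions. -/

section Chain

variable {V Y : Type} [NormedAddCommGroup V] [NormedSpace ℂ V] [NormedAddCommGroup Y]
  [NormedSpace ℂ Y]

/-- Iteration of a sequence of maps depending on parameters. -/
def chain (S : ℕ → V × Y → Y) : (k : ℕ) → (Fin k → V) → Y → Y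
  | 0, _, y => y
  | k + 1, u, y => S k (u (Fin.last k), chain S k (fun i => u i.castSucc) y)

/-- Drop the last entry. -/
def initCLM (V : Type) [NormedAddCommGroup V] [NormedSpace ℂ V] (k : ℕ) :
    (Fin (k + 1) → V) →L[ℂ] (Fin k → V) :=
  ContinuousLinearMap.pi fun i => proj i.castSucc

/-- Append one entry. -/
def snocCLM (V : Type) [NormedAddCommGroup V] [NormedSpace ℂ V] (k : ℕ) :
    ((Fin k → V) × V) →L[ℂ] (Fin (k + 1) → V) :=
  ContinuousLinearMap.pi fun i => Fin.lastCases (snd ℂ _ _)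
    (fun j => (proj j).comp (fst ℂ _ _)) i

@[simp] lemma initCLM_apply (k : ℕ) (u : Fin (k + 1) → V) (i : Fin k) :
    initCLM V k u i = u i.castSucc := rfl

@[simp] lemma snocCLM_last (k : ℕ) (p : (Fin k → V) × V) :
    snocCLM V k p (Fin.last k) = p.2 := by
  simp [snocCLM]

@[simp] lemma snocCLM_castSucc (k : ℕ) (p : (Fin k → V) × V) (i : Fin k) :
    snocCLM V k p i.castSucc = p.1 i := by
  simp [snocCLM]

@[simp] lemma initCLM_snocCLM (k : ℕ) (p : (Fin k → V) × V) :
    initCLM V k (snocCLM V k p) = p.1 := by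
  ext i; simp

lemma snocCLM_init_last (k : ℕ) (u : Fin (k + 1) → V) :
    snocCLM V k (initCLM V k u, u (Fin.last k)) = u := by
  ext i
  refine Fin.lastCases ?_ (fun j => ?_) i <;> simp

lemma chain_succ (S : ℕ → V × Y → Y) (k : ℕ) (u : Fin (k + 1) → V) (y : Y) :
    chain S (k + 1) u y = S k (u (Fin.last k), chain S k (initCLM V k u) y) := rfl

lemma chain_snoc (S : ℕ → V × Y → Y) (k : ℕ) (u : Fin k → V) (t : V) (y : Y) :
    chain S (k + 1) (snocCLM V k (u, t)) y = S k (t, chain S k u y) := by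
  rw [chain_succ, snocCLM_last, initCLM_snocCLM]

lemma chain_zero_zero {S : ℕ → V × Y → Y} (h0 : ∀ k, S k 0 = 0) (k : ℕ) :
    chain S k 0 0 = 0 := by
  induction k with
  | zero => rfl
  | succ k ih => rw [chain_succ, map_zero, ih]; exact h0 k

lemma analyticAt_chain {S : ℕ → V × Y → Y} (hS : ∀ k, AnalyticAt ℂ (S k) 0)
    (h0 : ∀ k, S k 0 = 0) (k : ℕ) :
    AnalyticAt ℂ (fun p : (Fin k → V) × Y => chain S k p.1 p.2) 0 := by
  induction k with
  | zero => exact analyticAt_snd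
  | succ k ih =>
    let ℓ : (Fin (k + 1) → V) × Y →L[ℂ] (Fin k → V) × Y :=
      ((initCLM V k).comp (fst ℂ _ _)).prod (snd ℂ _ _)
    let π : (Fin (k + 1) → V) × Y →L[ℂ] V :=
      (proj (R := ℂ) (φ := fun _ : Fin (k + 1) => V) (Fin.last k)).comp
        (fst ℂ _ _)
    have h1 : AnalyticAt ℂ (fun p => chain S k (ℓ p).1 (ℓ p).2) 0 :=
      AnalyticAt.fun_comp (f := ℓ) (by rw [map_zero]; exact ih) (ℓ.analyticAt _)
    have h2 : AnalyticAt ℂ (fun p => (π p, chain S k (ℓ p).1 (ℓ p).2)) 0 := (π.analyticAt _).prod h1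
    refine AnalyticAt.fun_comp (g := S k)
      (f := fun p => (π p, chain S k (ℓ p).1 (ℓ p).2)) ?_ h2
    have : (π 0, chain S k (ℓ 0).1 (ℓ 0).2) = (0 : V × Y) := by
      rw [map_zero, map_zero]
      exact Prod.ext rfl (chain_zero_zero h0 k)
    rw [this]
    exact hS k

lemma regAt_chain [FiniteDimensional ℂ V] [FiniteDimensional ℂ Y] {κ : Regularity}
    {S : ℕ → V × Y → Y} (hS : ∀ k, RegAt κ (S k) 0) (h0 : ∀ k, S k 0 = 0) (k : ℕ) :
    RegAt κ (fun p : (Fin k → V) × Y => chain S k p.1 p.2) 0 := by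
  induction k with
  | zero => exact regAt_clm (snd ℝ (Fin 0 → V) Y) 0
  | succ k ih =>
    let ℓ : (Fin (k + 1) → V) × Y →L[ℝ] (Fin k → V) × Y :=
      ((((initCLM V k).restrictScalars ℝ).comp (fst ℝ _ _)).prod (snd ℝ _ _))
    let π : (Fin (k + 1) → V) × Y →L[ℝ] V :=
      (proj (R := ℝ) (φ := fun _ : Fin (k + 1) => V) (Fin.last k)).comp
        (fst ℝ _ _)
    have h1 : RegAt κ (fun p => chain S k (ℓ p).1 (ℓ p).2) 0 :=
      RegAt.comp_of_eq ih (regAt_clm ℓ 0) (map_zero ℓ)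
    have h2 : RegAt κ (fun p => (π p, chain S k (ℓ p).1 (ℓ p).2)) 0 := (regAt_clm π 0).prodMk h1
    have : (π 0, chain S k (ℓ 0).1 (ℓ 0).2) = (0 : V × Y) := by
      rw [map_zero, map_zero]
      exact Prod.ext rfl (chain_zero_zero h0 k)
    exact RegAt.comp_of_eq (hS k) h2 this

lemma chain_append (S : V × Y → Y) (k l : ℕ) (u : Fin k → V) (v : Fin l → V) (y : Y) :
    chain (fun _ => S) (k + l) (Fin.append u v) y =
      chain (fun _ => S) l v (chain (fun _ => S) k u y) := by
  induction l with
  | zero =>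
    have : Fin.append u v = u := by
      ext i
      have := Fin.append_left u v i
      exact this
    rw [this]; rfl
  | succ l ih =>
    have h1 : (Fin.append u v) (Fin.last (k + l)) = v (Fin.last l) :=
      Fin.append_right u v (Fin.last l)
    have h2 : (fun i : Fin (k + l) => (Fin.append u v) i.castSucc) =
        Fin.append u fun i => v i.castSucc := by
      ext i
      refine Fin.addCases (fun i => ?_) (fun i => ?_) i
      · rw [Fin.append_left]
        exact Fin.append_left u v i
      · rw [Fin.append_right]
        exact Fin.append_right u v i.castSucc
    change S ((Fin.append u v) (Fin.last (k + l)), chain (fun _ => S) (k + l)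
      (fun i : Fin (k + l) => (Fin.append u v) i.castSucc) y) = _
    rw [h1, h2, ih]
    rfl

lemma chain_cons (S : V × Y → Y) (k : ℕ) (u : Fin (k + 1) → V) (y : Y) :
    chain (fun _ => S) (k + 1) u y = chain (fun _ => S) k (fun i => u i.succ) (S (u 0, y)) := by
  induction k with
  | zero => rfl
  | succ k ih =>
    rw [chain_succ, ih]
    rfl

/-- The parameters of the inverse chain. -/
def revCLM (σ : V →L[ℂ] V) (k : ℕ) : (Fin k → V) →L[ℂ] (Fin k → V) :=
  ContinuousLinearMap.pi fun i => σ.comp (proj i.rev)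

/-- Steps are undone in reverse order, each with its inverse parameter. Only the inversion of a
single step near the origin is needed, because all intermediate points stay near it. -/
lemma chain_rev {S : V × Y → Y} (hS : AnalyticAt ℂ S 0) (h0 : S 0 = 0) {σ : V →L[ℂ] V}
    (hσ : ∀ᶠ p : V × Y in 𝓝 0, S (σ p.1, S p) = p.2) (k : ℕ) :
    ∀ᶠ p : (Fin k → V) × Y in 𝓝 0,
      chain (fun _ => S) k (revCLM σ k p.1) (chain (fun _ => S) k p.1 p.2) = p.2 := by
  induction k with
  | zero => exact .of_forall fun _ => rfl
  | succ k ih =>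
    have h1 : Tendsto₀ (fun p : (Fin (k + 1) → V) × Y => (initCLM V k p.1, p.2)) := tendsto_cont
    have h2 : Tendsto₀ (fun p : (Fin (k + 1) → V) × Y => (p.1 (Fin.last k),
        chain (fun _ => S) k (initCLM V k p.1) p.2)) := by
      have e1 := (analyticAt_chain (S := fun _ => S) (fun _ => hS) (fun _ => h0) k).continuousAt
      have e2 : Tendsto₀ (fun p : (Fin k → V) × Y => chain (fun _ => S) k p.1 p.2) := by
        have := e1.tendsto
        simpa [chain_zero_zero (S := fun _ => S) (fun _ => h0) k] using this
      have e3 : Tendsto₀ (fun p : (Fin (k + 1) → V) × Y => p.1 (Fin.last k)) := tendsto_cont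
      exact e3.prodMk_nhds (e2.comp h1)
    filter_upwards [h1.eventually ih, h2.eventually hσ] with p hp1 hp2
    have e : (fun i : Fin k => revCLM σ (k + 1) p.1 i.succ) = revCLM σ k (initCLM V k p.1) := by
      ext i
      simp [revCLM, Fin.rev_succ]
    have e0 : revCLM σ (k + 1) p.1 0 = σ (p.1 (Fin.last k)) := by
      simp [revCLM]
    rw [chain_cons, e, e0, chain_succ, hp2]
    exact hp1

end Chain

/-! ### Stabilization of the generic ranks of chains. -/

section Stall

variable {V Y : Type} [NormedAddCommGroup V] [NormedSpace ℂ V] [NormedAddCommGroup Y]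
  [NormedSpace ℂ Y] [FiniteDimensional ℂ V] [FiniteDimensional ℂ Y]

lemma tendsto_chain {S : ℕ → V × Y → Y} (hS : ∀ k, AnalyticAt ℂ (S k) 0)
    (h0 : ∀ k, S k 0 = 0) (k : ℕ) :
    Tendsto₀ (fun u => chain S k u 0) := by
  have e1 := (analyticAt_chain hS h0 k).continuousAt.tendsto
  have e2 : Tendsto₀ (fun u : Fin k → V => (u, (0 : Y))) := tendsto_cont rfl
  have := e1.comp e2
  simpa [chain_zero_zero h0 k, Function.comp_def] using this

lemma analyticAt_chain_zero {S : ℕ → V × Y → Y} (hS : ∀ k, AnalyticAt ℂ (S k) 0)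
    (h0 : ∀ k, S k 0 = 0) (k : ℕ) : AnalyticAt ℂ (fun u => chain S k u 0) 0 :=
  (analyticAt_chain hS h0 k).fun_comp (f := fun u => (u, (0 : Y)))
    (analyticAt_id.prod analyticAt_const)

/-- A final step of time zero does nothing. The equality is asked on a neighbourhood of each `u` so
that both sides can be differentiated there. -/
lemma eventually_rk_chain_le_succ {S : ℕ → V × Y → Y} (hS : ∀ k, AnalyticAt ℂ (S k) 0)
    (hid : ∀ k, ∀ᶠ y in 𝓝 0, S k (0, y) = y) (k : ℕ) :
    ∀ᶠ u in 𝓝 0, ∀ᶠ v in 𝓝 u, chain S (k + 1) (snocCLM V k (v, 0)) 0 = chain S k v 0 := by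
  have h0 : ∀ k, S k 0 = 0 := fun k => (hid k).self_of_nhds
  refine Filter.Eventually.eventually_nhds ?_
  filter_upwards [(tendsto_chain hS h0 k).eventually (hid k)] with u hu
  rw [chain_snoc, hu]

lemma genericRank_chain_le_succ {S : ℕ → V × Y → Y} (hS : ∀ k, AnalyticAt ℂ (S k) 0)
    (hid : ∀ k, ∀ᶠ y in 𝓝 0, S k (0, y) = y) (k : ℕ) :
    genericRank (fun u => chain S k u 0) 0 ≤ genericRank (fun u => chain S (k + 1) u 0) 0 := by
  have h0 : ∀ k, S k 0 = 0 := fun k => (hid k).self_of_nhds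
  have ht : Tendsto₀ (fun v : Fin k → V => snocCLM V k (v, 0)) :=
    tendsto_cont (by
      have : ((0 : Fin k → V), (0 : V)) = 0 := rfl
      rw [this, map_zero])
  refine genericRank_le_iff.2 ?_
  filter_upwards [eventually_rk_chain_le_succ hS hid k,
    ht.eventually (eventually_rk_le_genericRank (fun u => chain S (k + 1) u 0) 0),
    ht.eventually (analyticAt_chain_zero hS h0 (k + 1)).eventually_analyticAt] with u h1 h2 h3
  refine le_trans ?_ h2
  have e1 : HasFDerivAt (fun v : Fin k → V => snocCLM V k (v, 0))
      ((snocCLM V k).comp (inl ℂ _ _)) u :=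
    ((snocCLM V k).comp (inl ℂ (Fin k → V) V)).hasFDerivAt
  have e2 := HasFDerivAt.comp (g := fun u => chain S (k + 1) u 0) u
    h3.hasFDerivAt e1
  rw [((e2.congr_of_eventuallyEq (h1.mono fun _ h => h.symm))).fderiv]
  exact rk_comp_le_left _ _

lemma exists_injective_comp {W : Type} [NormedAddCommGroup W] [NormedSpace ℂ W]
    (T : V →L[ℂ] W) : ∃ L : ℂ^(rk T) →L[ℂ] V, Injective (T.comp L) := by
  obtain ⟨b, hb⟩ := exists_linearIndependent_of_le_finrank (le_refl (rk T))
  choose v hv using fun j => (b j).2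
  have hb' : LinearIndependent ℂ fun j => ((b j : LinearMap.range T.toLinearMap) : W) :=
    hb.map' (LinearMap.range T.toLinearMap).subtype (Submodule.ker_subtype _)
  refine ⟨toContinuousLinearMap (Fintype.linearCombination ℂ v), ?_⟩
  have := hb'.fintypeLinearCombination_injective
  intro x y hxy
  refine this ?_
  have e : ∀ x, T (Fintype.linearCombination ℂ v x) = Fintype.linearCombination ℂ
      (fun j => ((b j : LinearMap.range T.toLinearMap) : W)) x := by
    intro x
    simp only [Fintype.linearCombination_apply, map_sum, map_smul]
    exact Finset.sum_congr rfl fun j _ => by rw [← hv j]; rfl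
  rw [← e, ← e]
  exact hxy

/-- Once the generic ranks of the chains of two alternating local actions stop growing, they are
constant. -/
lemma genericRank_chain_stall {S : ℕ → V × Y → Y} (hS : ∀ k, AnalyticAt ℂ (S k) 0)
    (hid : ∀ k, ∀ᶠ y in 𝓝 0, S k (0, y) = y)
    (hmul : ∀ k, ∀ᶠ p : V × V × Y in 𝓝 0, S k (p.1, S k (p.2.1, p.2.2)) = S k (p.2.1 + p.1, p.2.2))
    (hper : ∀ k, S (k + 2) = S k) (k : ℕ)
    (hst : genericRank (fun u => chain S (k + 1) u 0) 0 =
      genericRank (fun u => chain S (k + 2) u 0) 0) :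
    genericRank (fun u => chain S (k + 3) u 0) 0 =
      genericRank (fun u => chain S (k + 2) u 0) 0 := by
  have h0 : ∀ k, S k 0 = 0 := fun k => (hid k).self_of_nhds
  refine le_antisymm ?_ (genericRank_chain_le_succ hS hid (k + 2))
  rw [← hst]
  set r := genericRank (fun u => chain S (k + 1) u 0) 0 with hr
  obtain ⟨ε, hε, hball⟩ := eventually_nhds_iff_ball.1
    (analyticAt_chain_zero hS h0 (k + 3)).eventually_analyticAt
  let s1 : (Fin (k + 1) → V) →L[ℂ] (Fin (k + 2) → V) := (snocCLM V (k + 1)).comp (inl ℂ _ _)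
  let s2 : (Fin (k + 2) → V) →L[ℂ] (Fin (k + 3) → V) := (snocCLM V (k + 2)).comp (inl ℂ _ _)
  have hs1 : Tendsto₀ s1 := s1.tendsto_zero
  have hs2 : Tendsto₀ s2 := s2.tendsto_zero
  let θ : V × (Fin (k + 1) → V) → V × V × Y := fun p =>
    (p.1, p.2 (Fin.last k), chain S k (initCLM V k p.2) 0)
  have hθ : Tendsto₀ θ := by
    have e1 : Tendsto₀ (fun p : V × (Fin (k + 1) → V) => p.1) := tendsto_cont rfl
    have e2 : Tendsto₀ (fun p : V × (Fin (k + 1) → V) => p.2 (Fin.last k)) := tendsto_cont rfl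
    have e3 : Tendsto₀ (fun p : V × (Fin (k + 1) → V) => initCLM V k p.2) :=
      tendsto_cont (map_zero _)
    exact e1.prodMk_nhds (e2.prodMk_nhds ((tendsto_chain hS h0 k).comp e3))
  have hlaw : ∀ᶠ u : Fin (k + 1) → V in 𝓝 0, ∀ᶠ p : V × (Fin (k + 1) → V) in 𝓝 (0, u),
      S k (p.1, S k (p.2 (Fin.last k), chain S k (initCLM V k p.2) 0)) =
        S k (p.2 (Fin.last k) + p.1, chain S k (initCLM V k p.2) 0) := by
    have e : Tendsto₀ (fun u : Fin (k + 1) → V => ((0 : V), u)) := tendsto_cont rfl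
    exact e.eventually (hθ.eventually (hmul k)).eventually_nhds
  have hfreq : ∃ᶠ u in 𝓝 0, r ≤ rk (fderiv ℂ (fun u => chain S (k + 1) u 0) u) :=
    le_genericRank_iff.1 hr.le
  have hgood := (eventually_rk_chain_le_succ hS hid (k + 1)).and
    ((analyticAt_chain_zero hS h0 (k + 1)).eventually_analyticAt.and
    ((hs1.eventually (analyticAt_chain_zero hS h0 (k + 2)).eventually_analyticAt).and
    (((hs2.comp hs1).eventually (ball_mem_nhds _ hε)).and
    ((hs1.eventually (eventually_rk_le_genericRank (fun u => chain S (k + 2) u 0)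
      0).eventually_nhds).and
    ((eventually_rk_le_genericRank (fun u => chain S (k + 1) u 0) 0).eventually_nhds.and hlaw)))))
  -- The rank `r` is attained arbitrarily close to `0`, while the other conditions hold near `0`, so
  -- one point satisfies all of them.
  obtain ⟨u₀, hu₀, hA, hB, hC, hD, hE, hF, hG⟩ := (hfreq.and_eventually hgood).exists
  have hrk : rk (fderiv ℂ (fun u => chain S (k + 1) u 0) u₀) = r := le_antisymm hF.self_of_nhds hu₀
  obtain ⟨L, hL⟩ := exists_injective_comp (fderiv ℂ (fun u => chain S (k + 1) u 0) u₀)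
  let F := fun v => chain S (k + 1) (u₀ + L v) 0
  have haff : AnalyticAt ℂ (fun v => u₀ + L v) 0 := analyticAt_const.add (L.analyticAt 0)
  have haff0 : u₀ + L 0 = u₀ := by rw [map_zero, add_zero]
  have hBu : AnalyticAt ℂ (fun u => chain S (k + 1) u 0) (u₀ + L 0) := by rw [haff0]; exact hB
  have hFa : AnalyticAt ℂ F 0 := AnalyticAt.fun_comp (g := fun u => chain S (k + 1) u 0) hBu haff
  have hFd : fderiv ℂ F 0 = (fderiv ℂ (fun u => chain S (k + 1) u 0) u₀).comp L := by
    have e1 : HasFDerivAt (fun v => u₀ + L v) L 0 := L.hasFDerivAt.const_add u₀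
    have e2 := HasFDerivAt.comp (g := fun u => chain S (k + 1) u 0) 0
      hBu.hasFDerivAt e1
    rw [haff0] at e2
    exact e2.fderiv
  have hj0 : s1 (u₀ + L 0) = s1 u₀ := by rw [haff0]
  -- On a slice through `u₀` the chain of length `k + 1` is an immersion. Equality of the ranks
  -- forces the chain of length `k + 2` to take its values, near `u₀` extended by `0`, in the image
  -- of that slice.
  obtain ⟨φ, hφ, hφ0, hφG⟩ := exists_factor_through_immersion (F := F)
    (G := fun u => chain S (k + 2) u 0) (j := fun v => s1 (u₀ + L v)) (u₀ := 0) hFa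
    (by rw [hFd]; exact hL) (by rw [hj0]; exact hC)
    ((s1.analyticAt _).fun_comp haff) (by
      have e : Tendsto (fun v => u₀ + L v) (𝓝 0) (𝓝 u₀) := haff.tendsto haff0
      filter_upwards [e.eventually hA] with v hv
      exact hv.symm) (by
      rw [hj0]
      filter_upwards [hE] with q hq
      rw [finrank_fin_fun, hrk, hst]
      exact hq)
  rw [hj0] at hφ hφ0 hφG
  -- Once the first `k + 2` steps are replaced by a chain of length `k + 1`, which ends with `S k`,
  -- the remaining step is `S k` again by periodicity. The group law merges the two by adding the
  -- new time to the last entry.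
  let χ : (Fin (k + 3) → V) → (Fin (k + 1) → V) := fun q =>
    (u₀ + L (φ (initCLM V (k + 2) q))) + snocCLM V k (0, q (Fin.last (k + 2)))
  have hinit : initCLM V (k + 2) (s2 (s1 u₀)) = s1 u₀ := initCLM_snocCLM _ _
  have hlast : (s2 (s1 u₀)) (Fin.last (k + 2)) = 0 := snocCLM_last _ _
  have hχ : AnalyticAt ℂ χ (s2 (s1 u₀)) := by
    refine AnalyticAt.fun_add (analyticAt_const.fun_add ((L.analyticAt _).fun_comp ?_)) ?_
    · exact AnalyticAt.fun_comp (g := φ) (f := initCLM V (k + 2)) (by rw [hinit]; exact hφ)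
        ((initCLM V (k + 2)).analyticAt _)
    · exact ((snocCLM V k).analyticAt _).fun_comp (analyticAt_const.prod
        ((proj (R := ℂ) (φ := fun _ : Fin (k + 3) => V) (Fin.last (k + 2))).analyticAt _))
  have hχ0 : χ (s2 (s1 u₀)) = u₀ := by
    simp only [χ, hinit, hlast, hφ0, map_zero, add_zero]
    have : ((0 : Fin k → V), (0 : V)) = 0 := rfl
    rw [this, map_zero, add_zero]
  have hti : Tendsto (initCLM V (k + 2)) (𝓝 (s2 (s1 u₀))) (𝓝 (s1 u₀)) :=
    (initCLM V (k + 2)).continuous.tendsto' _ _ hinit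
  have hkey : ∀ᶠ q in 𝓝 (s2 (s1 u₀)), chain S (k + 3) q 0 = chain S (k + 1) (χ q) 0 := by
    have e1 : Tendsto (fun q : Fin (k + 3) → V => (q (Fin.last (k + 2)),
        u₀ + L (φ (initCLM V (k + 2) q)))) (𝓝 (s2 (s1 u₀))) (𝓝 (0, u₀)) := by
      refine Tendsto.prodMk_nhds (tendsto_cont hlast) ?_
      have e2 : Tendsto φ (𝓝 (s1 u₀)) (𝓝 0) := hφ.tendsto hφ0
      have e3 : Tendsto (fun v => u₀ + L v) (𝓝 0) (𝓝 u₀) := haff.tendsto haff0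
      exact e3.comp (e2.comp hti)
    filter_upwards [hti.eventually hφG, e1.eventually hG] with q hq1 hq2
    rw [chain_succ, hq1, hper]
    change S k (_, chain S (k + 1) (u₀ + L (φ (initCLM V (k + 2) q))) 0) = _
    rw [chain_succ, hq2, chain_succ]
    have e4 : χ q (Fin.last k) = (u₀ + L (φ (initCLM V (k + 2) q))) (Fin.last k) +
        q (Fin.last (k + 2)) := by
      simp [χ]
    have e5 : initCLM V k (χ q) = initCLM V k (u₀ + L (φ (initCLM V (k + 2) q))) := by
      simp only [χ]
      rw [map_add, initCLM_snocCLM, add_zero]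
    rw [e4, e5]
  -- The factorization bounds the rank near one point of a ball on which the chain is analytic;
  -- analytic continuation carries the bound to the centre.
  refine genericRank_le_of_isPreconnected (U := ball 0 ε) (x₁ := s2 (s1 u₀))
    (fun u hu => hball u hu) (convex_ball _ _).isPreconnected isOpen_ball
    (Metric.mem_ball_self hε) hD ?_
  have hχt : Tendsto χ (𝓝 (s2 (s1 u₀))) (𝓝 u₀) := hχ.tendsto hχ0
  filter_upwards [hkey.eventually_nhds, hχ.eventually_analyticAt,
    hχt.eventually hB.eventually_analyticAt, hχt.eventually hF] with q h1 h2 h3 h4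
  have e := HasFDerivAt.comp (g := fun u => chain S (k + 1) u 0) q
    h3.hasFDerivAt h2.hasFDerivAt
  rw [(e.congr_of_eventuallyEq h1).fderiv]
  exact (rk_comp_le_left _ _).trans h4

end Stall

/-! ### First integrals of a local action with orbits of constant dimension. -/

section FirstIntegral

variable {V W : Type} [NormedAddCommGroup V] [NormedSpace ℂ V] [NormedAddCommGroup W]
  [NormedSpace ℂ W] [FiniteDimensional ℂ V] [FiniteDimensional ℂ W]

lemma exists_injective_comp_of_rk_eq {T : V →L[ℂ] W} {r : ℕ} (h : rk T = r) :
    ∃ L : ℂ^r →L[ℂ] V, Injective (T.comp L) := by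
  subst h
  exact exists_injective_comp T

lemma exists_complement_map {r : ℕ} {A : ℂ^r →L[ℂ] W} (hA : Injective A) :
    ∃ (q : ℕ) (T : ℂ^q →L[ℂ] W), q + r = finrank ℂ W ∧
      Bijective fun p : ℂ^q × ℂ^r => T p.1 + A p.2 := by
  obtain ⟨N, hN⟩ := (LinearMap.range A.toLinearMap).exists_isCompl
  have h1 : finrank ℂ (LinearMap.range A.toLinearMap) = r := by
    rw [LinearMap.finrank_range_of_inj hA, finrank_fin_fun]
  have h2 := Submodule.finrank_add_eq_of_isCompl hN
  let b := finBasis ℂ N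
  refine ⟨finrank ℂ N, toContinuousLinearMap
    (N.subtype ∘ₗ b.equivFun.symm.toLinearMap), by omega, ?_⟩
  have hT : ∀ x, (toContinuousLinearMap
    (N.subtype ∘ₗ b.equivFun.symm.toLinearMap) : _ →L[ℂ] W) x = (b.equivFun.symm x : W) :=
    fun x => rfl
  constructor
  · rintro ⟨x, y⟩ ⟨x', y'⟩ h
    simp only [hT] at h
    have h3 : A (y' - y) = ((b.equivFun.symm (x - x') : N) : W) := by
      rw [map_sub, map_sub, Submodule.coe_sub, sub_eq_sub_iff_add_eq_add, add_comm, ← h, add_comm]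
    have h4 : ((b.equivFun.symm (x - x') : N) : W) = 0 := by
      refine Submodule.disjoint_def.1 hN.disjoint _ ?_ (b.equivFun.symm (x - x')).2
      rw [← h3]
      exact ⟨_, rfl⟩
    rw [h4] at h3
    have h5 : y' - y = 0 := hA (by rw [h3, map_zero])
    have h6 : x - x' = 0 := by
      have : b.equivFun.symm (x - x') = 0 := Subtype.ext h4
      exact (LinearEquiv.map_eq_zero_iff _).1 this
    rw [sub_eq_zero.1 h6, ← sub_eq_zero.1 h5]
  · intro w
    have hw : w ∈ LinearMap.range A.toLinearMap ⊔ N := by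
      rw [hN.sup_eq_top]; trivial
    obtain ⟨_, ⟨y, rfl⟩, n, hn, rfl⟩ := Submodule.mem_sup.1 hw
    refine ⟨(b.equivFun ⟨n, hn⟩, y), ?_⟩
    simp only [hT, LinearEquiv.symm_apply_apply]
    exact add_comm _ _

/-- The rank of a map over its source is bounded by the partial rank. -/
lemma rk_graph_le {X : Type} [NormedAddCommGroup X] [NormedSpace ℂ X] [FiniteDimensional ℂ X]
    {f : X × V → W} {p : X × V} (hf : DifferentiableAt ℂ f p) :
    rk (fderiv ℂ (fun x : X × V => (x.1, f x)) p) ≤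
      finrank ℂ X + rk (fderiv ℂ (fun v => f (p.1, v)) p.2) := by
  have h1 : HasFDerivAt (fun x : X × V => (x.1, f x))
      ((fst ℂ X V).prod (fderiv ℂ f p)) p :=
    hasFDerivAt_fst.prodMk hf.hasFDerivAt
  have h2 : HasFDerivAt (fun v => f (p.1, v))
      ((fderiv ℂ f p).comp (inr ℂ X V)) p.2 :=
    HasFDerivAt.comp (g := f) p.2 hf.hasFDerivAt (hasFDerivAt_prodMk_right p.1 p.2)
  rw [h1.fderiv, h2.fderiv]
  set A := fderiv ℂ f p
  have h3 : LinearMap.range ((fst ℂ X V).prod A).toLinearMap ≤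
      LinearMap.range (LinearMap.prod LinearMap.id (A.toLinearMap ∘ₗ LinearMap.inl ℂ X V)) ⊔
      (LinearMap.range (A.comp (inr ℂ X V)).toLinearMap).map
        (LinearMap.inr ℂ X W) := by
    rintro _ ⟨⟨x, v⟩, rfl⟩
    refine Submodule.mem_sup.2 ⟨(x, A (x, 0)), ⟨x, rfl⟩, (0, A (0, v)), ⟨A (0, v), ⟨v, rfl⟩, rfl⟩, ?_⟩
    refine Prod.ext (add_zero x) ?_
    change A (x, 0) + A (0, v) = A (x, v)
    rw [← map_add]
    simp
  refine (Submodule.finrank_mono h3).trans ((Submodule.finrank_add_le_finrank_add_finrank _ _).trans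
    (add_le_add (LinearMap.finrank_range_le _) (Submodule.finrank_map_le _ _)))

/-- Concatenation of parameters. -/
def appendCLM (V : Type) [NormedAddCommGroup V] [NormedSpace ℂ V] (k l : ℕ) :
    ((Fin k → V) × (Fin l → V)) →L[ℂ] (Fin (k + l) → V) :=
  ContinuousLinearMap.pi fun i => Fin.addCases
    (fun i => (proj i).comp (fst ℂ _ _))
    (fun i => (proj i).comp (snd ℂ _ _)) i

lemma appendCLM_apply (k l : ℕ) (p : (Fin k → V) × (Fin l → V)) :
    appendCLM V k l p = Fin.append p.1 p.2 := by
  ext i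
  refine Fin.addCases (fun i => ?_) (fun i => ?_) i <;> simp [appendCLM]

variable {P Y : Type} [NormedAddCommGroup P] [NormedSpace ℂ P] [NormedAddCommGroup Y]
  [NormedSpace ℂ Y] [FiniteDimensional ℂ P] [FiniteDimensional ℂ Y]

/-- The orbits through points near `0` have dimension `ρ`, and a transversal of dimension `q` at `0`
labels them. To parametrize an orbit near its own base point, one travels out along parameters where
the rank `ρ` is attained and returns along the inverse parameters. Transversal and orbit parameters
together form local coordinates, and `f` reads off the transversal ones. It is invariant because one
more action, being part of a longer chain of rank at most `ρ`, cannot leave the orbit already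
parametrized. -/
lemma exists_first_integrals {κ : Regularity} {Q : P × Y → Y} (hQ : AnalyticAt ℂ Q 0)
    (hQr : RegAt κ Q 0) (hid : ∀ᶠ y in 𝓝 0, Q (0, y) = y) {σ : P →L[ℂ] P}
    (hσ : ∀ᶠ p : P × Y in 𝓝 0, Q (σ p.1, Q p) = p.2) {ρ : ℕ}
    (hr : ∀ k, ∀ᶠ p : (Fin k → P) × Y in 𝓝 0,
      rk (fderiv ℂ (fun u => chain (fun _ => Q) k u p.2) p.1) ≤ ρ) {K : ℕ}
    (hK : ∃ᶠ c in 𝓝 0, ρ ≤ rk (fderiv ℂ (fun u => chain (fun _ => Q) K u 0) c)) :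
    ∃ q, q + ρ = finrank ℂ Y ∧ ∃ f : Y → ℂ^q, AnalyticAt ℂ f 0 ∧ RegAt κ f 0 ∧
      Surjective (fderiv ℂ f 0) ∧ ∀ᶠ p in 𝓝 0, f (Q p) = f p.2 := by
  have h0 : Q 0 = 0 := hid.self_of_nhds
  let C : (k : ℕ) → (Fin k → P) → Y → Y := chain fun _ => Q
  have hCa : ∀ k, AnalyticAt ℂ (fun p : (Fin k → P) × Y => C k p.1 p.2) 0 :=
    analyticAt_chain (fun _ => hQ) fun _ => h0
  have hCr : ∀ k, RegAt κ (fun p : (Fin k → P) × Y => C k p.1 p.2) 0 :=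
    regAt_chain (fun _ => hQr) fun _ => h0
  have hC0 : ∀ k, C k 0 0 = 0 := chain_zero_zero fun _ => h0
  have hCt : Tendsto₀ (fun u => C K u 0) := tendsto_chain (fun _ => hQ) (fun _ => h0) K
  have t1 : Tendsto₀ (fun c : Fin K → P => (c, (0 : Y))) := tendsto_cont rfl
  have t2 : Tendsto₀ (fun c : Fin K → P => (revCLM σ K c, C K c 0)) :=
    ((revCLM σ K).tendsto_zero).prodMk_nhds hCt
  have t3 : Tendsto₀ (fun c : Fin K → P => (snocCLM P (K + K)
      (appendCLM P K K (c, revCLM σ K c), 0), (0 : Y))) := by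
    refine tendsto_cont ?_
    have e1 : ((0 : Fin K → P), (0 : Fin K → P)) = 0 := rfl
    have e2 : ((0 : Fin (K + K) → P), (0 : P)) = 0 := rfl
    rw [map_zero, e1, map_zero, e2, map_zero]
    rfl
  have hgood := ((t1.eventually (hCa K).eventually_analyticAt).and
    ((t2.eventually (hCa K).eventually_analyticAt).and
    ((t1.eventually (chain_rev hQ h0 hσ K).eventually_nhds).and
    ((t1.eventually (hr K)).and
    ((t3.eventually (hr (K + K + 1)).eventually_nhds).and
    ((t1.eventually (hCr K).eventually).and
    ((t2.eventually (hCr K).eventually).and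
    (t3.eventually (hCa (K + K + 1)).eventually_analyticAt.eventually_nhds))))))))
  obtain ⟨c, hc, hA1, hA2, hinv, hle, hrk, hR1, hR2, hA3⟩ := (hK.and_eventually hgood).exists
  set c' := revCLM σ K c with hc'
  -- The rank `ρ` is attained at some `c` near `0`, perhaps not at `0`. Going out along `u` and back
  -- along the inverse of `c` fixes the base point for `u = c`, and the rank in `u` there is still
  -- `ρ` since the return map is a local diffeomorphism.
  let Ret : Y × (Fin K → P) → Y := fun p => C K c' (C K p.2 p.1)
  have hRet : ∀ᶠ x in 𝓝 (0 : Y), Ret (x, c) = x := by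
    have : Tendsto (fun x : Y => (c, x)) (𝓝 0) (𝓝 (c, 0)) := tendsto_cont rfl
    exact this.eventually hinv
  have hRet0 : Ret (0, c) = 0 := hRet.self_of_nhds
  let sw : Y × (Fin K → P) →L[ℂ] (Fin K → P) × Y := (snd ℂ _ _).prod (fst ℂ _ _)
  let CK := fun p : (Fin K → P) × Y => C K p.1 p.2
  have hin : AnalyticAt ℂ (fun p : Y × (Fin K → P) => C K p.2 p.1) (0, c) :=
    AnalyticAt.fun_comp (g := CK) (f := sw) hA1 (sw.analyticAt _)
  have hout : AnalyticAt ℂ (C K c') (C K c 0) :=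
    AnalyticAt.fun_comp (g := CK) (f := fun y => (c', y)) hA2
      (analyticAt_const.prod analyticAt_id)
  have hRa : AnalyticAt ℂ Ret (0, c) :=
    AnalyticAt.fun_comp (g := C K c') (f := fun p : Y × (Fin K → P) => C K p.2 p.1) hout hin
  have hinr : RegAt κ (fun p : Y × (Fin K → P) => C K p.2 p.1) (0, c) :=
    RegAt.comp_of_eq (g := CK) hR1
      (regAt_clm (sw.restrictScalars ℝ) _) rfl
  have houtr : RegAt κ (C K c') (C K c 0) := RegAt.comp_of_eq (g := CK) (f := fun y => (c', y)) hR2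
      ((regAt_const c' _).prodMk (regAt_id _)) rfl
  have hRr : RegAt κ Ret (0, c) :=
    RegAt.comp_of_eq (g := C K c') (f := fun p : Y × (Fin K → P) => C K p.2 p.1) houtr hinr rfl
  let D₀ := fderiv ℂ (fun u => C K u 0) c
  let R' := fderiv ℂ (C K c') (C K c 0)
  have hCc : AnalyticAt ℂ (fun u => C K u 0) c :=
    AnalyticAt.fun_comp (g := CK) (f := fun u => (u, (0 : Y)))
      hA1 (analyticAt_id.prod analyticAt_const)
  have hCx : AnalyticAt ℂ (fun x => C K c x) 0 :=
    AnalyticAt.fun_comp (g := CK) (f := fun x => (c, x))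
      hA1 (analyticAt_const.prod analyticAt_id)
  have hR'inj : Injective R' := by
    have e1 : HasFDerivAt (fun x => C K c' (C K c x)) (R'.comp (fderiv ℂ (fun x => C K c x) 0)) 0 :=
      HasFDerivAt.comp (g := C K c') 0 hout.hasFDerivAt
        hCx.hasFDerivAt
    have e2 : (fun x => C K c' (C K c x)) =ᶠ[𝓝 0] id := hRet
    have e3 := e1.unique ((hasFDerivAt_id (0 : Y)).congr_of_eventuallyEq e2)
    have e4 : Surjective R' := fun y =>
      ⟨_, DFunLike.congr_fun e3 y⟩
    exact LinearMap.injective_iff_surjective.2 e4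
  have hD : HasFDerivAt (fun u => Ret (0, u)) (R'.comp D₀) c :=
    HasFDerivAt.comp (g := C K c') c hout.hasFDerivAt
      hCc.hasFDerivAt
  have hDrk : rk (R'.comp D₀) = ρ := by
    rw [rk_comp_of_injective _ _ hR'inj]
    exact le_antisymm hle hc
  obtain ⟨L, hL⟩ := exists_injective_comp_of_rk_eq hDrk
  obtain ⟨q, T, hq, hTL⟩ := exists_complement_map hL
  let Xs := ℂ^q × ℂ^ρ
  -- The first variable moves the base point along the transversal, the second moves along the orbit
  -- in `ρ` independent directions; together they give the local coordinates `Ψ` of `Y`.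
  let aff : Xs → Y × (Fin K → P) := fun p => (T p.1, c + L p.2)
  have haff0 : aff 0 = (0, c) := by simp [aff]
  have haff : AnalyticAt ℂ aff 0 := ((T.comp (fst ℂ ℂ^q ℂ^ρ)).analyticAt 0).prod
      (analyticAt_const.fun_add ((L.comp (snd ℂ ℂ^q ℂ^ρ)).analyticAt 0))
  have haffr : RegAt κ aff 0 := (regAt_clm ((T.comp (fst ℂ ℂ^q ℂ^ρ)).restrictScalars ℝ)
      0).prodMk ((regAt_const c 0).add (regAt_clm ((L.comp (snd ℂ ℂ^q ℂ^ρ)).restrictScalars ℝ) 0))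
  let Ψ : Xs → Y := fun p => Ret (aff p)
  have hΨ : AnalyticAt ℂ Ψ 0 := AnalyticAt.fun_comp (g := Ret) (by rw [haff0]; exact hRa) haff
  have hΨr : RegAt κ Ψ 0 := RegAt.comp_of_eq (g := Ret) hRr haffr haff0
  have hΨ0 : Ψ 0 = 0 := by
    change Ret (aff 0) = 0
    rw [haff0, hRet0]
  have hdΨ : ∀ p : Xs, fderiv ℂ Ψ 0 p = T p.1 + (R'.comp D₀).comp L p.2 := by
    intro p
    have e1 : HasFDerivAt (fun τ : ℂ^q => Ψ (τ, 0))
        ((fderiv ℂ Ψ 0).comp (inl ℂ _ _)) 0 :=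
      HasFDerivAt.comp (g := Ψ) 0 hΨ.hasFDerivAt
        (hasFDerivAt_prodMk_left (0 : ℂ^q) (0 : ℂ^ρ))
    have e2 : (fun τ : ℂ^q => Ψ (τ, 0)) =ᶠ[𝓝 0] T := by
      have : Tendsto₀ T := T.tendsto_zero
      filter_upwards [this.eventually hRet] with τ hτ
      change Ret (T τ, c + L 0) = T τ
      rw [map_zero, add_zero, hτ]
    have e3 := e1.unique (T.hasFDerivAt.congr_of_eventuallyEq e2)
    have e4 : HasFDerivAt (fun v : ℂ^ρ => Ψ (0, v))
        ((fderiv ℂ Ψ 0).comp (inr ℂ _ _)) 0 :=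
      HasFDerivAt.comp (g := Ψ) 0 hΨ.hasFDerivAt
        (hasFDerivAt_prodMk_right (0 : ℂ^q) (0 : ℂ^ρ))
    have e5 : HasFDerivAt (fun v : ℂ^ρ => Ψ (0, v)) ((R'.comp D₀).comp L) 0 := by
      have h1 : HasFDerivAt (fun v : ℂ^ρ => c + L v) L 0 := L.hasFDerivAt.const_add c
      have h2 : HasFDerivAt (fun u => Ret (0, u)) (R'.comp D₀) (c + L 0) := by
        rw [map_zero, add_zero]; exact hD
      have h3 := HasFDerivAt.comp (g := fun u => Ret (0, u)) 0 h2 h1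
      refine h3.congr_of_eventuallyEq (.of_forall fun v => ?_)
      change Ret (T 0, c + L v) = Ret (0, c + L v)
      rw [map_zero]
    have e6 := e4.unique e5
    have e7 : p = inl ℂ _ _ p.1 + inr ℂ _ _ p.2 := Prod.ext (add_zero p.1).symm (zero_add p.2).symm
    conv_lhs => rw [e7, map_add]
    exact congrArg₂ (· + ·) (DFunLike.congr_fun e3 p.1)
      (DFunLike.congr_fun e6 p.2)
  have hbij : Bijective (fderiv ℂ Ψ 0) := by
    have : ⇑(fderiv ℂ Ψ 0) = fun p : Xs => T p.1 + (R'.comp D₀).comp L p.2 := funext hdΨ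
    rw [this]
    exact hTL
  obtain ⟨g, hg, hg0, hΨg, hgΨ⟩ := exists_localInverse hΨ hbij
  have hgr : RegAt κ g (Ψ 0) := by
    refine RegAt.inverse ?_ hΨr hg.restrictScalars hg0 hΨg
    rw [finrank_real_of_complex, finrank_real_of_complex, Module.finrank_prod,
      finrank_fin_fun, finrank_fin_fun, hq]
  rw [hΨ0] at hg hg0 hΨg hgr
  refine ⟨q, hq, fun y => (g y).1, analyticAt_fst.fun_comp hg, hgr.clm_comp (fst ℝ _ _), ?_, ?_⟩
  · have e1 : HasFDerivAt (fun p : Xs => (g (Ψ p)).1)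
        ((fderiv ℂ (fun y => (g y).1) (Ψ 0)).comp (fderiv ℂ Ψ 0)) 0 := by
      refine HasFDerivAt.comp (g := fun y => (g y).1) (0 : Xs) ?_ hΨ.hasFDerivAt
      rw [hΨ0]
      exact (analyticAt_fst.fun_comp hg).hasFDerivAt
    have e2 : (fun p : Xs => (g (Ψ p)).1) =ᶠ[𝓝 0] fun p => p.1 :=
      hgΨ.mono fun p hp => congrArg Prod.fst hp
    have e3 := e1.unique (hasFDerivAt_fst.congr_of_eventuallyEq e2)
    rw [hΨ0] at e3
    intro τ
    exact ⟨_, DFunLike.congr_fun e3 (τ, 0)⟩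
  · -- the orbit map factors through the adapted coordinates
    let Qs := ℂ^q × P × (Fin K → P)
    let ℓ : P × (Fin K → P) → (Fin (K + K + 1) → P) := fun s =>
      snocCLM P (K + K) (appendCLM P K K (s.2, c'), s.1)
    let H : Qs → Y := fun p => C (K + K + 1) (ℓ p.2) (T p.1)
    have hH : ∀ p : Qs, H p = Q (p.2.1, Ret (T p.1, p.2.2)) := by
      intro p
      change chain _ (K + K + 1) (snocCLM P (K + K) (_, _)) _ = _
      rw [chain_snoc, appendCLM_apply, chain_append]
    let m : Qs → (Fin (K + K + 1) → P) × Y := fun p => (ℓ p.2, T p.1)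
    have hℓ : Differentiable ℂ ℓ := by fun_prop
    have hma : ∀ p, AnalyticAt ℂ m p := by
      intro p
      refine AnalyticAt.prod ?_ ((T.comp (fst ℂ _ _)).analyticAt p)
      refine ((snocCLM P (K + K)).analyticAt _).fun_comp (AnalyticAt.prod ?_ ?_)
      · refine ((appendCLM P K K).analyticAt _).fun_comp (AnalyticAt.prod ?_ analyticAt_const)
        exact ((snd ℂ P (Fin K → P)).comp (snd ℂ ℂ^q (P × (Fin K → P)))).analyticAt p
      · exact ((fst ℂ P (Fin K → P)).comp
          (snd ℂ ℂ^q (P × (Fin K → P)))).analyticAt p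
    let q₀ : Qs := (0, 0, c)
    have hm0 : m q₀ = (snocCLM P (K + K) (appendCLM P K K (c, c'), 0), 0) :=
      Prod.ext rfl (map_zero T)
    have hmt : Tendsto m (𝓝 q₀) (𝓝 (snocCLM P (K + K) (appendCLM P K K (c, c'), 0), 0)) := (hma q₀).tendsto hm0
    have hHa : AnalyticAt ℂ H q₀ :=
      AnalyticAt.fun_comp (g := fun p : (Fin (K + K + 1) → P) × Y => C (K + K + 1) p.1 p.2) (f := m)
        (by rw [hm0]; exact hA3.self_of_nhds) (hma q₀)
    -- Adjoining the transversal parameter to `H` makes the factorization preserve it. The rank is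
    -- at most `q + ρ`, the dimension of `Xs`, because with this parameter fixed `H` is a chain of
    -- length `2K + 1`, of rank at most `ρ`.
    have hGr : ∀ᶠ p in 𝓝 q₀, rk (fderiv ℂ (fun x : Qs => (x.1, H x)) p) ≤
        finrank ℂ Xs := by
      filter_upwards [hmt.eventually hrk, hmt.eventually hA3,
        hHa.eventually_analyticAt] with p h1 h2 h3
      refine (rk_graph_le h3.differentiableAt).trans ?_
      rw [Module.finrank_prod, finrank_fin_fun, finrank_fin_fun]
      refine Nat.add_le_add_left ?_ q
      have e1 : AnalyticAt ℂ (fun u => C (K + K + 1) u (T p.1)) (ℓ p.2) :=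
        AnalyticAt.fun_comp (g := fun p : (Fin (K + K + 1) → P) × Y => C (K + K + 1) p.1 p.2)
          (f := fun u => (u, T p.1)) h2 (analyticAt_id.prod analyticAt_const)
      have e2 : HasFDerivAt (fun s => H (p.1, s)) _ p.2 :=
        HasFDerivAt.comp (g := fun u => C (K + K + 1) u (T p.1)) p.2
          e1.hasFDerivAt (hℓ p.2).hasFDerivAt
      rw [e2.fderiv]
      exact (rk_comp_le_left _ _).trans h1
    let F : Xs → ℂ^q × Y := fun p => (p.1, Ψ p)
    let j : Xs → Qs := fun p => (p.1, 0, c + L p.2)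
    have hj0 : j 0 = q₀ := by simp [j, q₀]
    have hja : AnalyticAt ℂ j 0 := analyticAt_fst.prod (analyticAt_const.prod
      (analyticAt_const.fun_add ((L.comp (snd ℂ ℂ^q ℂ^ρ)).analyticAt 0)))
    obtain ⟨φ, hφ, hφ0, hφG⟩ := exists_factor_through_immersion (F := F)
      (G := fun x : Qs => (x.1, H x)) (j := j) (u₀ := 0) (analyticAt_fst.prod hΨ) (by
        have e1 : HasFDerivAt F ((fst ℂ _ _).prod (fderiv ℂ Ψ 0)) 0 :=
          hasFDerivAt_fst.prodMk hΨ.hasFDerivAt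
        rw [e1.fderiv]
        intro a b hab
        exact hbij.1 (Prod.mk.inj hab).2)
      (by rw [hj0]; exact analyticAt_fst.prod hHa) hja (by
        have t : Tendsto₀ Ψ := hΨ.tendsto hΨ0
        filter_upwards [t.eventually hid] with p hp
        refine Prod.ext rfl ?_
        change Ψ p = H (j p)
        rw [hH]
        exact hp.symm)
      (by rw [hj0]; exact hGr)
    rw [hj0] at hφ hφ0 hφG
    have tg : Tendsto₀ g := hg.tendsto hg0
    have tsnd : Tendsto₀ (fun p : P × Y => p.2) := tendsto_cont rfl
    let χ : P × Y → Qs := fun p => ((g p.2).1, p.1, c + L (g p.2).2)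
    have tχ : Tendsto χ (𝓝 0) (𝓝 q₀) := by
      have e1 : Tendsto (fun p : P × ℂ^q × ℂ^ρ => ((p.2.1, p.1, c + L p.2.2) : Qs)) (𝓝 0) (𝓝 q₀) :=
        tendsto_cont (by simp [q₀])
      have e2 : Tendsto₀ (fun p : P × Y => (p.1, g p.2)) :=
        Tendsto.prodMk_nhds (tendsto_cont rfl) (tg.comp tsnd)
      exact e1.comp e2
    have tφ : Tendsto φ (𝓝 q₀) (𝓝 0) := hφ.tendsto hφ0
    -- A point `Ψ (τ, v)` is moved by `Q` to a value of `H` at transversal parameter `τ`, which by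
    -- the factorization is `Ψ (τ, v')` with the same `τ`.
    filter_upwards [tsnd.eventually hΨg, tχ.eventually hφG, (tφ.comp tχ).eventually hgΨ]
      with p h1 h2 h3
    have e1 : Q p = H (χ p) := by
      rw [hH]
      change Q p = Q (p.1, Ψ (g p.2))
      rw [h1]
    have e2 := Prod.mk.inj h2
    rw [e1, e2.2]
    change (g (Ψ (φ (χ p)))).1 = _
    have h3' : g (Ψ (φ (χ p))) = φ (χ p) := h3
    rw [h3', ← e2.1]

end FirstIntegral

/-! ### Power series with conjugated coefficients. -/

section Conjugation

variable {E F : Type} [NormedAddCommGroup E] [NormedSpace ℂ E] [StarAddMonoid E]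
  [NormedStarGroup E] [StarModule ℂ E] [NormedAddCommGroup F] [NormedSpace ℂ F] [StarAddMonoid F]
  [NormedStarGroup F] [StarModule ℂ F]

/-- The multilinear form with conjugated coefficients. -/
def conjForm {n : ℕ} (p : E [×n]→L[ℂ] F) : E [×n]→L[ℂ] F :=
  MultilinearMap.mkContinuous
    { toFun := fun v => star (p fun i => star (v i))
      map_update_add' := fun v i x y => by
        have h : ∀ x : E, (fun j => star (Function.update v i x j)) =
            Function.update (fun j => star (v j)) i (star x) := fun x => by
          funext j; exact Function.apply_update (fun _ : Fin n => (star : E → E)) v i x j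
        simp only [h, star_add, p.map_update_add]
      map_update_smul' := fun v i c x => by
        have h : ∀ x : E, (fun j => star (Function.update v i x j)) =
            Function.update (fun j => star (v j)) i (star x) := fun x => by
          funext j; exact Function.apply_update (fun _ : Fin n => (star : E → E)) v i x j
        simp only [h, star_smul, p.map_update_smul, star_star] } ‖p‖ (fun v => by
      change ‖star (p fun i => star (v i))‖ ≤ _
      rw [norm_star]
      refine (p.le_opNorm _).trans (le_of_eq ?_)
      simp only [norm_star])

lemma norm_conjForm_le {n : ℕ} (p : E [×n]→L[ℂ] F) : ‖conjForm p‖ ≤ ‖p‖ :=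
  MultilinearMap.mkContinuous_norm_le _ (norm_nonneg _) _

/-- The function with conjugated Taylor coefficients is analytic. -/
lemma analyticAt_star_star {f : E → F} {x : E} (hf : AnalyticAt ℂ f (star x)) :
    AnalyticAt ℂ (fun y => star (f (star y))) x := by
  obtain ⟨p, r, hp⟩ := hf
  refine ⟨fun n => conjForm (p n), r, ?_, hp.r_pos, ?_⟩
  · exact hp.r_le.trans (FormalMultilinearSeries.radius_le_of_le fun n => norm_conjForm_le _)
  · intro y hy
    have hy' : star y ∈ Metric.eball (0 : E) r := by
      rw [Metric.mem_eball, edist_zero_right] at hy ⊢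
      rwa [← ofReal_norm, norm_star, ofReal_norm]
    have h := (hp.hasSum hy').map (starAddEquiv : F ≃+ F) continuous_star
    have e : star (x + y) = star x + star y := star_add x y
    rw [e]
    exact h

end Conjugation

/-! ### The two flows on the complexification and the Segre chains. -/

section Segre

variable {m d : ℕ}

/-- Coordinates `(z, w, ζ)` on the complexification. -/
abbrev GraphSpace (m d : ℕ) : Type := ℂ^m × ℂ^d × ℂ^m

/-- A time `t` of a flow, followed by a point of the complexification. -/
abbrev ActSpace (m d : ℕ) : Type := ℂ^m × GraphSpace m d

/-- The source of the defining function: the space of the variables `(ζ, z, w)`. -/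
abbrev ThetaSpace (m d : ℕ) : Type := ℂ^m × ℂ^m × ℂ^d

lemma conjTheta_eq (Θ : ThetaSpace m d → ℂ^d) :
    conjTheta Θ = fun a => star (Θ (star a)) := rfl

lemma conjTheta_conjTheta (Θ : ThetaSpace m d → ℂ^d) : conjTheta (conjTheta Θ) = Θ := by
  funext a
  simp only [conjTheta_eq, star_star]

lemma analyticAt_conjTheta {Θ : ThetaSpace m d → ℂ^d} (h : AnalyticAt ℂ Θ 0) :
    AnalyticAt ℂ (conjTheta Θ) 0 :=
  analyticAt_star_star (by rwa [star_zero])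

lemma regAt_conjTheta {κ : Regularity} {Θ : ThetaSpace m d → ℂ^d} (h : RegAt κ Θ 0) :
    RegAt κ (conjTheta Θ) 0 := by
  have h1 := regAt_clm (κ := κ) ((starL' ℝ : ThetaSpace m d ≃L[ℝ] ThetaSpace m d) :
    ThetaSpace m d →L[ℝ] ThetaSpace m d) 0
  have h2 : RegAt κ (fun a : ThetaSpace m d => Θ (star a)) 0 := RegAt.comp_of_eq h h1 (star_zero _)
  exact h2.clm_comp ((starL' ℝ : ℂ^d ≃L[ℝ] ℂ^d) : ℂ^d →L[ℝ] ℂ^d)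

/-- The reality condition satisfied by complex defining functions of real submanifolds. -/
structure IsReflexive (Θ : ThetaSpace m d → ℂ^d) : Prop where
  analytic : AnalyticAt ℂ Θ 0
  theta_zero : Θ 0 = 0
  conj_apply : ∀ᶠ y : GraphSpace m d in 𝓝 0, conjTheta Θ (y.1, y.2.2, Θ (y.2.2, y.1, y.2.1)) = y.2.1

/-- The parametrization of the complexification. -/
def toX (Θ : ThetaSpace m d → ℂ^d) (y : GraphSpace m d) : ComplexifiedSpace m d :=
  (y.1, y.2.1, y.2.2, Θ (y.2.2, y.1, y.2.1))

/-- The multiple flow of the `(1,0)` fields in the coordinates `(z, w, ζ)`. -/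
def actA (Θ : ThetaSpace m d → ℂ^d) (p : ActSpace m d) :
    GraphSpace m d :=
  (p.2.1 + p.1, conjTheta Θ (p.2.1 + p.1, p.2.2.2, Θ (p.2.2.2, p.2.1, p.2.2.1)), p.2.2.2)

/-- The multiple flow of the `(0,1)` fields in the coordinates `(z, w, ζ)`. -/
def actB (p : ActSpace m d) : GraphSpace m d :=
  (p.2.1, p.2.2.1, p.2.2.2 + p.1)

/-- The alternating sequence of multiple flows. -/
def act (Θ : ThetaSpace m d → ℂ^d) (k : ℕ) : ActSpace m d → GraphSpace m d :=
  if Even k then actA Θ else actB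

/-- The alternating sequence of multiple flows in the space `(z, w, ζ, ξ)`. -/
def flowStep (Θ : ThetaSpace m d → ℂ^d) (k : ℕ)
    (p : ℂ^m × ComplexifiedSpace m d) : ComplexifiedSpace m d :=
  if Even k then flow Θ p.1 p.2 else conjFlow Θ p.1 p.2

lemma segreChain_eq (Θ : ThetaSpace m d → ℂ^d) (k : ℕ) (u : Fin k → ℂ^m) :
    segreChain Θ k u = chain (flowStep Θ) k u 0 := by
  induction k with
  | zero => rfl
  | succ k ih =>
    rw [segreChain, chain, flowStep, ih]

/-- The projection to the coordinates `(z, w, ζ)`. -/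
def ofX (m d : ℕ) : ComplexifiedSpace m d →L[ℂ] GraphSpace m d :=
  (fst ℂ _ _).prod
    (((fst ℂ _ _).comp (snd ℂ _ _)).prod ((fst ℂ _ _).comp ((snd ℂ _ _).comp (snd ℂ _ _))))

/-- The arguments of the defining function. -/
def thetaArg (m d : ℕ) : GraphSpace m d →L[ℂ] ThetaSpace m d :=
  ((snd ℂ _ _).comp (snd ℂ _ _)).prod
    ((fst ℂ _ _).prod ((fst ℂ _ _).comp (snd ℂ _ _)))

@[simp] lemma thetaArg_apply (y : GraphSpace m d) : thetaArg m d y = (y.2.2, y.1, y.2.1) := rfl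

variable {Θ : ThetaSpace m d → ℂ^d}

lemma analyticAt_graph {y : GraphSpace m d} (h : AnalyticAt ℂ Θ (y.2.2, y.1, y.2.1)) :
    AnalyticAt ℂ (fun y : GraphSpace m d => Θ (y.2.2, y.1, y.2.1)) y :=
  AnalyticAt.fun_comp (g := Θ) (f := thetaArg m d) h ((thetaArg m d).analyticAt y)

lemma regAt_graph {κ : Regularity} {y : GraphSpace m d} (h : RegAt κ Θ (y.2.2, y.1, y.2.1)) :
    RegAt κ (fun y : GraphSpace m d => Θ (y.2.2, y.1, y.2.1)) y :=
  RegAt.comp_of_eq (g := Θ) h (regAt_clm ((thetaArg m d).restrictScalars ℝ) y) rfl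

lemma analyticAt_toX {y : GraphSpace m d} (h : AnalyticAt ℂ Θ (y.2.2, y.1, y.2.1)) :
    AnalyticAt ℂ (toX Θ) y :=
  analyticAt_fst.prod ((analyticAt_fst.fun_comp analyticAt_snd).prod
    ((analyticAt_snd.fun_comp analyticAt_snd).prod (analyticAt_graph h)))

lemma injective_fderiv_toX {y : GraphSpace m d} (h : AnalyticAt ℂ Θ (y.2.2, y.1, y.2.1)) :
    Injective (fderiv ℂ (toX Θ) y) := by
  have h1 : HasFDerivAt (fun y => ofX m d (toX Θ y)) ((ofX m d).comp (fderiv ℂ (toX Θ) y)) y :=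
    (ofX m d).hasFDerivAt.comp y (analyticAt_toX h).hasFDerivAt
  have h2 := h1.unique (hasFDerivAt_id y)
  intro a b hab
  have h3 := DFunLike.congr_fun h2 a
  have h4 := DFunLike.congr_fun h2 b
  have h5 : ofX m d (fderiv ℂ (toX Θ) y a) = a := h3
  have h6 : ofX m d (fderiv ℂ (toX Θ) y b) = b := h4
  rw [← h5, hab, h6]

namespace IsReflexive

/-- Complex conjugation of `conj_apply`: together the two identities say that `ξ = Θ (ζ, z, w)` and
`w = Θ̄ (z, ζ, ξ)` are equivalent equations of the complexification. -/
lemma apply_conj (h : IsReflexive Θ) :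
    ∀ᶠ a : ThetaSpace m d in 𝓝 0, Θ (a.2.1, a.1, conjTheta Θ a) = a.2.2 := by
  have t : Tendsto₀ (fun a : ThetaSpace m d => ((star a.2.1, star a.2.2, star a.1) : GraphSpace m d)) := tendsto_cont
  filter_upwards [t.eventually h.conj_apply] with a ha
  refine star_injective ?_
  rw [← ha]
  simp only [conjTheta_eq, Prod.star_def, star_star]

lemma conj (h : IsReflexive Θ) : IsReflexive (conjTheta Θ) where
  analytic := analyticAt_conjTheta h.analytic
  theta_zero := by
    change star (Θ (star 0)) = 0
    rw [star_zero, h.theta_zero, star_zero]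
  conj_apply := by
    have t : Tendsto₀ (thetaArg m d) := (thetaArg m d).tendsto_zero
    filter_upwards [t.eventually h.apply_conj] with y hy
    rw [conjTheta_conjTheta]
    exact hy

lemma analyticAt_actA (h : IsReflexive Θ) : AnalyticAt ℂ (actA Θ) 0 := by
  let π : ActSpace m d →L[ℂ] GraphSpace m d := snd ℂ _ _
  have h1 : AnalyticAt ℂ (fun p : ActSpace m d => Θ (p.2.2.2, p.2.1, p.2.2.1)) 0 :=
    AnalyticAt.fun_comp (g := fun y : GraphSpace m d => Θ (y.2.2, y.1, y.2.1)) (f := π)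
      (analyticAt_graph h.analytic) (π.analyticAt 0)
  have e1 : AnalyticAt ℂ (fun p : ActSpace m d => p.2.1 + p.1) 0 :=
    (analyticAt_fst.fun_comp analyticAt_snd).fun_add analyticAt_fst
  have e2 : AnalyticAt ℂ (fun p : ActSpace m d => p.2.2.2) 0 :=
    analyticAt_snd.fun_comp (analyticAt_snd.fun_comp analyticAt_snd)
  refine e1.prod (AnalyticAt.prod ?_ e2)
  refine AnalyticAt.fun_comp (g := conjTheta Θ) ?_ (e1.prod (e2.prod h1))
  have : ((0 : ActSpace m d).2.1 + (0 : ActSpace m d).1,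
    (0 : ActSpace m d).2.2.2, Θ ((0 : ActSpace m d).2.2.2,
      (0 : ActSpace m d).2.1, (0 : ActSpace m d).2.2.1)) =
      (0 : ThetaSpace m d) :=
    Prod.ext (add_zero _) (Prod.ext rfl h.theta_zero)
  rw [this]
  exact analyticAt_conjTheta h.analytic

lemma regAt_actA {κ : Regularity} (h : IsReflexive Θ) (hr : RegAt κ Θ 0) :
    RegAt κ (actA Θ) 0 := by
  let π : ActSpace m d →L[ℝ] GraphSpace m d := snd ℝ _ _
  have h1 : RegAt κ (fun p : ActSpace m d => Θ (p.2.2.2, p.2.1, p.2.2.1)) 0 :=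
    RegAt.comp_of_eq (g := fun y : GraphSpace m d => Θ (y.2.2, y.1, y.2.1)) (f := π)
      (regAt_graph (y := 0) hr) (regAt_clm π 0) rfl
  have e1 : RegAt κ (fun p : ActSpace m d => p.2.1 + p.1) 0 :=
    regAt_clm ((fst ℝ _ _).comp π + fst ℝ _ _) 0
  have e2 : RegAt κ (fun p : ActSpace m d => p.2.2.2) 0 := regAt_clm ((snd ℝ ℂ^d ℂ^m).comp
      ((snd ℝ ℂ^m (ℂ^d × ℂ^m)).comp π)) 0
  refine e1.prodMk (RegAt.prodMk ?_ e2)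
  exact RegAt.comp_of_eq (g := conjTheta Θ) (regAt_conjTheta hr) (e1.prodMk (e2.prodMk h1))
    (Prod.ext (add_zero _) (Prod.ext rfl h.theta_zero))

lemma analyticAt_actB : AnalyticAt ℂ (actB (m := m) (d := d)) 0 :=
  (analyticAt_fst.fun_comp analyticAt_snd).prod
    ((analyticAt_fst.fun_comp (analyticAt_snd.fun_comp analyticAt_snd)).prod
      ((analyticAt_snd.fun_comp (analyticAt_snd.fun_comp analyticAt_snd)).fun_add analyticAt_fst))

lemma regAt_actB {κ : Regularity} : RegAt κ (actB (m := m) (d := d)) 0 := by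
  let π : ActSpace m d →L[ℝ] GraphSpace m d := snd ℝ _ _
  let π' := (snd ℝ ℂ^m (ℂ^d × ℂ^m)).comp π
  exact regAt_clm (((fst ℝ _ _).comp π).prod (((fst ℝ _ _).comp π').prod
      ((snd ℝ _ _).comp π' + fst ℝ _ _))) 0

lemma analyticAt_act (h : IsReflexive Θ) (k : ℕ) : AnalyticAt ℂ (act Θ k) 0 := by
  unfold act
  split_ifs
  · exact h.analyticAt_actA
  · exact analyticAt_actB

lemma regAt_act {κ : Regularity} (h : IsReflexive Θ) (hr : RegAt κ Θ 0) (k : ℕ) :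
    RegAt κ (act Θ k) 0 := by
  unfold act
  split_ifs
  · exact h.regAt_actA hr
  · exact regAt_actB

lemma actA_zero (h : IsReflexive Θ) : ∀ᶠ y in 𝓝 0, actA Θ (0, y) = y := by
  filter_upwards [h.conj_apply] with y hy
  simp only [actA, add_zero, hy]

lemma actB_zero (y : GraphSpace m d) : actB (0, y) = y := by
  simp only [actB, add_zero]

lemma act_zero (h : IsReflexive Θ) (k : ℕ) : ∀ᶠ y in 𝓝 0, act Θ k (0, y) = y := by
  unfold act
  split_ifs
  · exact h.actA_zero
  · exact .of_forall actB_zero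

lemma act_apply_zero (h : IsReflexive Θ) (k : ℕ) : act Θ k 0 = 0 :=
  (h.act_zero k).self_of_nhds

lemma act_periodic (k : ℕ) : act Θ (k + 2) = act Θ k := by
  unfold act
  have : Even (k + 2) ↔ Even k := by simp [Nat.even_add]
  simp only [this]

lemma continuousAt_graph (h : IsReflexive Θ) :
    Tendsto₀ (fun y : GraphSpace m d => Θ (y.2.2, y.1, y.2.1)) := by
  have := (analyticAt_graph (y := 0) h.analytic).continuousAt.tendsto
  have e : Θ ((0 : GraphSpace m d).2.2, (0 : GraphSpace m d).1, (0 : GraphSpace m d).2.1) = 0 :=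
    h.theta_zero
  rwa [e] at this

lemma tendsto_shift_conj (h : IsReflexive Θ) : Tendsto₀ (fun p : ActSpace m d =>
    ((p.2.1 + p.1, p.2.2.2, Θ (p.2.2.2, p.2.1, p.2.2.1)) : ThetaSpace m d)) := by
  have e1 : Tendsto₀ (fun p : ActSpace m d => p.2.1 + p.1) := tendsto_cont
  have e2 : Tendsto₀ (fun p : ActSpace m d => p.2.2.2) := tendsto_cont
  have e3 : Tendsto₀ (fun p : ActSpace m d => p.2) := tendsto_cont
  exact e1.prodMk_nhds (e2.prodMk_nhds (h.continuousAt_graph.comp e3))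

/-- The `(1,0)` flow fixes `ζ` and `ξ`; in the coordinates `(z, w, ζ)` this means that `ξ`,
recomputed after the flow, is unchanged. The group law and the comparison with `flow` rest on it. -/
lemma eventually_apply_conj (h : IsReflexive Θ) :
    ∀ᶠ p : ActSpace m d in 𝓝 0, Θ (p.2.2.2, p.2.1 + p.1,
        conjTheta Θ (p.2.1 + p.1, p.2.2.2, Θ (p.2.2.2, p.2.1, p.2.2.1))) =
        Θ (p.2.2.2, p.2.1, p.2.2.1) := by
  filter_upwards [h.tendsto_shift_conj.eventually h.apply_conj] with p hp
  exact hp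

lemma act_mul (h : IsReflexive Θ) (k : ℕ) :
    ∀ᶠ p : ℂ^m × ActSpace m d in 𝓝 0,
      act Θ k (p.1, act Θ k (p.2.1, p.2.2)) = act Θ k (p.2.1 + p.1, p.2.2) := by
  unfold act
  split_ifs
  · have t : Tendsto₀ (fun p : ℂ^m × ActSpace m d => p.2) :=
      tendsto_cont rfl
    filter_upwards [t.eventually h.eventually_apply_conj] with p hp
    simp only [actA, hp, add_assoc]
  · exact .of_forall fun p => by simp only [actB, add_assoc]

lemma flowStep_toX (h : IsReflexive Θ) (k : ℕ) :
    ∀ᶠ p : ActSpace m d in 𝓝 0,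
      flowStep Θ k (p.1, toX Θ p.2) = toX Θ (act Θ k p) := by
  unfold flowStep act
  split_ifs
  · filter_upwards [h.eventually_apply_conj] with p hp
    simp only [flow, toX, actA, hp]
  · exact .of_forall fun p => rfl

lemma chain_flowStep_toX (h : IsReflexive Θ) (k : ℕ) :
    ∀ᶠ p : (Fin k → ℂ^m) × GraphSpace m d in 𝓝 0,
      chain (flowStep Θ) k p.1 (toX Θ p.2) = toX Θ (chain (act Θ) k p.1 p.2) := by
  induction k with
  | zero => exact .of_forall fun p => rfl
  | succ k ih =>
    have t1 : Tendsto₀ (fun p : (Fin (k + 1) → ℂ^m) × GraphSpace m d => (initCLM ℂ^m k p.1, p.2)) :=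
      tendsto_cont
    have t2 : Tendsto₀ (fun p : (Fin (k + 1) → ℂ^m) × GraphSpace m d =>
        (p.1 (Fin.last k), chain (act Θ) k (initCLM _ k p.1) p.2)) := by
      refine Tendsto.prodMk_nhds (tendsto_cont rfl) ?_
      have e1 := (analyticAt_chain h.analyticAt_act h.act_apply_zero k).continuousAt.tendsto
      have e2 : chain (act Θ) k (0 : (Fin k → ℂ^m) × GraphSpace m d).1
        (0 : (Fin k → ℂ^m) × GraphSpace m d).2 = 0 := chain_zero_zero h.act_apply_zero k
      rw [e2] at e1
      exact e1.comp t1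
    filter_upwards [t1.eventually ih, t2.eventually (h.flowStep_toX k)] with p h1 h2
    rw [chain_succ, chain_succ, h1, h2]

lemma toX_zero (h : IsReflexive Θ) : toX Θ 0 = 0 :=
  Prod.ext rfl (Prod.ext rfl (Prod.ext rfl h.theta_zero))

/-- The ranks of the chains in the two systems of coordinates agree. -/
lemma rk_chain_flowStep (h : IsReflexive Θ) (k : ℕ) :
    ∀ᶠ p : (Fin k → ℂ^m) × GraphSpace m d in 𝓝 0,
      rk (fderiv ℂ (fun u => chain (flowStep Θ) k u (toX Θ p.2)) p.1) =
        rk (fderiv ℂ (fun u => chain (act Θ) k u p.2) p.1) := by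
  have ha := analyticAt_chain h.analyticAt_act h.act_apply_zero k
  have t : Tendsto₀ (fun p : (Fin k → ℂ^m) × GraphSpace m d => chain (act Θ) k p.1 p.2) := by
    have := ha.continuousAt.tendsto
    have e2 : chain (act Θ) k (0 : (Fin k → ℂ^m) × GraphSpace m d).1
        (0 : (Fin k → ℂ^m) × GraphSpace m d).2 = 0 := chain_zero_zero h.act_apply_zero k
    rwa [e2] at this
  have t0 : Tendsto₀ (thetaArg m d) := (thetaArg m d).tendsto_zero
  filter_upwards [(h.chain_flowStep_toX k).eventually_nhds, ha.eventually_analyticAt,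
    t.eventually (t0.eventually h.analytic.eventually_analyticAt)] with p h1 h2 h3
  have e1 : AnalyticAt ℂ (fun u => chain (act Θ) k u p.2) p.1 :=
    AnalyticAt.fun_comp (g := fun p : (Fin k → ℂ^m) × GraphSpace m d =>
      chain (act Θ) k p.1 p.2) (f := fun u => (u, p.2)) h2 (analyticAt_id.prod analyticAt_const)
  have e2 : HasFDerivAt (fun u => toX Θ (chain (act Θ) k u p.2)) _ p.1 :=
    HasFDerivAt.comp (g := toX Θ) p.1 (analyticAt_toX h3).hasFDerivAt
      e1.hasFDerivAt
  have e3 : (fun u => chain (flowStep Θ) k u (toX Θ p.2)) =ᶠ[𝓝 p.1]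
      fun u => toX Θ (chain (act Θ) k u p.2) := by
    have : Tendsto (fun u : Fin k → Fin m → ℂ => (u, p.2)) (𝓝 p.1) (𝓝 p) := tendsto_cont rfl
    exact this.eventually h1
  rw [(e2.congr_of_eventuallyEq e3).fderiv]
  exact rk_comp_of_injective _ _ (injective_fderiv_toX h3)

lemma genericRank_segreChain (h : IsReflexive Θ) (k : ℕ) :
    genericRank (segreChain Θ k) 0 = genericRank (fun u => chain (act Θ) k u 0) 0 := by
  have t : Tendsto₀ (fun u : Fin k → Fin m → ℂ => (u, (0 : GraphSpace m d))) := tendsto_cont rfl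
  have e : segreChain Θ k = fun u => chain (flowStep Θ) k u (toX Θ 0) := by
    funext u
    rw [segreChain_eq, h.toX_zero]
  rw [e]
  exact genericRank_congr_rk (t.eventually (h.rk_chain_flowStep k))

lemma genericRank_segreChain_stall (h : IsReflexive Θ) (k : ℕ)
    (hst : genericRank (segreChain Θ (k + 1)) 0 = genericRank (segreChain Θ (k + 2)) 0) :
    genericRank (segreChain Θ (k + 3)) 0 = genericRank (segreChain Θ (k + 2)) 0 := by
  rw [h.genericRank_segreChain, h.genericRank_segreChain] at hst ⊢
  exact genericRank_chain_stall h.analyticAt_act h.act_zero h.act_mul act_periodic k hst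

lemma genericRank_segreChain_le_succ (h : IsReflexive Θ) (k : ℕ) :
    genericRank (segreChain Θ k) 0 ≤ genericRank (segreChain Θ (k + 1)) 0 := by
  rw [h.genericRank_segreChain, h.genericRank_segreChain]
  exact genericRank_chain_le_succ h.analyticAt_act h.act_zero k

lemma genericRank_segreChain_le (h : IsReflexive Θ) (k : ℕ) :
    genericRank (segreChain Θ k) 0 ≤ 2 * m + d := by
  rw [h.genericRank_segreChain]
  refine genericRank_le_iff.2 (.of_forall fun u => ?_)
  refine (rk_le_finrank' _).trans (le_of_eq ?_)
  simp only [Module.finrank_prod, finrank_fin_fun]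
  ring

end IsReflexive

/-- The free variable `lam` absorbs `b`, so the range is the product of the range of `a` with the
whole of `V`. -/
lemma rk_shear {U V A : Type} [NormedAddCommGroup U] [NormedSpace ℂ U] [NormedAddCommGroup V]
    [NormedSpace ℂ V] [NormedAddCommGroup A] [NormedSpace ℂ A] [FiniteDimensional ℂ A]
    [FiniteDimensional ℂ V] {X : Type}
    [NormedAddCommGroup X] [NormedSpace ℂ X] (π : X →L[ℂ] U) (lam : X →L[ℂ] V)
    (hs : Surjective fun x => (π x, lam x)) (a : U →L[ℂ] A) (b : U →L[ℂ] V) :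
    rk ((a.comp π).prod (b.comp π + lam)) = finrank ℂ V + rk a := by
  have h1 : LinearMap.range ((a.comp π).prod (b.comp π + lam)).toLinearMap =
      (LinearMap.range a.toLinearMap).prod ⊤ := by
    ext ⟨p, v⟩
    constructor
    · rintro ⟨x, hx⟩
      exact ⟨⟨π x, congrArg Prod.fst hx⟩, trivial⟩
    · rintro ⟨⟨u, hu⟩, -⟩
      obtain ⟨x, hx⟩ := hs (u, v - b u)
      have hx1 : π x = u := congrArg Prod.fst hx
      have hx2 : lam x = v - b u := congrArg Prod.snd hx
      refine ⟨x, Prod.ext ?_ ?_⟩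
      · change a (π x) = p
        rw [hx1]; exact hu
      · change b (π x) + lam x = v
        rw [hx1, hx2]; abel
  let e : ((LinearMap.range a.toLinearMap).prod (⊤ : Submodule ℂ V)) ≃ₗ[ℂ]
      LinearMap.range a.toLinearMap × V :=
    { toFun := fun x => (⟨x.1.1, x.2.1⟩, x.1.2)
      map_add' := fun _ _ => rfl
      map_smul' := fun _ _ => rfl
      invFun := fun x => ⟨(x.1.1, x.2), x.1.2, trivial⟩
      left_inv := fun _ => rfl
      right_inv := fun _ => rfl }
  rw [rk, h1, e.finrank_eq, Module.finrank_prod, add_comm]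
  rfl

/-- Adding a step to a Segre chain has this form: `π` forgets the last time, `a` is the projected
chain, `lam` is the new time, and `e` recovers the remaining coordinates from the defining equation.
The rank depends on `x` only through `π x`, so points of high rank are found on the section `ι`. -/
lemma genericRank_shear {U A : Type} [NormedAddCommGroup U] [NormedSpace ℂ U]
    [NormedAddCommGroup A] [NormedSpace ℂ A] [FiniteDimensional ℂ A] [FiniteDimensional ℂ U]
    {X Z : Type} [NormedAddCommGroup X] [NormedSpace ℂ X] [FiniteDimensional ℂ X]
    [NormedAddCommGroup Z] [NormedSpace ℂ Z] [CompleteSpace Z]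
    (π : X →L[ℂ] U) (lam : X →L[ℂ] ℂ^m) (ι : U →L[ℂ] X) (hι : ∀ u, π (ι u) = u)
    (hs : Surjective fun x => (π x, lam x)) {a : U → A} {b : U → ℂ^m}
    (ha : AnalyticAt ℂ a 0) (hb : AnalyticAt ℂ b 0) {e : A × ℂ^m → Z}
    {e' : Z →L[ℂ] A × ℂ^m} (he' : ∀ x, e' (e x) = x) (ha0 : a 0 = 0) (hb0 : b 0 = 0)
    (he : AnalyticAt ℂ e 0) {f : X → Z} (hf : ∀ x, f x = e (a (π x), b (π x) + lam x)) :
    genericRank f 0 = m + genericRank a 0 := by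
  have tπ : Tendsto₀ π := π.tendsto_zero
  have tι : Tendsto₀ ι := ι.tendsto_zero
  have hG : AnalyticAt ℂ (fun x => (a (π x), b (π x) + lam x)) 0 :=
    (AnalyticAt.fun_comp (g := a) (by rwa [map_zero]) (π.analyticAt 0)).prod
      ((AnalyticAt.fun_comp (g := b) (by rwa [map_zero]) (π.analyticAt 0)).fun_add
        (lam.analyticAt 0))
  have tG : Tendsto₀ (fun x => (a (π x), b (π x) + lam x)) := by
    have := hG.continuousAt.tendsto
    simp only [map_zero, ha0, hb0, add_zero] at this
    exact this
  have key : ∀ᶠ x in 𝓝 0, rk (fderiv ℂ f x) = m + rk (fderiv ℂ a (π x)) := by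
    filter_upwards [tπ.eventually ha.eventually_analyticAt, tπ.eventually hb.eventually_analyticAt,
      tG.eventually he.eventually_analyticAt] with x h1 h2 h3
    have d1 : HasFDerivAt (fun x => a (π x)) ((fderiv ℂ a (π x)).comp π) x :=
      HasFDerivAt.comp (g := a) x h1.hasFDerivAt π.hasFDerivAt
    have d2 : HasFDerivAt (fun x => b (π x) + lam x) ((fderiv ℂ b (π x)).comp π + lam) x :=
      (HasFDerivAt.comp (g := b) x h2.hasFDerivAt π.hasFDerivAt).add
        lam.hasFDerivAt
    have d3 : HasFDerivAt (fun x => e (a (π x), b (π x) + lam x)) _ x :=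
      HasFDerivAt.comp (g := e) x h3.hasFDerivAt (d1.prodMk d2)
    have hinj : Injective (fderiv ℂ e (a (π x), b (π x) + lam x)) := by
      have i1 : HasFDerivAt (fun y => e' (e y)) _ (a (π x), b (π x) + lam x) :=
        HasFDerivAt.comp (g := e') _ e'.hasFDerivAt h3.hasFDerivAt
      have i2 := i1.unique ((hasFDerivAt_id _).congr_of_eventuallyEq (.of_forall he'))
      refine Function.LeftInverse.injective (g := e') fun v => ?_
      exact DFunLike.congr_fun i2 v
    have hf' : f = fun x => e (a (π x), b (π x) + lam x) := funext hf
    rw [hf', d3.fderiv, rk_comp_of_injective _ _ hinj, rk_shear π lam hs, finrank_fin_fun]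
  refine le_antisymm (genericRank_le_iff.2 ?_) (le_genericRank_iff.2 ?_)
  · filter_upwards [key, tπ.eventually (eventually_rk_le_genericRank a 0)] with x h1 h2
    omega
  · have hfr : ∃ᶠ u in 𝓝 0, genericRank a 0 ≤ rk (fderiv ℂ a u) := le_genericRank_iff.1 le_rfl
    refine tι.frequently ((hfr.and_eventually (tι.eventually key)).mono fun u hu => ?_)
    rw [hu.2, hι]
    exact Nat.add_le_add_left hu.1 m

lemma IsReflexive.flowStep_apply_zero (h : IsReflexive Θ) (k : ℕ) : flowStep Θ k 0 = 0 := by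
  have := (h.flowStep_toX k).self_of_nhds
  rw [h.act_apply_zero, h.toX_zero] at this
  have e : ((0 : ActSpace m d).1, toX Θ (0 : ActSpace m d).2) =
      (0 : ℂ^m × ComplexifiedSpace m d) := Prod.ext rfl h.toX_zero
  rwa [e] at this

lemma analyticAt_flowStep (h : AnalyticAt ℂ Θ 0) (k : ℕ) : AnalyticAt ℂ (flowStep Θ k) 0 := by
  let π : ℂ^m × ComplexifiedSpace m d →L[ℂ] ComplexifiedSpace m d := snd ℂ _ _
  have p1 : AnalyticAt ℂ (fun p : ℂ^m × ComplexifiedSpace m d => p.2.1) 0 :=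
    analyticAt_fst.fun_comp analyticAt_snd
  have p2 : AnalyticAt ℂ (fun p : ℂ^m × ComplexifiedSpace m d => p.2.2.1) 0 :=
    analyticAt_fst.fun_comp (analyticAt_snd.fun_comp analyticAt_snd)
  have p3 : AnalyticAt ℂ (fun p : ℂ^m × ComplexifiedSpace m d => p.2.2.2.1) 0 :=
    analyticAt_fst.fun_comp (analyticAt_snd.fun_comp (analyticAt_snd.fun_comp analyticAt_snd))
  have p4 : AnalyticAt ℂ (fun p : ℂ^m × ComplexifiedSpace m d => p.2.2.2.2) 0 :=
    analyticAt_snd.fun_comp (analyticAt_snd.fun_comp (analyticAt_snd.fun_comp analyticAt_snd))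
  have q1 : AnalyticAt ℂ (fun p : ℂ^m × ComplexifiedSpace m d => p.2.1 + p.1) 0 :=
    p1.fun_add analyticAt_fst
  have q3 : AnalyticAt ℂ (fun p : ℂ^m × ComplexifiedSpace m d => p.2.2.2.1 + p.1) 0 :=
    p3.fun_add analyticAt_fst
  by_cases hk : Even k
  · have e : flowStep Θ k = fun p => flow Θ p.1 p.2 := by funext p; simp only [flowStep, hk, if_true]
    rw [e]
    refine q1.prod (AnalyticAt.prod ?_ (p3.prod p4))
    exact AnalyticAt.comp_of_eq (g := conjTheta Θ) (analyticAt_conjTheta h) (q1.prod (p3.prod p4))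
      (Prod.ext (add_zero _) rfl)
  · have e : flowStep Θ k = fun p => conjFlow Θ p.1 p.2 := by
      funext p; simp only [flowStep, hk, if_false]
    rw [e]
    refine p1.prod (p2.prod (q3.prod ?_))
    exact AnalyticAt.comp_of_eq (g := Θ) h (q3.prod (p1.prod p2)) (Prod.ext (add_zero _) rfl)

lemma IsReflexive.analyticAt_segreChain (h : IsReflexive Θ) (k : ℕ) :
    AnalyticAt ℂ (segreChain Θ k) 0 := by
  have e : segreChain Θ k = fun u => chain (flowStep Θ) k u 0 := funext (segreChain_eq Θ k)
  rw [e]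
  exact analyticAt_chain_zero (analyticAt_flowStep h.analytic) h.flowStep_apply_zero k

lemma IsReflexive.segreChain_zero (h : IsReflexive Θ) (k : ℕ) : segreChain Θ k 0 = 0 := by
  rw [segreChain_eq]
  exact chain_zero_zero h.flowStep_apply_zero k

/-- The generic ranks of the chains and of the projected chains. -/
lemma IsReflexive.genericRank_segreChain_succ (h : IsReflexive Θ) (k : ℕ) :
    genericRank (segreChain Θ (k + 1)) 0 = m + genericRank (segreMap Θ k) 0 := by
  let π := initCLM ℂ^m k
  let lam : (Fin (k + 1) → ℂ^m) →L[ℂ] ℂ^m := proj (Fin.last k)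
  let ι := (snocCLM ℂ^m k).comp (inl ℂ _ _)
  have hι : ∀ u, π (ι u) = u := fun u => initCLM_snocCLM k (u, 0)
  have hs : Surjective fun x => (π x, lam x) := fun p =>
    ⟨snocCLM ℂ^m k p, Prod.ext (initCLM_snocCLM k p) (snocCLM_last k p)⟩
  have hc := h.analyticAt_segreChain k
  have hc0 := h.segreChain_zero k
  have p1 : AnalyticAt ℂ (fun u => (segreChain Θ k u).1) 0 := analyticAt_fst.fun_comp hc
  have p2 : AnalyticAt ℂ (fun u => (segreChain Θ k u).2.1) 0 :=
    analyticAt_fst.fun_comp (analyticAt_snd.fun_comp hc)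
  have p3 : AnalyticAt ℂ (fun u => (segreChain Θ k u).2.2.1) 0 :=
    analyticAt_fst.fun_comp (analyticAt_snd.fun_comp (analyticAt_snd.fun_comp hc))
  have p4 : AnalyticAt ℂ (fun u => (segreChain Θ k u).2.2.2) 0 :=
    analyticAt_snd.fun_comp (analyticAt_snd.fun_comp (analyticAt_snd.fun_comp hc))
  have s1 : AnalyticAt ℂ (fun x : (ℂ^m × ℂ^d) × ℂ^m => x.1.1) 0 :=
    analyticAt_fst.fun_comp analyticAt_fst
  have s2 : AnalyticAt ℂ (fun x : (ℂ^m × ℂ^d) × ℂ^m => x.1.2) 0 :=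
    analyticAt_snd.fun_comp analyticAt_fst
  by_cases hk : Even k
  -- For even `k` the new flow keeps `(ζ, ξ)`, moves `z` freely and computes `w` from `(z, ζ, ξ)`,
  -- so the projected chain and the new `z` determine the point. For odd `k` the two halves exchange
  -- roles.
  · let e' : ComplexifiedSpace m d →L[ℂ] (ℂ^m × ℂ^d) × ℂ^m :=
      ((snd ℂ _ _).comp (snd ℂ _ _)).prod
        (fst ℂ _ _)
    refine genericRank_shear (a := segreMap Θ k) (b := fun u => (segreChain Θ k u).1)
      (e := fun x => (x.2, conjTheta Θ (x.2, x.1.1, x.1.2), x.1.1, x.1.2)) (e' := e') π lam ι hι hs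
      ?_ p1 (fun x => rfl) ?_ (by rw [hc0]; rfl) ?_ ?_
    · have e : segreMap Θ k = fun u => ((segreChain Θ k u).2.2.1, (segreChain Θ k u).2.2.2) := by
        funext u; simp only [segreMap, hk, if_true]
      rw [e]; exact p3.prod p4
    · simp only [segreMap, hk, if_true, hc0]; rfl
    · refine analyticAt_snd.prod (AnalyticAt.prod ?_ (s1.prod s2))
      exact AnalyticAt.fun_comp (g := conjTheta Θ) (analyticAt_conjTheta h.analytic)
        (analyticAt_snd.prod (s1.prod s2))
    · intro x
      simp only [segreChain, hk, if_true, flow, segreMap]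
      rfl
  · let e' : ComplexifiedSpace m d →L[ℂ] (ℂ^m × ℂ^d) × ℂ^m :=
      ((fst ℂ _ _).prod ((fst ℂ _ _).comp (snd ℂ _ _))).prod
        ((fst ℂ _ _).comp ((snd ℂ _ _).comp (snd ℂ _ _)))
    refine genericRank_shear (a := segreMap Θ k) (b := fun u => (segreChain Θ k u).2.2.1)
      (e := fun x => (x.1.1, x.1.2, x.2, Θ (x.2, x.1.1, x.1.2))) (e' := e') π lam ι hι hs
      ?_ p3 (fun x => rfl) ?_ (by rw [hc0]; rfl) ?_ ?_
    · have e : segreMap Θ k = fun u => ((segreChain Θ k u).1, (segreChain Θ k u).2.1) := by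
        funext u; simp only [segreMap, hk, if_false]
      rw [e]; exact p1.prod p2
    · simp only [segreMap, hk, if_false, hc0]; rfl
    · refine s1.prod (s2.prod (analyticAt_snd.prod ?_))
      exact AnalyticAt.fun_comp (g := Θ) h.analytic (analyticAt_snd.prod (s1.prod s2))
    · intro x
      simp only [segreChain, hk, if_false, conjFlow, segreMap]
      rfl

lemma genericRank_const {V W : Type} [NormedAddCommGroup V] [NormedSpace ℂ V]
    [NormedAddCommGroup W] [NormedSpace ℂ W] [FiniteDimensional ℂ V] {f : V → W} {c : W}
    (hf : ∀ v, f v = c) (x : V) : genericRank f x = 0 := by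
  have e : f = fun _ => c := funext hf
  refine Nat.le_zero.1 (genericRank_le_iff.2 (.of_forall fun v => ?_))
  rw [e, fderiv_fun_const]
  simp [rk]

lemma genericRank_segreMap_zero (Θ : ThetaSpace m d → ℂ^d) :
    genericRank (segreMap Θ 0) 0 = 0 :=
  genericRank_const (c := 0) (fun _ => rfl) 0

lemma genericRank_segreChain_zero (Θ : ThetaSpace m d → ℂ^d) :
    genericRank (segreChain Θ 0) 0 = 0 :=
  genericRank_const (c := 0) (fun _ => rfl) 0

lemma IsReflexive.genericRank_segreChain_one (h : IsReflexive Θ) :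
    genericRank (segreChain Θ 1) 0 = m := by
  rw [h.genericRank_segreChain_succ, genericRank_segreMap_zero, add_zero]

lemma IsReflexive.genericRank_segreMap_one (h : IsReflexive Θ) :
    genericRank (segreMap Θ 1) 0 = m := by
  have h1 := h.genericRank_segreChain_one
  refine le_antisymm ?_ ?_
  · refine genericRank_le_iff.2 (.of_forall fun u => ?_)
    refine (rk_le_finrank _).trans (le_of_eq ?_)
    rw [Module.finrank_pi_fintype]
    simp
  · -- the first component already has rank `m`
    let lam : (Fin 1 → ℂ^m) →L[ℂ] ℂ^m := proj 0
    have hinj : Injective lam := fun a b hab => by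
      ext i j
      rw [Subsingleton.elim i 0]
      exact congrFun hab j
    have hrk : rk lam = m := by
      rw [rk_eq_finrank_of_injective _ hinj, Module.finrank_pi_fintype]; simp
    refine le_genericRank_iff.2 (Filter.Eventually.frequently ?_)
    have ha : AnalyticAt ℂ (segreMap Θ 1) 0 := by
      have hc := h.analyticAt_segreChain 1
      have e : segreMap Θ 1 = fun u => ((segreChain Θ 1 u).1, (segreChain Θ 1 u).2.1) := by
        funext u; simp [segreMap]
      rw [e]
      exact (analyticAt_fst.fun_comp hc).prod (analyticAt_fst.fun_comp (analyticAt_snd.fun_comp hc))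
    filter_upwards [ha.eventually_analyticAt] with u hu
    have e1 : HasFDerivAt (fun u => (segreMap Θ 1 u).1)
        ((fst ℂ _ _).comp (fderiv ℂ (segreMap Θ 1) u)) u :=
      (fst ℂ ℂ^m ℂ^d).hasFDerivAt.comp u
        hu.hasFDerivAt
    have e2 : (fun u => (segreMap Θ 1 u).1) = lam := by
      funext u
      simp [segreMap, segreChain, flow, lam]
    rw [e2] at e1
    have e3 := e1.unique lam.hasFDerivAt
    calc m = rk lam := hrk.symm
      _ = rk ((fst ℂ _ _).comp (fderiv ℂ (segreMap Θ 1) u)) := by rw [e3]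
      _ ≤ _ := rk_comp_le_right _ _

lemma IsReflexive.genericRank_segreChain_two (h : IsReflexive Θ) :
    genericRank (segreChain Θ 2) 0 = 2 * m := by
  rw [h.genericRank_segreChain_succ, h.genericRank_segreMap_one]
  ring

end Segre

end CoordinateProjections

/-! ### Tangent spaces of real submanifolds. -/

section Tangent

variable {n : ℕ} {M : Set ℂ^n}

lemma fderiv_eq_zero_of_mem_tangentSpace {x v : ℂ^n} (hv : v ∈ tangentSpace M x)
    {G : Type} [NormedAddCommGroup G] [NormedSpace ℝ G] {F : ℂ^n → G}
    (hF : AnalyticAt ℝ F x) (h0 : ∀ᶠ y in 𝓝 x, y ∈ M → F y = 0) : fderiv ℝ F x v = 0 := by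
  refine (SeparatingDual.eq_zero_iff_forall_dual_eq_zero (R := ℝ) _).2 fun ℓ => ?_
  have h1 := hv (fun y => ℓ (F y)) ((ℓ.analyticAt _).comp hF) (by
    filter_upwards [mem_nhdsWithin_of_mem_nhds h0, self_mem_nhdsWithin] with y hy hyM
    rw [hy hyM, map_zero])
  have h2 := (ℓ.hasFDerivAt.comp x hF.hasFDerivAt).fderiv
  exact (DFunLike.congr_fun h2.symm v).trans h1

lemma tangentSpace_le_ker {c : ℕ} {x v : ℂ^n} {r : Fin c → ℂ^n → ℝ}
    (hr : ∀ j, AnalyticAt ℝ (r j) x) (hM : ∀ᶠ y in 𝓝 x, (y ∈ M ↔ ∀ j, r j y = 0))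
    (hv : v ∈ tangentSpace M x) (j : Fin c) : fderiv ℝ (r j) x v = 0 :=
  fderiv_eq_zero_of_mem_tangentSpace hv (hr j) (hM.mono fun _ h hy => h.1 hy j)

/-- Lagrange multipliers: an analytic function vanishing on `M` has a constrained extremum at `x`,
so its differential is a combination of those of the defining functions. Independence of the latter
excludes the multiplier `0` of `f`. -/
lemma mem_tangentSpace_of_ker {c : ℕ} {x v : ℂ^n} {r : Fin c → ℂ^n → ℝ}
    (hr : ∀ j, AnalyticAt ℝ (r j) x) (hli : LinearIndependent ℝ fun j => fderiv ℝ (r j) x)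
    (hM : ∀ᶠ y in 𝓝 x, (y ∈ M ↔ ∀ j, r j y = 0)) (hx : x ∈ M)
    (hv : ∀ j, fderiv ℝ (r j) x v = 0) : v ∈ tangentSpace M x := by
  intro f hf h0
  have hrx := hM.self_of_nhds.1 hx
  have h1 : IsLocalExtrOn f {y | ∀ j, r j y = r j x} x := by
    refine Or.inl ?_
    filter_upwards [mem_nhdsWithin_of_mem_nhds hM, self_mem_nhdsWithin,
      mem_nhdsWithin_of_mem_nhds (eventually_nhdsWithin_iff.1 h0)] with y h1 h2 h3
    have hy : y ∈ M := h1.2 fun j => (h2 j).trans (hrx j)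
    have e1 : f y = 0 := h3 hy
    have e2 : f x = 0 := (eventually_nhdsWithin_iff.1 h0).self_of_nhds hx
    rw [e1, e2]
  obtain ⟨Λ, Λ₀, hne, hsum⟩ := h1.exists_multipliers_of_hasStrictFDerivAt
    (fun j => (hr j).hasStrictFDerivAt) hf.hasStrictFDerivAt
  have hΛ₀ : Λ₀ ≠ 0 := by
    rintro rfl
    rw [zero_smul, add_zero] at hsum
    refine hne ?_
    have := Fintype.linearIndependent_iff.1 hli Λ hsum
    exact Prod.ext (funext this) rfl
  have h2 := DFunLike.congr_fun hsum v
  simp only [add_apply, sum_apply, smul_apply, hv, smul_eq_mul, mul_zero, Finset.sum_const_zero,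
    zero_add, zero_apply] at h2
  exact (mul_eq_zero.1 h2).resolve_left hΛ₀

lemma le_finrank_tangentSpace {κ : Regularity} {c : ℕ} {x : ℂ^n}
    (h : IsSubmanifoldAt κ M c x) (hx : x ∈ M) :
    2 * n ≤ finrank ℝ (tangentSpace M x) + c := by
  obtain ⟨r, hr, hli, hM⟩ := h
  let R : ℂ^n →ₗ[ℝ] (Fin c → ℝ) := LinearMap.pi fun j => (fderiv ℝ (r j) x).toLinearMap
  have h1 : LinearMap.ker R ≤ tangentSpace M x := fun v hv =>
    mem_tangentSpace_of_ker (fun j => (hr j).1) hli hM hx fun j => congrFun hv j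
  have h2 := LinearMap.finrank_range_add_finrank_ker R
  have h3 := Submodule.finrank_mono h1
  have h4 := Submodule.finrank_le (LinearMap.range R)
  rw [finrank_fin_fun] at h4
  rw [finrank_real_of_complex, finrank_fin_fun] at h2
  omega

end Tangent

/-! ### `M` as a maximal totally real submanifold of its complexification. -/

section Chart

variable {n m d : ℕ} {M : Set ℂ^n} {p : ℂ^n}

/-- The real linear part of the parametrization of `M` inside its complexification. -/
def realGraph (A : ℂ^n ≃L[ℂ] ℂ^m × ℂ^d) :
    ℂ^n →L[ℝ] GraphSpace m d :=
  let A' : ℂ^n →L[ℝ] ℂ^m × ℂ^d := (A : ℂ^n →L[ℂ] ℂ^m × ℂ^d).restrictScalars ℝ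
  ((fst ℝ _ _).comp A').prod
    (((snd ℝ _ _).comp A').prod (((starL' ℝ : ℂ^m ≃L[ℝ] ℂ^m) : ℂ^m →L[ℝ] ℂ^m).comp
        ((fst ℝ _ _).comp A')))

lemma realGraph_apply (A : ℂ^n ≃L[ℂ] ℂ^m × ℂ^d) (v : ℂ^n) :
    realGraph A v = ((A v).1, (A v).2, star (A v).1) := rfl

lemma realGraph_injective (A : ℂ^n ≃L[ℂ] ℂ^m × ℂ^d) :
    Injective (realGraph A) := by
  intro a b h
  rw [realGraph_apply, realGraph_apply] at h
  exact A.injective (Prod.ext (Prod.mk.inj h).1 (Prod.mk.inj (Prod.mk.inj h).2).1)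

variable (C : SegreChart M p m d)

/-- The parametrization of `M` inside its complexification. -/
def SegreChart.emb (t : ℂ^n) : GraphSpace m d := realGraph C.coord (t - p)

/-- The inverse of the parametrization. -/
def SegreChart.proj (y : GraphSpace m d) : Fin n → ℂ := p + C.coord.symm (y.1, y.2.1)

lemma SegreChart.proj_emb (t : ℂ^n) : C.proj (C.emb t) = t := by
  change p + C.coord.symm (C.coord (t - p)) = t
  simp

lemma SegreChart.emb_base : C.emb p = 0 := by
  simp [SegreChart.emb]

lemma SegreChart.continuous_emb : Continuous C.emb := by
  unfold SegreChart.emb; fun_prop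

lemma SegreChart.continuous_proj : Continuous C.proj := by
  unfold SegreChart.proj; fun_prop

lemma SegreChart.tendsto_emb : Tendsto C.emb (𝓝 p) (𝓝 0) :=
  C.continuous_emb.tendsto' _ _ C.emb_base

lemma SegreChart.tendsto_proj : Tendsto C.proj (𝓝 0) (𝓝 p) :=
  C.continuous_proj.tendsto' _ _ (by
    have : C.proj 0 = p + C.coord.symm 0 := rfl
    rw [this, map_zero, add_zero])

lemma SegreChart.theta_zero (hp : p ∈ M) : C.Θ 0 = 0 := by
  have h := C.mem_iff.self_of_nhds.1 hp
  simp only [sub_self, map_zero, Prod.fst_zero, Prod.snd_zero, star_zero] at h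
  exact h.symm

lemma SegreChart.theta_emb : ∀ᶠ t in 𝓝 p, t ∈ M →
    C.Θ ((C.emb t).2.2, (C.emb t).1, (C.emb t).2.1) = star (C.emb t).2.1 := by
  filter_upwards [C.mem_iff] with t ht hM
  exact (ht.1 hM).symm

/-- The differential of the complex defining equation on the tangent space. -/
lemma SegreChart.tangent_eq : ∀ᶠ t in 𝓝 p, ∀ v ∈ tangentSpace M t,
    star (C.coord v).2 = fderiv ℂ C.Θ ((C.emb t).2.2, (C.emb t).1, (C.emb t).2.1)
      (star (C.coord v).1, (C.coord v).1, (C.coord v).2) := by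
  have h1 : Tendsto (fun t => thetaArg m d (C.emb t)) (𝓝 p) (𝓝 0) :=
    ((thetaArg m d).tendsto_zero).comp C.tendsto_emb
  filter_upwards [h1.eventually C.analytic.eventually_analyticAt, C.theta_emb.eventually_nhds]
    with t h2 h3 v hv
  let L : ℂ^n →L[ℝ] ThetaSpace m d := ((thetaArg m d).restrictScalars ℝ).comp (realGraph C.coord)
  let W : ℂ^n →L[ℝ] ℂ^d := ((starL' ℝ : ℂ^d ≃L[ℝ] ℂ^d) : ℂ^d →L[ℝ] ℂ^d).comp
      ((snd ℝ _ _).comp ((C.coord : ℂ^n →L[ℂ] ℂ^m × ℂ^d).restrictScalars ℝ))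
  have hL : AnalyticAt ℝ (fun t => L (t - p)) t :=
    (L.analyticAt _).fun_comp (analyticAt_id.fun_sub analyticAt_const)
  have hW : AnalyticAt ℝ (fun t => W (t - p)) t :=
    (W.analyticAt _).fun_comp (analyticAt_id.fun_sub analyticAt_const)
  have hF : AnalyticAt ℝ (fun t => W (t - p) - C.Θ (L (t - p))) t :=
    hW.fun_sub (AnalyticAt.fun_comp (g := C.Θ) (f := fun t => L (t - p)) h2.restrictScalars hL)
  have h4 := fderiv_eq_zero_of_mem_tangentSpace hv hF (by
    filter_upwards [h3] with s hs hsM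
    rw [sub_eq_zero]
    exact (hs hsM).symm)
  have d1 : HasFDerivAt (fun t => L (t - p)) L t :=
    HasFDerivAt.comp (g := L) t L.hasFDerivAt ((hasFDerivAt_id t).sub_const p)
  have d2 : HasFDerivAt (fun t => W (t - p)) W t :=
    HasFDerivAt.comp (g := W) t W.hasFDerivAt ((hasFDerivAt_id t).sub_const p)
  have d3 : HasFDerivAt (fun t => C.Θ (L (t - p)))
      (((fderiv ℂ C.Θ (L (t - p))).restrictScalars ℝ).comp L) t :=
    HasFDerivAt.comp (g := C.Θ) t (h2.hasFDerivAt.restrictScalars ℝ) d1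
  rw [(d2.fun_sub d3).fderiv] at h4
  exact sub_eq_zero.1 h4

/-- `M` is maximal totally real in its complexification. -/
lemma SegreChart.eventually_isUniquenessPoint {κ : Regularity} (hn : n = m + d)
    (hM : IsSubmanifold κ M d) :
    ∀ᶠ t in 𝓝 p, t ∈ M → IsUniquenessPoint (C.emb '' M) (C.emb t) := by
  filter_upwards [C.tangent_eq] with t hT ht g hg h0
  have key : ∀ v ∈ tangentSpace M t, fderiv ℂ g (C.emb t) (realGraph C.coord v) = 0 := by
    intro v hv
    have hA : AnalyticAt ℝ (fun t => g (C.emb t)) t :=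
      AnalyticAt.fun_comp (g := g) (f := C.emb) hg.restrictScalars
        (((realGraph C.coord).analyticAt _).fun_comp (analyticAt_id.fun_sub analyticAt_const))
    have h1 := fderiv_eq_zero_of_mem_tangentSpace hv hA (by
      filter_upwards [C.continuous_emb.continuousAt.eventually h0] with s hs hsM
      exact hs ⟨s, hsM, rfl⟩)
    have d1 : HasFDerivAt C.emb (realGraph C.coord) t :=
      HasFDerivAt.comp (g := realGraph C.coord) t (realGraph C.coord).hasFDerivAt
        ((hasFDerivAt_id t).sub_const p)
    have d2 : HasFDerivAt (fun t => g (C.emb t)) _ t :=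
      HasFDerivAt.comp (g := g) t (hg.hasFDerivAt.restrictScalars ℝ) d1
    rw [d2.fderiv] at h1
    exact h1
  set T := tangentSpace M t
  have hdim : 2 * n ≤ finrank ℝ T + d := le_finrank_tangentSpace (hM t ht) ht
  set Θ' := fderiv ℂ C.Θ ((C.emb t).2.2, (C.emb t).1, (C.emb t).2.1)
  let J : ℂ^n →ₗ[ℝ] GraphSpace m d := (realGraph C.coord).toLinearMap
  let I' : GraphSpace m d →ₗ[ℝ] GraphSpace m d :=
    (Complex.I • (LinearMap.id : GraphSpace m d →ₗ[ℂ] GraphSpace m d)).restrictScalars ℝ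
  have hI' : ∀ y, I' y = Complex.I • y := fun y => rfl
  have hI'inj : Injective I' := fun a b hab => by
    rw [hI', hI'] at hab
    exact smul_right_injective _ Complex.I_ne_zero hab
  have f1 : finrank ℝ (T.map J) = finrank ℝ T :=
    (Submodule.equivMapOfInjective J (realGraph_injective C.coord) T).finrank_eq.symm
  have f2 : finrank ℝ ((T.map J).map I') = finrank ℝ (T.map J) :=
    (Submodule.equivMapOfInjective I' hI'inj (T.map J)).finrank_eq.symm
  -- Suppose `J v = i J v'`. The third component of `J` is conjugate linear in `z`, which forces the
  -- `z`-components to vanish. The differentiated equation then equates the conjugate of the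
  -- `w`-component with a complex linear expression in it, which forces the `w`-components to vanish
  -- as well.
  have hdisj : (T.map J) ⊓ ((T.map J).map I') = ⊥ := by
    rw [Submodule.eq_bot_iff]
    rintro _ ⟨⟨v, hv, rfl⟩, ⟨_, ⟨v', hv', rfl⟩, h⟩⟩
    have h1 : Complex.I • realGraph C.coord v' = realGraph C.coord v := h
    rw [realGraph_apply, realGraph_apply] at h1
    have e1 : Complex.I • (C.coord v').1 = (C.coord v).1 := (Prod.mk.inj h1).1
    have e2 : Complex.I • (C.coord v').2 = (C.coord v).2 := (Prod.mk.inj (Prod.mk.inj h1).2).1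
    have e3 : Complex.I • star (C.coord v').1 = star (C.coord v).1 :=
      (Prod.mk.inj (Prod.mk.inj h1).2).2
    have hz' : (C.coord v').1 = 0 := by
      have e4 := congrArg star e3
      rw [star_smul, star_star, star_star, ← e1] at e4
      have e5 : (star Complex.I - Complex.I) • (C.coord v').1 = 0 := by
        rw [sub_smul, e4, sub_self]
      refine (smul_eq_zero.1 e5).resolve_left ?_
      intro e6
      have := congrArg Complex.im e6
      simp at this
      norm_num at this
    have hz : (C.coord v).1 = 0 := by rw [← e1, hz', smul_zero]
    have t1 := hT v hv
    have t2 := hT v' hv'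
    rw [hz] at t1
    rw [hz'] at t2
    have t3 : (star (0 : ℂ^m), (0 : ℂ^m), (C.coord v).2) =
        Complex.I • ((star (0 : ℂ^m), (0 : ℂ^m), (C.coord v').2) : ThetaSpace m d) := by
      simp [← e2]
    rw [t3, map_smul, ← t2, ← e2, star_smul] at t1
    have t4 : (star Complex.I - Complex.I) • star (C.coord v').2 = 0 := by
      rw [sub_smul, t1, sub_self]
    have hw' : star (C.coord v').2 = 0 := by
      refine (smul_eq_zero.1 t4).resolve_left ?_
      intro e6
      have := congrArg Complex.im e6
      simp at this
      norm_num at this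
    have hw : (C.coord v).2 = 0 := by
      rw [← e2, star_eq_zero.1 hw', smul_zero]
    change realGraph C.coord v = 0
    rw [realGraph_apply, hz, hw, star_zero]
    rfl
  -- Each summand has real dimension at least `2n - d = 2m + d`, half the real dimension of the
  -- complexification.
  have hsup : (T.map J) ⊔ ((T.map J).map I') = ⊤ := by
    refine Submodule.eq_top_of_finrank_eq ?_
    have h1 := Submodule.finrank_sup_add_finrank_inf_eq (T.map J) ((T.map J).map I')
    rw [hdisj, finrank_bot, add_zero, f2, f1] at h1
    have h2 : finrank ℝ (GraphSpace m d) = 2 * (2 * m + d) := by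
      rw [finrank_real_of_complex]
      simp only [Module.finrank_prod, finrank_fin_fun]
      ring
    have h3 := Submodule.finrank_le ((T.map J) ⊔ ((T.map J).map I'))
    omega
  refine ContinuousLinearMap.ext fun y => ?_
  have hy : y ∈ (T.map J) ⊔ ((T.map J).map I') := by rw [hsup]; trivial
  obtain ⟨_, ⟨v, hv, rfl⟩, _, ⟨_, ⟨v', hv', rfl⟩, rfl⟩, rfl⟩ := Submodule.mem_sup.1 hy
  rw [map_add, hI', map_smul]
  have k1 : fderiv ℂ g (C.emb t) (J v) = 0 := key v hv
  have k2 : fderiv ℂ g (C.emb t) (J v') = 0 := key v' hv'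
  rw [k1, k2]
  simp

/-- An analytic function on the complexification vanishes if it vanishes on `M`. -/
lemma SegreChart.eventually_eq_zero {κ : Regularity} (hn : n = m + d)
    (hM : IsSubmanifold κ M d) (hp : p ∈ M) {F : Type} [NormedAddCommGroup F] [NormedSpace ℂ F]
    [CompleteSpace F] {g : GraphSpace m d → F} (hg : AnalyticAt ℂ g 0)
    (h0 : ∀ᶠ t in 𝓝 p, t ∈ M → g (C.emb t) = 0) : ∀ᶠ y in 𝓝 0, g y = 0 := by
  refine eventually_eq_zero_of_uniqueness (S := C.emb '' M) ⟨p, hp, C.emb_base⟩ ?_ hg ?_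
  · filter_upwards [C.tendsto_proj.eventually (C.eventually_isUniquenessPoint hn hM)] with y hy
    rintro ⟨t, ht, rfl⟩
    rw [C.proj_emb] at hy
    exact hy ht
  · filter_upwards [C.tendsto_proj.eventually h0] with y hy
    rintro ⟨t, ht, rfl⟩
    rw [C.proj_emb] at hy
    exact hy ht

/-- The version with parameters. -/
lemma SegreChart.eventually_eq_zero_prod {κ : Regularity} (hn : n = m + d)
    (hM : IsSubmanifold κ M d) (hp : p ∈ M) {A F : Type} [NormedAddCommGroup A] [NormedSpace ℂ A]
    [NormedAddCommGroup F] [NormedSpace ℂ F]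
    [CompleteSpace F] {g : A × GraphSpace m d → F} (hg : AnalyticAt ℂ g 0)
    (h0 : ∀ᶠ q : A × ℂ^n in 𝓝 (0, p), q.2 ∈ M → g (q.1, C.emb q.2) = 0) :
    ∀ᶠ y in 𝓝 0, g y = 0 := by
  obtain ⟨ε, hε, hball⟩ := eventually_nhds_iff_ball.1 hg.eventually_analyticAt
  have h1 : ∀ᶠ a in 𝓝 (0 : A), ∀ᶠ t in 𝓝 p, t ∈ M → g (a, C.emb t) = 0 := h0.curry_nhds
  have h2 : ∀ᶠ y : A × GraphSpace m d in 𝓝 0, ∀ᶠ t in 𝓝 p, t ∈ M → g (y.1, C.emb t) = 0 :=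
    (Continuous.tendsto' continuous_fst (0 : A × GraphSpace m d) 0 rfl).eventually h1
  filter_upwards [h2, ball_mem_nhds _ hε] with y hy hyε
  rw [mem_ball, dist_zero_right, Prod.norm_def, max_lt_iff] at hyε
  have hA : AnalyticOnNhd ℂ (fun x => g (y.1, x)) (ball 0 ε) := by
    intro x hx
    refine AnalyticAt.fun_comp (g := g) (f := fun x => (y.1, x)) (hball _ ?_)
      (analyticAt_const.prod analyticAt_id)
    rw [mem_ball, dist_zero_right] at hx ⊢
    rw [Prod.norm_def]
    exact max_lt hyε.1 hx
  have h3 := C.eventually_eq_zero hn hM hp (hA 0 (Metric.mem_ball_self hε)) hy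
  exact hA.eqOn_zero_of_preconnected_of_eventuallyEq_zero (convex_ball _ _).isPreconnected
    (Metric.mem_ball_self hε) h3 (by rw [mem_ball, dist_zero_right]; exact hyε.2)

/-- At points of `M` the function `Θ` returns the conjugate of `w`, from which the conjugated
function recovers `w`. The resulting identity is holomorphic on the complexification, so it extends
from the totally real `M` to a neighbourhood. -/
lemma SegreChart.isReflexive {κ : Regularity} (hn : n = m + d) (hM : IsSubmanifold κ M d)
    (hp : p ∈ M) : IsReflexive C.Θ where
  analytic := C.analytic
  theta_zero := C.theta_zero hp
  conj_apply := by
    have hz : (0 : ThetaSpace m d) = ((0 : GraphSpace m d).1, (0 : GraphSpace m d).2.2,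
        C.Θ ((0 : GraphSpace m d).2.2, (0 : GraphSpace m d).1, (0 : GraphSpace m d).2.1)) :=
      Prod.ext rfl (Prod.ext rfl (C.theta_zero hp).symm)
    have h1 : AnalyticAt ℂ (fun y : GraphSpace m d =>
        conjTheta C.Θ (y.1, y.2.2, C.Θ (y.2.2, y.1, y.2.1)) - y.2.1) 0 := by
      refine AnalyticAt.fun_sub ?_ (analyticAt_fst.fun_comp analyticAt_snd)
      exact AnalyticAt.comp_of_eq (g := conjTheta C.Θ) (analyticAt_conjTheta C.analytic)
        (analyticAt_fst.prod ((analyticAt_snd.fun_comp analyticAt_snd).prod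
          (analyticAt_graph (y := 0) C.analytic))) hz.symm
    filter_upwards [C.eventually_eq_zero hn hM hp h1 (by
      filter_upwards [C.theta_emb] with t ht htM
      have h2 := ht htM
      rw [sub_eq_zero, h2, conjTheta_eq]
      have e : star ((C.emb t).1, (C.emb t).2.2, star (C.emb t).2.1) =
          (((C.emb t).2.2, (C.emb t).1, (C.emb t).2.1) : ThetaSpace m d) := by
        simp only [SegreChart.emb, realGraph_apply, Prod.star_def, star_star]
      change star (C.Θ (star ((C.emb t).1, (C.emb t).2.2, star (C.emb t).2.1))) = _
      rw [e, h2, star_star])] with y hy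
    exact sub_eq_zero.1 hy

end Chart

/-! ### Flatness of minors and its invariance. -/

section Flat

variable {V W V' W' : Type} [NormedAddCommGroup V] [NormedSpace ℂ V] [NormedAddCommGroup W]
  [NormedSpace ℂ W] [NormedAddCommGroup V'] [NormedSpace ℂ V'] [NormedAddCommGroup W']
  [NormedSpace ℂ W']

/-- All minors of size `r` of the differential of `F` vanish to order greater than `N` at `0`. -/
def HasFlatMinors (F : V → W) (r N : ℕ) : Prop :=
  ∃ c : ℝ, ∀ᶠ u in 𝓝 0, ∀ (v : Fin r → V) (l : Fin r → W →L[ℂ] ℂ),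
    ‖minor (fderiv ℂ F u) v l‖ ≤ c * ‖u‖ ^ (N + 1) * (∏ j, ‖v j‖) * ∏ i, ‖l i‖

/-- By the chain rule a minor of `F` at `u` is a minor of `F'` at `α u` with transported vectors and
functionals, whose norms grow by bounded factors, and `‖α u‖` is at most a multiple of `‖u‖`.
Uniformity over vectors in the notion of flatness is needed because the transported vectors depend
on `u`. -/
lemma HasFlatMinors.of_comp {F : V → W} {F' : V' → W'} {α : V → V'} (Φ : W ≃L[ℂ] W')
    (hα : AnalyticAt ℂ α 0) (hα0 : α 0 = 0) (hF : ∀ᶠ u in 𝓝 0, DifferentiableAt ℂ F u)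
    (hF' : ∀ᶠ u in 𝓝 0, DifferentiableAt ℂ F' u) (h : ∀ᶠ u in 𝓝 0, F' (α u) = Φ (F u))
    [CompleteSpace V'] {r N : ℕ} (hflat : HasFlatMinors F' r N) : HasFlatMinors F r N := by
  obtain ⟨c, hc⟩ := hflat
  have tα : Tendsto₀ α := hα.tendsto hα0
  set K := ‖fderiv ℂ α 0‖ + 1
  have hK0 : 0 ≤ K := by positivity
  have hK : ∀ᶠ u in 𝓝 0, ‖fderiv ℂ α u‖ ≤ K := by
    have : Tendsto (fun u => ‖fderiv ℂ α u‖) (𝓝 0) (𝓝 ‖fderiv ℂ α 0‖) :=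
      hα.fderiv.continuousAt.norm.tendsto
    exact (this.eventually (gt_mem_nhds (lt_add_one _))).mono fun u hu => le_of_lt hu
  obtain ⟨B, hB⟩ := hα.differentiableAt.isBigO_sub.bound
  simp only [hα0, sub_zero] at hB
  refine ⟨|c| * |B| ^ (N + 1) * K ^ r * ‖(Φ.symm : W' →L[ℂ] W)‖ ^ r, ?_⟩
  filter_upwards [tα.eventually hc, hK, hB, hF, tα.eventually hF', h.eventually_nhds,
    hα.eventually_analyticAt] with u h1 h2 h3 h4 h5 h6 h7 v l
  have d1 : HasFDerivAt (fun u => F' (α u)) _ u :=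
    HasFDerivAt.comp (g := F') u h5.hasFDerivAt h7.hasFDerivAt
  have d2 : HasFDerivAt (fun u => Φ (F u)) ((Φ : W →L[ℂ] W').comp (fderiv ℂ F u)) u :=
    HasFDerivAt.comp (g := Φ) u Φ.hasFDerivAt h4.hasFDerivAt
  have d3 := d1.unique (d2.congr_of_eventuallyEq h6)
  have e1 : minor (fderiv ℂ F u) v l = minor (fderiv ℂ F' (α u)) (fun j => fderiv ℂ α u (v j))
      fun i => (l i).comp (Φ.symm : W' →L[ℂ] W) := by
    rw [← minor_comp', d3]
    unfold minor
    congr 1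
    ext i j
    simp
  rw [e1]
  have hv : ∏ j, ‖fderiv ℂ α u (v j)‖ ≤ K ^ r * ∏ j, ‖v j‖ := by
    have : ∏ j : Fin r, K * ‖v j‖ = K ^ r * ∏ j, ‖v j‖ := by
      rw [Finset.prod_mul_distrib, Finset.prod_const, Finset.card_univ, Fintype.card_fin]
    rw [← this]
    refine Finset.prod_le_prod (fun _ _ => norm_nonneg _) fun j _ => ?_
    exact ((fderiv ℂ α u).le_opNorm _).trans (mul_le_mul_of_nonneg_right h2 (norm_nonneg _))
  have hl : ∏ i, ‖(l i).comp (Φ.symm : W' →L[ℂ] W)‖ ≤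
      ‖(Φ.symm : W' →L[ℂ] W)‖ ^ r * ∏ i, ‖l i‖ := by
    have : ∏ i : Fin r, ‖(Φ.symm : W' →L[ℂ] W)‖ * ‖l i‖ =
        ‖(Φ.symm : W' →L[ℂ] W)‖ ^ r * ∏ i, ‖l i‖ := by
      rw [Finset.prod_mul_distrib, Finset.prod_const, Finset.card_univ, Fintype.card_fin]
    rw [← this]
    refine Finset.prod_le_prod (fun _ _ => norm_nonneg _) fun j _ => ?_
    rw [mul_comm]
    exact (l j).opNorm_comp_le _
  have hu : ‖α u‖ ^ (N + 1) ≤ |B| ^ (N + 1) * ‖u‖ ^ (N + 1) := by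
    rw [← mul_pow]
    refine pow_le_pow_left₀ (norm_nonneg _) (h3.trans ?_) _
    exact mul_le_mul_of_nonneg_right (le_abs_self B) (norm_nonneg _)
  have hp1 : 0 ≤ ∏ j, ‖v j‖ := Finset.prod_nonneg fun _ _ => norm_nonneg _
  have hp2 : 0 ≤ ∏ i, ‖l i‖ := Finset.prod_nonneg fun _ _ => norm_nonneg _
  have hp3 : 0 ≤ ∏ j, ‖fderiv ℂ α u (v j)‖ := Finset.prod_nonneg fun _ _ => norm_nonneg _
  have hp4 : 0 ≤ ∏ i, ‖(l i).comp (Φ.symm : W' →L[ℂ] W)‖ :=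
    Finset.prod_nonneg fun _ _ => norm_nonneg _
  calc _ ≤ c * ‖α u‖ ^ (N + 1) * (∏ j, ‖fderiv ℂ α u (v j)‖) *
        ∏ i, ‖(l i).comp (Φ.symm : W' →L[ℂ] W)‖ := h1 _ _
    _ ≤ |c| * (|B| ^ (N + 1) * ‖u‖ ^ (N + 1)) * (K ^ r * ∏ j, ‖v j‖) *
        (‖(Φ.symm : W' →L[ℂ] W)‖ ^ r * ∏ i, ‖l i‖) := by
      refine mul_le_mul (mul_le_mul (mul_le_mul (le_abs_self c) hu (by positivity) (abs_nonneg c))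
        hv hp3 (by positivity)) hl hp4 (by positivity)
    _ = _ := by ring

lemma genericRank_le_of_comp [FiniteDimensional ℂ V] [FiniteDimensional ℂ V'] {F : V → W}
    {F' : V' → W'} {α : V → V'} (Φ : W ≃L[ℂ] W')
    (hα : AnalyticAt ℂ α 0) (hα0 : α 0 = 0) (hF : ∀ᶠ u in 𝓝 0, DifferentiableAt ℂ F u)
    (hF' : ∀ᶠ u in 𝓝 0, DifferentiableAt ℂ F' u) (h : ∀ᶠ u in 𝓝 0, F' (α u) = Φ (F u)) :
    genericRank F 0 ≤ genericRank F' 0 := by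
  have tα : Tendsto₀ α := hα.tendsto hα0
  refine genericRank_le_iff.2 ?_
  filter_upwards [tα.eventually (eventually_rk_le_genericRank F' 0), hF, tα.eventually hF',
    h.eventually_nhds, hα.eventually_analyticAt] with u h1 h4 h5 h6 h7
  have d1 : HasFDerivAt (fun u => F' (α u)) _ u :=
    HasFDerivAt.comp (g := F') u h5.hasFDerivAt h7.hasFDerivAt
  have d2 : HasFDerivAt (fun u => Φ (F u)) ((Φ : W →L[ℂ] W').comp (fderiv ℂ F u)) u :=
    HasFDerivAt.comp (g := Φ) u Φ.hasFDerivAt h4.hasFDerivAt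
  have d3 := d1.unique (d2.congr_of_eventuallyEq h6)
  rw [← rk_comp_of_injective (Φ : W →L[ℂ] W') (fderiv ℂ F u) Φ.injective, ← d3]
  refine le_trans ?_ h1
  refine Submodule.finrank_mono ?_
  rintro _ ⟨x, rfl⟩
  exact ⟨_, rfl⟩

end Flat

/-! ### Independence of the Segre chains of the choice of coordinates. -/

section ChartChange

variable {n m d : ℕ} {M : Set ℂ^n} {p : ℂ^n}

/-- The extension to `(z, w, ζ, ξ)` of a linear change of the coordinates `(z, w)`. -/
def extendLinear (G : (ℂ^m × ℂ^d) ≃L[ℂ] (ℂ^m × ℂ^d)) :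
    ComplexifiedSpace m d →ₗ[ℂ] ComplexifiedSpace m d where
  toFun q := ((G (q.1, q.2.1)).1, (G (q.1, q.2.1)).2, star (G (star q.2.2.1, star q.2.2.2)).1,
    star (G (star q.2.2.1, star q.2.2.2)).2)
  map_add' a b := by
    have e1 : ((a + b).1, (a + b).2.1) = (a.1, a.2.1) + (b.1, b.2.1) := rfl
    have e2 : (star (a + b).2.2.1, star (a + b).2.2.2) =
        (star a.2.2.1, star a.2.2.2) + (star b.2.2.1, star b.2.2.2) :=
      Prod.ext (star_add _ _) (star_add _ _)
    rw [e1, e2, map_add, map_add]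
    simp only [Prod.fst_add, Prod.snd_add, star_add]
    rfl
  map_smul' c a := by
    have e1 : ((c • a).1, (c • a).2.1) = c • (a.1, a.2.1) := rfl
    have e2 : (star (c • a).2.2.1, star (c • a).2.2.2) = star c • (star a.2.2.1, star a.2.2.2) :=
      Prod.ext (star_smul _ _) (star_smul _ _)
    rw [e1, e2, map_smul, map_smul]
    simp only [Prod.smul_fst, Prod.smul_snd, star_smul, star_star]
    rfl

lemma extendLinear_injective
    (G : (ℂ^m × ℂ^d) ≃L[ℂ] (ℂ^m × ℂ^d)) :
    Injective (extendLinear G) := by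
  intro a b h
  have h1 := Prod.mk.inj h
  have h2 := Prod.mk.inj h1.2
  have h3 := Prod.mk.inj h2.2
  have e1 : (a.1, a.2.1) = (b.1, b.2.1) := G.injective (Prod.ext h1.1 h2.1)
  have e2 : (star a.2.2.1, star a.2.2.2) = (star b.2.2.1, star b.2.2.2) :=
    G.injective (Prod.ext (star_injective h3.1) (star_injective h3.2))
  have e3 := Prod.mk.inj e1
  have e4 := Prod.mk.inj e2
  exact Prod.ext e3.1 (Prod.ext e3.2 (Prod.ext (star_injective e4.1) (star_injective e4.2)))

/-- The change of coordinates as a continuous linear equivalence. -/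
def extendEquiv (G : (ℂ^m × ℂ^d) ≃L[ℂ] (ℂ^m × ℂ^d)) :
    ComplexifiedSpace m d ≃L[ℂ] ComplexifiedSpace m d :=
  (LinearEquiv.ofInjectiveEndo (extendLinear G) (extendLinear_injective G)).toContinuousLinearEquiv

lemma extendEquiv_apply (G : (ℂ^m × ℂ^d) ≃L[ℂ] (ℂ^m × ℂ^d))
    (q : ComplexifiedSpace m d) : extendEquiv G q =
      ((G (q.1, q.2.1)).1, (G (q.1, q.2.1)).2, star (G (star q.2.2.1, star q.2.2.2)).1,
    star (G (star q.2.2.1, star q.2.2.2)).2) := rfl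

variable (C C' : SegreChart M p m d)

/-- The complexifications in two charts correspond to each other. -/
lemma SegreChart.eventually_graph_eq {κ : Regularity} (hn : n = m + d)
    (hM : IsSubmanifold κ M d) (hp : p ∈ M) : ∀ᶠ y in 𝓝 0,
      C'.Θ ((extendEquiv (C.coord.symm.trans C'.coord) (toX C.Θ y)).2.2.1,
        (extendEquiv (C.coord.symm.trans C'.coord) (toX C.Θ y)).1,
        (extendEquiv (C.coord.symm.trans C'.coord) (toX C.Θ y)).2.1) =
      (extendEquiv (C.coord.symm.trans C'.coord) (toX C.Θ y)).2.2.2 := by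
  set Φ := extendEquiv (C.coord.symm.trans C'.coord)
  let π : ComplexifiedSpace m d →L[ℂ] ThetaSpace m d := (thetaArg m d).comp (ofX m d)
  let π' : ComplexifiedSpace m d →L[ℂ] ℂ^d := (snd ℂ _ _).comp
    ((snd ℂ _ _).comp (snd ℂ _ _))
  have hX : AnalyticAt ℂ (fun y => Φ (toX C.Θ y)) 0 :=
    AnalyticAt.fun_comp (g := Φ) (Φ.analyticAt _) (analyticAt_toX (y := 0) C.analytic)
  have hX0 : Φ (toX C.Θ 0) = 0 := by
    rw [(C.isReflexive hn hM hp).toX_zero, map_zero]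
  have hg : AnalyticAt ℂ (fun y => C'.Θ (π (Φ (toX C.Θ y))) - π' (Φ (toX C.Θ y))) 0 := by
    refine AnalyticAt.fun_sub ?_ ((π'.analyticAt _).fun_comp hX)
    exact AnalyticAt.comp_of_eq (g := C'.Θ) C'.analytic ((π.analyticAt _).fun_comp hX) (by
      rw [hX0, map_zero])
  filter_upwards [C.eventually_eq_zero hn hM hp hg (by
    filter_upwards [C.theta_emb, C'.mem_iff] with t h1 h2 ht
    rw [sub_eq_zero]
    have e1 : toX C.Θ (C.emb t) = ((C.coord (t - p)).1, (C.coord (t - p)).2,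
        star (C.coord (t - p)).1, star (C.coord (t - p)).2) := by
      rw [toX, h1 ht]; rfl
    have e2 : Φ (toX C.Θ (C.emb t)) = ((C'.coord (t - p)).1, (C'.coord (t - p)).2,
        star (C'.coord (t - p)).1, star (C'.coord (t - p)).2) := by
      rw [e1, extendEquiv_apply]
      simp only [star_star, Prod.mk.eta]
      simp
    rw [e2]
    exact (h2.1 ht).symm)] with y hy
  exact sub_eq_zero.1 hy

/-- The Segre chains in two charts correspond to each other. -/
lemma SegreChart.exists_chain_change {κ : Regularity} (hn : n = m + d)
    (hM : IsSubmanifold κ M d) (hp : p ∈ M) (k : ℕ) :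
    ∃ α : (Fin k → ℂ^m) → (Fin k → ℂ^m), AnalyticAt ℂ α 0 ∧ α 0 = 0 ∧
      ∀ᶠ u in 𝓝 0, segreChain C'.Θ k (α u) =
        extendEquiv (C.coord.symm.trans C'.coord) (segreChain C.Θ k u) := by
  have hR := C.isReflexive hn hM hp
  have hR' := C'.isReflexive hn hM hp
  have hgr := C.eventually_graph_eq C' hn hM hp
  set Φ := extendEquiv (C.coord.symm.trans C'.coord) with hΦ
  induction k with
  | zero =>
    refine ⟨fun u => u, analyticAt_id, rfl, Eventually.of_forall fun u => ?_⟩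
    change (0 : ComplexifiedSpace m d) = Φ 0
    rw [map_zero]
  | succ k ih =>
    obtain ⟨α, hα, hα0, hαc⟩ := ih
    let π : ComplexifiedSpace m d →L[ℂ] ℂ^m := if Even k then fst ℂ _ _ else
        (fst ℂ _ _).comp
          ((snd ℂ _ _).comp (snd ℂ _ _))
    -- The new last time is the displacement, measured in the second chart, of the coordinate moved
    -- by the last flow: `z` for even `k`, `ζ` for odd `k`.
    let τ : (Fin (k + 1) → ℂ^m) → ℂ^m := fun u =>
      π (Φ (segreChain C.Θ (k + 1) u)) - π (Φ (segreChain C.Θ k (initCLM _ k u)))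
    have tinit : Tendsto₀ (initCLM ℂ^m k) := (initCLM ℂ^m k).tendsto_zero
    have hτ : AnalyticAt ℂ τ 0 := by
      have a1 : AnalyticAt ℂ (fun u => π (Φ (segreChain C.Θ (k + 1) u))) 0 :=
        (π.analyticAt _).fun_comp ((Φ.analyticAt _).fun_comp (hR.analyticAt_segreChain (k + 1)))
      have a2 : AnalyticAt ℂ (fun u => π (Φ (segreChain C.Θ k (initCLM _ k u)))) 0 :=
        (π.analyticAt _).fun_comp ((Φ.analyticAt _).fun_comp (AnalyticAt.comp_of_eq
          (hR.analyticAt_segreChain k) ((initCLM ℂ^m k).analyticAt 0) (map_zero _)))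
      exact a1.fun_sub a2
    have hτ0 : τ 0 = 0 := by
      simp only [τ, map_zero, hR.segreChain_zero, sub_self]
    refine ⟨fun u => snocCLM _ k (α (initCLM _ k u), τ u), ?_, ?_, ?_⟩
    · refine ((snocCLM _ k).analyticAt _).fun_comp (AnalyticAt.prod ?_ hτ)
      exact AnalyticAt.comp_of_eq hα ((initCLM ℂ^m k).analyticAt 0) (map_zero _)
    · change snocCLM ℂ^m k (α (initCLM ℂ^m k 0), τ 0) = 0
      rw [map_zero, hα0, hτ0]
      exact map_zero (snocCLM ℂ^m k)
    · have t2 : Tendsto₀ (fun u : Fin (k + 1) → Fin m → ℂ => (u (Fin.last k),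
          chain (act C.Θ) k (initCLM _ k u) 0)) :=
        Tendsto.prodMk_nhds (tendsto_cont rfl)
          ((tendsto_chain hR.analyticAt_act hR.act_apply_zero k).comp tinit)
      have t3 : Tendsto₀ (fun u : Fin (k + 1) → Fin m → ℂ => (initCLM _ k u, (0 : GraphSpace m d))) := tendsto_cont (by rw [map_zero]; rfl)
      have t4 : Tendsto₀ (fun u : Fin (k + 1) → Fin m → ℂ => act C.Θ k (u (Fin.last k),
          chain (act C.Θ) k (initCLM _ k u) 0)) := by
        have := (hR.analyticAt_act k).continuousAt.tendsto
        rw [hR.act_apply_zero] at this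
        exact this.comp t2
      have tX : Tendsto₀ (toX C.Θ) := (analyticAt_toX (y := (0 : GraphSpace m d)) C.analytic).tendsto hR.toX_zero
      have t5 : Tendsto₀ (fun u : Fin (k + 1) → Fin m → ℂ => ofX m d (Φ (toX C.Θ
          (act C.Θ k (u (Fin.last k), chain (act C.Θ) k (initCLM _ k u) 0))))) := by
        have : Tendsto₀ (fun q => ofX m d (Φ q)) := tendsto_cont (by rw [map_zero, map_zero])
        exact this.comp (tX.comp t4)
      filter_upwards [tinit.eventually hαc, t3.eventually (hR.chain_flowStep_toX k),
        t2.eventually (hR.flowStep_toX k), t4.eventually hgr,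
        t5.eventually hR'.conj_apply] with u h1 h2 h3 h4 h5
      set y := chain (act C.Θ) k (initCLM _ k u) 0 with hy
      have hX0 : toX C.Θ 0 = 0 := hR.toX_zero
      have e1 : segreChain C.Θ k (initCLM _ k u) = toX C.Θ y := by
        rw [segreChain_eq, ← hX0]; exact h2
      have e2 : segreChain C.Θ (k + 1) u = flowStep C.Θ k (u (Fin.last k), toX C.Θ y) := by
        rw [← e1, segreChain_eq, chain_succ, segreChain_eq]
      have e3 : segreChain C.Θ (k + 1) u = toX C.Θ (act C.Θ k (u (Fin.last k), y)) := by
        rw [e2]; exact h3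
      have e4 : segreChain C'.Θ (k + 1) (snocCLM _ k (α (initCLM _ k u), τ u)) =
          flowStep C'.Θ k (τ u, Φ (toX C.Θ y)) := by
        rw [segreChain_eq, chain_snoc, ← segreChain_eq, h1, e1]
      rw [e4]
      rw [← e3] at h4 h5
      by_cases hk : Even k
      -- The change of coordinates acts separately on `(z, w)` and on `(ζ, ξ)`, so the transported
      -- step still fixes `(ζ, ξ)`. Its end point lies on the second complexification, where the new
      -- `z` determines `w` by reflexivity.
      · have hτu : (Φ (toX C.Θ y)).1 + τ u = (Φ (segreChain C.Θ (k + 1) u)).1 := by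
          have : τ u = (Φ (segreChain C.Θ (k + 1) u)).1 - (Φ (toX C.Θ y)).1 := by
            simp only [τ, π, hk, if_true, e1]; rfl
          rw [this]; abel
        have hs1 : (Φ (segreChain C.Θ (k + 1) u)).2.2 = (Φ (toX C.Θ y)).2.2 := by
          rw [e2]
          simp only [hΦ, extendEquiv_apply, flowStep, hk, if_true, flow]
        simp only [flowStep, hk, if_true, flow]
        rw [hτu, ← hs1]
        refine Prod.ext rfl (Prod.ext ?_ rfl)
        have h5' : conjTheta C'.Θ ((Φ (segreChain C.Θ (k + 1) u)).1,
          (Φ (segreChain C.Θ (k + 1) u)).2.2.1, C'.Θ ((Φ (segreChain C.Θ (k + 1) u)).2.2.1,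
          (Φ (segreChain C.Θ (k + 1) u)).1, (Φ (segreChain C.Θ (k + 1) u)).2.1)) =
          (Φ (segreChain C.Θ (k + 1) u)).2.1 := h5
        rw [h4] at h5'
        exact h5'
      · have hτu : (Φ (toX C.Θ y)).2.2.1 + τ u = (Φ (segreChain C.Θ (k + 1) u)).2.2.1 := by
          have : τ u = (Φ (segreChain C.Θ (k + 1) u)).2.2.1 - (Φ (toX C.Θ y)).2.2.1 := by
            simp only [τ, π, hk, if_false, e1]; rfl
          rw [this]; abel
        have hs1 : (Φ (segreChain C.Θ (k + 1) u)).1 = (Φ (toX C.Θ y)).1 := by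
          rw [e2]
          simp only [hΦ, extendEquiv_apply, flowStep, hk, if_false, conjFlow]
        have hs2 : (Φ (segreChain C.Θ (k + 1) u)).2.1 = (Φ (toX C.Θ y)).2.1 := by
          rw [e2]
          simp only [hΦ, extendEquiv_apply, flowStep, hk, if_false, conjFlow]
        simp only [flowStep, hk, if_false, conjFlow]
        rw [hτu, ← hs1, ← hs2]
        exact Prod.ext rfl (Prod.ext rfl (Prod.ext rfl h4))

lemma SegreChart.genericRank_eq {κ : Regularity} (hn : n = m + d)
    (hM : IsSubmanifold κ M d) (hp : p ∈ M) (k : ℕ) :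
    genericRank (segreChain C.Θ k) 0 = genericRank (segreChain C'.Θ k) 0 := by
  have hle : ∀ C C' : SegreChart M p m d,
      genericRank (segreChain C.Θ k) 0 ≤ genericRank (segreChain C'.Θ k) 0 := by
    intro C C'
    obtain ⟨α, h1, h2, h3⟩ := C.exists_chain_change C' hn hM hp k
    exact genericRank_le_of_comp _ h1 h2
      (((C.isReflexive hn hM hp).analyticAt_segreChain k).eventually_analyticAt.mono fun _ h => h.differentiableAt)
      (((C'.isReflexive hn hM hp).analyticAt_segreChain k).eventually_analyticAt.mono fun _ h => h.differentiableAt) h3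
  exact le_antisymm (hle C C') (hle C' C)

lemma SegreChart.hasFlatMinors_of {κ : Regularity} (hn : n = m + d)
    (hM : IsSubmanifold κ M d) (hp : p ∈ M) {k r N : ℕ}
    (h : HasFlatMinors (segreChain C'.Θ k) r N) : HasFlatMinors (segreChain C.Θ k) r N := by
  obtain ⟨α, h1, h2, h3⟩ := C.exists_chain_change C' hn hM hp k
  exact HasFlatMinors.of_comp _ h1 h2
    (((C.isReflexive hn hM hp).analyticAt_segreChain k).eventually_analyticAt.mono fun _ h => h.differentiableAt)
    (((C'.isReflexive hn hM hp).analyticAt_segreChain k).eventually_analyticAt.mono fun _ h => h.differentiableAt) h3 h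

end ChartChange

/-! ### Implicit functions and the existence of complex defining equations. -/

section Existence

/-- The analytic implicit function theorem. -/
lemma exists_implicit_inverse {T X : Type} [NormedAddCommGroup T] [NormedSpace ℂ T]
    [CompleteSpace T] [NormedAddCommGroup X] [NormedSpace ℂ X] [CompleteSpace X]
    {S : T × X → X} (hS : AnalyticAt ℂ S 0) (h0 : S 0 = 0) (hd : ∀ ξ, fderiv ℂ S 0 (0, ξ) = ξ) :
    ∃ g : T × X → T × X, AnalyticAt ℂ g 0 ∧ g 0 = 0 ∧ (∀ᶠ y in 𝓝 0, ((g y).1, S (g y)) = y) ∧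
      ∀ᶠ q : T × X in 𝓝 0, (S q = 0 ↔ q.2 = (g (q.1, 0)).2) := by
  let H : T × X → T × X := fun q => (q.1, S q)
  have hH : AnalyticAt ℂ H 0 := analyticAt_fst.prod hS
  have hH0 : H 0 = 0 := Prod.ext rfl h0
  have hHd : fderiv ℂ H 0 = (fst ℂ T X).prod (fderiv ℂ S 0) :=
    ((fst ℂ T X).hasFDerivAt.prodMk hS.hasFDerivAt).fderiv
  have hsplit : ∀ t ξ, fderiv ℂ S 0 (t, ξ) = fderiv ℂ S 0 (t, 0) + ξ := by
    intro t ξ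
    rw [← hd ξ, ← map_add, hd ξ]
    simp
  have hb : Bijective (fderiv ℂ H 0) := by
    rw [hHd]
    constructor
    · rw [injective_iff_map_eq_zero]
      rintro ⟨t, ξ⟩ h
      have h1 : t = 0 := (Prod.mk.inj h).1
      have h2 : fderiv ℂ S 0 (t, ξ) = 0 := (Prod.mk.inj h).2
      rw [h1, hd] at h2
      rw [h1, h2]; rfl
    · rintro ⟨t, x⟩
      refine ⟨(t, x - fderiv ℂ S 0 (t, 0)), Prod.ext rfl ?_⟩
      change fderiv ℂ S 0 (t, x - fderiv ℂ S 0 (t, 0)) = x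
      rw [hsplit]; abel
  obtain ⟨g, hg, hg0, hHg, hgH⟩ := exists_localInverse hH hb
  rw [hH0] at hg hg0 hHg
  refine ⟨g, hg, hg0, hHg, ?_⟩
  have t1 : Tendsto₀ (fun q : T × X => (q.1, (0 : X))) := tendsto_cont rfl
  filter_upwards [hgH, t1.eventually hHg] with q h1 h2
  have e1 : (g (q.1, 0)).1 = q.1 := (Prod.mk.inj h2).1
  have e2 : S (g (q.1, 0)) = 0 := (Prod.mk.inj h2).2
  constructor
  · intro h
    have : H q = (q.1, 0) := Prod.ext rfl h
    rw [← this, h1]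
  · intro h
    have : q = g (q.1, 0) := Prod.ext e1.symm h
    rw [this]; exact e2

/-- The regular implicit function theorem. -/
lemma exists_implicit {κ : Regularity} {T X : Type} [NormedAddCommGroup T] [NormedSpace ℂ T]
    [FiniteDimensional ℂ T] [NormedAddCommGroup X] [NormedSpace ℂ X] [FiniteDimensional ℂ X]
    {S : T × X → X} (hS : AnalyticAt ℂ S 0) (hr : RegAt κ S 0) (h0 : S 0 = 0)
    (hd : ∀ ξ, fderiv ℂ S 0 (0, ξ) = ξ) :
    ∃ Θ : T → X, AnalyticAt ℂ Θ 0 ∧ RegAt κ Θ 0 ∧ ∀ᶠ q : T × X in 𝓝 0, (S q = 0 ↔ q.2 = Θ q.1) := by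
  obtain ⟨g, hg, hg0, hHg, hΘS⟩ := exists_implicit_inverse hS h0 hd
  have hH0 : ((0 : T × X).1, S 0) = 0 := Prod.ext rfl h0
  have hgr := RegAt.inverse (e := g) rfl ((regAt_fst (κ := κ) (0 : T × X)).prodMk hr)
    (by rw [hH0]; exact hg.restrictScalars) (by rw [hH0, hg0]) (by rw [hH0]; exact hHg)
  rw [hH0] at hgr
  let j : T →L[ℂ] T × X := inl ℂ T X
  have hj0 : j 0 = 0 := map_zero j
  exact ⟨fun t => (g (j t)).2,
    analyticAt_snd.fun_comp (AnalyticAt.comp_of_eq hg (j.analyticAt 0) hj0),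
    (hgr.comp_of_eq (regAt_clm (j.restrictScalars ℝ) 0) hj0).clm_comp
      (snd ℝ T X), hΘS⟩

variable {n m d : ℕ} {M : Set ℂ^n} {p : ℂ^n}

/-- The complex coordinates `(t + τ) / 2`, `(t - τ) / 2i` extending the real and imaginary parts. -/
def polarCLM (n : ℕ) : ℂ^n × ℂ^n →L[ℂ] (Fin n ⊕ Fin n → ℂ) :=
  ContinuousLinearMap.pi (Sum.elim
    (fun i => (2⁻¹ : ℂ) • ((ContinuousLinearMap.proj i).comp (fst ℂ _ _) +
      (ContinuousLinearMap.proj i).comp (snd ℂ _ _)))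
    (fun i => (2 * Complex.I)⁻¹ • ((ContinuousLinearMap.proj i).comp (fst ℂ _ _) -
      (ContinuousLinearMap.proj i).comp (snd ℂ _ _))))

lemma polarCLM_star (y : ℂ^n) : polarCLM n (y, star y) = ofRealPi _ (reImEquiv n y) := by
  ext (i | i)
  · change (2⁻¹ : ℂ) * (y i + star (y i)) = ((y i).re : ℂ)
    rw [Complex.star_def, Complex.add_conj]
    push_cast; ring
  · change (2 * Complex.I)⁻¹ * (y i - star (y i)) = ((y i).im : ℂ)
    rw [Complex.star_def, Complex.sub_conj]
    push_cast
    field_simp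

/-- The defining functions are complexified in the real coordinates of `ℂⁿ`, whose complex values
are then expressed through `t` and an independent variable playing the role of its conjugate. -/
lemma exists_polarization {κ : Regularity} {r : Fin d → ℂ^n → ℝ}
    (hr : ∀ j, RegAt κ (r j) p) : ∃ R : ℂ^n × ℂ^n → ℂ^d,
      AnalyticAt ℂ R (p, star p) ∧ RegAt κ R (p, star p) ∧
      ∀ᶠ y in 𝓝 p, ∀ j, R (y, star y) j = (r j y : ℂ) := by
  have h1 : ∀ j, RegAt κ (fun v => r j ((reImEquiv n).symm v)) (reImEquiv n p) := fun j =>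
    (hr j).comp_of_eq (regAt_clm ((reImEquiv n).symm : (Fin n ⊕ Fin n → ℝ) →L[ℝ] ℂ^n) _)
      ((reImEquiv n).symm_apply_apply p)
  choose g hg hgr hgf using fun j => exists_regular_complexification (h1 j)
  refine ⟨fun q j => g j (polarCLM n q), ?_, ?_, ?_⟩
  · refine AnalyticAt.pi fun j => ?_
    exact AnalyticAt.comp_of_eq (hg j) ((polarCLM n).analyticAt _) (polarCLM_star p)
  · refine RegAt.pi fun j => ?_
    exact (hgr j).comp_of_eq (regAt_clm ((polarCLM n).restrictScalars ℝ) _) (polarCLM_star p)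
  · refine eventually_all.2 fun j => ?_
    filter_upwards [(reImEquiv n).continuous.continuousAt.eventually (hgf j)] with y hy
    rw [polarCLM_star]
    simpa using hy

lemma linearIndependent_iff_surjective {ι E : Type} [Fintype ι] [NormedAddCommGroup E]
    [NormedSpace ℝ E] {T : ι → E →L[ℝ] ℝ} :
    LinearIndependent ℝ T ↔ Surjective fun v j => T j v := by
  classical
  constructor
  · intro hli
    let R : E →ₗ[ℝ] (ι → ℝ) := LinearMap.pi fun j => (T j).toLinearMap
    have : LinearMap.range R = ⊤ := by
      by_contra hne
      obtain ⟨f, hf0, hf⟩ := Submodule.exists_le_ker_of_lt_top _ (lt_top_iff_ne_top.2 hne)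
      refine hf0 (LinearMap.pi_ext' fun j => LinearMap.ext_ring ?_)
      have h1 : ∑ j, f (Pi.single j 1) • T j = 0 := by
        ext v
        have h2 : f (R v) = 0 := hf ⟨v, rfl⟩
        rw [← Finset.univ_sum_single (R v), map_sum] at h2
        rw [sum_apply, zero_apply, ← h2]
        refine Finset.sum_congr rfl fun j _ => ?_
        have : Pi.single j (R v j) = R v j • (Pi.single j 1 : ι → ℝ) := by
          rw [← Pi.single_smul, smul_eq_mul, mul_one]
        rw [this, map_smul, smul_apply, smul_eq_mul, smul_eq_mul, mul_comm]
        rfl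
      exact Fintype.linearIndependent_iff.1 hli _ h1 j
    exact LinearMap.range_eq_top.1 this
  · intro hT
    rw [Fintype.linearIndependent_iff]
    intro g hg j
    obtain ⟨v, hv⟩ := hT (Pi.single j 1)
    have h1 := DFunLike.congr_fun hg v
    simp only [sum_apply, smul_apply, zero_apply, smul_eq_mul] at h1
    have h2 : ∀ i, T i v = Pi.single (M := fun _ => ℝ) j 1 i := fun i => congrFun hv i
    simpa [h2, Pi.single_apply] using h1

/-- The differential in the conjugate variables of the polarized equations of a generic
submanifold is onto. -/
lemma surjective_of_generic {r : Fin d → ℂ^n → ℝ} (hr : ∀ j, AnalyticAt ℝ (r j) p)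
    (hli : LinearIndependent ℝ fun j => fderiv ℝ (r j) p)
    (hM : ∀ᶠ y in 𝓝 p, (y ∈ M ↔ ∀ j, r j y = 0))
    (hgen : ∀ v : ℂ^n, ∃ a ∈ tangentSpace M p, ∃ b ∈ tangentSpace M p, v = a + Complex.I • b)
    {T : ℂ^n × ℂ^n →L[ℂ] ℂ^d}
    (hT : ∀ v j, T (v, star v) j = (fderiv ℝ (r j) p v : ℂ)) :
    Surjective fun τ => T (0, τ) := by
  have hsplit : ∀ v w, T (v, w) = T (v, 0) + T (0, w) := fun v w => by
    rw [← map_add]; simp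
  -- Along a tangent vector the holomorphic and antiholomorphic parts of the differential cancel.
  -- Hence for tangent `b` the derivative of the real equations along `i b` is visible in the
  -- conjugate variables alone, and by genericity these derivatives exhaust all values.
  have hker : ∀ b ∈ tangentSpace M p, T (b, 0) = - T (0, star b) := by
    intro b hb
    rw [eq_neg_iff_add_eq_zero, ← hsplit]
    ext j
    rw [hT, tangentSpace_le_ker hr hM hb]
    rfl
  have hib : ∀ b ∈ tangentSpace M p, ∀ j,
      T (0, star b) j = (Complex.I / 2) * (fderiv ℝ (r j) p (Complex.I • b) : ℂ) := by
    intro b hb j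
    have h1 : (Complex.I • b, star (Complex.I • b)) =
        Complex.I • (b, (0 : ℂ^n)) - Complex.I • ((0 : ℂ^n), star b) := by
      ext <;> simp
    rw [← hT, h1, map_sub, map_smul, map_smul, hker b hb]
    simp only [Pi.sub_apply, Pi.smul_apply, Pi.neg_apply, smul_eq_mul]
    linear_combination T (0, star b) j * Complex.I_sq
  have hsurj : Surjective fun v => fun j => fderiv ℝ (r j) p v :=
    linearIndependent_iff_surjective.1 hli
  have hreal : ∀ e : Fin d → ℝ, ∃ τ, ∀ j, T (0, τ) j = (e j : ℂ) := by
    intro e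
    obtain ⟨v, hv⟩ := hsurj e
    obtain ⟨a, ha, b, hb, rfl⟩ := hgen v
    -- The factor `-2i` cancels the factor `i / 2` of `hib`.
    refine ⟨(-2 * Complex.I) • star b, fun j => ?_⟩
    have h1 : ((0 : ℂ^n), (-2 * Complex.I) • star b) =
        (-2 * Complex.I) • ((0 : ℂ^n), star b) := by simp
    have h2 : fderiv ℝ (r j) p (Complex.I • b) = e j := by
      rw [← hv]
      change _ = fderiv ℝ (r j) p (a + Complex.I • b)
      rw [map_add, tangentSpace_le_ker hr hM ha, zero_add]
    rw [h1, map_smul, Pi.smul_apply, hib b hb, h2, smul_eq_mul]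
    linear_combination -(e j : ℂ) * Complex.I_sq
  intro x
  obtain ⟨τ, hτ⟩ := hreal fun j => (x j).re
  obtain ⟨τ', hτ'⟩ := hreal fun j => (x j).im
  refine ⟨τ + Complex.I • τ', ?_⟩
  ext j
  have h1 : ((0 : ℂ^n), τ + Complex.I • τ') = (0, τ) + Complex.I • ((0 : ℂ^n), τ') := by
    simp
  change T (0, τ + Complex.I • τ') j = x j
  rw [h1, map_add, map_smul, Pi.add_apply, Pi.smul_apply, hτ, hτ', smul_eq_mul, mul_comm]
  exact Complex.re_add_im (x j)

/-- A surjection completes to coordinates. -/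
lemma exists_adapted_coordinates (hn : n = m + d) {β : ℂ^n →L[ℂ] ℂ^d}
    (hβ : Surjective β) :
    ∃ B : ℂ^n ≃L[ℂ] ℂ^m × ℂ^d, ∀ τ, (B τ).2 = β τ := by
  obtain ⟨s, hs⟩ := β.toLinearMap.exists_rightInverse_of_surjective (LinearMap.range_eq_top.2 hβ)
  have hs' : ∀ x, β (s x) = x := fun x => LinearMap.congr_fun hs x
  let K := LinearMap.ker β.toLinearMap
  have hK : finrank ℂ K = m := by
    have h1 := LinearMap.finrank_range_add_finrank_ker β.toLinearMap
    rw [LinearMap.range_eq_top.2 hβ, finrank_top, finrank_fin_fun, finrank_fin_fun] at h1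
    change d + finrank ℂ K = n at h1
    omega
  let φ : K ≃ₗ[ℂ] ℂ^m := LinearEquiv.ofFinrankEq _ _ (by rw [hK, finrank_fin_fun])
  let π : ℂ^n →ₗ[ℂ] K := LinearMap.codRestrict K (LinearMap.id - s.comp β.toLinearMap)
    fun x => by
      change β (x - s (β x)) = 0
      rw [map_sub, hs', sub_self]
  let B : ℂ^n →ₗ[ℂ] ℂ^m × ℂ^d := (φ.toLinearMap.comp π).prod β.toLinearMap
  have hinj : Injective B := by
    rw [injective_iff_map_eq_zero]
    intro x hx
    have h1 : β x = 0 := (Prod.mk.inj hx).2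
    have h2 : π x = 0 := φ.injective (((Prod.mk.inj hx).1).trans φ.map_zero.symm)
    have h3 : x - s (β x) = 0 := congrArg Subtype.val h2
    rwa [h1, map_zero, sub_zero] at h3
  exact ⟨(LinearEquiv.ofInjectiveOfFinrankEq B hinj (by
    rw [Module.finrank_prod, finrank_fin_fun, finrank_fin_fun,
      finrank_fin_fun, hn])).toContinuousLinearEquiv, fun τ => rfl⟩

/-- The conjugate of a complex linear map. -/
def conjLinear {a b : Type} [AddCommMonoid a] [Module ℂ a] [StarAddMonoid a] [StarModule ℂ a]
    [AddCommMonoid b] [Module ℂ b] [StarAddMonoid b] [StarModule ℂ b] (B : a →ₗ[ℂ] b) :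
    a →ₗ[ℂ] b where
  toFun x := star (B (star x))
  map_add' x y := by rw [star_add, map_add, star_add]
  map_smul' c x := by rw [star_smul, map_smul, star_smul, star_star, RingHom.id_apply]

/-- The conjugate of a linear equivalence. -/
def conjEquiv (B : ℂ^n ≃L[ℂ] ℂ^m × ℂ^d) :
    ℂ^n ≃L[ℂ] ℂ^m × ℂ^d :=
  LinearEquiv.toContinuousLinearEquiv <| LinearEquiv.ofLinearMap
    (conjLinear B.toLinearEquiv.toLinearMap) (conjLinear B.symm.toLinearEquiv.toLinearMap)
    (LinearMap.ext fun x => by simp [conjLinear]) (LinearMap.ext fun x => by simp [conjLinear])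

lemma conjEquiv_apply (B : ℂ^n ≃L[ℂ] ℂ^m × ℂ^d) (x : ℂ^n) :
    conjEquiv B x = star (B (star x)) := rfl

/-- Generic submanifolds have regular complex defining equations. -/
lemma exists_segreChart {κ : Regularity} (hn : n = m + d) (hM : IsGenericSubmanifold κ M d)
    (hp : p ∈ M) : ∃ C : SegreChart M p m d, RegAt κ C.Θ 0 := by
  obtain ⟨r, hr, hli, hMr⟩ := hM.1 p hp
  have hr' : ∀ j, RegAt κ (r j) p := fun j => isRealRegularAt_iff.1 (hr j)
  obtain ⟨R, hR, hRr, hRf⟩ := exists_polarization hr'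
  have hT : ∀ v j, fderiv ℂ R (p, star p) (v, star v) j = (fderiv ℝ (r j) p v : ℂ) := by
    intro v j
    let J : ℂ^n →L[ℝ] ℂ^n × ℂ^n := (ContinuousLinearMap.id ℝ _).prod
      ((starL' ℝ : ℂ^n ≃L[ℝ] ℂ^n) : ℂ^n →L[ℝ] ℂ^n)
    have d1 : HasFDerivAt (fun y => R (J y))
        (((fderiv ℂ R (p, star p)).restrictScalars ℝ).comp J) p :=
      HasFDerivAt.comp (g := R) p (hR.hasFDerivAt.restrictScalars ℝ) J.hasFDerivAt
    have d2 : HasFDerivAt (fun y => ofRealCLM (r j y))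
        (ofRealCLM.comp (fderiv ℝ (r j) p)) p :=
      HasFDerivAt.comp (g := ofRealCLM) p ofRealCLM.hasFDerivAt
        (hr j).1.hasFDerivAt
    have d3 : HasFDerivAt (fun y => R (J y) j) _ p := (hasFDerivAt_pi'.1 d1) j
    have d4 := (d3.congr_of_eventuallyEq (hRf.mono fun y hy => (hy j).symm)).unique d2
    exact DFunLike.congr_fun d4 v
  have hsurj := surjective_of_generic (fun j => (hr j).1) hli hMr (hM.2 p hp) hT
  obtain ⟨B, hB⟩ := exists_adapted_coordinates (m := m) hn
    (β := (fderiv ℂ R (p, star p)).comp (inr ℂ _ _)) hsurj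
  -- The coordinates `B` of the conjugate variable are adapted so that the derivative of the
  -- polarized equations in `ξ` is the identity. The coordinates of `t` itself are then their
  -- conjugates.
  let A := conjEquiv B
  let Q : ThetaSpace m d × ℂ^d →L[ℂ] ℂ^n × ℂ^n := ((A.symm : _ →L[ℂ] _).comp ((snd ℂ _ _).comp
      (fst ℂ _ _))).prod
    ((B.symm : _ →L[ℂ] _).comp (((fst ℂ _ _).comp (fst ℂ _ _)).prod (snd ℂ _ _)))
  let S : ThetaSpace m d × ℂ^d → ℂ^d := fun q => R ((p, star p) + Q q)
  have hQ0 : (p, star p) + Q 0 = (p, star p) := by rw [map_zero, add_zero]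
  have hS : AnalyticAt ℂ S 0 :=
    AnalyticAt.comp_of_eq hR (analyticAt_const.fun_add (Q.analyticAt 0)) hQ0
  have hSr : RegAt κ S 0 :=
    hRr.comp_of_eq ((regAt_const _ 0).add (regAt_clm (Q.restrictScalars ℝ) 0)) hQ0
  have hS0 : S 0 = 0 := by
    change R _ = 0
    rw [hQ0]
    ext j
    rw [hRf.self_of_nhds j, hMr.self_of_nhds.1 hp j]; rfl
  have hSd : ∀ ξ, fderiv ℂ S 0 (0, ξ) = ξ := by
    intro ξ
    have d1 : HasFDerivAt S ((fderiv ℂ R (p, star p)).comp Q) 0 := by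
      refine HasFDerivAt.comp (g := R) 0 ?_ (Q.hasFDerivAt.const_add _)
      rw [hQ0]
      exact hR.hasFDerivAt
    rw [d1.fderiv]
    have e1 : Q (0, ξ) = (0, B.symm (0, ξ)) := by
      change (A.symm 0, B.symm (0, ξ)) = _
      rw [map_zero]
    change fderiv ℂ R (p, star p) (Q (0, ξ)) = ξ
    rw [e1]
    have := hB (B.symm (0, ξ))
    rw [ContinuousLinearEquiv.apply_symm_apply] at this
    exact this.symm
  obtain ⟨Θ, hΘ, hΘr, hΘS⟩ := exists_implicit hS hSr hS0 hSd
  refine ⟨⟨A, Θ, hΘ, ?_⟩, hΘr⟩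
  have t1 : Tendsto (fun t : ℂ^n => (((star (A (t - p)).1, (A (t - p)).1, (A (t - p)).2),
      star (A (t - p)).2) : ThetaSpace m d × ℂ^d)) (𝓝 p) (𝓝 0) := by
    refine tendsto_cont ?_
    simp
  filter_upwards [hMr, hRf, t1.eventually hΘS] with t h1 h2 h3
  rw [← h3, h1]
  have e1 : (p, star p) + Q ((star (A (t - p)).1, (A (t - p)).1, (A (t - p)).2),
      star (A (t - p)).2) = (t, star t) := by
    refine Prod.ext ?_ ?_
    · change p + A.symm (A (t - p)) = t
      simp
    · change star p + B.symm (star (A (t - p))) = star t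
      rw [conjEquiv_apply, star_star, ContinuousLinearEquiv.symm_apply_apply, star_sub]
      abel
  change _ ↔ R _ = 0
  rw [e1, funext_iff]
  refine forall_congr' fun j => ?_
  rw [h2 j]
  exact Complex.ofReal_eq_zero.symm

end Existence

open Asymptotics

/-! ### Orders of vanishing expressed by finitely many equations. -/

section Order

variable {U : Type} [NormedAddCommGroup U] [NormedSpace ℂ U]

/-- Cauchy's estimate: differentiation lowers the order of vanishing by at most one. -/
lemma isBigO_fderiv_apply {g : U → ℂ} (hg : AnalyticAt ℂ g 0) {n : ℕ}
    (h : g =O[𝓝 0] fun u => ‖u‖ ^ (n + 1)) (e : U) :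
    (fun u => fderiv ℂ g u e) =O[𝓝 0] fun u => ‖u‖ ^ n := by
  rcases n with _ | n
  · simp only [pow_zero]
    exact ((analyticAt_fderiv_apply hg e).continuousAt.norm.isBoundedUnder_le).isBigO_one ℝ
  obtain ⟨c, hc0, hc⟩ := h.exists_pos
  obtain ⟨ε, hε, hball⟩ := eventually_nhds_iff_ball.1
    ((isBigOWith_iff.1 hc).and hg.eventually_analyticAt)
  have hder0 : fderiv ℂ g 0 = 0 := (IsBigO.hasFDerivAt (n := n + 1 + 1) (x₀ := (0 : U))
    (by simpa using h) (by omega)).fderiv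
  refine IsBigO.of_bound (c * 2 ^ (n + 1 + 1) * (‖e‖ + 1)) ?_
  filter_upwards [ball_mem_nhds (0 : U) (half_pos hε)] with u hu
  rw [mem_ball, dist_zero_right] at hu
  by_cases h0 : u = 0
  · subst h0
    rw [hder0]
    simp
  have hupos : 0 < ‖u‖ := norm_pos_iff.2 h0
  -- For `‖z‖ ≤ R` the point `u + z • e` has norm at most `2‖u‖`, and Cauchy's estimate divides by
  -- `R`, which costs exactly one power of `‖u‖`. The summand `1` allows `e = 0`.
  set R := ‖u‖ / (‖e‖ + 1) with hR
  have hR0 : 0 < R := by positivity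
  have hmem : ∀ z : ℂ, ‖z‖ ≤ R → ‖u + z • e‖ ≤ 2 * ‖u‖ := by
    intro z hz
    have h1 : ‖z • e‖ ≤ ‖u‖ := by
      rw [norm_smul]
      calc ‖z‖ * ‖e‖ ≤ R * (‖e‖ + 1) := by gcongr; linarith
        _ = ‖u‖ := by rw [hR]; field_simp
    calc ‖u + z • e‖ ≤ ‖u‖ + ‖z • e‖ := norm_add_le _ _
      _ ≤ 2 * ‖u‖ := by linarith
  have hin : ∀ z : ℂ, ‖z‖ ≤ R → u + z • e ∈ ball (0 : U) ε := by
    intro z hz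
    rw [mem_ball, dist_zero_right]
    linarith [hmem z hz]
  have hd : ∀ z : ℂ, ‖z‖ ≤ R → HasDerivAt (fun z : ℂ => g (u + z • e))
      (fderiv ℂ g (u + z • e) e) z := by
    intro z hz
    have d1 : HasDerivAt (fun z : ℂ => u + z • e) e z := by
      simpa using ((hasDerivAt_id z).smul_const e).const_add u
    exact ((hball _ (hin z hz)).2.hasFDerivAt).comp_hasDerivAt z d1
  have hcl : DiffContOnCl ℂ (fun z : ℂ => g (u + z • e)) (ball 0 R) := by
    refine DifferentiableOn.diffContOnCl ?_
    rw [closure_ball _ hR0.ne']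
    intro z hz
    exact (hd z (by simpa using hz)).differentiableAt.differentiableWithinAt
  have h2 := Complex.norm_deriv_le_of_forall_mem_sphere_norm_le (C := c * (2 * ‖u‖) ^ (n + 1 + 1))
    hR0 hcl (by
      intro z hz
      have hz' : ‖z‖ ≤ R := by simpa using hz.le
      refine ((hball _ (hin z hz')).1).trans ?_
      rw [norm_pow, norm_norm]
      gcongr
      exact hmem z hz')
  rw [(hd 0 (by simpa using hR0.le)).deriv, zero_smul, add_zero] at h2
  refine h2.trans (le_of_eq ?_)
  rw [norm_pow, norm_norm, hR]
  field_simp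
  rw [mul_pow]; ring

lemma isBigO_of_fderiv {g : U → ℂ} (hg : AnalyticAt ℂ g 0) {n : ℕ} (h0 : g 0 = 0)
    (h : fderiv ℂ g =O[𝓝 0] fun u => ‖u‖ ^ n) : g =O[𝓝 0] fun u => ‖u‖ ^ (n + 1) := by
  obtain ⟨c, hc0, hc⟩ := h.exists_pos
  obtain ⟨ε, hε, hball⟩ := eventually_nhds_iff_ball.1
    ((isBigOWith_iff.1 hc).and hg.eventually_analyticAt)
  refine IsBigO.of_bound c ?_
  filter_upwards [ball_mem_nhds (0 : U) hε] with u hu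
  rw [mem_ball, dist_zero_right] at hu
  have hin : ∀ x ∈ Metric.closedBall (0 : U) ‖u‖, x ∈ ball (0 : U) ε := by
    intro x hx
    rw [Metric.mem_closedBall, dist_zero_right] at hx
    rw [mem_ball, dist_zero_right]
    linarith
  have h1 := Convex.norm_image_sub_le_of_norm_fderiv_le (𝕜 := ℂ) (f := g) (C := c * ‖u‖ ^ n)
    (s := Metric.closedBall (0 : U) ‖u‖) (x := 0) (y := u)
    (fun x hx => (hball x (hin x hx)).2.differentiableAt) (fun x hx => by
      refine (hball x (hin x hx)).1.trans ?_
      rw [Metric.mem_closedBall, dist_zero_right] at hx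
      rw [norm_pow, norm_norm]
      gcongr) (convex_closedBall _ _) (Metric.mem_closedBall_self (norm_nonneg _)) (by simp)
  rw [h0, sub_zero, sub_zero] at h1
  rw [norm_pow, norm_norm, pow_succ, ← mul_assoc]
  exact h1

/-- The order of vanishing of an analytic function is greater than `n` if and only if its value
and the orders of its partial derivatives are. -/
lemma isBigO_pow_succ_iff [FiniteDimensional ℂ U] {ι : Type} [Fintype ι] (e : Module.Basis ι ℂ U)
    {g : U → ℂ} (hg : AnalyticAt ℂ g 0) {n : ℕ} : (g =O[𝓝 0] fun u => ‖u‖ ^ (n + 1)) ↔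
      g 0 = 0 ∧ ∀ i, (fun u => fderiv ℂ g u (e i)) =O[𝓝 0] fun u => ‖u‖ ^ n := by
  constructor
  · intro h
    refine ⟨?_, fun i => isBigO_fderiv_apply hg h _⟩
    obtain ⟨c, hc⟩ := h.bound
    have := hc.self_of_nhds
    simpa using this
  · rintro ⟨h0, h⟩
    refine isBigO_of_fderiv hg h0 ?_
    have h1 : fderiv ℂ g = fun u => ∑ i, fderiv ℂ g u (e i) •
        toContinuousLinearMap (e.coord i) := by
      funext u
      refine ContinuousLinearMap.ext fun v => ?_
      conv_lhs => rw [← e.sum_repr v, map_sum]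
      rw [sum_apply]
      refine Finset.sum_congr rfl fun i _ => ?_
      rw [map_smul, smul_apply, smul_eq_mul, smul_eq_mul, mul_comm]
      rfl
    rw [h1]
    refine IsBigO.fun_sum fun i _ => ?_
    have := (h i).smul (isBigO_refl (fun _ : U => toContinuousLinearMap (e.coord i)) (𝓝 0))
    refine this.trans (IsBigO.of_bound ‖toContinuousLinearMap (e.coord i)‖ (.of_forall fun u => ?_))
    rw [norm_smul, mul_comm]

/-- The homogeneous terms of the power series vanish one after the other: the first term not yet
excluded agrees with `g` up to higher order. -/
lemma eventually_eq_zero_of_isBigO {g : U → ℂ} (hg : AnalyticAt ℂ g 0)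
    (h : ∀ n : ℕ, g =O[𝓝 0] fun u => ‖u‖ ^ (n + 1)) : ∀ᶠ u in 𝓝 0, g u = 0 := by
  obtain ⟨p, r, hp⟩ := hg
  have hp0 : ∀ n y, (p n fun _ => y) = 0 := by
    intro n
    induction n using Nat.strong_induction_on with
    | _ n ih =>
      refine IsBigO.continuousMultilinearMap_apply_eq_zero ?_
      have h1 := hp.hasFPowerSeriesAt.isBigO_sub_partialSum_pow (n + 1)
      have h2 : ∀ y, p.partialSum (n + 1) y = p n fun _ => y := by
        intro y
        rw [FormalMultilinearSeries.partialSum, Finset.sum_range_succ,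
          Finset.sum_eq_zero fun k hk => ih k (Finset.mem_range.1 hk) y, zero_add]
      simp only [zero_add, h2] at h1
      simpa using (h n).sub h1
  filter_upwards [Metric.eball_mem_nhds 0 hp.r_pos] with y hy
  have h1 := hp.hasSum hy
  simp only [hp0, zero_add] at h1
  exact h1.unique hasSum_zero

variable {κ : Regularity} {Y : Type} [NormedAddCommGroup Y] [NormedSpace ℂ Y]

lemma regAt_fderiv_apply {g : Y → U} [CompleteSpace U] {x : Y} (hg : AnalyticAt ℂ g x)
    (hr : RegAt κ g x) (v : Y) : RegAt κ (fun y => fderiv ℂ g y v) x := by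
  refine (hr.fderiv_apply v).congr ?_
  filter_upwards [hg.eventually_analyticAt] with y hy
  rw [(hy.hasFDerivAt.restrictScalars ℝ).fderiv]
  rfl

/-- The equations expressing that `g (y, ·)` vanishes to order `n` at `0`. -/
lemma exists_order_equations [FiniteDimensional ℂ U] (n : ℕ) : ∀ {g : Y × U → ℂ},
    AnalyticAt ℂ g 0 → RegAt κ g 0 →
    ∃ (ι : Type) (_ : Fintype ι) (G : ι → Y → ℂ), (∀ i, RegAt κ (G i) 0) ∧
      ∀ᶠ y in 𝓝 0, ((fun u => g (y, u)) =O[𝓝 0] fun u => ‖u‖ ^ n) ↔ ∀ i, G i y = 0 := by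
  have hline : Tendsto₀ (fun y : Y => (y, (0 : U))) := tendsto_cont rfl
  have hslice : ∀ {g : Y × U → ℂ}, AnalyticAt ℂ g 0 →
      ∀ᶠ y in 𝓝 0, AnalyticAt ℂ (fun u => g (y, u)) 0 := by
    intro g hg
    filter_upwards [hline.eventually hg.eventually_analyticAt] with y hy
    exact AnalyticAt.fun_comp (g := g) (f := fun u => (y, u)) hy (analyticAt_const.prod analyticAt_id)
  induction n with
  | zero =>
    intro g hg hr
    refine ⟨Empty, inferInstance, fun i => i.elim, fun i => i.elim, ?_⟩
    filter_upwards [hslice hg] with y hy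
    simp only [pow_zero, IsEmpty.forall_iff, iff_true]
    exact hy.continuousAt.norm.isBoundedUnder_le.isBigO_one ℝ
  | succ n ih =>
    intro g hg hr
    let e := finBasis ℂ U
    choose ι hι G hG hGe using fun i => ih (analyticAt_fderiv_apply hg ((0 : Y), e i))
      (regAt_fderiv_apply hg hr _)
    -- Order `n + 1` means a zero value and order `n` for all partial derivatives: `none` indexes
    -- the value, the sigma type the equations of the derivatives.
    refine ⟨Option (Σ i, ι i), inferInstance, fun o => o.elim (fun y => g (y, 0)) fun s => G s.1 s.2,
      ?_, ?_⟩
    · rintro (_ | ⟨i, j⟩)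
      · exact hr.comp_of_eq (regAt_clm (inl ℝ Y U) 0) rfl
      · exact hG i j
    · filter_upwards [hslice hg, hline.eventually hg.eventually_analyticAt.eventually_nhds,
        eventually_all.2 hGe] with y hy hy2 hy3
      rw [isBigO_pow_succ_iff e hy]
      have h1 : ∀ᶠ u in 𝓝 (0 : U), ∀ v, fderiv ℂ (fun u => g (y, u)) u v = fderiv ℂ g (y, u) (0, v) := by
        have : Tendsto (fun u : U => (y, u)) (𝓝 0) (𝓝 (y, 0)) := tendsto_cont rfl
        filter_upwards [this.eventually hy2] with u hu v
        have d : HasFDerivAt (fun u => g (y, u)) _ u :=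
          HasFDerivAt.comp (g := g) u hu.hasFDerivAt (hasFDerivAt_prodMk_right y u)
        rw [d.fderiv]
        rfl
      have h2 : ∀ i, ((fun u => fderiv ℂ (fun u => g (y, u)) u (e i)) =O[𝓝 0] fun u => ‖u‖ ^ n) ↔
          ∀ j, G i j y = 0 := fun i =>
        (isBigO_congr (h1.mono fun u hu => hu (e i)) EventuallyEq.rfl).trans (hy3 i)
      simp only [h2]
      constructor
      · rintro ⟨h3, h4⟩ (_ | ⟨i, j⟩)
        exacts [h3, h4 i j]
      · exact fun h => ⟨h none, fun i j => h (some ⟨i, j⟩)⟩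

end Order

/-! ### Flatness of minors in analytic families. -/

section Minors

variable {V W Y : Type} [NormedAddCommGroup V] [NormedSpace ℂ V] [NormedAddCommGroup W]
  [NormedSpace ℂ W] [FiniteDimensional ℂ V] [FiniteDimensional ℂ W] [NormedAddCommGroup Y]
  [NormedSpace ℂ Y]

/-- The minors as multilinear functions of the vectors. -/
def minorVec (T : V →L[ℂ] W) {r : ℕ} (l : Fin r → W →L[ℂ] ℂ) :
    MultilinearMap ℂ (fun _ : Fin r => V) ℂ :=
  (Matrix.detRowAlternating (n := Fin r) (R := ℂ)).toMultilinearMap.compLinearMap fun _ =>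
    LinearMap.pi fun i => ((l i).comp T).toLinearMap

lemma minorVec_apply (T : V →L[ℂ] W) {r : ℕ} (v : Fin r → V) (l : Fin r → W →L[ℂ] ℂ) :
    minorVec T l v = minor T v l := by
  rw [minor, ← Matrix.det_transpose]
  rfl

/-- The minors as multilinear functions of the functionals. -/
def minorForm (T : V →L[ℂ] W) {r : ℕ} (v : Fin r → V) :
    MultilinearMap ℂ (fun _ : Fin r => W →L[ℂ] ℂ) ℂ :=
  (Matrix.detRowAlternating (n := Fin r) (R := ℂ)).toMultilinearMap.compLinearMap fun _ =>
    LinearMap.pi fun j => (ContinuousLinearMap.apply ℂ ℂ (T (v j))).toLinearMap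

lemma minorForm_apply (T : V →L[ℂ] W) {r : ℕ} (v : Fin r → V) (l : Fin r → W →L[ℂ] ℂ) :
    minorForm T v l = minor T v l := rfl

/-- Expansion in the basis. The constant does not depend on the form, which matters because the
minors vary with the point. -/
lemma exists_norm_multilinear_le {X : Type} [NormedAddCommGroup X] [NormedSpace ℂ X]
    [FiniteDimensional ℂ X] {ι : Type} [Fintype ι] (e : Module.Basis ι ℂ X) (r : ℕ) : ∃ c : ℝ,
      ∀ f : MultilinearMap ℂ (fun _ : Fin r => X) ℂ, ∀ v, ‖f v‖ ≤
        c * (∑ I : Fin r → ι, ‖f fun j => e (I j)‖) * ∏ j, ‖v j‖ := by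
  classical
  let K := ∑ i, ‖toContinuousLinearMap (e.coord i)‖
  refine ⟨K ^ r, fun f v => ?_⟩
  have hv : f v = ∑ I : Fin r → ι, (∏ j, e.coord (I j) (v j)) • f fun j => e (I j) := by
    have h1 : v = fun j => ∑ i, e.coord i (v j) • e i := funext fun j => (e.sum_repr (v j)).symm
    conv_lhs => rw [h1]
    rw [f.map_sum]
    exact Finset.sum_congr rfl fun I _ => f.map_smul_univ (fun j => e.coord (I j) (v j)) _
  rw [hv, Finset.mul_sum, Finset.sum_mul]
  refine norm_sum_le_of_le _ fun I _ => ?_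
  rw [norm_smul, norm_prod]
  have h2 : ∏ j, ‖e.coord (I j) (v j)‖ ≤ K ^ r * ∏ j, ‖v j‖ := by
    have : K ^ r * ∏ j, ‖v j‖ = ∏ j : Fin r, K * ‖v j‖ := by
      rw [Finset.prod_mul_distrib, Finset.prod_const, Finset.card_univ, Fintype.card_fin]
    rw [this]
    refine Finset.prod_le_prod (fun _ _ => norm_nonneg _) fun j _ => ?_
    refine ((toContinuousLinearMap (e.coord (I j))).le_opNorm (v j)).trans ?_
    refine mul_le_mul_of_nonneg_right ?_ (norm_nonneg _)
    exact Finset.single_le_sum (f := fun i => ‖toContinuousLinearMap (e.coord i)‖)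
      (fun _ _ => norm_nonneg _) (Finset.mem_univ (I j))
  calc _ ≤ (K ^ r * ∏ j, ‖v j‖) * ‖f fun j => e (I j)‖ :=
        mul_le_mul_of_nonneg_right h2 (norm_nonneg _)
    _ = _ := by ring

lemma minor_eq_zero_of_basis {ι ι' : Type} [Fintype ι] [Fintype ι'] (e : Module.Basis ι ℂ V)
    (e' : Module.Basis ι' ℂ (W →L[ℂ] ℂ)) {T : V →L[ℂ] W} {r : ℕ}
    (h : ∀ (I : Fin r → ι) (J : Fin r → ι'), minor T (fun j => e (I j)) (fun i => e' (J i)) = 0)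
    (v : Fin r → V) (l : Fin r → W →L[ℂ] ℂ) : minor T v l = 0 := by
  obtain ⟨c₁, hc₁⟩ := exists_norm_multilinear_le e r
  obtain ⟨c₂, hc₂⟩ := exists_norm_multilinear_le e' r
  refine norm_le_zero_iff.1 ?_
  have h1 := hc₁ (minorVec T l) v
  simp only [minorVec_apply] at h1
  have h2 : ∀ I : Fin r → ι, ‖minor T (fun j => e (I j)) l‖ = 0 := by
    intro I
    refine le_antisymm ?_ (norm_nonneg _)
    have := hc₂ (minorForm T fun j => e (I j)) l
    simpa only [minorForm_apply, h, norm_zero, Finset.sum_const_zero, mul_zero, zero_mul] using this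
  simpa only [h2, Finset.sum_const_zero, mul_zero, zero_mul] using h1

/-- Flatness can be tested on bases. -/
lemma hasFlatMinors_iff {ι ι' : Type} [Fintype ι] [Fintype ι'] (e : Module.Basis ι ℂ V)
    (e' : Module.Basis ι' ℂ (W →L[ℂ] ℂ)) {F : V → W} {r N : ℕ} : HasFlatMinors F r N ↔
      ∀ (I : Fin r → ι) (J : Fin r → ι'),
        (fun u => minor (fderiv ℂ F u) (fun j => e (I j)) fun i => e' (J i)) =O[𝓝 0]
          fun u => ‖u‖ ^ (N + 1) := by
  constructor
  · rintro ⟨c, hc⟩ I J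
    refine IsBigO.of_bound (c * (∏ j, ‖e (I j)‖) * ∏ i, ‖e' (J i)‖) ?_
    filter_upwards [hc] with u hu
    rw [norm_pow, norm_norm]
    refine (hu _ _).trans (le_of_eq ?_)
    ring
  · intro h
    choose c hc using fun I J => (h I J).bound
    obtain ⟨c₁, hc₁⟩ := exists_norm_multilinear_le e r
    obtain ⟨c₂, hc₂⟩ := exists_norm_multilinear_le e' r
    refine ⟨|c₁| * ∑ I, |c₂| * ∑ J, c I J, ?_⟩
    filter_upwards [eventually_all.2 fun I => eventually_all.2 (hc I)] with u hu v l
    set A := ‖u‖ ^ (N + 1)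
    have hv0 : 0 ≤ ∏ j, ‖v j‖ := Finset.prod_nonneg fun _ _ => norm_nonneg _
    have hl0 : 0 ≤ ∏ i, ‖l i‖ := Finset.prod_nonneg fun _ _ => norm_nonneg _
    have h2 : ∀ I : Fin r → ι, ‖minor (fderiv ℂ F u) (fun j => e (I j)) l‖ ≤
        |c₂| * (∑ J, c I J * A) * ∏ i, ‖l i‖ := by
      intro I
      have := hc₂ (minorForm (fderiv ℂ F u) fun j => e (I j)) l
      rw [minorForm_apply] at this
      refine this.trans (mul_le_mul_of_nonneg_right ?_ hl0)
      refine mul_le_mul (le_abs_self _) (Finset.sum_le_sum fun J _ => ?_)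
        (Finset.sum_nonneg fun _ _ => norm_nonneg _) (abs_nonneg _)
      have := hu I J
      rwa [norm_pow, norm_norm] at this
    have h1 := hc₁ (minorVec (fderiv ℂ F u) l) v
    simp only [minorVec_apply] at h1
    calc _ ≤ _ := h1
      _ ≤ |c₁| * (∑ I : Fin r → ι, |c₂| * (∑ J, c I J * A) * ∏ i, ‖l i‖) * ∏ j, ‖v j‖ := by
        refine mul_le_mul_of_nonneg_right ?_ hv0
        exact mul_le_mul (le_abs_self _) (Finset.sum_le_sum fun I _ => h2 I)
          (Finset.sum_nonneg fun _ _ => norm_nonneg _) (abs_nonneg _)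
      _ = _ := by
        simp only [← Finset.sum_mul, ← mul_assoc]
        simp only [mul_assoc, ← Finset.mul_sum]
        ring

/-- The equations expressing flatness of the members of an analytic family of maps. -/
lemma exists_flat_equations {κ : Regularity} {F : V × Y → W} (hF : AnalyticAt ℂ F 0)
    (hr : RegAt κ F 0) (r N : ℕ) : ∃ (ι : Type) (_ : Fintype ι) (G : ι → Y → ℂ),
      (∀ i, RegAt κ (G i) 0) ∧
      ∀ᶠ y in 𝓝 0, HasFlatMinors (fun u => F (u, y)) r N ↔ ∀ i, G i y = 0 := by
  let e := finBasis ℂ V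
  let e' := finBasis ℂ (W →L[ℂ] ℂ)
  let σ : Y × V →L[ℂ] V × Y := (snd ℂ Y V).prod (fst ℂ Y V)
  have hF' : AnalyticAt ℂ (fun q : Y × V => F (σ q)) 0 :=
    AnalyticAt.comp_of_eq hF (σ.analyticAt 0) (map_zero σ)
  have hr' : RegAt κ (fun q : Y × V => F (σ q)) 0 :=
    hr.comp_of_eq (regAt_clm (σ.restrictScalars ℝ) 0) (map_zero σ)
  let D : V → Y × V → W := fun v q => fderiv ℂ (fun q : Y × V => F (σ q)) q (0, v)
  have hD : ∀ v, AnalyticAt ℂ (D v) 0 := fun v => analyticAt_fderiv_apply hF' _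
  have hDr : ∀ v, RegAt κ (D v) 0 := fun v => regAt_fderiv_apply hF' hr' _
  choose ι hι G hG hGe using fun (I : Fin r → Fin (finrank ℂ V))
    (J : Fin r → Fin (finrank ℂ (W →L[ℂ] ℂ))) =>
    exists_order_equations (κ := κ) (N + 1)
      (g := fun q : Y × V => Matrix.det (Matrix.of fun i j => e' (J i) (D (e (I j)) q)))
      (by
        simp only [Matrix.det_apply, Units.smul_def, zsmul_eq_mul]
        refine Finset.analyticAt_fun_sum _ fun τ _ => analyticAt_const.fun_mul ?_
        exact Finset.analyticAt_fun_prod _ fun i _ => ((e' _).analyticAt _).fun_comp (hD _))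
      (RegAt.det fun i j => (hDr _).clm_comp ((e' (J i)).restrictScalars ℝ))
  refine ⟨Σ I, Σ J, ι I J, inferInstance, fun s => G s.1 s.2.1 s.2.2, fun s => hG _ _ _, ?_⟩
  have hline : Tendsto₀ (fun y : Y => (y, (0 : V))) := tendsto_cont rfl
  filter_upwards [eventually_all.2 fun I => eventually_all.2 (hGe I),
    hline.eventually hF'.eventually_analyticAt.eventually_nhds] with y hy hy2
  have h1 : ∀ᶠ u in 𝓝 (0 : V), ∀ v, fderiv ℂ (fun u => F (u, y)) u v = D v (y, u) := by
    have : Tendsto (fun u : V => (y, u)) (𝓝 0) (𝓝 (y, 0)) := tendsto_cont rfl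
    filter_upwards [this.eventually hy2] with u hu v
    have d : HasFDerivAt (fun u => F (u, y)) _ u :=
      HasFDerivAt.comp (g := fun q : Y × V => F (σ q)) u hu.hasFDerivAt
        (hasFDerivAt_prodMk_right y u)
    rw [d.fderiv]
    rfl
  rw [hasFlatMinors_iff e e']
  have h2 : ∀ I J, ((fun u => minor (fderiv ℂ (fun u => F (u, y)) u) (fun j => e (I j))
      fun i => e' (J i)) =O[𝓝 0] fun u => ‖u‖ ^ (N + 1)) ↔ ∀ i, G I J i y = 0 := by
    intro I J
    refine (isBigO_congr (h1.mono fun u hu => ?_) EventuallyEq.rfl).trans (hy I J)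
    simp only [minor, hu]
  simp only [h2, Sigma.forall]

/-- A map of generic rank at least `r` is not flat to infinite order. -/
lemma exists_not_hasFlatMinors {F : V → W} (hF : AnalyticAt ℂ F 0) {r : ℕ}
    (hr : r ≤ genericRank F 0) : ∃ N₀, ∀ N ≥ N₀, ¬ HasFlatMinors F r N := by
  let e := finBasis ℂ V
  let e' := finBasis ℂ (W →L[ℂ] ℂ)
  by_contra hcon
  push Not at hcon
  -- Flatness to a higher order implies flatness to lower orders, so flatness for arbitrarily large
  -- `N` means vanishing to infinite order, hence identically.
  have hflat : ∀ N, HasFlatMinors F r N := by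
    intro N
    obtain ⟨N', hN', h⟩ := hcon N
    rw [hasFlatMinors_iff e e'] at h ⊢
    refine fun I J => (h I J).trans ?_
    refine IsBigO.of_bound 1 ?_
    filter_upwards [ball_mem_nhds (0 : V) one_pos] with u hu
    rw [mem_ball, dist_zero_right] at hu
    rw [norm_pow, norm_pow, norm_norm, one_mul]
    exact pow_le_pow_of_le_one (norm_nonneg _) hu.le (by omega)
  have hz : ∀ (I : Fin r → _) (J : Fin r → _), ∀ᶠ u in 𝓝 0, minor (fderiv ℂ F u) (fun j => e (I j)) (fun i => e' (J i)) = 0 :=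
    fun I J => eventually_eq_zero_of_isBigO
      (analyticAt_minor _ _ fun j => analyticAt_fderiv_apply hF _)
      fun n => (hasFlatMinors_iff e e').1 (hflat n) I J
  refine absurd ((le_genericRank_iff).1 hr) ?_
  rw [Filter.not_frequently]
  filter_upwards [eventually_all.2 fun I => eventually_all.2 (hz I)] with u hu hle
  obtain ⟨v, l, hvl⟩ := exists_minor_ne_zero hle
  exact hvl (minor_eq_zero_of_basis e e' hu v l)

/-- If the rank is below `r` near `0`, all minors of size `r` vanish there, and vanishing minors are
flat to every order. -/
lemma le_genericRank_of_not_hasFlatMinors {F : V → W} {r N : ℕ} (h : ¬ HasFlatMinors F r N) :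
    r ≤ genericRank F 0 := by
  rw [le_genericRank_iff]
  intro hcon
  refine h ⟨0, ?_⟩
  filter_upwards [hcon] with u hu v l
  have : minor (fderiv ℂ F u) v l = 0 := by
    by_contra hne
    exact hu (le_rk_of_minor_ne_zero hne)
  rw [this]
  simp

end Minors

section Flat

variable {V W : Type} [NormedAddCommGroup V] [NormedSpace ℂ V] [NormedAddCommGroup W]
  [NormedSpace ℂ W]

lemma HasFlatMinors.congr {F F' : V → W} (h : ∀ᶠ u in 𝓝 0, fderiv ℂ F u = fderiv ℂ F' u)
    {r N : ℕ} (hF : HasFlatMinors F r N) : HasFlatMinors F' r N := by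
  obtain ⟨c, hc⟩ := hF
  refine ⟨c, ?_⟩
  filter_upwards [hc, h] with u h1 h2
  rwa [h2] at h1

end Flat

/-! ### Charts and Segre chains at nearby base points. -/

section Translate

variable {n m d : ℕ} {M : Set ℂ^n} {x : ℂ^n}

/-- The chart at a nearby point. -/
def SegreChart.translate (C : SegreChart M x m d) {p : ℂ^n}
    (ha : AnalyticAt ℂ C.Θ (thetaArg m d (C.emb p)))
    (hmem : ∀ᶠ t in 𝓝 p, (t ∈ M ↔ star (C.coord (t - x)).2 =
      C.Θ (star (C.coord (t - x)).1, (C.coord (t - x)).1, (C.coord (t - x)).2))) :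
    SegreChart M p m d where
  coord := C.coord
  Θ θ := C.Θ (θ + thetaArg m d (C.emb p)) - star (C.emb p).2.1
  analytic := (AnalyticAt.comp_of_eq ha (analyticAt_id.fun_add analyticAt_const)
    (zero_add _)).fun_sub analyticAt_const
  mem_iff := by
    filter_upwards [hmem] with t ht
    rw [ht]
    have e1 : C.coord (t - x) = C.coord (t - p) + C.coord (p - x) := by
      rw [← map_add]; congr 1; abel
    have e2 : (star (C.coord (t - p)).1, (C.coord (t - p)).1, (C.coord (t - p)).2) +
        thetaArg m d (C.emb p) =
        (star (C.coord (t - x)).1, (C.coord (t - x)).1, (C.coord (t - x)).2) := by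
      rw [e1]
      simp only [thetaArg_apply, SegreChart.emb, realGraph_apply, Prod.fst_add, Prod.snd_add,
        star_add]
      rfl
    rw [e2, eq_sub_iff_add_eq, e1]
    simp only [SegreChart.emb, realGraph_apply, Prod.snd_add, star_add]

/-- Translation of the chart moves the starting point of the chains to the point above `p`, whose
`ξ` is the conjugate of its `w` because `p ∈ M`. The chains at all nearby points of `M` thus belong
to one family. -/
lemma SegreChart.segreChain_translate (C : SegreChart M x m d) {p : ℂ^n}
    (ha : AnalyticAt ℂ C.Θ (thetaArg m d (C.emb p)))
    (hmem : ∀ᶠ t in 𝓝 p, (t ∈ M ↔ star (C.coord (t - x)).2 =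
      C.Θ (star (C.coord (t - x)).1, (C.coord (t - x)).1, (C.coord (t - x)).2)))
    (hp : p ∈ M) (k : ℕ) (u : Fin k → ℂ^m) :
    segreChain (C.translate ha hmem).Θ k u =
      chain (flowStep C.Θ) k u (toX C.Θ (C.emb p)) - toX C.Θ (C.emb p) := by
  have hθ : C.Θ (star (C.coord (p - x)).1, (C.coord (p - x)).1, (C.coord (p - x)).2) =
      star (C.coord (p - x)).2 := (hmem.self_of_nhds.1 hp).symm
  have hX : toX C.Θ (C.emb p) = ((C.coord (p - x)).1, (C.coord (p - x)).2,
      star (C.coord (p - x)).1, star (C.coord (p - x)).2) := by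
    rw [← hθ]; rfl
  rw [hX]
  induction k with
  | zero =>
    exact (sub_self (_ : ComplexifiedSpace m d)).symm
  | succ k ih =>
    have ih' := eq_add_of_sub_eq (ih fun i => u i.castSucc).symm
    rw [segreChain_eq, chain, ← segreChain_eq, chain, ih']
    by_cases hk : Even k
    · simp only [flowStep, hk, if_true, flow]
      refine Prod.ext ?_ (Prod.ext ?_ (Prod.ext ?_ ?_))
      · simp only [Prod.fst_add, Prod.fst_sub]; abel
      · simp only [Prod.fst_add, Prod.fst_sub, Prod.snd_add, Prod.snd_sub, conjTheta,
          SegreChart.translate, thetaArg_apply, SegreChart.emb, realGraph_apply, star_sub,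
          star_star, Prod.mk_add_mk, star_add]
        congr 4
        abel
      · simp only [Prod.fst_add, Prod.fst_sub, Prod.snd_add, Prod.snd_sub]; abel
      · simp only [Prod.snd_add, Prod.snd_sub]; abel
    · simp only [flowStep, hk, if_false, conjFlow]
      refine Prod.ext ?_ (Prod.ext ?_ (Prod.ext ?_ ?_))
      · simp only [Prod.fst_add, Prod.fst_sub]; abel
      · simp only [Prod.fst_add, Prod.fst_sub, Prod.snd_add, Prod.snd_sub]; abel
      · simp only [Prod.fst_add, Prod.fst_sub, Prod.snd_add, Prod.snd_sub]; abel
      · simp only [Prod.fst_add, Prod.snd_add, Prod.snd_sub,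
          SegreChart.translate, thetaArg_apply, SegreChart.emb, realGraph_apply, Prod.mk_add_mk]
        congr 3
        abel

/-- The chains at nearby points. -/
lemma SegreChart.eventually_exists_translate (C : SegreChart M x m d) :
    ∀ᶠ p in 𝓝 x, p ∈ M → ∃ C' : SegreChart M p m d, ∀ k u, segreChain C'.Θ k u =
      chain (flowStep C.Θ) k u (toX C.Θ (C.emb p)) - toX C.Θ (C.emb p) := by
  have h1 : Tendsto (fun t => thetaArg m d (C.emb t)) (𝓝 x) (𝓝 0) :=
    ((thetaArg m d).tendsto_zero).comp C.tendsto_emb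
  filter_upwards [h1.eventually C.analytic.eventually_analyticAt, C.mem_iff.eventually_nhds]
    with p h2 h3 hp
  exact ⟨C.translate h2 h3, fun k u => C.segreChain_translate h2 h3 hp k u⟩

/-- The generic ranks of the chains at nearby points. -/
lemma SegreChart.eventually_fderiv_segreChain {κ : Regularity} (hn : n = m + d)
    (hM : IsSubmanifold κ M d) (hx : x ∈ M) (C : SegreChart M x m d) (k : ℕ) :
    ∀ᶠ p in 𝓝 x, p ∈ M → ∃ C' : SegreChart M p m d, ∀ᶠ u in 𝓝 0, fderiv ℂ (segreChain C'.Θ k) u =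
        fderiv ℂ (fun u => toX C.Θ (chain (act C.Θ) k u (C.emb p))) u := by
  have hR := C.isReflexive hn hM hx
  have t1 : Tendsto (fun p => ((0 : Fin k → ℂ^m), C.emb p)) (𝓝 x) (𝓝 0) :=
    tendsto_const_nhds.prodMk_nhds C.tendsto_emb
  filter_upwards [C.eventually_exists_translate,
    t1.eventually (hR.chain_flowStep_toX k).eventually_nhds] with p h1 h2 hp
  obtain ⟨C', hC'⟩ := h1 hp
  refine ⟨C', ?_⟩
  have e1 : segreChain C'.Θ k = fun u => chain (flowStep C.Θ) k u (toX C.Θ (C.emb p)) -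
      toX C.Θ (C.emb p) := funext (hC' k)
  have t2 : Tendsto (fun u : Fin k → Fin m → ℂ => (u, C.emb p)) (𝓝 0) (𝓝 (0, C.emb p)) :=
    tendsto_cont rfl
  filter_upwards [(t2.eventually h2).eventually_nhds] with u hu
  rw [e1, fderiv_sub_const]
  exact Filter.EventuallyEq.fderiv_eq hu

end Translate

/-! ### The exceptional subvariety and the generic multitypes. -/

section Degeneracy

variable {n m d : ℕ} {M : Set ℂ^n} {κ : Regularity}

/-- The points at which one of the chains of length at most `K` fails to have generic rank `r k`
to order `N`. -/
def degenerateSet (M : Set ℂ^n) (m d K N : ℕ) (r : ℕ → ℕ) : Set ℂ^n :=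
  {p | p ∈ M ∧ ∃ C : SegreChart M p m d, ∃ k : Fin (K + 1), HasFlatMinors (segreChain C.Θ k) (r k) N}

/-- Flatness is independent of the chart, so near `x` it can be tested in one analytic family, where
it amounts to finitely many equations. The product over `k` of sums of squared moduli encodes a
union over `k` of common zero sets by a single real function. -/
lemma degenerateSet_equations (hn : n = m + d) (hM : IsGenericSubmanifold κ M d) {x : ℂ^n}
    (hx : x ∈ M) (K N : ℕ) (r : ℕ → ℕ) : ∃ f : ℂ^n → ℝ, IsRealRegularAt κ f x ∧
      ∀ᶠ y in 𝓝 x, (y ∈ degenerateSet M m d K N r ↔ y ∈ M ∧ f y = 0) := by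
  obtain ⟨C, hCr⟩ := exists_segreChart hn hM hx
  have hR := C.isReflexive hn hM.1 hx
  have hX0 : AnalyticAt ℂ (toX C.Θ) 0 := analyticAt_toX (y := 0) C.analytic
  have hX0r : RegAt κ (toX C.Θ) 0 :=
    (regAt_fst 0).prodMk ((regAt_snd 0).clm_comp (fst ℝ _ _) |>.prodMk
      (((regAt_snd 0).clm_comp (snd ℝ _ _)).prodMk (regAt_graph (y := 0) hCr)))
  have hch : ∀ k, chain (act C.Θ) k (0 : (Fin k → ℂ^m) × GraphSpace m d).1
      (0 : (Fin k → ℂ^m) × GraphSpace m d).2 = 0 := chain_zero_zero hR.act_apply_zero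
  choose ι hι G hG hGe using fun k : ℕ => exists_flat_equations (κ := κ)
    (F := fun q : (Fin k → ℂ^m) × GraphSpace m d => toX C.Θ (chain (act C.Θ) k q.1 q.2))
    (AnalyticAt.comp_of_eq hX0 (analyticAt_chain hR.analyticAt_act hR.act_apply_zero k) (hch k))
    (hX0r.comp_of_eq (regAt_chain (hR.regAt_act hCr) hR.act_apply_zero k) (hch k)) (r k) N
  have hemb : RegAt κ C.emb x := ((regAt_id x).sub (regAt_const x x)).clm_comp (realGraph C.coord)
  have hGr : ∀ k i, RegAt κ (fun t => Complex.normSq (G k i (C.emb t))) x := by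
    intro k i
    have h1 : RegAt κ (fun t => G k i (C.emb t)) x := (hG k i).comp_of_eq hemb C.emb_base
    exact ((h1.clm_comp reCLM).mul_real (h1.clm_comp reCLM)).add
      ((h1.clm_comp imCLM).mul_real (h1.clm_comp imCLM))
  refine ⟨fun t => ∏ k : Fin (K + 1), ∑ i, Complex.normSq (G k i (C.emb t)),
    isRealRegularAt_iff.2 (RegAt.prod_real _ fun k _ => RegAt.sum _ fun i _ => hGr k i), ?_⟩
  filter_upwards [eventually_all.2 fun k : Fin (K + 1) =>
    C.eventually_fderiv_segreChain hn hM.1 hx k,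
    eventually_all.2 fun k : Fin (K + 1) => C.tendsto_emb.eventually (hGe k)] with t h1 h2
  refine and_congr_right fun ht => ?_
  rw [Finset.prod_eq_zero_iff]
  have h3 : ∀ k : Fin (K + 1), (∃ C : SegreChart M t m d, HasFlatMinors (segreChain C.Θ k) (r k) N) ↔
      ∑ i, Complex.normSq (G k i (C.emb t)) = 0 := by
    intro k
    rw [Finset.sum_eq_zero_iff_of_nonneg fun i _ => Complex.normSq_nonneg _]
    simp only [Finset.mem_univ, forall_const, Complex.normSq_eq_zero]
    rw [← h2 k]
    obtain ⟨C', hC'⟩ := h1 k ht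
    constructor
    · rintro ⟨C'', h⟩
      exact (C'.hasFlatMinors_of C'' hn hM.1 ht h).congr hC'
    · exact fun h => ⟨C', h.congr (hC'.mono fun _ h => h.symm)⟩
  simp only [Finset.mem_univ, true_and, ← h3]
  exact exists_comm

/-- Eventual stability of a sequence of dimensions. -/
lemma exists_stable_index {a : ℕ → ℕ} {m d : ℕ} (hmono : ∀ k, a k ≤ a (k + 1)) (h2 : a 2 = 2 * m)
    (hle : ∀ k, a k ≤ 2 * m + d) (hst : ∀ k, a (k + 1) = a (k + 2) → a (k + 3) = a (k + 2)) :
    ∃ μ, 2 ≤ μ ∧ μ ≤ d + 2 ∧ (∀ k, 2 ≤ k → k < μ → a k < a (k + 1)) ∧ ∀ k, μ ≤ k → a k = a μ := by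
  classical
  -- Each strict increase from index `2` on gains at least one, and the values lie between `2m` and
  -- `2m + d`; at most `d` increases are possible, whence `μ ≤ d + 2`.
  have hgrow : ∀ j, (∀ i, 2 ≤ i → i < j + 2 → a i < a (i + 1)) → 2 * m + j ≤ a (j + 2) := by
    intro j
    induction j with
    | zero =>
      intro _
      have : a (0 + 2) = 2 * m := h2
      omega
    | succ j ih =>
      intro h
      have h3 := ih fun i hi hj => h i hi (by omega)
      have h4 := h (j + 2) (by omega) (by omega)
      have : j + 1 + 2 = j + 2 + 1 := by ring
      rw [this]
      omega
  have hex : ∃ k, 2 ≤ k ∧ a k = a (k + 1) := by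
    by_contra hcon
    push Not at hcon
    have := hgrow (d + 1) fun i hi _ => lt_of_le_of_ne (hmono i) (hcon i hi)
    have := hle (d + 1 + 2)
    omega
  have hlt : ∀ k, 2 ≤ k → k < Nat.find hex → a k < a (k + 1) := fun k hk hlt =>
    lt_of_le_of_ne (hmono k) fun h => Nat.find_min hex hlt ⟨hk, h⟩
  obtain ⟨hμ2, hμ⟩ := Nat.find_spec hex
  set μ := Nat.find hex
  refine ⟨μ, hμ2, ?_, hlt, ?_⟩
  · have h3 := hgrow (μ - 2) fun i hi hj => hlt i hi (by omega)
    have := hle (μ - 2 + 2)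
    omega
  · have key : ∀ j, a (μ + j) = a (μ + j + 1) := by
      intro j
      induction j with
      | zero => exact hμ
      | succ j ih =>
        obtain ⟨i, hi⟩ : ∃ i, μ + j = i + 1 := ⟨μ + j - 1, by omega⟩
        have h3 := hst i (by
          change a (i + 1) = a (i + 1 + 1)
          rw [← hi]; exact ih)
        have e1 : μ + (j + 1) = i + 2 := by omega
        rw [e1]
        exact h3.symm
    intro k hk
    obtain ⟨j, rfl⟩ := Nat.exists_eq_add_of_le hk
    induction j with
    | zero => rfl
    | succ j ih => rw [← add_assoc, ← key j, ih (by omega)]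

/-- Off a proper subvariety, the chains have the same generic ranks. -/
lemma exists_generic_ranks (hn : n = m + d) (hM : IsGenericSubmanifold κ M d)
    (hne : M.Nonempty) : ∃ (E : Set ℂ^n) (a : ℕ → ℕ), IsProperSubvariety κ M E ∧
      (∃ p₀ ∈ M, ∃ C₀ : SegreChart M p₀ m d, ∀ k, a k = genericRank (segreChain C₀.Θ k) 0) ∧
      ∀ p ∈ M \ E, ∀ (C : SegreChart M p m d) k, genericRank (segreChain C.Θ k) 0 = a k := by
  have hC : ∀ p : M, Nonempty (SegreChart M p.1 m d) := fun p =>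
    (exists_segreChart hn hM p.2).nonempty
  let Cp : ∀ p : M, SegreChart M p.1 m d := fun p => (hC p).some
  let g : M → ℕ → ℕ := fun p k => genericRank (segreChain (Cp p).Θ k) 0
  have hRp : ∀ p : M, IsReflexive (Cp p).Θ := fun p => (Cp p).isReflexive hn hM.1 p.2
  have hgle : ∀ p k, g p k ≤ 2 * m + d := fun p k => (hRp p).genericRank_segreChain_le k
  -- The ranks with index at most `d + 2` determine all later ones. At a point where the sum of
  -- these ranks is maximal, any other point with no smaller individual rank must have the same
  -- ranks.
  let S : M → ℕ := fun p => ∑ k ∈ Finset.range (d + 3), g p k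
  have hSb : ∀ p, S p ≤ (d + 3) * (2 * m + d) := fun p => by
    refine (Finset.sum_le_card_nsmul _ _ _ fun k _ => hgle p k).trans (le_of_eq ?_)
    simp
  obtain ⟨p₁, hp₁⟩ := hne
  obtain ⟨p₀, hp₀⟩ : ∃ p₀, ∀ p, S p ≤ S p₀ := by
    have hb : BddAbove (Set.range S) := ⟨_, by rintro _ ⟨p, rfl⟩; exact hSb p⟩
    obtain ⟨p₀, h⟩ := Nat.sSup_mem ⟨S ⟨p₁, hp₁⟩, Set.mem_range_self _⟩ hb
    exact ⟨p₀, fun p => by rw [h]; exact le_csSup hb (Set.mem_range_self _)⟩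
  choose N₀ hN₀ using fun k => exists_not_hasFlatMinors ((hRp p₀).analyticAt_segreChain k)
    (le_refl (g p₀ k))
  -- One order serves for all the finitely many chains at `p₀`. Hence `p₀` is outside the
  -- exceptional set, and truncation at this order keeps the number of equations finite.
  let N := ∑ k : Fin (d + 2 + 1), N₀ k
  have hNk : ∀ k : Fin (d + 2 + 1), N₀ k ≤ N := fun k =>
    Finset.single_le_sum (f := fun k : Fin (d + 2 + 1) => N₀ k) (fun _ _ => Nat.zero_le _)
      (Finset.mem_univ k)
  refine ⟨degenerateSet M m d (d + 2) N (g p₀), g p₀, ⟨⟨fun p hp => hp.1, fun h => ?_⟩, ?_⟩,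
    ⟨p₀, p₀.2, Cp p₀, fun k => rfl⟩, ?_⟩
  · obtain ⟨-, C, k, hflat⟩ := h p₀.2
    exact hN₀ k N (hNk k) ((Cp p₀).hasFlatMinors_of C hn hM.1 p₀.2 hflat)
  · intro x hx
    obtain ⟨f, hf, hfe⟩ := degenerateSet_equations hn hM hx (d + 2) N (g p₀)
    refine ⟨1, fun _ => f, fun _ => hf, ?_⟩
    filter_upwards [hfe] with y hy
    rw [hy]
    simp
  · rintro p ⟨hp, hpE⟩ C
    -- Outside the exceptional set none of these ranks is smaller than at `p₀`; maximality of the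
    -- sum then turns the inequalities into equalities.
    have hge : ∀ k < d + 3, g p₀ k ≤ g ⟨p, hp⟩ k := by
      intro k hk
      refine le_genericRank_of_not_hasFlatMinors (N := N) fun hflat => hpE ?_
      exact ⟨hp, Cp ⟨p, hp⟩, ⟨k, hk⟩, hflat⟩
    have heq : ∀ k < d + 3, g ⟨p, hp⟩ k = g p₀ k := by
      intro k hk
      have h1 : ∑ k ∈ Finset.range (d + 3), g p₀ k = ∑ k ∈ Finset.range (d + 3), g ⟨p, hp⟩ k :=
        le_antisymm (Finset.sum_le_sum fun k hk => hge k (Finset.mem_range.1 hk)) (hp₀ ⟨p, hp⟩)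
      exact ((Finset.sum_eq_sum_iff_of_le fun k hk => hge k (Finset.mem_range.1 hk)).1 h1 k
        (Finset.mem_range.2 hk)).symm
    have hstab : ∀ p k, d + 2 ≤ k → g p k = g p (d + 2) := by
      intro p k hk
      obtain ⟨μ, -, h1, -, h2⟩ := exists_stable_index (a := g p)
        (hRp p).genericRank_segreChain_le_succ (hRp p).genericRank_segreChain_two (hgle p)
        (hRp p).genericRank_segreChain_stall
      rw [h2 k (h1.trans hk), h2 _ h1]
    intro k
    rw [C.genericRank_eq (Cp ⟨p, hp⟩) hn hM.1 hp]
    by_cases hk : k < d + 3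
    · exact heq k hk
    · change g ⟨p, hp⟩ k = _
      rw [hstab _ k (by omega), hstab p₀ k (by omega), heq _ (by omega)]

/-- The multitypes at the points where the chains have given generic ranks. -/
lemma hasSegreMultitype_of_ranks {p : ℂ^n} (hn : n = m + d) (hm : 1 ≤ m)
    (hM : IsGenericSubmanifold κ M d) (hp : p ∈ M) {a : ℕ → ℕ} {μ : ℕ}
    (ha : ∀ (C : SegreChart M p m d) k, genericRank (segreChain C.Θ k) 0 = a k) (hμ2 : 2 ≤ μ)
    (hlt : ∀ k, 2 ≤ k → k < μ → a k < a (k + 1)) (hge : ∀ k, μ ≤ k → a k = a μ) :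
    HasComplexifiedSegreMultitype M p m d μ (fun k => a k - a (k - 1)) ∧
    HasSegreMultitype M p m d (μ - 1)
      (fun k => if k ≤ 1 then m else a (k + 1) - a (k + 1 - 1)) := by
  obtain ⟨C₀, -⟩ := exists_segreChart hn hM hp
  obtain ⟨ν, rfl⟩ : ∃ ν, μ = ν + 1 := ⟨μ - 1, by omega⟩
  rw [Nat.add_sub_cancel]
  have hR : ∀ C : SegreChart M p m d, IsReflexive C.Θ := fun C => C.isReflexive hn hM.1 hp
  have a0 : a 0 = 0 := by rw [← ha C₀, genericRank_segreChain_zero]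
  have a1 : a 1 = m := by rw [← ha C₀, (hR C₀).genericRank_segreChain_one]
  have a2 : a 2 = 2 * m := by rw [← ha C₀, (hR C₀).genericRank_segreChain_two]
  have hmono : ∀ k, a k ≤ a (k + 1) := fun k => by
    rw [← ha C₀, ← ha C₀]; exact (hR C₀).genericRank_segreChain_le_succ k
  have hb : ∀ (C : SegreChart M p m d) k, m + genericRank (segreMap C.Θ k) 0 = a (k + 1) :=
    fun C k => by rw [← ha C, (hR C).genericRank_segreChain_succ]
  have hz : ∀ k, ν + 1 < k → a k - a (k - 1) = 0 := fun k hk => by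
    rw [hge k hk.le, hge (k - 1) (by omega), Nat.sub_self]
  refine ⟨⟨⟨C₀⟩, hμ2, ?_, ?_, ?_, hz, ?_⟩, ⟨⟨C₀⟩, ?_, fun C => ⟨⟨?_, ?_⟩, ?_⟩⟩⟩
  · simp [a0, a1]
  · simp only [Nat.add_one_sub_one, a1, a2]; omega
  · intro k hk3 hkμ
    have := hlt (k - 1) (by omega) (by omega)
    rw [Nat.sub_add_cancel (by omega)] at this
    simp only
    omega
  · intro C k
    rw [ha C]
    induction k with
    | zero => simpa using a0
    | succ k ih =>
      rw [Finset.sum_Icc_succ_top (by omega), ← ih, Nat.add_sub_cancel]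
      have := hmono k
      omega
  · intro k hk
    simp only [show ¬ k ≤ 1 by omega, if_false]
    exact hz (k + 1) (by omega)
  -- The projected chain of length `k` has rank `a (k + 1) - m`, so its ranks stop growing one index
  -- before those of the full chains.
  · change genericRank (segreMap C.Θ ν) 0 = genericRank (segreMap C.Θ (ν + 1)) 0
    have h1 := hb C ν
    have h2 := hb C (ν + 1)
    rw [hge (ν + 1 + 1) (by omega)] at h2
    omega
  · intro k hk
    change genericRank (segreMap C.Θ k) 0 = genericRank (segreMap C.Θ (k + 1)) 0 at hk
    have h1 := hb C k
    have h2 := hb C (k + 1)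
    by_contra hcon
    -- At `k = 0` the two ranks are `0` and `m`, which differ because `m ≥ 1`.
    rcases Nat.eq_zero_or_pos k with rfl | hk0
    · rw [zero_add, a1] at h1
      rw [show 0 + 1 + 1 = 2 by rfl, a2] at h2
      omega
    · have := hlt (k + 1) (by omega) (by omega)
      omega
  · intro k
    change _ = ∑ i ∈ Finset.Icc 1 k, if i ≤ 1 then m else a (i + 1) - a (i + 1 - 1)
    have h1 : ∀ k, 1 ≤ k → ∑ i ∈ Finset.Icc 1 k,
        (if i ≤ 1 then m else a (i + 1) - a (i + 1 - 1)) + m = a (k + 1) := by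
      intro k hk
      induction k, hk using Nat.le_induction with
      | base => simp [a2]; omega
      | succ k hk ih =>
        rw [Finset.sum_Icc_succ_top (by omega), if_neg (show ¬ k + 1 ≤ 1 by omega),
          Nat.add_sub_cancel]
        have := hmono (k + 1)
        omega
    rcases Nat.eq_zero_or_pos k with rfl | hk
    · exact genericRank_segreMap_zero C.Θ
    · have := hb C k
      have := h1 k hk
      omega

end Degeneracy

/-! ### Alternating flows combined into one invertible action. -/

section Invariants

variable {m d : ℕ} {Θ : ThetaSpace m d → ℂ^d} {κ : Regularity}

/-- The parameters of three alternating flows. -/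
abbrev TripleSpace (m : ℕ) : Type := ℂ^m × ℂ^m × ℂ^m

/-- Three alternating flows. -/
def triple (Θ : ThetaSpace m d → ℂ^d)
    (q : TripleSpace m × GraphSpace m d) : GraphSpace m d :=
  actA Θ (q.1.2.2, actB (q.1.2.1, actA Θ (q.1.1, q.2)))

namespace IsReflexive

lemma act_of_even {k : ℕ} (hk : Even k) : act Θ k = actA Θ := by simp [act, hk]

lemma act_of_odd {k : ℕ} (hk : ¬ Even k) : act Θ k = actB := by simp [act, hk]

lemma tendsto_actA (h : IsReflexive Θ) : Tendsto₀ (actA Θ) := h.analyticAt_actA.tendsto (h.actA_zero.self_of_nhds)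

lemma tendsto_actB : Tendsto₀ (actB (m := m) (d := d)) := (analyticAt_actB (m := m) (d := d)).tendsto (actB_zero 0)

lemma actA_actA (h : IsReflexive Θ) :
    ∀ᶠ p : ℂ^m × ActSpace m d in 𝓝 0,
      actA Θ (p.1, actA Θ (p.2.1, p.2.2)) = actA Θ (p.2.1 + p.1, p.2.2) := by
  simpa only [act_of_even (Θ := Θ) (k := 0) ⟨0, rfl⟩] using h.act_mul 0

lemma actA_neg (h : IsReflexive Θ) : ∀ᶠ p : ActSpace m d in 𝓝 0,
    actA Θ (-p.1, actA Θ p) = p.2 := by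
  have t : Tendsto₀ (fun p : ActSpace m d => (-p.1, p)) := tendsto_cont
  filter_upwards [t.eventually h.actA_actA,
    (continuousAt_snd (p := (0 : ActSpace m d))).eventually h.actA_zero]
    with p h1 h2
  have h3 : actA Θ (-p.1, actA Θ p) = actA Θ (p.1 + -p.1, p.2) := h1
  rw [h3, add_neg_cancel, h2]

lemma analyticAt_triple (h : IsReflexive Θ) : AnalyticAt ℂ (triple Θ) 0 := by
  have p1 : ∀ q, AnalyticAt ℂ
      (fun q : TripleSpace m × GraphSpace m d => q.1) q :=
    fun q => analyticAt_fst
  have a0 : actA Θ 0 = 0 := h.actA_zero.self_of_nhds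
  have h1 : AnalyticAt ℂ (fun q : TripleSpace m × GraphSpace m d => actA Θ (q.1.1, q.2)) 0 :=
    AnalyticAt.comp_of_eq h.analyticAt_actA ((analyticAt_fst.fun_comp (p1 0)).prod analyticAt_snd) rfl
  have h2 := AnalyticAt.comp_of_eq (analyticAt_actB (m := m) (d := d))
    ((analyticAt_fst.fun_comp (analyticAt_snd.fun_comp (p1 0))).prod h1) (Prod.ext rfl a0)
  exact AnalyticAt.comp_of_eq h.analyticAt_actA
    ((analyticAt_snd.fun_comp (analyticAt_snd.fun_comp (p1 0))).prod h2)
    (Prod.ext rfl ((congrArg (fun y => actB ((0 : ℂ^m), y)) a0).trans (actB_zero 0)))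

lemma regAt_triple (h : IsReflexive Θ) (hr : RegAt κ Θ 0) : RegAt κ (triple Θ) 0 := by
  have a0 : actA Θ 0 = 0 := h.actA_zero.self_of_nhds
  have p1 := regAt_fst (κ := κ)
    (0 : TripleSpace m × GraphSpace m d)
  have p2 := p1.clm_comp (snd ℝ _ _)
  have h1 := (h.regAt_actA hr).comp_of_eq
    ((p1.clm_comp (fst ℝ _ _)).prodMk (regAt_snd 0)) rfl
  have h2 := (regAt_actB (κ := κ)).comp_of_eq
    ((p2.clm_comp (fst ℝ _ _)).prodMk h1) (Prod.ext rfl a0)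
  exact (h.regAt_actA hr).comp_of_eq ((p2.clm_comp (snd ℝ _ _)).prodMk h2)
    (Prod.ext rfl ((congrArg (fun y => actB ((0 : ℂ^m), y)) a0).trans (actB_zero 0)))

lemma triple_zero (h : IsReflexive Θ) : ∀ᶠ y in 𝓝 0, triple Θ (0, y) = y := by
  filter_upwards [h.actA_zero] with y hy
  change actA Θ (0, actB (0, actA Θ (0, y))) = y
  rw [hy, actB_zero, hy]

lemma tendsto_chain_act (h : IsReflexive Θ) (k : ℕ) : Tendsto
    (fun p : (Fin k → ℂ^m) × GraphSpace m d => chain (act Θ) k p.1 p.2) (𝓝 0) (𝓝 0) := by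
  have := (analyticAt_chain h.analyticAt_act h.act_apply_zero k).continuousAt.tendsto
  rwa [show chain (act Θ) k (0 : (Fin k → ℂ^m) × GraphSpace m d).1
    (0 : (Fin k → ℂ^m) × GraphSpace m d).2 = 0 from
    chain_zero_zero h.act_apply_zero k] at this

/-- The inverse of three alternating flows. -/
def tripleInv (m : ℕ) : TripleSpace m →L[ℂ]
    TripleSpace m :=
  -((snd ℂ _ _).comp (snd ℂ _ _)).prod
    (((fst ℂ _ _).comp (snd ℂ _ _)).prod (fst ℂ _ _))

/-- The pattern of flows is a palindrome, so reversing the order and negating the times gives the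
same kind of map. This is the reason for combining three flows rather than two. -/
lemma triple_inv (h : IsReflexive Θ) : ∀ᶠ q in 𝓝 0,
    triple Θ (tripleInv m q.1, triple Θ q) = q.2 := by
  have t1 : Tendsto₀ (fun q : TripleSpace m × GraphSpace m d => (q.1.1, q.2)) := tendsto_cont rfl
  have t2 := tendsto_actB.comp (Tendsto.prodMk_nhds (Continuous.tendsto'
    (f := fun q : TripleSpace m × GraphSpace m d => q.1.2.1)
    (by fun_prop) 0 0 rfl) (h.tendsto_actA.comp t1))
  have t3 := Tendsto.prodMk_nhds (Continuous.tendsto'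
    (f := fun q : TripleSpace m × GraphSpace m d => q.1.2.2)
    (by fun_prop) 0 0 rfl) t2
  filter_upwards [t1.eventually h.actA_neg, t3.eventually h.actA_neg] with q h1 h2
  refine (congrArg (fun y => actA Θ (-q.1.1, actB (-q.1.2.1, y))) h2).trans ?_
  have : actB (-q.1.2.1, actB (q.1.2.1, actA Θ (q.1.1, q.2))) = actA Θ (q.1.1, q.2) := by
    simp [actB]
  exact (congrArg (fun y => actA Θ (-q.1.1, y)) this).trans h1

/-- Chains of triples as chains of single flows. -/
lemma exists_chain_triple_eq (h : IsReflexive Θ) (k : ℕ) :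
    ∃ L : (Fin k → TripleSpace m) →L[ℂ] (Fin (2 * k + 1) → ℂ^m),
      ∀ᶠ p : (Fin k → TripleSpace m) × GraphSpace m d in 𝓝 0,
        chain (fun _ => triple Θ) k p.1 p.2 = chain (act Θ) (2 * k + 1) (L p.1) p.2 := by
  induction k with
  | zero =>
    refine ⟨0, ?_⟩
    filter_upwards [continuousAt_snd.eventually (h.act_zero 0)] with p hp
    exact hp.symm
  | succ k ih =>
    obtain ⟨L, hL⟩ := ih
    let ℓ : (Fin (k + 1) → TripleSpace m) →L[ℂ] TripleSpace m := ContinuousLinearMap.proj (Fin.last k)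
    let L₀ := L.comp (initCLM (TripleSpace m) k)
    let lam : (Fin (2 * k + 1) → ℂ^m) →L[ℂ] ℂ^m := ContinuousLinearMap.proj (Fin.last (2 * k))
    -- Consecutive triples meet in two flows of the same kind, which the group law merges by adding
    -- times; `k` triples therefore need `2k + 1` single flows.
    let L₁ := (snocCLM ℂ^m (2 * k)).comp (((initCLM ℂ^m (2 * k)).comp L₀).prod
      (lam.comp L₀ + (fst ℂ _ _).comp ℓ))
    let L₂ := (snocCLM ℂ^m (2 * k + 1)).comp (L₁.prod ((fst ℂ _ _).comp ((snd ℂ _ _).comp ℓ)))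
    let L₃ := (snocCLM ℂ^m (2 * k + 2)).comp (L₂.prod ((snd ℂ _ _).comp ((snd ℂ _ _).comp ℓ)))
    refine ⟨L₃, ?_⟩
    have t1 : Tendsto₀ (fun p : (Fin (k + 1) → TripleSpace m) × GraphSpace m d => (initCLM (TripleSpace m) k p.1, p.2)) := tendsto_cont
    have t2 : Tendsto₀ (fun p : (Fin (k + 1) → TripleSpace m) × GraphSpace m d =>
        ((ℓ p.1).1, L₀ p.1 (Fin.last (2 * k)), chain (act Θ) (2 * k)
          (initCLM ℂ^m (2 * k) (L₀ p.1)) p.2)) := by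
      refine Tendsto.prodMk_nhds (tendsto_cont rfl)
        (Tendsto.prodMk_nhds (tendsto_cont ?_)
          ((h.tendsto_chain_act (2 * k)).comp (Continuous.tendsto'
            (f := fun p : (Fin (k + 1) → TripleSpace m) × GraphSpace m d =>
              (initCLM ℂ^m (2 * k) (L₀ p.1), p.2)) (by fun_prop) 0 0 ?_)))
      · rw [Prod.fst_zero, map_zero]; rfl
      · rw [Prod.fst_zero, map_zero, map_zero]; rfl
    filter_upwards [t1.eventually hL, t2.eventually h.actA_actA] with p h1 h2
    have hL₃ : L₃ p.1 = snocCLM ℂ^m (2 * k + 2) (L₂ p.1, (p.1 (Fin.last k)).2.2) := rfl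
    have hL₂ : L₂ p.1 = snocCLM ℂ^m (2 * k + 1) (L₁ p.1, (p.1 (Fin.last k)).2.1) := rfl
    have hL₁ : L₁ p.1 = snocCLM ℂ^m (2 * k) (initCLM ℂ^m (2 * k) (L₀ p.1),
      L₀ p.1 (Fin.last (2 * k)) + (p.1 (Fin.last k)).1) := rfl
    have he : Even (2 * k) := even_two_mul k
    have e3 : act Θ (2 * k + 2) = actA Θ := by rw [act_periodic, act_of_even he]
    have e2 : act Θ (2 * k + 1) = actB := act_of_odd (by simp)
    rw [hL₃]
    refine Eq.trans ?_ (chain_snoc (act Θ) (2 * k + 2) _ _ _).symm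
    rw [hL₂, chain_snoc, hL₁, chain_snoc, e3, e2, act_of_even he, chain_succ, h1, chain_succ,
      act_of_even he]
    exact congrArg (fun y => actA Θ ((p.1 (Fin.last k)).2.2, actB ((p.1 (Fin.last k)).2.1, y))) h2

/-- Chains of single flows as chains of triples. -/
lemma exists_chain_act_eq (h : IsReflexive Θ) (k : ℕ) :
    ∃ R : (Fin (2 * k) → ℂ^m) →L[ℂ] (Fin k → TripleSpace m),
      ∀ᶠ p : (Fin (2 * k) → ℂ^m) × GraphSpace m d in 𝓝 0,
        chain (act Θ) (2 * k) p.1 p.2 = chain (fun _ => triple Θ) k (R p.1) p.2 := by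
  induction k with
  | zero => exact ⟨0, Eventually.of_forall fun p => rfl⟩
  | succ k ih =>
    obtain ⟨R, hR⟩ := ih
    let V := Fin m → ℂ
    let π := (initCLM V (2 * k)).comp (initCLM V (2 * k + 1))
    let α : (Fin (2 * k + 2) → V) →L[ℂ] V := ContinuousLinearMap.proj (Fin.last (2 * k)).castSucc
    let β : (Fin (2 * k + 2) → V) →L[ℂ] V := ContinuousLinearMap.proj (Fin.last (2 * k + 1))
    -- Each pair of single flows is a triple with third time `0`.
    refine ⟨(snocCLM (V × V × V) k).comp ((R.comp π).prod (α.prod (β.prod 0))), ?_⟩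
    have t1 : Tendsto₀ (fun p : (Fin (2 * k + 2) → V) × GraphSpace m d => (π p.1, p.2)) := tendsto_cont
    have t2 := tendsto_actB.comp (Tendsto.prodMk_nhds (Continuous.tendsto'
      (f := fun p : (Fin (2 * k + 2) → V) × GraphSpace m d => β p.1) (by fun_prop) 0 0 rfl)
      (h.tendsto_actA.comp (Tendsto.prodMk_nhds (Continuous.tendsto'
      (f := fun p : (Fin (2 * k + 2) → V) × GraphSpace m d => α p.1) (by fun_prop) 0 0 rfl)
      ((h.tendsto_chain_act (2 * k)).comp t1))))
    filter_upwards [t1.eventually hR, t2.eventually h.actA_zero] with p h1 h2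
    have he : Even (2 * k) := even_two_mul k
    have e2 : act Θ (2 * k + 1) = actB := act_of_odd (by simp)
    refine Eq.trans ?_ (chain_snoc (fun _ => triple Θ) k (R (π p.1)) (α p.1, β p.1, 0) p.2).symm
    refine (chain_succ (act Θ) (2 * k + 1) p.1 p.2).trans ?_
    rw [chain_succ, e2, act_of_even he, ← h1]
    exact h2.symm

end IsReflexive

end Invariants

/-! ### Rank bounds at all base points and first integrals. -/

section Charts

variable {n m d : ℕ} {M : Set ℂ^n} {p : ℂ^n} {κ : Regularity}

/-- A bound for the ranks of the chains at the points of `M` propagates to all base points. -/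
lemma SegreChart.eventually_rk_chain_act_le (C : SegreChart M p m d) (hn : n = m + d)
    (hM : IsSubmanifold κ M d) (hp : p ∈ M) {k ρ : ℕ}
    (hρ : ∀ᶠ q in 𝓝 p, q ∈ M → ∀ C' : SegreChart M q m d, genericRank (segreChain C'.Θ k) 0 ≤ ρ) :
    ∀ᶠ y : (Fin k → ℂ^m) × GraphSpace m d in 𝓝 0,
      rk (fderiv ℂ (fun u => chain (act C.Θ) k u y.2) y.1) ≤ ρ := by
  have hR := C.isReflexive hn hM hp
  let V := Fin k → Fin m → ℂ
  let H : GraphSpace m d × V → ComplexifiedSpace m d := fun q => toX C.Θ (chain (act C.Θ) k q.2 q.1)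
  have hH : AnalyticAt ℂ H 0 := by
    refine AnalyticAt.comp_of_eq (analyticAt_toX (y := 0) C.analytic) (AnalyticAt.comp_of_eq
      (g := fun q : V × GraphSpace m d => chain (act C.Θ) k q.1 q.2)
      (f := fun q : GraphSpace m d × V => (q.2, q.1))
      (analyticAt_chain hR.analyticAt_act hR.act_apply_zero k) (analyticAt_snd.prod analyticAt_fst) rfl)
      (chain_zero_zero hR.act_apply_zero k)
  let T : V × GraphSpace m d → V →L[ℂ] ComplexifiedSpace m d := fun q =>
    fderiv ℂ (fun u => H (q.2, u)) q.1
  have hT : ∀ v, AnalyticAt ℂ (fun q => T q v) 0 := fun v =>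
    AnalyticAt.comp_of_eq (f := fun q : V × GraphSpace m d => (q.2, q.1))
      (analyticAt_fderiv_snd_apply hH v) (analyticAt_snd.prod analyticAt_fst) rfl
  let e := finBasis ℂ V
  let e' := finBasis ℂ (ComplexifiedSpace m d →L[ℂ] ℂ)
  -- At base points of `M` the minors of size `ρ + 1` vanish for small `u`, hence on a ball of fixed
  -- radius by the identity theorem. As `M` is maximal totally real, they then vanish at all base
  -- points near `0`.
  have key : ∀ (I : Fin (ρ + 1) → _) (J : Fin (ρ + 1) → _), ∀ᶠ q in 𝓝 0,
      minor (T q) (fun j => e (I j)) (fun i => e' (J i)) = 0 := by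
    intro I J
    have hg := analyticAt_minor (T := T) (x := 0) (fun j => e (I j)) (fun i => e' (J i))
      fun j => hT _
    refine C.eventually_eq_zero_prod hn hM hp hg ?_
    obtain ⟨ε, hε, hball⟩ := eventually_nhds_iff_ball.1 hg.eventually_analyticAt
    have t1 : Tendsto (fun q : V × ℂ^n => (q.1, C.emb q.2)) (𝓝 (0, p)) (𝓝 0) :=
      have := C.continuous_emb
      tendsto_cont (Prod.ext rfl C.emb_base)
    have t2 : Tendsto (fun q : V × ℂ^n => q.2) (𝓝 (0, p)) (𝓝 p) := continuousAt_snd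
    filter_upwards [t2.eventually hρ, t2.eventually (C.eventually_fderiv_segreChain hn hM hp k),
      t1.eventually (ball_mem_nhds _ hε)] with q h1 h2 h3 hq
    rw [dist_zero_right, Prod.norm_def, max_lt_iff] at h3
    obtain ⟨C', hC'⟩ := h2 hq
    have hA : AnalyticOnNhd ℂ (fun u => minor (T (u, C.emb q.2)) (fun j => e (I j))
        (fun i => e' (J i))) (ball 0 ε) := by
      intro u hu
      refine AnalyticAt.fun_comp (f := fun u => (u, C.emb q.2)) (hball _ ?_)
        (analyticAt_id.prod analyticAt_const)
      rw [mem_ball, dist_zero_right] at hu ⊢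
      rw [Prod.norm_def]
      exact max_lt hu h3.2
    refine hA.eqOn_zero_of_preconnected_of_eventuallyEq_zero (convex_ball _ _).isPreconnected
      (Metric.mem_ball_self hε) ?_ (by rw [mem_ball, dist_zero_right]; exact h3.1)
    filter_upwards [hC', eventually_rk_le_genericRank (segreChain C'.Θ k) 0] with u h4 h5
    have h6 : rk (T (u, C.emb q.2)) ≤ ρ := by
      change rk (fderiv ℂ (fun u => toX C.Θ (chain (act C.Θ) k u (C.emb q.2))) u) ≤ ρ
      rw [← h4]
      exact h5.trans (h1 hq C')
    exact minor_eq_zero_of_rk_le h6 _ _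
  have t3 : Tendsto₀ (fun q : V × GraphSpace m d => (q.2, q.1)) := tendsto_cont rfl
  filter_upwards [eventually_all.2 fun I => eventually_all.2 (key I),
    t3.eventually hH.eventually_analyticAt] with q hq hq2
  have h1 : rk (T q) ≤ ρ := rk_le_of_minor_eq_zero (minor_eq_zero_of_basis e e' hq)
  have d1 : HasFDerivAt (fun u => H (q.2, u)) (T q) q.1 :=
    (AnalyticAt.fun_comp (g := H) (f := fun u => (q.2, u)) hq2
      (analyticAt_const.prod analyticAt_id)).hasFDerivAt
  have d2 : HasFDerivAt (fun u => chain (act C.Θ) k u q.2) ((ofX m d).comp (T q)) q.1 :=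
    HasFDerivAt.comp (g := ofX m d) q.1 (ofX m d).hasFDerivAt d1
  rw [d2.fderiv]
  exact (rk_comp_le_right _ _).trans h1

/-- The first integrals of the two families of flows. -/
lemma SegreChart.exists_first_integrals (C : SegreChart M p m d) (hC : RegAt κ C.Θ 0)
    (hn : n = m + d) (hM : IsSubmanifold κ M d) (hp : p ∈ M) {ρ K : ℕ}
    (hρ : ∀ᶠ q in 𝓝 p, q ∈ M → ∀ (C' : SegreChart M q m d) k, genericRank (segreChain C'.Θ k) 0 ≤ ρ)
    (hK : ρ ≤ genericRank (segreChain C.Θ (2 * K)) 0) :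
    ∃ q, q + ρ = 2 * m + d ∧ ∃ f : GraphSpace m d → ℂ^q, AnalyticAt ℂ f 0 ∧ RegAt κ f 0 ∧
      Surjective (fderiv ℂ f 0) ∧ (∀ᶠ p in 𝓝 0, f (actA C.Θ p) = f p.2) ∧
      ∀ᶠ p in 𝓝 0, f (actB p) = f p.2 := by
  have hR := C.isReflexive hn hM hp
  have hQ0 : triple C.Θ 0 = 0 := hR.triple_zero.self_of_nhds
  obtain ⟨q, hq, f, hf, hfr, hfs, hfQ⟩ := SegreCR.exists_first_integrals (κ := κ) (K := K) (ρ := ρ)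
    hR.analyticAt_triple (hR.regAt_triple hC) hR.triple_zero hR.triple_inv (by
      intro k
      obtain ⟨L, hL⟩ := hR.exists_chain_triple_eq k
      have t1 : Tendsto₀ (fun q : (Fin k → TripleSpace m) × GraphSpace m d => (L q.1, q.2)) :=
        tendsto_cont
      filter_upwards [hL.eventually_nhds,
        t1.eventually (C.eventually_rk_chain_act_le hn hM hp (hρ.mono fun q h hq C' => h hq C' _)),
        t1.eventually (analyticAt_chain hR.analyticAt_act hR.act_apply_zero
          (2 * k + 1)).eventually_analyticAt] with q h1 h2 h3
      have t2 : Tendsto (fun u : Fin k → TripleSpace m => (u, q.2)) (𝓝 q.1) (𝓝 q) :=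
        tendsto_cont rfl
      have d1 : HasFDerivAt (fun u => chain (act C.Θ) (2 * k + 1) u q.2) _ (L q.1) :=
        (AnalyticAt.fun_comp (g := fun q : (Fin (2 * k + 1) → ℂ^m) × GraphSpace m d =>
          chain (act C.Θ) (2 * k + 1) q.1 q.2) (f := fun u => (u, q.2)) h3
          (analyticAt_id.prod analyticAt_const)).hasFDerivAt
      have d2 := (HasFDerivAt.comp (g := fun u => chain (act C.Θ) (2 * k + 1) u q.2) q.1 d1
        L.hasFDerivAt).congr_of_eventuallyEq (t2.eventually h1)
      rw [d2.fderiv]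
      exact (rk_comp_le_left _ _).trans h2) (by
      obtain ⟨R, hRc⟩ := hR.exists_chain_act_eq K
      rw [hR.genericRank_segreChain, le_genericRank_iff] at hK
      have t0 : Tendsto₀ R := R.tendsto_zero
      have t1 : Tendsto₀ (fun u : Fin (2 * K) → Fin m → ℂ => (u, (0 : GraphSpace m d))) :=
        tendsto_cont rfl
      refine t0.frequently ((hK.and_eventually ((t1.eventually hRc).eventually_nhds.and
        (t0.eventually (analyticAt_chain_zero (fun _ => hR.analyticAt_triple) (fun _ => hQ0)
          K).eventually_analyticAt))).mono ?_)
      rintro u ⟨h1, h2, h3⟩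
      have d2 := (HasFDerivAt.comp (g := fun u => chain (fun _ => triple C.Θ) K u 0) u
        h3.hasFDerivAt R.hasFDerivAt).congr_of_eventuallyEq h2
      rw [d2.fderiv] at h1
      exact h1.trans (rk_comp_le_left _ _))
  refine ⟨q, ?_, f, hf, hfr, hfs, ?_, ?_⟩
  · rw [hq]
    simp only [Module.finrank_prod, finrank_fin_fun]
    ring
  -- A triple in which only one time is nonzero is a single flow, so invariance under triples
  -- contains invariance under each of the two flows.
  · have t1 : Tendsto₀ (fun p : ActSpace m d => ((p.1, (0 : ℂ^m),
        (0 : ℂ^m)), p.2)) := tendsto_cont rfl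
    filter_upwards [t1.eventually hfQ, hR.tendsto_actA.eventually hR.actA_zero] with p h1 h2
    rw [← h1]
    change _ = f (actA C.Θ (0, actB (0, actA C.Θ p)))
    rw [IsReflexive.actB_zero, h2]
  · have t1 : Tendsto₀ (fun p : ActSpace m d => (((0 : ℂ^m), p.1,
        (0 : ℂ^m)), p.2)) := tendsto_cont rfl
    filter_upwards [t1.eventually hfQ, IsReflexive.tendsto_actB.eventually hR.actA_zero,
      continuousAt_snd.eventually hR.actA_zero] with p h1 h2 h3
    rw [← h1]
    change _ = f (actA C.Θ (0, actB (p.1, actA C.Θ (0, p.2))))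
    rw [h3, h2]

end Charts

/-! ### Holomorphic functions with real values on `M`. -/

section RealInvariants

/-- A maximal independent subfamily of `v` spans the same space, which contains `q` independent
vectors. -/
lemma exists_linearIndependent_selection {V : Type} [AddCommGroup V] [Module ℂ V] {ι : Type}
    [Finite ι] {q : ℕ} (v : ι → V) {w : Fin q → V} (hw : LinearIndependent ℂ w)
    (hwv : ∀ j, w j ∈ Submodule.span ℂ (Set.range v)) :
    ∃ a : Fin q → ι, LinearIndependent ℂ fun j => v (a j) := by
  obtain ⟨τ, a, ha, hspan, hli⟩ := exists_linearIndependent' ℂ v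
  have : Finite τ := Finite.of_injective a ha
  have : Fintype τ := Fintype.ofFinite τ
  have h1 : q ≤ Fintype.card τ := by
    have h2 : Submodule.span ℂ (Set.range w) ≤ Submodule.span ℂ (Set.range (v ∘ a)) := by
      rw [hspan, Submodule.span_le]
      rintro _ ⟨j, rfl⟩
      exact hwv j
    have := FiniteDimensional.span_of_finite ℂ (Set.finite_range (v ∘ a))
    have h3 := Submodule.finrank_mono h2
    rwa [finrank_span_eq_card hw, finrank_span_eq_card hli, Fintype.card_fin] at h3
  let e : Fin q ↪ τ := (Fin.castLEEmb h1).trans (Fintype.equivFin τ).symm.toEmbedding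
  exact ⟨fun j => a (e j), hli.comp e e.injective⟩

lemma linearIndependent_of_surjective {V : Type} [NormedAddCommGroup V] [NormedSpace ℂ V] {q : ℕ}
    {T : V →L[ℂ] ℂ^q} (hT : Surjective T) :
    LinearIndependent ℂ fun j => (ContinuousLinearMap.proj (R := ℂ) (φ := fun _ : Fin q => ℂ) j).comp T := by
  rw [Fintype.linearIndependent_iff]
  intro g hg j
  obtain ⟨v, hv⟩ := hT (Pi.single j 1)
  have h1 := DFunLike.congr_fun hg v
  simp only [sum_apply, smul_apply, ContinuousLinearMap.comp_apply, hv,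
    ContinuousLinearMap.proj_apply, zero_apply, smul_eq_mul] at h1
  simpa [Pi.single_apply] using h1

variable {n m d : ℕ} {M : Set ℂ^n} {p : ℂ^n} {κ : Regularity}

set_option maxHeartbeats 1600000 in
/-- Invariants of the two families of flows yield holomorphic functions that are real on `M`. -/
lemma SegreChart.exists_real_invariants (C : SegreChart M p m d) (hC : RegAt κ C.Θ 0)
    (hp : p ∈ M) {q : ℕ} {f : GraphSpace m d → ℂ^q} (hf : AnalyticAt ℂ f 0)
    (hfr : RegAt κ f 0) (hfs : Surjective (fderiv ℂ f 0))
    (hfA : ∀ᶠ p in 𝓝 0, f (actA C.Θ p) = f p.2) (hfB : ∀ᶠ p in 𝓝 0, f (actB p) = f p.2) :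
    ∃ h : Fin q → ℂ^n → ℂ, (∀ i, AnalyticAt ℂ (h i) p) ∧ (∀ i, RegAt κ (h i) p) ∧
      (LinearIndependent ℂ fun i => fderiv ℂ (h i) p) ∧
      ∀ᶠ t in 𝓝 p, t ∈ M → ∀ i, h i t = star (h i t) := by
  let A : ℂ^n →L[ℂ] ℂ^m × ℂ^d := C.coord
  let j : ℂ^m × ℂ^d →L[ℂ] GraphSpace m d := (fst ℂ _ _).prod ((snd ℂ _ _).prod 0)
  -- Invariance under the `(0,1)` flow makes `f` independent of `ζ`, so setting `ζ = 0` gives a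
  -- holomorphic function of the point `t` without loss.
  let h₀ : ℂ^n → ℂ^q := fun t => f (j (A (t - p)))
  let b : ℂ^m × ℂ^d →L[ℂ] ThetaSpace m d := (0 : _ →L[ℂ] ℂ^m).prod (ContinuousLinearMap.id ℂ _)
  -- Invariance under the `(1,0)` flow lets `z` be moved to `0`, which expresses `f` through `(ζ,
  -- ξ)` only. On `M` these are the conjugates of `(z, w)`, so the conjugated function `k₀` is
  -- holomorphic in `t` and agrees on `M` with the conjugate of `h₀`.
  let k : ℂ^m × ℂ^d → ℂ^q := fun x => f (0, conjTheta C.Θ (b x), x.1)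
  let k₀ : ℂ^n → ℂ^q := fun t => star (k (star (A (t - p))))
  have hA0 : A (p - p) = 0 := by rw [sub_self, map_zero]
  have hAa : AnalyticAt ℂ (fun t => A (t - p)) p :=
    (A.analyticAt _).fun_comp (analyticAt_id.fun_sub analyticAt_const)
  have hAr : RegAt κ (fun t => A (t - p)) p :=
    ((regAt_id p).sub (regAt_const p p)).clm_comp (A.restrictScalars ℝ)
  have hb0 : conjTheta C.Θ (b 0) = 0 := by
    rw [map_zero, conjTheta_eq]
    change star (C.Θ (star 0)) = 0
    rw [star_zero, C.theta_zero hp, star_zero]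
  have hk : AnalyticAt ℂ k 0 := AnalyticAt.comp_of_eq hf (analyticAt_const.prod
    ((AnalyticAt.comp_of_eq (analyticAt_conjTheta C.analytic) (b.analyticAt 0)
      (map_zero b)).prod analyticAt_fst)) (Prod.ext rfl (Prod.ext hb0 rfl))
  have hkr : RegAt κ k 0 := hfr.comp_of_eq ((regAt_const _ 0).prodMk
    (((regAt_conjTheta hC).comp_of_eq (regAt_clm (b.restrictScalars ℝ) 0)
      (map_zero b)).prodMk (regAt_fst 0))) (Prod.ext rfl (Prod.ext hb0 rfl))
  have hk₀ : AnalyticAt ℂ k₀ p := by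
    refine AnalyticAt.comp_of_eq (g := fun x => star (k (star x))) (f := fun t => A (t - p))
      (analyticAt_star_star ?_) hAa hA0
    rwa [star_zero]
  have hk₀r : RegAt κ k₀ p := by
    let S : ℂ^m × ℂ^d →L[ℝ] ℂ^m × ℂ^d := ((starL' ℝ : (ℂ^m × ℂ^d) ≃L[ℝ] (ℂ^m × ℂ^d)) : _ →L[ℝ] _)
    have h1 : RegAt κ (fun t => k (S (A (t - p)))) p :=
      hkr.comp_of_eq (hAr.clm_comp S) (by rw [hA0, map_zero])
    exact h1.clm_comp
      ((starL' ℝ : ℂ^q ≃L[ℝ] ℂ^q) : ℂ^q →L[ℝ] ℂ^q)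
  have hj0 : j (A (p - p)) = 0 := by rw [hA0, map_zero]
  have hh₀ : AnalyticAt ℂ h₀ p := AnalyticAt.comp_of_eq hf ((j.analyticAt _).fun_comp hAa) hj0
  have hh₀r : RegAt κ h₀ p := hfr.comp_of_eq (hAr.clm_comp (j.restrictScalars ℝ)) hj0
  have hfj : ∀ᶠ y in 𝓝 0, f y = f (j (y.1, y.2.1)) := by
    have t : Tendsto₀ (fun y : GraphSpace m d => (-y.2.2, y)) := tendsto_cont
    filter_upwards [t.eventually hfB] with y hy
    rw [← hy]
    simp only [actB, add_neg_cancel]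
    rfl
  have hh₀s : Surjective (fderiv ℂ h₀ p) := by
    let π : GraphSpace m d →L[ℂ] GraphSpace m d := j.comp ((fst ℂ _ _).prod
      ((fst ℂ _ _).comp (snd ℂ _ _)))
    have d1 : HasFDerivAt h₀ ((fderiv ℂ f 0).comp (j.comp A)) p := by
      have d := HasFDerivAt.comp (g := f) (f := fun t => (j.comp A) (t - p)) p
        (by rw [show (j.comp A) (p - p) = 0 from hj0]; exact hf.hasFDerivAt)
        ((j.comp A).hasFDerivAt.comp p ((hasFDerivAt_id p).sub_const p))
      exact d
    have d2 : HasFDerivAt (fun y => f (π y)) ((fderiv ℂ f 0).comp π) 0 := by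
      refine HasFDerivAt.comp (g := f) 0 ?_ π.hasFDerivAt
      rw [map_zero]
      exact hf.hasFDerivAt
    have d3 := hf.hasFDerivAt.unique (d2.congr_of_eventuallyEq hfj)
    intro c
    obtain ⟨y, hy⟩ := hfs c
    refine ⟨C.coord.symm (y.1, y.2.1), ?_⟩
    rw [d1.fderiv, ← hy, d3]
    change fderiv ℂ f 0 (j (C.coord (C.coord.symm (y.1, y.2.1)))) = _
    rw [C.coord.apply_symm_apply]
    rfl
  have hreal : ∀ᶠ t in 𝓝 p, t ∈ M → k₀ t = star (h₀ t) := by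
    have t1 : Tendsto (fun t => (-(C.emb t).1, C.emb t)) (𝓝 p) (𝓝 0) :=
      Tendsto.prodMk_nhds ((Continuous.tendsto' (f := fun y : GraphSpace m d => -y.1)
        (by fun_prop) 0 0 (by simp)).comp C.tendsto_emb) C.tendsto_emb
    filter_upwards [C.tendsto_emb.eventually hfj, t1.eventually hfA, C.theta_emb]
      with t h1 h2 h3 ht
    have e1 : f (C.emb t) = h₀ t := h1
    rw [← e1, ← h2]
    simp only [actA, add_neg_cancel, h3 ht]
    rfl
  -- These `2q` functions are real on `M` because `k₀` is conjugate to `h₀` there. Their span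
  -- contains the components of `h₀`, so `q` of them have independent differentials.
  let F : Fin q ⊕ Fin q → ℂ^n → ℂ := Sum.elim (fun i t => h₀ t i + k₀ t i)
    fun i t => Complex.I * (h₀ t i - k₀ t i)
  have hpi : ∀ {g : ℂ^n → ℂ^q}, AnalyticAt ℂ g p → ∀ i,
      AnalyticAt ℂ (fun t => g t i) p := fun hg i =>
    ((ContinuousLinearMap.proj (R := ℂ) (φ := fun _ : Fin q => ℂ) i).analyticAt _).fun_comp hg
  have hF : ∀ s, AnalyticAt ℂ (F s) p := by
    rintro (i | i)
    · exact (hpi hh₀ i).fun_add (hpi hk₀ i)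
    · exact analyticAt_const.fun_mul ((hpi hh₀ i).fun_sub (hpi hk₀ i))
  have hFr : ∀ s, RegAt κ (F s) p := by
    rintro (i | i)
    · exact (hh₀r.apply i).add (hk₀r.apply i)
    · exact (regAt_const _ _).mul ((hh₀r.apply i).sub (hk₀r.apply i))
  obtain ⟨a, ha⟩ := exists_linearIndependent_selection (fun s => fderiv ℂ (F s) p)
    (linearIndependent_of_surjective hh₀s) (fun i => by
      have e1 : (fun t => h₀ t i) = fun t => (2⁻¹ : ℂ) * F (Sum.inl i) t +
          (-Complex.I / 2) * F (Sum.inr i) t := by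
        funext t
        simp only [F, Sum.elim_inl, Sum.elim_inr]
        linear_combination ((h₀ t i - k₀ t i) / 2) * Complex.I_sq
      have d1 : HasFDerivAt (fun t => h₀ t i) _ p := (hasFDerivAt_pi'.1 hh₀.hasFDerivAt) i
      have d2 := ((hF (Sum.inl i)).hasFDerivAt.const_mul (2⁻¹ : ℂ)).fun_add
        ((hF (Sum.inr i)).hasFDerivAt.const_mul (-Complex.I / 2))
      rw [e1] at d1
      rw [d1.unique d2]
      exact add_mem (Submodule.smul_mem _ _ (Submodule.subset_span ⟨_, rfl⟩))
        (Submodule.smul_mem _ _ (Submodule.subset_span ⟨_, rfl⟩)))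
  refine ⟨fun i => F (a i), fun i => hF _, fun i => hFr _, ha, ?_⟩
  filter_upwards [hreal] with t ht htM i
  rcases a i with i | i
  · simp only [F, Sum.elim_inl, ht htM, Pi.star_apply, star_add, star_star]
    ring
  · simp only [F, Sum.elim_inr, ht htM, Pi.star_apply, star_mul', star_sub,
      Complex.star_def, Complex.conj_I, Complex.conj_conj]
    ring

end RealInvariants

/-! ### Superposition operators on spaces of continuous functions. -/

section Superposition

variable {I A B : Type} [TopologicalSpace I] [CompactSpace I] [NormedAddCommGroup A]
  [NormedSpace ℂ A] [NormedAddCommGroup B] [NormedSpace ℂ B]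

/-- The pointwise action of a multilinear map on continuous functions. -/
def liftForm {n : ℕ} (p : A [×n]→L[ℂ] B) : C(I, A) [×n]→L[ℂ] C(I, B) :=
  MultilinearMap.mkContinuous
    { toFun := fun v => ⟨fun t => p fun i => v i t, by fun_prop⟩
      map_update_add' := fun v i x y => by
        ext t
        have h : ∀ z : C(I, A), (fun j => Function.update v i z j t) =
            Function.update (fun j => v j t) i (z t) := fun z => by
          ext j; by_cases hj : j = i
          · subst hj; simp
          · simp [hj]
        simp only [ContinuousMap.coe_mk, ContinuousMap.add_apply]
        rw [h, h, h, ContinuousMap.add_apply, p.map_update_add]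
      map_update_smul' := fun v i c x => by
        ext t
        have h : ∀ z : C(I, A), (fun j => Function.update v i z j t) =
            Function.update (fun j => v j t) i (z t) := fun z => by
          ext j; by_cases hj : j = i
          · subst hj; simp
          · simp [hj]
        simp only [ContinuousMap.coe_mk, ContinuousMap.smul_apply]
        rw [h, h, ContinuousMap.smul_apply, p.map_update_smul] } ‖p‖ fun v => by
    refine (ContinuousMap.norm_le _ (by positivity)).2 fun t => ?_
    refine (p.le_opNorm _).trans ?_
    gcongr with i
    exact (v i).norm_coe_le_norm t

/-- Superposition with an analytic function is analytic in the space of continuous functions. -/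
lemma exists_superposition [CompleteSpace B] {G : A → B} (hG : AnalyticAt ℂ G 0) :
    ∃ N : C(I, A) → C(I, B), AnalyticAt ℂ N 0 ∧ ∀ᶠ v in 𝓝 0, ∀ t, N v t = G (v t) := by
  obtain ⟨p, r, hp⟩ := hG
  let P : FormalMultilinearSeries ℂ C(I, A) C(I, B) := fun n => liftForm (p n)
  have hrad : p.radius ≤ P.radius := FormalMultilinearSeries.radius_le_of_le fun n =>
    MultilinearMap.mkContinuous_norm_le _ (norm_nonneg _) _
  have hP := P.hasFPowerSeriesOnBall ((hp.r_pos.trans_le hp.r_le).trans_le hrad)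
  refine ⟨P.sum, hP.analyticAt, ?_⟩
  filter_upwards [Metric.eball_mem_nhds 0 hp.r_pos] with v hv t
  have hv' : v ∈ Metric.eball (0 : C(I, A)) P.radius :=
    Metric.eball_subset_eball (hp.r_le.trans hrad) hv
  have h1 := (hP.hasSum hv').mapL (ContinuousMap.evalCLM ℂ t)
  have h2 : v t ∈ Metric.eball (0 : A) r := by
    rw [Metric.mem_eball, edist_zero_right] at hv ⊢
    refine lt_of_le_of_lt ?_ hv
    rw [← ofReal_norm, ← ofReal_norm]
    exact ENNReal.ofReal_le_ofReal (v.norm_coe_le_norm t)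
  have h3 := hp.hasSum h2
  rw [zero_add] at h1 h3
  exact h1.unique h3

end Superposition

/-! ### Differential equations with analytic dependence on parameters. -/

section Solutions

open MeasureTheory

/-- The unit interval. -/
abbrev UI : Type := Icc (0 : ℝ) 1

/-- The extension of a function on the unit interval by constants. -/
def ext {W : Type} [TopologicalSpace W] (v : C(UI, W)) (s : ℝ) : W :=
  v (projIcc 0 1 zero_le_one s)

lemma continuous_ext {W : Type} [TopologicalSpace W] (v : C(UI, W)) : Continuous (ext v) :=
  v.continuous.comp continuous_projIcc

lemma ext_of_mem {W : Type} [TopologicalSpace W] (v : C(UI, W)) {s : ℝ} (hs : s ∈ Icc (0 : ℝ) 1) :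
    ext v s = v ⟨s, hs⟩ := by rw [ext, projIcc_of_mem _ hs]

variable {E X W : Type} [NormedAddCommGroup E] [NormedSpace ℂ E] [NormedAddCommGroup X]
  [NormedSpace ℂ X] [NormedAddCommGroup W] [NormedSpace ℂ W]

/-- Integration from `0`. -/
def primitive : C(UI, W) →L[ℂ] C(UI, W) :=
  LinearMap.mkContinuous
    { toFun := fun v => ⟨fun t => ∫ s in (0 : ℝ)..t, ext v s,
        (intervalIntegral.continuous_primitive
          (fun a b => (continuous_ext v).intervalIntegrable a b) 0).comp continuous_subtype_val⟩
      map_add' := fun v w => by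
        ext1 t
        exact intervalIntegral.integral_add ((continuous_ext v).intervalIntegrable _ _)
          ((continuous_ext w).intervalIntegrable _ _)
      map_smul' := fun c v => by
        ext1 t
        exact intervalIntegral.integral_smul c (ext v) } 1 fun v => by
    refine (ContinuousMap.norm_le _ (by positivity)).2 fun t => ?_
    rw [one_mul]
    refine (intervalIntegral.norm_integral_le_of_norm_le_const (C := ‖v‖)
      fun s _ => v.norm_coe_le_norm _).trans ?_
    rw [sub_zero, abs_of_nonneg t.2.1]
    exact mul_le_of_le_one_right (norm_nonneg _) t.2.2

/-- The solutions of an analytic family of differential equations `u' = G (Λ e, u)`, `u 0 = c e`,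
depend analytically on the parameter `e`. -/
lemma exists_solution_family [CompleteSpace E] [CompleteSpace W] {G : X × W → W} (hG : AnalyticAt ℂ G 0)
    (hG0 : G 0 = 0) (hGw : ∀ w, fderiv ℂ G 0 (0, w) = 0) (Λ : E →L[ℂ] C(UI, X)) (c : E →L[ℂ] W) :
    ∃ Φ : E → C(UI, W), AnalyticAt ℂ Φ 0 ∧ Φ 0 = 0 ∧ ∀ᶠ q : E × C(UI, W) in 𝓝 0,
      Continuous (fun s => G (ext (Λ q.1) s, ext q.2 s)) ∧
      ((∀ t : UI, q.2 t = c q.1 + ∫ s in (0 : ℝ)..t, G (ext (Λ q.1) s, ext q.2 s)) ↔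
        q.2 = Φ q.1) := by
  obtain ⟨N, hN, hNG⟩ := exists_superposition (I := UI) hG
  let pair : E × C(UI, W) →L[ℂ] C(UI, X × W) :=
    ((ContinuousLinearMap.compLeftContinuous ℂ UI (inl ℂ X W)).comp (Λ.comp (fst ℂ _ _))) +
    (ContinuousLinearMap.compLeftContinuous ℂ UI (inr ℂ X W)).comp
      (snd ℂ _ _)
  have hpair : ∀ q t, pair q t = (Λ q.1 t, q.2 t) := fun q t => by simp [pair]
  let k : W →L[ℂ] C(UI, W) := LinearMap.mkContinuous
    { toFun := fun w => ContinuousMap.const UI w, map_add' := fun _ _ => rfl,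
      map_smul' := fun _ _ => rfl } 1 fun w => by
    refine (ContinuousMap.norm_le _ (by positivity)).2 fun t => ?_
    rw [one_mul]; rfl
  -- The integral equation is solved by the implicit function theorem in the space of continuous
  -- functions. Since `G` has zero derivative in `w` at the origin, the linearization in the unknown
  -- function is the identity.
  let S : E × C(UI, W) → C(UI, W) := fun q => q.2 - k (c q.1) - primitive (N (pair q))
  have hp0 : pair 0 = 0 := map_zero pair
  have hNp : AnalyticAt ℂ (fun q => N (pair q)) 0 :=
    AnalyticAt.comp_of_eq hN (pair.analyticAt 0) hp0
  have hN0 : N 0 = 0 := by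
    ext1 t
    have := hNG.self_of_nhds t
    rw [this]
    exact hG0
  have hS : AnalyticAt ℂ S 0 := (analyticAt_snd.fun_sub
    ((k.analyticAt _).fun_comp ((c.analyticAt _).fun_comp analyticAt_fst))).fun_sub
    ((primitive.analyticAt _).fun_comp hNp)
  have hS0 : S 0 = 0 := by
    change (0 : C(UI, W)) - k (c 0) - primitive (N (pair 0)) = 0
    rw [map_zero, map_zero, hp0, hN0, map_zero, sub_zero, sub_zero]
  have hN' : ∀ v t, fderiv ℂ N 0 v t = fderiv ℂ G 0 (v t) := by
    intro v t
    let ev₁ : C(UI, W) →L[ℂ] W := ContinuousMap.evalCLM ℂ t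
    let ev₂ : C(UI, X × W) →L[ℂ] X × W := ContinuousMap.evalCLM ℂ t
    have d1 : HasFDerivAt (fun v => ev₁ (N v)) (ev₁.comp (fderiv ℂ N 0)) 0 :=
      HasFDerivAt.comp (g := ev₁) 0 ev₁.hasFDerivAt hN.hasFDerivAt
    have d2 : HasFDerivAt (fun v : C(UI, X × W) => G (ev₂ v)) ((fderiv ℂ G 0).comp ev₂) 0 :=
      HasFDerivAt.comp (g := G) 0 (hG.hasFDerivAt) ev₂.hasFDerivAt
    have d3 := d1.unique (d2.congr_of_eventuallyEq (hNG.mono fun v hv => hv t))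
    exact DFunLike.congr_fun d3 v
  obtain ⟨g, hg, hg0, -, hΦ⟩ := exists_implicit_inverse hS hS0 (by
    intro ξ
    have d1 : HasFDerivAt S (snd ℂ _ _ - k.comp (c.comp (fst ℂ _ _)) -
        primitive.comp ((fderiv ℂ N 0).comp pair)) 0 := by
      have dk : HasFDerivAt (fun q : E × C(UI, W) => k (c q.1))
          (k.comp (c.comp (fst ℂ E C(UI, W)))) 0 :=
        (k.comp (c.comp (fst ℂ E C(UI, W)))).hasFDerivAt
      refine HasFDerivAt.fun_sub (HasFDerivAt.fun_sub hasFDerivAt_snd dk) ?_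
      refine HasFDerivAt.comp (g := primitive) 0 (ContinuousLinearMap.hasFDerivAt (primitive (W := W))) ?_
      refine HasFDerivAt.comp (g := N) 0 ?_ pair.hasFDerivAt
      rw [hp0]
      exact hN.hasFDerivAt
    rw [d1.fderiv]
    have e1 : fderiv ℂ N 0 (pair (0, ξ)) = 0 := by
      ext1 t
      rw [hN', hpair, map_zero]
      exact hGw _
    change ξ - k (c 0) - primitive (fderiv ℂ N 0 (pair (0, ξ))) = ξ
    rw [e1, map_zero, map_zero, map_zero, sub_zero, sub_zero])
  have hin : AnalyticAt ℂ (fun e : E => (e, (0 : C(UI, W)))) 0 := analyticAt_id.prod analyticAt_const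
  refine ⟨fun e => (g (e, 0)).2, analyticAt_snd.fun_comp (AnalyticAt.comp_of_eq hg hin rfl), ?_, ?_⟩
  · change (g 0).2 = 0
    rw [hg0]; rfl
  · filter_upwards [hΦ, (pair.continuous.tendsto' 0 0 hp0).eventually hNG] with q h1 h2
    have e1 : (fun s => G (ext (Λ q.1) s, ext q.2 s)) = ext (N (pair q)) := by
      funext s
      rw [ext, ext, ext, h2, hpair]
    refine ⟨by rw [e1]; exact continuous_ext _, ?_⟩
    rw [← h1, e1]
    change _ ↔ q.2 - k (c q.1) - primitive (N (pair q)) = 0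
    rw [sub_sub, sub_eq_zero]
    constructor
    · exact fun h => ContinuousMap.ext h
    · exact fun h t => congrArg (fun v : C(UI, W) => v t) h

/-- The solutions of an analytic family of differential equations near the zero solution: they
depend analytically on the parameters and are unique among small functions. -/
lemma exists_analytic_flow [CompleteSpace E] [CompleteSpace W] {G : X × W → W}
    (hG : AnalyticAt ℂ G 0) (hG0 : G 0 = 0) (hGw : ∀ w, fderiv ℂ G 0 (0, w) = 0)
    (Λ : E →L[ℂ] C(UI, X)) (c : E →L[ℂ] W) :
    ∃ Φ : E → C(UI, W), AnalyticAt ℂ Φ 0 ∧ Φ 0 = 0 ∧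
      (∀ᶠ e in 𝓝 0, ext (Φ e) 0 = c e ∧ ∀ s ∈ Icc (0 : ℝ) 1,
        HasDerivWithinAt (ext (Φ e)) (G (ext (Λ e) s, ext (Φ e) s)) (Icc 0 1) s) ∧
      ∃ δ > 0, ∀ᶠ e in 𝓝 0, ∀ U : ℝ → W, (∀ s ∈ Icc (0 : ℝ) 1, ‖U s‖ < δ) → U 0 = c e →
        (∀ s ∈ Icc (0 : ℝ) 1, HasDerivWithinAt U (G (ext (Λ e) s, U s)) (Icc 0 1) s) →
        ∀ s ∈ Icc (0 : ℝ) 1, U s = ext (Φ e) s := by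
  obtain ⟨Φ, hΦ, hΦ0, hsol⟩ := exists_solution_family hG hG0 hGw Λ c
  refine ⟨Φ, hΦ, hΦ0, ?_, ?_⟩
  · have ht : Tendsto (fun e => (e, Φ e)) (𝓝 0) (𝓝 (0 : E × C(UI, W))) := by
      have := (continuousAt_id (x := (0 : E))).prodMk hΦ.continuousAt
      rw [ContinuousAt, id, hΦ0] at this
      exact this
    filter_upwards [ht.eventually hsol] with e he
    obtain ⟨hc, hiff⟩ := he
    have heq : ∀ s ∈ Icc (0 : ℝ) 1, ext (Φ e) s =
        c e + ∫ r in (0 : ℝ)..s, G (ext (Λ e) r, ext (Φ e) r) := fun s hs => by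
      rw [ext_of_mem _ hs]
      exact hiff.2 rfl ⟨s, hs⟩
    refine ⟨?_, fun s hs => ?_⟩
    · rw [heq 0 (by simp), intervalIntegral.integral_same, add_zero]
    · have h1 := (intervalIntegral.integral_hasDerivAt_right (hc.intervalIntegrable 0 s)
        hc.stronglyMeasurable.stronglyMeasurableAtFilter hc.continuousAt).const_add (c e)
      exact h1.hasDerivWithinAt.congr heq (heq s hs)
  · obtain ⟨δ, hδ, hball⟩ := Metric.eventually_nhds_iff.1 hsol
    refine ⟨δ, hδ, ?_⟩
    filter_upwards [ball_mem_nhds 0 hδ] with e he U hU hU0 hd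
    have hUc : ContinuousOn U (Icc 0 1) := fun s hs => (hd s hs).continuousWithinAt
    let v : C(UI, W) := ⟨fun t => U t, continuousOn_iff_continuous_domRestrict.1 hUc⟩
    have hv : ∀ s ∈ Icc (0 : ℝ) 1, ext v s = U s := fun s hs => ext_of_mem v hs
    have hnear : dist (e, v) 0 < δ := by
      rw [dist_zero_right, Prod.norm_def]
      refine max_lt (by simpa using he) ((ContinuousMap.norm_lt_iff _ hδ).2 fun t => hU t t.2)
    obtain ⟨hc, hiff⟩ := hball hnear
    have hvΦ : v = Φ e := hiff.1 fun t => by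
      have h1 := intervalIntegral.integral_eq_sub_of_hasDerivAt_of_le t.2.1
        (f := U) (f' := fun s => G (ext (Λ e) s, ext v s))
        (hUc.mono (Icc_subset_Icc_right t.2.2)) (fun s hs => by
          have hs' : s ∈ Ioo (0 : ℝ) 1 := ⟨hs.1, hs.2.trans_le t.2.2⟩
          have h2 := (hd s (Ioo_subset_Icc_self hs')).hasDerivAt (Icc_mem_nhds hs'.1 hs'.2)
          rwa [← hv s (Ioo_subset_Icc_self hs')] at h2) (hc.intervalIntegrable _ _)
      rw [h1, hU0, add_sub_cancel]; rfl
    intro s hs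
    rw [← hv s hs, hvΦ]

end Solutions

/-- A condition valid near a limit holds uniformly along the segment. -/
lemma eventually_forall_Icc {E T : Type} [TopologicalSpace E] [TopologicalSpace T] {e₀ : E}
    {t₀ : T} {f : E × ℝ → T} (hf : ∀ s, Tendsto f (𝓝 (e₀, s)) (𝓝 t₀)) {P : T → Prop}
    (hP : ∀ᶠ t in 𝓝 t₀, P t) : ∀ᶠ e in 𝓝 e₀, ∀ s ∈ Icc (0 : ℝ) 1, P (f (e, s)) :=
  isCompact_Icc.eventually_forall_of_forall_eventually fun s _ => (hf s).eventually hP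

lemma tendsto_ext {E W : Type} [NormedAddCommGroup E] [NormedAddCommGroup W] {Φ : E → C(UI, W)}
    {e₀ : E} (h : ContinuousAt Φ e₀) (h0 : Φ e₀ = 0) (s : ℝ) :
    Tendsto (fun q : E × ℝ => ext (Φ q.1) q.2) (𝓝 (e₀, s)) (𝓝 0) := by
  have h1 : Tendsto (fun q : E × ℝ => Φ q.1) (𝓝 (e₀, s)) (𝓝 0) := by
    have := h.tendsto.comp (continuousAt_fst (p := (e₀, s))).tendsto
    rwa [h0] at this
  refine squeeze_zero_norm (fun q => ?_) (tendsto_zero_iff_norm_tendsto_zero.1 h1)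
  exact (Φ q.1).norm_coe_le_norm _

/-! ### Integral curves of the complexified CR fields. -/

variable {m d : ℕ} {Θ : ThetaSpace m d → ℂ^d}

/-- The `w`-component of the complexified `(1,0)` field with `z`-component `x.1.1` at the point
`(z, w, ζ) = (x.1.2.1, x.2, x.1.2.2)`. -/
def crSlope (Θ : ThetaSpace m d → ℂ^d)
    (x : (ℂ^m × ℂ^m × ℂ^m) × ℂ^d) : Fin d → ℂ :=
  fderiv ℂ (conjTheta Θ) (x.1.2.1, x.1.2.2, Θ (x.1.2.2, x.1.2.1, x.2)) (x.1.1, 0, 0)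

/-- Directions `(a, b)` together with initial points `(z, w, ζ)`. -/
abbrev FlowSpace (m d : ℕ) : Type := (ℂ^m × ℂ^m) × GraphSpace m d

/-- The path `s ↦ (a, z + s a, ζ + s b)`. -/
def crPath (m d : ℕ) : FlowSpace m d →L[ℂ] C(UI, ℂ^m × ℂ^m × ℂ^m) :=
  toContinuousLinearMap
    { toFun := fun e => ⟨fun s => (e.1.1, e.2.1 + (s : ℝ) • e.1.1, e.2.2.2 + (s : ℝ) • e.1.2),
        by fun_prop⟩
      map_add' := fun e f => by
        ext1 s
        simp only [ContinuousMap.coe_mk, ContinuousMap.add_apply, Prod.fst_add, Prod.snd_add,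
          Prod.mk_add_mk, smul_add, Prod.mk.injEq]
        exact ⟨trivial, by abel, by abel⟩
      map_smul' := fun c e => by
        ext1 s
        simp only [ContinuousMap.coe_mk, ContinuousMap.smul_apply, Prod.smul_fst, Prod.smul_snd,
          Prod.smul_mk, RingHom.id_apply, smul_add, smul_comm c (s : ℝ)] }

lemma ext_crPath (e : FlowSpace m d) {s : ℝ} (hs : s ∈ Icc (0 : ℝ) 1) :
    ext (crPath m d e) s = (e.1.1, e.2.1 + s • e.1.1, e.2.2.2 + s • e.1.2) := by
  rw [ext_of_mem _ hs]; rfl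

/-- The two conjugations are real linear, so the chain rule applies over `ℝ` and its result is
compared with the complex differential. -/
lemma fderiv_conjTheta {x : ThetaSpace m d} (hΘ : AnalyticAt ℂ Θ (star x)) (v : ThetaSpace m d) :
    fderiv ℂ (conjTheta Θ) x v = star (fderiv ℂ Θ (star x) (star v)) := by
  have h1 : AnalyticAt ℂ (conjTheta Θ) x := analyticAt_star_star hΘ
  let S : ThetaSpace m d →L[ℝ] ThetaSpace m d :=
    ((starL' ℝ : ThetaSpace m d ≃L[ℝ] ThetaSpace m d) : ThetaSpace m d →L[ℝ] ThetaSpace m d)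
  let S' : ℂ^d →L[ℝ] ℂ^d := ((starL' ℝ : ℂ^d ≃L[ℝ] ℂ^d) : ℂ^d →L[ℝ] ℂ^d)
  have d1 : HasFDerivAt (conjTheta Θ)
      (S'.comp (((fderiv ℂ Θ (S x)).restrictScalars ℝ).comp S)) x :=
    HasFDerivAt.comp (g := S') x S'.hasFDerivAt (HasFDerivAt.comp (g := Θ) x
      ((show AnalyticAt ℂ Θ (S x) from hΘ).hasFDerivAt.restrictScalars ℝ)
      S.hasFDerivAt)
  have d2 := (h1.hasFDerivAt.restrictScalars ℝ).unique d1
  exact DFunLike.congr_fun d2 v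

namespace IsReflexive

lemma tendsto_graph_conj (h : IsReflexive Θ) : Tendsto₀ (fun y : GraphSpace m d =>
    ((y.1, y.2.2, Θ (y.2.2, y.1, y.2.1)) : ThetaSpace m d)) :=
  (tendsto_cont (f := fun y : GraphSpace m d => y.1) rfl).prodMk_nhds
    ((tendsto_cont (f := fun y : GraphSpace m d => y.2.2) rfl).prodMk_nhds h.continuousAt_graph)

/-- The complexified `(1,0)` fields annihilate the complex defining equations. -/
lemma fderiv_crSlope (h : IsReflexive Θ) : ∀ᶠ y : GraphSpace m d in 𝓝 0, ∀ a,
    fderiv ℂ Θ (y.2.2, y.1, y.2.1) (0, a, crSlope Θ ((a, y.1, y.2.2), y.2.1)) = 0 := by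
  have t0 : Tendsto₀ (fun y : GraphSpace m d => thetaArg m d y) := (thetaArg m d).tendsto_zero
  filter_upwards [h.tendsto_graph_conj.eventually h.apply_conj.eventually_nhds,
    h.tendsto_graph_conj.eventually h.conj.analytic.eventually_analyticAt, h.conj_apply,
    t0.eventually h.analytic.eventually_analyticAt] with y h1 h2 h3 h4 a
  let x : ThetaSpace m d := (y.1, y.2.2, Θ (y.2.2, y.1, y.2.1))
  let fz : ThetaSpace m d →L[ℂ] ℂ^m := fst ℂ _ _
  let fζ : ThetaSpace m d →L[ℂ] ℂ^m := (fst ℂ _ _).comp (snd ℂ _ _)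
  let fξ : ThetaSpace m d →L[ℂ] ℂ^d := (snd ℂ _ _).comp (snd ℂ _ _)
  have d1 : HasFDerivAt (fun a : ThetaSpace m d => ((fζ a, fz a, conjTheta Θ a) : ThetaSpace m d))
      (fζ.prod (fz.prod (fderiv ℂ (conjTheta Θ) x))) x :=
    fζ.hasFDerivAt.prodMk (fz.hasFDerivAt.prodMk h2.hasFDerivAt)
  have d2 : HasFDerivAt (fun a : ThetaSpace m d => Θ (fζ a, fz a, conjTheta Θ a))
      ((fderiv ℂ Θ (y.2.2, y.1, y.2.1)).comp
        (fζ.prod (fz.prod (fderiv ℂ (conjTheta Θ) x)))) x := by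
    refine HasFDerivAt.comp (g := Θ) x ?_ d1
    have e : ((fζ x, fz x, conjTheta Θ x) : ThetaSpace m d) = (y.2.2, y.1, y.2.1) := by
      change (y.2.2, y.1, conjTheta Θ (y.1, y.2.2, Θ (y.2.2, y.1, y.2.1))) = (y.2.2, y.1, y.2.1)
      rw [h3]
    rw [e]
    exact h4.hasFDerivAt
  -- The identity `apply_conj` is differentiated in the direction of `z`: its right side `ξ` does
  -- not change, and the slope is the `w`-component of the resulting direction.
  have d3 := d2.unique (fξ.hasFDerivAt.congr_of_eventuallyEq h1)
  exact DFunLike.congr_fun d3 (a, 0, 0)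

lemma analyticAt_crSlope (h : IsReflexive Θ) : AnalyticAt ℂ (crSlope Θ) 0 := by
  have hc := h.conj.analytic
  have h1 : AnalyticAt ℂ (fun x : (ℂ^m × ℂ^m × ℂ^m) × ℂ^d =>
      ((x.1.2.1, x.1.2.2, Θ (x.1.2.2, x.1.2.1, x.2)) : ThetaSpace m d)) 0 := by
    have e1 := (analyticAt_fst (𝕜 := ℂ) (p := (0 : (ℂ^m × ℂ^m × ℂ^m) × ℂ^d)))
    have e2 := (analyticAt_snd (𝕜 := ℂ)).fun_comp e1
    have e3 := (analyticAt_fst (𝕜 := ℂ)).fun_comp e2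
    have e4 := (analyticAt_snd (𝕜 := ℂ)).fun_comp e2
    exact e3.prod (e4.prod (AnalyticAt.comp_of_eq h.analytic (e4.prod (e3.prod analyticAt_snd)) rfl))
  have h2 := AnalyticAt.comp_of_eq (g := fderiv ℂ (conjTheta Θ)) hc.fderiv h1
    (by change (0, 0, Θ 0) = _; rw [h.theta_zero]; rfl)
  have h3 : AnalyticAt ℂ (fun x : (ℂ^m × ℂ^m × ℂ^m) × ℂ^d => ((x.1.1, 0, 0) : ThetaSpace m d)) 0 :=
    ((analyticAt_fst (𝕜 := ℂ)).fun_comp analyticAt_fst).prod analyticAt_const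
  exact ((ContinuousLinearMap.id ℂ (ThetaSpace m d →L[ℂ] ℂ^d)).analyticAt_bilinear _).comp₂
    h2 h3

/-- The integral curves of the complexified `(1,0)` and `(0,1)` fields. -/
lemma exists_crFlow (h : IsReflexive Θ) : ∃ Φ : FlowSpace m d → C(UI, ℂ^d),
    AnalyticAt ℂ Φ 0 ∧ Φ 0 = 0 ∧
    (∀ᶠ e : FlowSpace m d in 𝓝 0, ext (Φ e) 0 = e.2.2.1 ∧ ∀ s ∈ Icc (0 : ℝ) 1,
      HasDerivWithinAt (ext (Φ e))
        (crSlope Θ ((e.1.1, e.2.1 + s • e.1.1, e.2.2.2 + s • e.1.2), ext (Φ e) s)) (Icc 0 1) s) ∧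
    (∀ᶠ e : FlowSpace m d in 𝓝 0, e.1.2 = 0 → ∀ s ∈ Icc (0 : ℝ) 1,
      ext (Φ e) s = (actA Θ (s • e.1.1, e.2)).2.1) ∧
    (∀ᶠ e : FlowSpace m d in 𝓝 0, e.1.1 = 0 → ∀ s ∈ Icc (0 : ℝ) 1, ext (Φ e) s = e.2.2.1) ∧
    ∀ᶠ e : FlowSpace m d in 𝓝 0, e.1.2 = star e.1.1 → e.2.2.2 = star e.2.1 →
      Θ (e.2.2.2, e.2.1, e.2.2.1) = star e.2.2.1 → ∀ s ∈ Icc (0 : ℝ) 1,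
      Θ (e.2.2.2 + s • e.1.2, e.2.1 + s • e.1.1, ext (Φ e) s) = star (ext (Φ e) s) := by
  have hc := h.conj.analytic
  have hG := h.analyticAt_crSlope
  have hG0 : ∀ w, crSlope Θ (0, w) = 0 := fun w => map_zero (fderiv ℂ (conjTheta Θ) _)
  -- The slope is linear in the direction `a`, so at `a = 0` it vanishes identically in `w`.
  have hGw : ∀ w, fderiv ℂ (crSlope Θ) 0 (0, w) = 0 := by
    intro w
    have d1 : HasFDerivAt (fun w => crSlope Θ (0, w)) ((fderiv ℂ (crSlope Θ) 0).comp
        (inr ℂ (ℂ^m × ℂ^m × ℂ^m) ℂ^d)) 0 :=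
      HasFDerivAt.comp (g := crSlope Θ) 0 hG.hasFDerivAt
        (ContinuousLinearMap.hasFDerivAt (inr ℂ (ℂ^m × ℂ^m × ℂ^m) ℂ^d))
    have d2 := d1.unique ((hasFDerivAt_const 0 _).congr_of_eventuallyEq (.of_forall hG0))
    exact DFunLike.congr_fun d2 w
  let c : FlowSpace m d →L[ℂ] ℂ^d := (fst ℂ _ _).comp
    ((snd ℂ _ _).comp (snd ℂ _ _))
  obtain ⟨Φ, hΦ, hΦ0, hsol, δ, hδ, huniq⟩ := exists_analytic_flow hG (hG0 0) hGw (crPath m d) c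
  have hsmall : ∀ᶠ w : Fin d → ℂ in 𝓝 0, ‖w‖ < δ := by
    filter_upwards [ball_mem_nhds (0 : ℂ^d) hδ] with w hw
    simpa using hw
  have hshift : ∀ s, Tendsto (fun q : FlowSpace m d × ℝ => ((q.2 • q.1.1.1, q.1.2) :
      ActSpace m d)) (𝓝 (0, s)) (𝓝 0) := fun s =>
    tendsto_cont
  have hpath : ∀ s, Tendsto (fun q : FlowSpace m d × ℝ => ((q.1.2.1 + q.2 • q.1.1.1,
      ext (Φ q.1) q.2, q.1.2.2.2 + q.2 • q.1.1.2) : GraphSpace m d)) (𝓝 (0, s)) (𝓝 0) := fun s => by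
    have e1 : Tendsto (fun q : FlowSpace m d × ℝ => q.1.2.1 + q.2 • q.1.1.1) (𝓝 (0, s)) (𝓝 0) :=
      tendsto_cont
    have e2 : Tendsto (fun q : FlowSpace m d × ℝ => q.1.2.2.2 + q.2 • q.1.1.2) (𝓝 (0, s)) (𝓝 0) :=
      tendsto_cont
    exact e1.prodMk_nhds ((tendsto_ext hΦ.continuousAt hΦ0 s).prodMk_nhds e2)
  have hy : Tendsto₀ (fun e : FlowSpace m d => e.2) := tendsto_cont rfl
  have hA0 : Tendsto₀ (fun p => (actA Θ p).2.1) := by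
    have := (continuous_fst.comp continuous_snd).continuousAt.tendsto.comp h.analyticAt_actA.continuousAt.tendsto
    have e : actA Θ 0 = 0 := h.act_apply_zero 0
    rw [e] at this
    exact this
  have hd : ∀ (z a : ℂ^m) (s : ℝ), HasDerivAt (fun s : ℝ => z + s • a) a s := fun z a s => by
    simpa using ((hasDerivAt_id s).smul_const a).const_add z
  refine ⟨Φ, hΦ, hΦ0, ?_, ?_, ?_, ?_⟩
  · filter_upwards [hsol] with e he
    refine ⟨he.1, fun s hs => ?_⟩
    have := he.2 s hs
    rwa [ext_crPath e hs] at this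
  -- For `b = 0` the multiple flow with time `s • a` is a small solution of the same equation, so
  -- uniqueness identifies it with the solution curve.
  · filter_upwards [huniq, eventually_forall_Icc hshift (hA0.eventually hsmall),
      hy.eventually h.actA_zero, eventually_forall_Icc hshift h.eventually_apply_conj,
      eventually_forall_Icc hshift (h.tendsto_shift_conj.eventually hc.eventually_analyticAt)]
      with e h1 h2 h3 h4 h5 hb s hs
    refine (h1 (fun s => (actA Θ (s • e.1.1, e.2)).2.1) h2 ?_ (fun s hs => ?_) s hs).symm
    · change (actA Θ ((0 : ℝ) • e.1.1, e.2)).2.1 = e.2.2.1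
      rw [zero_smul, h3]
    · rw [ext_crPath e hs, hb, smul_zero, add_zero]
      change HasDerivWithinAt (fun s : ℝ => conjTheta Θ (e.2.1 + s • e.1.1, e.2.2.2,
        Θ (e.2.2.2, e.2.1, e.2.2.1))) (fderiv ℂ (conjTheta Θ) (e.2.1 + s • e.1.1, e.2.2.2,
        Θ (e.2.2.2, e.2.1 + s • e.1.1, _)) (e.1.1, 0, 0)) (Icc 0 1) s
      rw [show Θ (e.2.2.2, e.2.1 + s • e.1.1, (actA Θ (s • e.1.1, e.2)).2.1) = _ from h4 s hs]
      have d1 := (hd e.2.1 e.1.1 s).prodMk ((hasDerivAt_const s e.2.2.2).prodMk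
        (hasDerivAt_const s (Θ (e.2.2.2, e.2.1, e.2.2.1))))
      exact (((h5 s hs).hasFDerivAt.restrictScalars ℝ).comp_hasDerivAt s d1).hasDerivWithinAt
  · have t1 : Tendsto₀ (fun e : FlowSpace m d => e.2.2.1) :=
      tendsto_cont rfl
    filter_upwards [huniq, t1.eventually hsmall] with e h1 h2 ha s hs
    refine (h1 (fun _ => e.2.2.1) (fun _ _ => h2) rfl (fun s hs => ?_) s hs).symm
    rw [ext_crPath e hs, ha, show crSlope Θ ((0, e.2.1 + s • (0 : ℂ^m), e.2.2.2 + s • e.1.2),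
      e.2.2.1) = 0 from map_zero (fderiv ℂ (conjTheta Θ) _)]
    exact hasDerivWithinAt_const _ _ _
  -- For conjugate directions and a starting point satisfying the defining equation, the conjugate
  -- of `Θ` along the curve solves the same equation with the same initial value. Uniqueness shows
  -- that the defining equation persists along the curve.
  · have t0 : Tendsto₀ (fun y : GraphSpace m d => thetaArg m d y) :=
      (thetaArg m d).tendsto_zero
    have t2 : Tendsto₀ (fun y : GraphSpace m d => star (Θ (y.2.2, y.1, y.2.1))) := by
      have := (continuous_star (R := ℂ^d)).continuousAt.tendsto.comp h.continuousAt_graph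
      rwa [star_zero] at this
    have t3 : Tendsto₀ (fun y : GraphSpace m d => ((y.1, y.2.2, star y.2.1) : ThetaSpace m d)) := tendsto_cont
    filter_upwards [huniq, hsol, eventually_forall_Icc hpath (t2.eventually hsmall),
      eventually_forall_Icc hpath (t0.eventually h.analytic.eventually_analyticAt),
      eventually_forall_Icc hpath h.fderiv_crSlope,
      eventually_forall_Icc hpath (t3.eventually h.apply_conj)]
      with e h1 h2 h3 h4 h5 h6 hb hζ hM s hs
    have hbs : ∀ s : ℝ, e.2.2.2 + s • e.1.2 = star (e.2.1 + s • e.1.1) := fun s => by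
      rw [hb, hζ, star_add, star_smul, star_trivial s]
    refine star_injective ?_
    rw [star_star]
    refine h1 (fun s => star (Θ (e.2.2.2 + s • e.1.2, e.2.1 + s • e.1.1, ext (Φ e) s))) h3 ?_
      (fun s hs => ?_) s hs
    · simp only [zero_smul, add_zero]
      rw [h2.1]
      exact (congrArg star hM).trans (star_star _)
    · have d0 := h2.2 s hs
      rw [ext_crPath e hs] at d0 ⊢
      have d1 := (hd e.2.2.2 e.1.2 s).hasDerivWithinAt.prodMk
        ((hd e.2.1 e.1.1 s).hasDerivWithinAt.prodMk d0)
      have d2 := (((h4 s hs).hasFDerivAt.restrictScalars ℝ).comp_hasDerivWithinAt s d1).star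
      refine d2.congr_deriv ?_
      have e1 : ((e.1.2, e.1.1, crSlope Θ ((e.1.1, e.2.1 + s • e.1.1, e.2.2.2 + s • e.1.2),
          ext (Φ e) s)) : ThetaSpace m d) = (e.1.2, 0, 0) + (0, e.1.1,
          crSlope Θ ((e.1.1, e.2.1 + s • e.1.1, e.2.2.2 + s • e.1.2), ext (Φ e) s)) := by simp
      have e2 : Θ (e.2.2.2 + s • e.1.2, e.2.1 + s • e.1.1,
          star (Θ (e.2.2.2 + s • e.1.2, e.2.1 + s • e.1.1, ext (Φ e) s))) = star (ext (Φ e) s) := by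
        have e3 : star (Θ (e.2.2.2 + s • e.1.2, e.2.1 + s • e.1.1, ext (Φ e) s)) = conjTheta Θ
            (e.2.1 + s • e.1.1, e.2.2.2 + s • e.1.2, star (ext (Φ e) s)) := by
          rw [conjTheta, hbs, star_star, star_star]
        rw [e3]
        exact h6 s hs
      have e4 : star ((e.2.1 + s • e.1.1, e.2.2.2 + s • e.1.2, star (ext (Φ e) s)) : ThetaSpace m d)
          = (e.2.2.2 + s • e.1.2, e.2.1 + s • e.1.1, ext (Φ e) s) := by
        rw [hbs]; simp [Prod.star_def]
      change star (fderiv ℂ Θ (e.2.2.2 + s • e.1.2, e.2.1 + s • e.1.1, ext (Φ e) s)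
        (e.1.2, e.1.1, crSlope Θ ((e.1.1, e.2.1 + s • e.1.1, e.2.2.2 + s • e.1.2), ext (Φ e) s))) =
        fderiv ℂ (conjTheta Θ) (e.2.1 + s • e.1.1, e.2.2.2 + s • e.1.2,
          Θ (e.2.2.2 + s • e.1.2, e.2.1 + s • e.1.1, _)) (e.1.1, 0, 0)
      rw [e1, map_add, h5 s hs e.1.1, add_zero, e2,
        fderiv_conjTheta (by rw [e4]; exact h4 s hs), e4]
      simp [Prod.star_def, hb]

end IsReflexive

/-! ### CR curves and CR orbits. -/

section Curves

variable {n : ℕ} {M N U : Set ℂ^n} {x y : ℂ^n}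

lemma tangentSpace_mono (h : M ⊆ N) (x : ℂ^n) : tangentSpace M x ≤ tangentSpace N x :=
  fun _ hv f hf hN => hv f hf (hN.filter_mono (nhdsWithin_mono x h))

lemma tangentSpace_inter (hU : U ∈ 𝓝 x) : tangentSpace (M ∩ U) x = tangentSpace M x := by
  have e : 𝓝[M ∩ U] x = 𝓝[M] x := nhdsWithin_inter_of_mem' (mem_nhdsWithin_of_mem_nhds hU)
  ext v
  change (∀ f : ℂ^n → ℝ, AnalyticAt ℝ f x → (∀ᶠ y in 𝓝[M ∩ U] x, f y = 0) → fderiv ℝ f x v = 0) ↔ _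
  rw [e]
  rfl

lemma CRStep.mono (h : M ⊆ N) (hs : CRStep M x y) : CRStep N x y := by
  obtain ⟨γ, h1, h2, h3, h4⟩ := hs
  exact ⟨γ, h1, h2, h3, fun t ht => ⟨h (h4 t ht).1, tangentSpace_mono h _ (h4 t ht).2.1,
    tangentSpace_mono h _ (h4 t ht).2.2⟩⟩

lemma CRStep.symm (hs : CRStep M x y) : CRStep M y x := by
  obtain ⟨γ, h1, h2, h3, h4⟩ := hs
  have hmaps : MapsTo (fun s : ℝ => 1 - s) (Icc 0 1) (Icc 0 1) := fun s hs =>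
    ⟨by linarith [hs.2], by linarith [hs.1]⟩
  refine ⟨fun s => γ (1 - s), h1.comp (by fun_prop) hmaps, by simpa using h3, by simpa using h2,
    fun t ht => ⟨(h4 _ (hmaps ht)).1, ?_⟩⟩
  have d1 : HasDerivWithinAt γ (derivWithin γ (Icc 0 1) (1 - t)) (Icc 0 1) (1 - t) :=
    (h1.differentiableOn one_ne_zero _ (hmaps ht)).hasDerivWithinAt
  have d2 : HasDerivWithinAt (fun s : ℝ => 1 - s) (-1) (Icc 0 1) t :=
    ((hasDerivAt_id t).const_sub 1).hasDerivWithinAt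
  have d3 := (d1.scomp t d2 hmaps).derivWithin (uniqueDiffOn_Icc zero_lt_one t ht)
  change derivWithin (γ ∘ fun s => 1 - s) (Icc 0 1) t ∈ _
  rw [d3, neg_one_smul]
  obtain ⟨h5, h6⟩ := (h4 _ (hmaps ht)).2
  refine ⟨(tangentSpace M (γ (1 - t))).neg_mem h5, ?_⟩
  rw [smul_neg]
  exact (tangentSpace M (γ (1 - t))).neg_mem h6

lemma crOrbit_mono (h : M ⊆ N) (x : ℂ^n) : crOrbit M x ⊆ crOrbit N x :=
  fun _ hy => Relation.ReflTransGen.mono (r := CRStep M) (p := CRStep N) (fun _ _ => CRStep.mono h)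
    _ _ hy

lemma mem_crOrbit_symm (h : y ∈ crOrbit M x) : x ∈ crOrbit M y := by
  induction h with
  | refl => exact .refl
  | tail _ hs ih => exact .head hs.symm ih

lemma crOrbit_subset (hx : x ∈ M) : crOrbit M x ⊆ M := fun y hy => by
  rcases Relation.ReflTransGen.cases_tail hy with h | ⟨z, -, γ, -, -, h3, h4⟩
  · exact h ▸ hx
  · exact h3 ▸ (h4 1 (by simp)).1

/-- A holomorphic function with real values on `M` is constant along complex tangent curves. -/
lemma CRStep.eq_of_real {h : ℂ^n → ℂ} (hh : ∀ x ∈ M, AnalyticAt ℂ h x)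
    (hr : ∀ x ∈ M, h x = star (h x)) (hs : CRStep M x y) : h y = h x := by
  obtain ⟨γ, h1, h2, h3, h4⟩ := hs
  have hzero : ∀ t ∈ Icc (0 : ℝ) 1, HasDerivWithinAt (fun s => h (γ s)) 0 (Icc 0 1) t := by
    intro t ht
    obtain ⟨hM, hv, hIv⟩ := h4 t ht
    have d0 : HasDerivWithinAt γ (derivWithin γ (Icc 0 1) t) (Icc 0 1) t :=
      (h1.differentiableOn one_ne_zero _ ht).hasDerivWithinAt
    have d1 := ((hh _ hM).hasFDerivAt.restrictScalars ℝ).comp_hasDerivWithinAt t d0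
    have him : ∀ v ∈ tangentSpace M (γ t), (fderiv ℂ h (γ t) v).im = 0 := fun v hv => by
      have a1 : AnalyticAt ℝ (fun x => imCLM (h x)) (γ t) :=
        (imCLM.analyticAt _).fun_comp (hh _ hM).restrictScalars
      have a2 := hv _ a1 (by
        filter_upwards [self_mem_nhdsWithin] with x hx
        exact conj_eq_iff_im.1 (hr x hx).symm)
      have d2 : HasFDerivAt (fun x => imCLM (h x))
          (imCLM.comp ((fderiv ℂ h (γ t)).restrictScalars ℝ)) (γ t) :=
        HasFDerivAt.comp (g := imCLM) _ imCLM.hasFDerivAt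
          ((hh _ hM).hasFDerivAt.restrictScalars ℝ)
      rw [d2.fderiv] at a2
      exact a2
    -- The differential is complex linear and real on tangent vectors. Applied to `v` it has no
    -- imaginary part, and applied to `i v` it shows that there is no real part either.
    have e1 := him _ hv
    have e2 := him _ hIv
    rw [map_smul, smul_eq_mul, Complex.I_mul_im] at e2
    exact d1.congr_deriv (Complex.ext e2 e1)
  have := constant_of_derivWithin_zero (f := fun s => h (γ s)) (a := 0) (b := 1)
    (fun t ht => (hzero t ht).differentiableWithinAt)
    (fun t ht => (hzero t (Ico_subset_Icc_self ht)).derivWithin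
      (uniqueDiffOn_Icc zero_lt_one t (Ico_subset_Icc_self ht))) 1 (by simp)
  rwa [h2, h3] at this

lemma eq_of_mem_crOrbit {h : ℂ^n → ℂ} (hh : ∀ x ∈ M, AnalyticAt ℂ h x)
    (hr : ∀ x ∈ M, h x = star (h x)) (hy : y ∈ crOrbit M x) : h y = h x := by
  induction hy with
  | refl => rfl
  | tail _ hs ih => rw [hs.eq_of_real hh hr, ih]

end Curves

/-! ### An analytic flow joining the Segre flows to CR curves. -/

variable {n m d : ℕ} {M : Set ℂ^n} {p : ℂ^n} (C : SegreChart M p m d)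

/-- The complex tangent vector of `M` with `z`-component `a`. -/
def SegreChart.crVector (y : GraphSpace m d) (a : ℂ^m) : Fin n → ℂ :=
  C.coord.symm (a, crSlope C.Θ ((a, y.1, y.2.2), y.2.1))

lemma crSlope_smul {Θ : ThetaSpace m d → ℂ^d} (c : ℂ) (a z ζ : ℂ^m)
    (w : ℂ^d) : crSlope Θ ((c • a, z, ζ), w) = c • crSlope Θ ((a, z, ζ), w) := by
  have e : ((c • a, 0, 0) : ThetaSpace m d) = c • (a, 0, 0) := by simp
  exact (congrArg _ e).trans (map_smul _ _ _)

lemma SegreChart.crVector_smul (c : ℂ) (y : GraphSpace m d) (a : ℂ^m) :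
    C.crVector y (c • a) = c • C.crVector y a := by
  rw [crVector, crVector, crSlope_smul, ← map_smul]; rfl

/-- The flow of the complexified complex tangent fields: it restricts to the multiple flows of the
`(1,0)` and of the `(0,1)` fields, and its real form follows complex tangent curves. -/
lemma SegreChart.exists_crFlow {κ : Regularity} (hn : n = m + d) (hM : IsSubmanifold κ M d)
    (hp : p ∈ M) : ∃ F : FlowSpace m d → GraphSpace m d, AnalyticAt ℂ F 0 ∧ F 0 = 0 ∧
      (∀ᶠ q : ActSpace m d in 𝓝 0, F ((q.1, 0), q.2) = actA C.Θ q) ∧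
      (∀ᶠ q : ActSpace m d in 𝓝 0, F ((0, q.1), q.2) = actB q) ∧
      ∀ V ∈ 𝓝 p, ∀ᶠ q : ℂ^m × ℂ^n in 𝓝 (0, p), q.2 ∈ M →
        C.emb (C.proj (F ((q.1, star q.1), C.emb q.2))) = F ((q.1, star q.1), C.emb q.2) ∧
        CRStep (M ∩ V) q.2 (C.proj (F ((q.1, star q.1), C.emb q.2))) := by
  have h := C.isReflexive hn hM hp
  obtain ⟨Φ, hΦ, hΦ0, hsol, hA, hB, hreal⟩ := h.exists_crFlow
  have hembproj : ∀ y : GraphSpace m d, y.2.2 = star y.1 → C.emb (C.proj y) = y := by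
    intro y hy
    have e : C.coord (C.proj y - p) = (y.1, y.2.1) := by simp [SegreChart.proj]
    change ((C.coord (C.proj y - p)).1, (C.coord (C.proj y - p)).2,
      star (C.coord (C.proj y - p)).1) = y
    rw [e, ← hy]
  -- The curve moves `z` with velocity `a` and `ζ` with velocity `b`, both constant, and `w` by the
  -- solution of the differential equation. The wanted map is its value at time `1`.
  let path : FlowSpace m d → ℝ → GraphSpace m d := fun e s =>
    (e.2.1 + s • e.1.1, ext (Φ e) s, e.2.2.2 + s • e.1.2)
  have hpath : ∀ s, Tendsto (fun q : FlowSpace m d × ℝ => path q.1 q.2) (𝓝 (0, s)) (𝓝 0) := by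
    intro s
    have e1 : Tendsto (fun q : FlowSpace m d × ℝ => q.1.2.1 + q.2 • q.1.1.1) (𝓝 (0, s)) (𝓝 0) :=
      tendsto_cont
    have e2 : Tendsto (fun q : FlowSpace m d × ℝ => q.1.2.2.2 + q.2 • q.1.1.2) (𝓝 (0, s)) (𝓝 0) :=
      tendsto_cont
    exact e1.prodMk_nhds ((tendsto_ext hΦ.continuousAt hΦ0 s).prodMk_nhds e2)
  let e₀ : ℂ^m × ℂ^n → FlowSpace m d := fun q => ((q.1, star q.1), C.emb q.2)
  have he₀ : Tendsto e₀ (𝓝 (0, p)) (𝓝 0) := by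
    have e1 : Tendsto (fun q : ℂ^m × ℂ^n => (q.1, star q.1)) (𝓝 (0, p)) (𝓝 0) := tendsto_cont
    exact e1.prodMk_nhds (C.tendsto_emb.comp (continuousAt_snd (p := ((0 : ℂ^m), p))))
  have ht : Tendsto (fun q : ℂ^m × ℂ^n => q.2) (𝓝 (0, p)) (𝓝 p) :=
    continuousAt_snd (p := ((0 : ℂ^m), p))
  have hcurve : ∀ᶠ q : ℂ^m × ℂ^n in 𝓝 (0, p), q.2 ∈ M →
      C.proj (path (e₀ q) 0) = q.2 ∧ ∀ s ∈ Icc (0 : ℝ) 1, C.proj (path (e₀ q) s) ∈ M ∧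
        HasDerivWithinAt (fun s => C.proj (path (e₀ q) s)) (C.crVector (path (e₀ q) s) q.1)
          (Icc 0 1) s := by
    filter_upwards [he₀.eventually hreal, he₀.eventually hsol, ht.eventually C.theta_emb,
      he₀.eventually (eventually_forall_Icc hpath (C.tendsto_proj.eventually C.mem_iff))]
      with q h1 h2 h3 h4 hqM
    refine ⟨?_, fun s hs => ⟨?_, ?_⟩⟩
    · have e1 : path (e₀ q) 0 = C.emb q.2 := by
        simp only [path, zero_smul, add_zero, h2.1]
        rfl
      rw [e1, C.proj_emb]
    · have e1 := h1 rfl rfl (h3 hqM) s hs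
      have e2 : (e₀ q).2.2.2 + s • (e₀ q).1.2 = star ((e₀ q).2.1 + s • (e₀ q).1.1) := by
        rw [star_add, star_smul, star_trivial s]; rfl
      have e3 : C.coord (C.proj (path (e₀ q) s) - p) = ((path (e₀ q) s).1, (path (e₀ q) s).2.1) := by
        simp [SegreChart.proj]
      rw [h4 s hs, e3, ← e1, e2]
    · have d1 : HasDerivAt (fun s : ℝ => (e₀ q).2.1 + s • (e₀ q).1.1) (e₀ q).1.1 s := by
        simpa using ((hasDerivAt_id s).smul_const (e₀ q).1.1).const_add (e₀ q).2.1
      have d2 := d1.hasDerivWithinAt.prodMk (h2.2 s hs)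
      let S : ℂ^m × ℂ^d →L[ℝ] ℂ^n := (C.coord.symm : ℂ^m × ℂ^d →L[ℂ] ℂ^n).restrictScalars ℝ
      exact (S.hasFDerivAt.comp_hasDerivWithinAt s d2).const_add p
  -- For small `a` the CR vector is the initial velocity of a curve in `M`, hence tangent. A general
  -- `a` is first scaled down by a positive real, which the real tangent space does not notice.
  have htan : ∀ᶠ t in 𝓝 p, t ∈ M → ∀ a, C.crVector (C.emb t) a ∈ tangentSpace M t := by
    rw [nhds_prod_eq, eventually_prod_iff] at hcurve
    obtain ⟨Pa, hPa, Pt, hPt, hc⟩ := hcurve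
    filter_upwards [hPt] with t h1 htM a
    have hs0 : Tendsto (fun s : ℝ => s • a) (𝓝[>] 0) (𝓝 0) :=
      (tendsto_cont (f := fun s : ℝ => s • a) (zero_smul ℝ a)).mono_left nhdsWithin_le_nhds
    obtain ⟨ε, hε, hε0⟩ := ((hs0.eventually hPa).and self_mem_nhdsWithin).exists
    obtain ⟨h2, h3⟩ := hc hε h1 htM
    have hε0' : (0 : ℝ) < ε := hε0
    have h0 : (0 : ℝ) ∈ Icc (0 : ℝ) 1 := by simp
    have e1 : path (e₀ (ε • a, t)) 0 = C.emb t := by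
      have e2 : (path (e₀ (ε • a, t)) 0).2.2 = star (path (e₀ (ε • a, t)) 0).1 := by
        simp only [path, zero_smul, add_zero]; rfl
      rw [← hembproj _ e2, h2]
    have hv : C.crVector (C.emb t) (ε • a) ∈ tangentSpace M t := by
      intro f hf hfM
      have d1 := (h3 0 h0).2
      rw [e1] at d1
      have hf' : HasFDerivAt f (fderiv ℝ f t) (C.proj (path (e₀ (ε • a, t)) 0)) := by
        rw [h2]; exact hf.hasFDerivAt
      have d2 := hf'.comp_hasDerivWithinAt (0 : ℝ) d1
      have t1 : Tendsto (fun s => C.proj (path (e₀ (ε • a, t)) s)) (𝓝[Icc 0 1] 0) (𝓝[M] t) := by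
        refine tendsto_nhdsWithin_iff.2 ⟨?_, ?_⟩
        · have := d1.continuousWithinAt.tendsto
          rwa [h2] at this
        · filter_upwards [self_mem_nhdsWithin] with s hs
          exact (h3 s hs).1
      have d3 : HasDerivWithinAt (f ∘ fun s => C.proj (path (e₀ (ε • a, t)) s)) 0 (Icc 0 1) 0 :=
        (hasDerivWithinAt_const _ _ (0 : ℝ)).congr_of_eventuallyEq_of_mem (t1.eventually hfM) h0
      exact (uniqueDiffOn_Icc zero_lt_one 0 h0).eq_deriv _ d2 d3
    have e3 : C.crVector (C.emb t) a = ε⁻¹ • C.crVector (C.emb t) (ε • a) := by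
      have := C.crVector_smul (ε : ℂ) (C.emb t) a
      rw [Complex.coe_smul, Complex.coe_smul] at this
      rw [this, smul_smul, inv_mul_cancel₀ hε0'.ne', one_smul]
    rw [e3]
    exact (tangentSpace M t).smul_mem _ hv
  have hy₁ : Tendsto (fun q : ActSpace m d => ((q.1, 0), q.2)) (𝓝 0)
      (𝓝 (0 : FlowSpace m d)) := tendsto_cont rfl
  have hy₂ : Tendsto (fun q : ActSpace m d => ((0, q.1), q.2)) (𝓝 0)
      (𝓝 (0 : FlowSpace m d)) := tendsto_cont rfl
  refine ⟨fun e => path e 1, ?_, ?_, ?_, ?_, fun V hV => ?_⟩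
  · have ev : AnalyticAt ℂ (fun e : FlowSpace m d => ext (Φ e) 1) 0 :=
      ((ContinuousMap.evalCLM ℂ (projIcc (0 : ℝ) 1 zero_le_one 1) :
        C(UI, ℂ^d) →L[ℂ] ℂ^d).analyticAt _).fun_comp hΦ
    have e1 := (analyticAt_fst (𝕜 := ℂ) (p := (0 : FlowSpace m d)))
    have e2 := (analyticAt_snd (𝕜 := ℂ) (p := (0 : FlowSpace m d)))
    have e3 := (((analyticAt_fst (𝕜 := ℂ)).fun_comp e2).fun_add
      ((analyticAt_fst (𝕜 := ℂ)).fun_comp e1)).prod (ev.prod (((analyticAt_snd (𝕜 := ℂ)).fun_comp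
        ((analyticAt_snd (𝕜 := ℂ)).fun_comp e2)).fun_add ((analyticAt_snd (𝕜 := ℂ)).fun_comp e1)))
    simpa only [path, one_smul] using e3
  · simp only [path, hΦ0]
    simp [ext]
  · filter_upwards [hy₁.eventually hA] with q hq
    have := hq rfl 1 (by simp)
    simp only [path, one_smul, this, add_zero]
    rfl
  · filter_upwards [hy₂.eventually hB] with q hq
    have := hq rfl 1 (by simp)
    simp only [path, one_smul, this, add_zero]
    rfl
  · let arg : FlowSpace m d × ℝ → (ℂ^m × ℂ^m × ℂ^m) × ℂ^d := fun q =>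
      ((q.1.1.1, (path q.1 q.2).1, (path q.1 q.2).2.2), (path q.1 q.2).2.1)
    have harg : ∀ s, Tendsto arg (𝓝 (0, s)) (𝓝 0) := fun s => by
      have e1 : Tendsto (fun q : FlowSpace m d × ℝ => q.1.1.1) (𝓝 (0, s)) (𝓝 0) := tendsto_cont rfl
      have e2 : Tendsto (fun q : FlowSpace m d × ℝ => (path q.1 q.2).1) (𝓝 (0, s)) (𝓝 0) :=
        (continuousAt_fst (p := (0 : GraphSpace m d))).tendsto.comp (hpath s)
      have e3 := (continuousAt_snd (p := (0 : GraphSpace m d))).tendsto.comp (hpath s)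
      exact (e1.prodMk_nhds (e2.prodMk_nhds (e3.snd_nhds))).prodMk_nhds e3.fst_nhds
    filter_upwards [hcurve, he₀.eventually (eventually_forall_Icc hpath
      (C.tendsto_proj.eventually htan)), he₀.eventually (eventually_forall_Icc hpath
      (C.tendsto_proj.eventually (isOpen_interior.mem_nhds (mem_interior_iff_mem_nhds.2 hV)))),
      he₀.eventually (eventually_forall_Icc harg
        (h.analyticAt_crSlope.eventually_analyticAt))] with q h1 h2 h3 h7 hqM
    obtain ⟨h4, h5⟩ := h1 hqM
    have h6 : ∀ s, (path (e₀ q) s).2.2 = star (path (e₀ q) s).1 := fun s => by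
      simp only [path, star_add, star_smul, star_trivial s]; rfl
    have huniq := uniqueDiffOn_Icc (zero_lt_one (α := ℝ))
    have hderiv : ∀ s ∈ Icc (0 : ℝ) 1, derivWithin (fun s => C.proj (path (e₀ q) s)) (Icc 0 1) s =
        C.crVector (path (e₀ q) s) q.1 := fun s hs => (h5 s hs).2.derivWithin (huniq s hs)
    refine ⟨hembproj _ (h6 1), fun s => C.proj (path (e₀ q) s), ?_, h4, rfl, fun s hs => ⟨⟨(h5 s hs).1,
      interior_subset (h3 s hs)⟩, ?_⟩⟩
    · rw [contDiffOn_one_iff_derivWithin huniq]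
      refine ⟨fun s hs => (h5 s hs).2.differentiableWithinAt, ?_⟩
      refine ContinuousOn.congr (fun s hs => ContinuousAt.continuousWithinAt ?_) hderiv
      have e1 : Continuous fun s => arg (e₀ q, s) := by
        have := continuous_ext (Φ (e₀ q))
        simp only [arg, path]
        fun_prop
      have e2 : ContinuousAt (fun s => crSlope C.Θ (arg (e₀ q, s))) s :=
        ContinuousAt.comp (g := crSlope C.Θ) (h7 s hs).continuousAt e1.continuousAt
      exact C.coord.symm.continuous.continuousAt.comp (continuousAt_const.prodMk e2)
    · rw [hderiv s hs]
      have e1 := h2 s hs (h5 s hs).1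
      rw [hembproj _ (h6 s)] at e1
      rw [complexTangentSpace, tangentSpace_inter (mem_interior_iff_mem_nhds.1 (h3 s hs))]
      refine ⟨e1 _, ?_⟩
      rw [← C.crVector_smul]
      exact e1 _

/-! ### Real forms, real ranks and coverings of level sets. -/

section RealRank

variable {E X Z : Type} [NormedAddCommGroup E] [NormedSpace ℝ E] [NormedAddCommGroup X]
  [NormedSpace ℝ X] [NormedAddCommGroup Z] [NormedSpace ℝ Z]

lemma exists_rightInverse [FiniteDimensional ℝ Z] {T : X →L[ℝ] Z} (hT : Surjective T) :
    ∃ S : Z →L[ℝ] X, ∀ z, T (S z) = z := by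
  obtain ⟨S, hS⟩ := LinearMap.exists_rightInverse_of_surjective T.toLinearMap
    (LinearMap.range_eq_top.2 hT)
  exact ⟨toContinuousLinearMap S, fun z => DFunLike.congr_fun hS z⟩

lemma eventually_surjective_fderiv {ι : Type} [Fintype ι] {g : ι → X → ℝ} {p : X}
    (hg : ∀ i, AnalyticAt ℝ (g i) p) (hli : LinearIndependent ℝ fun i => fderiv ℝ (g i) p) :
    ∀ᶠ t in 𝓝 p, Surjective fun v i => fderiv ℝ (g i) t v := by
  filter_upwards [(continuousAt_pi.2 fun i => (hg i).fderiv.continuousAt).eventually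
    (LinearIndependent.eventually hli)] with t ht
  exact linearIndependent_iff_surjective.1 ht

/-- A map onto the tangent space of a level set covers the level set. -/
lemma eventually_mem_image_of_level [FiniteDimensional ℝ Z] [CompleteSpace E] [CompleteSpace X]
    {φ : E → X} {G : X → Z} {φ' : E →L[ℝ] X} {G' : X →L[ℝ] Z} {u : E}
    (hφ : HasStrictFDerivAt φ φ' u) (hG : HasStrictFDerivAt G G' (φ u))
    (hs : Surjective G') (hker : ∀ v, G' v = 0 → ∃ e, φ' e = v)
    (hc : ∀ᶠ e in 𝓝 u, G (φ e) = G (φ u)) {W : Set E} (hW : W ∈ 𝓝 u) :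
    ∀ᶠ x in 𝓝 (φ u), G x = G (φ u) → x ∈ φ '' W := by
  obtain ⟨S, hS⟩ := exists_rightInverse hs
  -- Added transversal directions make `Ψ` a submersion, so it covers a neighbourhood of `φ u`. It
  -- remains to see that points of the level set are reached only with zero transversal part.
  let Ψ : E × Z → X := fun q => φ q.1 + S q.2
  have hΨ : HasStrictFDerivAt Ψ (φ'.comp (fst ℝ E Z) + S.comp (snd ℝ E Z)) (u, 0) :=
    (HasStrictFDerivAt.comp (g := φ) (u, (0 : Z)) hφ hasStrictFDerivAt_fst).fun_add
      (S.hasStrictFDerivAt.comp (u, (0 : Z)) hasStrictFDerivAt_snd)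
  have hmap := hΨ.map_nhds_eq_of_surj (by
    refine LinearMap.range_eq_top.2 fun v => ?_
    obtain ⟨e, he⟩ := hker (v - S (G' v)) (by rw [map_sub, hS, sub_self])
    refine ⟨(e, G' v), ?_⟩
    change φ' e + S (G' v) = v
    rw [he, sub_add_cancel])
  have hΨ0 : Ψ (u, 0) = φ u := by simp [Ψ]
  rw [hΨ0] at hmap
  -- With this constant the error in strict differentiability is at most half the norm of the
  -- transversal part `z`. On the level set the error has norm exactly `‖z‖`, because `G' (S z) =
  -- z`, so `z = 0`.
  have hε : (0 : ℝ) < 1 / (2 * (‖S‖ + 1)) := by positivity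
  have hlip := hG.isLittleO.bound hε
  have hpair : Tendsto (fun q : E × Z => (Ψ q, φ q.1)) (𝓝 (u, 0)) (𝓝 (φ u, φ u)) := by
    have e1 := hΨ.continuousAt.tendsto
    rw [hΨ0] at e1
    exact e1.prodMk_nhds (hφ.continuousAt.tendsto.comp (continuousAt_fst (p := (u, (0 : Z)))))
  have hfst : Tendsto (fun q : E × Z => q.1) (𝓝 (u, 0)) (𝓝 u) := continuousAt_fst (p := (u, (0 : Z)))
  have hset : {q : E × Z | q.1 ∈ W ∧ G (φ q.1) = G (φ u) ∧ ‖G (Ψ q) - G (φ q.1) - G' (Ψ q - φ q.1)‖ ≤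
      1 / (2 * (‖S‖ + 1)) * ‖Ψ q - φ q.1‖} ∈ 𝓝 (u, (0 : Z)) := by
    filter_upwards [hfst.eventually hW, hfst.eventually hc, hpair.eventually hlip] with q h1 h2 h3
    exact ⟨h1, h2, h3⟩
  have himg := image_mem_map (m := Ψ) hset
  rw [hmap] at himg
  filter_upwards [himg] with x hx hGx
  obtain ⟨q, ⟨h1, h2, h3⟩, rfl⟩ := hx
  have e1 : Ψ q - φ q.1 = S q.2 := add_sub_cancel_left _ _
  rw [hGx, h2, e1, hS, sub_self, zero_sub, norm_neg] at h3
  have e2 : ‖S q.2‖ ≤ (‖S‖ + 1) * ‖q.2‖ := (S.le_opNorm _).trans (by gcongr; linarith)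
  have e3 : 1 / (2 * (‖S‖ + 1)) * ‖S q.2‖ ≤ 1 / (2 * (‖S‖ + 1)) * ((‖S‖ + 1) * ‖q.2‖) := by gcongr
  have e4 : 1 / (2 * (‖S‖ + 1)) * ((‖S‖ + 1) * ‖q.2‖) = ‖q.2‖ / 2 := by
    have : ‖S‖ + 1 ≠ 0 := by positivity
    field_simp
  have e5 : q.2 = 0 := norm_le_zero_iff.1 (by linarith [norm_nonneg q.2])
  refine ⟨q.1, h1, ?_⟩
  change φ q.1 = φ q.1 + S q.2
  rw [e5, map_zero, add_zero]

/-- The real rank of a linear map on a real form is at least its complex rank. -/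
lemma rk_le_finrank_range {V Y : Type} [NormedAddCommGroup V] [NormedSpace ℂ V]
    [NormedAddCommGroup Y] [NormedSpace ℂ Y] [FiniteDimensional ℝ E] [FiniteDimensional ℂ Y]
    (T : V →L[ℂ] Y) (j : E →L[ℝ] V)
    (hj : ∀ e, ∃ u u', e = j u + Complex.I • j u') :
    rk T ≤ finrank ℝ (LinearMap.range ((T.restrictScalars ℝ).comp j).toLinearMap) := by
  let R := LinearMap.range ((T.restrictScalars ℝ).comp j).toLinearMap
  let b := finBasis ℝ R
  have hle : LinearMap.range T.toLinearMap ≤ Submodule.span ℂ (range fun i => (b i : Y)) := by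
    have hR : ∀ y ∈ R, y ∈ Submodule.span ℂ (range fun i => (b i : Y)) := fun y hy => by
      have h1 := congrArg (Submodule.subtype R) (b.sum_repr ⟨y, hy⟩)
      rw [map_sum] at h1
      have h2 : y = ∑ i, (b.repr ⟨y, hy⟩ i) • (b i : Y) := by
        simpa using h1.symm
      rw [h2]
      refine Submodule.sum_mem _ fun i _ => ?_
      rw [← Complex.coe_smul]
      exact Submodule.smul_mem _ _ (Submodule.subset_span ⟨i, rfl⟩)
    rintro _ ⟨e, rfl⟩
    obtain ⟨u, u', rfl⟩ := hj e
    have h3 : T (j u + Complex.I • j u') = T (j u) + Complex.I • T (j u') := by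
      rw [map_add, map_smul]
    exact h3 ▸ add_mem (hR _ ⟨u, rfl⟩) (Submodule.smul_mem _ _ (hR _ ⟨u', rfl⟩))
  refine (Submodule.finrank_mono hle).trans ((finrank_range_le_card (R := ℂ) _).trans ?_)
  rw [Fintype.card_fin]

/-- The generic rank is attained at points of a real form. -/
lemma frequently_rk_realForm {V Y : Type} [NormedAddCommGroup V] [NormedSpace ℂ V]
    [FiniteDimensional ℂ V] [NormedAddCommGroup Y] [NormedSpace ℂ Y] [FiniteDimensional ℂ Y]
    (j : E →L[ℝ] V) (hj : ∀ e, ∃ u u', e = j u + Complex.I • j u') {F : V → Y}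
    (hF : AnalyticAt ℂ F 0) {r : ℕ} (hr : ∃ᶠ v in 𝓝 0, r ≤ rk (fderiv ℂ F v)) :
    ∃ᶠ u in 𝓝 0, r ≤ rk (fderiv ℂ F (j u)) := by
  let e := finBasis ℂ V
  let e' := finBasis ℂ (Y →L[ℂ] ℂ)
  by_contra hcon
  rw [Filter.not_frequently] at hcon
  have hz : ∀ (I : Fin r → _) (J : Fin r → _), ∀ᶠ u in 𝓝 0,
      minor (fderiv ℂ F u) (fun k => e (I k)) (fun i => e' (J i)) = 0 := by
    intro I J
    have h0 : (0 : V) + j 0 = 0 := by simp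
    have h1 := eventually_eq_zero_of_realForm j hj (b := 0) (v := 0)
      (g := fun u => minor (fderiv ℂ F u) (fun k => e (I k)) (fun i => e' (J i))) (by
        rw [h0]
        exact analyticAt_minor _ _ fun k => analyticAt_fderiv_apply hF _) (by
        filter_upwards [hcon] with u hu
        by_contra hne
        rw [zero_add] at hne
        exact hu (le_rk_of_minor_ne_zero hne))
    rwa [h0] at h1
  refine absurd hr ?_
  rw [Filter.not_frequently]
  filter_upwards [eventually_all.2 fun I => eventually_all.2 (hz I)] with u hu hle
  obtain ⟨v, l, hvl⟩ := exists_minor_ne_zero hle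
  exact hvl (minor_eq_zero_of_basis e e' hu v l)

end RealRank

/-! ### Local reachability along CR curves. -/

variable {n m d : ℕ} {M : Set ℂ^n} {p : ℂ^n}

/-- The real defining functions of a generic submanifold and independent holomorphic functions with
real values on it have independent real differentials. -/
lemma linearIndependent_real {q : ℕ} {r : Fin d → ℂ^n → ℝ}
    (hr : ∀ j, AnalyticAt ℝ (r j) p) (hli : LinearIndependent ℝ fun j => fderiv ℝ (r j) p)
    (hM : ∀ᶠ y in 𝓝 p, (y ∈ M ↔ ∀ j, r j y = 0))
    (hgen : ∀ v : ℂ^n, ∃ a ∈ tangentSpace M p, ∃ b ∈ tangentSpace M p, v = a + Complex.I • b)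
    {h : Fin q → ℂ^n → ℂ} (hh : ∀ i, AnalyticAt ℂ (h i) p)
    (hreal : ∀ᶠ t in 𝓝 p, t ∈ M → ∀ i, h i t = star (h i t))
    (hhli : LinearIndependent ℂ fun i => fderiv ℂ (h i) p) :
    LinearIndependent ℝ fun s : Fin d ⊕ Fin q =>
      fderiv ℝ (Sum.elim r (fun i t => (h i t).re) s) p := by
  have hder : ∀ i, ∀ L : ℂ →L[ℝ] ℝ, fderiv ℝ (fun t => L (h i t)) p =
      L.comp ((fderiv ℂ (h i) p).restrictScalars ℝ) := fun i L =>
    (HasFDerivAt.comp (g := L) p L.hasFDerivAt ((hh i).hasFDerivAt.restrictScalars ℝ)).fderiv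
  have him : ∀ i, ∀ v ∈ tangentSpace M p, (fderiv ℂ (h i) p v).im = 0 := fun i v hv => by
    have h1 := hv (fun t => imCLM (h i t))
      ((imCLM.analyticAt _).fun_comp (hh i).restrictScalars) (by
        rw [eventually_nhdsWithin_iff]
        filter_upwards [hreal] with t ht htM
        exact conj_eq_iff_im.1 (ht htM i).symm)
    rw [hder] at h1
    exact h1
  rw [Fintype.linearIndependent_iff]
  intro g hg
  rw [Fintype.sum_sum_type] at hg
  simp only [Sum.elim_inl, Sum.elim_inr] at hg
  have hzero : ∀ v ∈ tangentSpace M p, ∑ i, (g (Sum.inr i) : ℂ) * fderiv ℂ (h i) p v = 0 := by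
    intro v hv
    have h1 := DFunLike.congr_fun hg v
    simp only [add_apply, sum_apply, smul_apply, zero_apply, tangentSpace_le_ker hr hM hv,
      smul_zero, Finset.sum_const_zero, zero_add] at h1
    have h2 : ∀ i, fderiv ℂ (h i) p v = ((fderiv ℝ (fun t => (h i t).re) p v : ℝ) : ℂ) := fun i => by
      have := hder i reCLM
      simp only [Complex.reCLM_apply] at this
      rw [this]
      exact Complex.ext rfl (him i v hv)
    simp only [h2, ← Complex.ofReal_mul, ← Complex.ofReal_sum]
    exact congrArg _ h1
  -- On tangent vectors the differentials of the `h i` are real and those of the `r j` vanish, so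
  -- the relation becomes one between complex linear forms. By genericity tangent vectors span `ℂⁿ`
  -- over `ℂ`.
  have hβ : ∑ i, (g (Sum.inr i) : ℂ) • fderiv ℂ (h i) p = 0 := by
    ext v
    obtain ⟨a, ha, b, hb, rfl⟩ := hgen v
    simp only [sum_apply, smul_apply, zero_apply, smul_eq_mul, map_add, map_smul,
      hzero a ha, zero_add, hzero b hb, mul_zero]
  have hβ0 : ∀ i, g (Sum.inr i) = 0 := fun i =>
    Complex.ofReal_eq_zero.1 (Fintype.linearIndependent_iff.1 hhli _ hβ i)
  simp only [hβ0, zero_smul, Finset.sum_const_zero, add_zero] at hg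
  rintro (j | i)
  · exact Fintype.linearIndependent_iff.1 hli _ hg j
  · exact hβ0 i

/-- The real form of the space of directions of the flow. -/
def realDirections (m K : ℕ) : (Fin K → ℂ^m) →L[ℝ] (Fin K → ℂ^m × ℂ^m) :=
  ContinuousLinearMap.pi fun i =>
    (ContinuousLinearMap.proj (R := ℝ) (φ := fun _ : Fin K => ℂ^m) i).prod
      (((starL' ℝ : ℂ^m ≃L[ℝ] ℂ^m) : ℂ^m →L[ℝ] ℂ^m).comp
        (ContinuousLinearMap.proj (R := ℝ) (φ := fun _ : Fin K => ℂ^m) i))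

lemma realDirections_apply {K : ℕ} (u : Fin K → ℂ^m) :
    realDirections m K u = fun i => (u i, star (u i)) := rfl

/-- The pairs `(a, ā)` are the fixed points of the conjugation `(a, b) ↦ (b̄, ā)`, and every vector
splits into its real and imaginary parts with respect to it. -/
lemma exists_realDirections {K : ℕ} (e : Fin K → ℂ^m × ℂ^m) :
    ∃ u u', e = realDirections m K u + Complex.I • realDirections m K u' := by
  refine ⟨fun i => (2⁻¹ : ℂ) • ((e i).1 + star (e i).2),
    fun i => (-Complex.I / 2) • ((e i).1 - star (e i).2), funext fun i => Prod.ext ?_ ?_⟩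
  · ext k
    simp only [realDirections_apply, Pi.add_apply, Pi.smul_apply, Prod.fst_add, Prod.smul_fst,
      Pi.sub_apply, smul_eq_mul]
    linear_combination ((e i).1 k - star (e i).2 k) / 2 * Complex.I_sq
  · ext k
    simp only [realDirections_apply, Pi.add_apply, Pi.smul_apply, Prod.snd_add, Prod.smul_snd,
      Pi.sub_apply, smul_eq_mul, star_smul, star_add, star_sub, star_star, Pi.star_apply]
    simp only [Complex.star_def, map_neg, map_div₀, Complex.conj_I, map_ofNat, map_inv₀]
    linear_combination ((e i).2 k - (starRingEnd ℂ) ((e i).1 k)) / 2 * Complex.I_sq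

variable {κ : Regularity} (C : SegreChart M p m d)

/-- The ranks of the chains of a flow containing both multiple flows. -/
lemma frequently_rk_chain {Θ : ThetaSpace m d → ℂ^d} (hΘ : IsReflexive Θ)
    {F : FlowSpace m d → GraphSpace m d} (hF : AnalyticAt ℂ F 0) (hF0 : F 0 = 0)
    (hA : ∀ᶠ q : ActSpace m d in 𝓝 0, F ((q.1, 0), q.2) = actA Θ q)
    (hB : ∀ᶠ q : ActSpace m d in 𝓝 0, F ((0, q.1), q.2) = actB q) {K ρ : ℕ}
    (hK : ρ ≤ genericRank (segreChain Θ K) 0) :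
    ∃ᶠ c in 𝓝 0, ρ ≤ rk (fderiv ℂ (fun c => chain (fun _ => F) K c 0) c) := by
  rw [hΘ.genericRank_segreChain, le_genericRank_iff] at hK
  -- Even steps use directions `(u, 0)` and odd steps `(0, u)`, so the alternating chain is the
  -- chain of `F` restricted to a linear subspace of parameters.
  let L : ∀ K, (Fin K → ℂ^m) →L[ℂ] (Fin K → ℂ^m × ℂ^m) := fun K =>
    ContinuousLinearMap.pi fun i => (if Even (i : ℕ) then inl ℂ _ _ else
      inr ℂ _ _).comp (ContinuousLinearMap.proj i)
  have hL : ∀ K u i, L K u i = if Even (i : ℕ) then (u i, 0) else (0, u i) := fun K u i => by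
    simp only [L, ContinuousLinearMap.pi_apply, ContinuousLinearMap.comp_apply]
    split_ifs <;> rfl
  have heq : ∀ K, ∀ᶠ u in 𝓝 0, chain (act Θ) K u 0 = chain (fun _ => F) K (L K u) 0 := by
    intro K
    induction K with
    | zero => exact .of_forall fun _ => rfl
    | succ k ih =>
      have t1 : Tendsto₀ (fun u : Fin (k + 1) → Fin m → ℂ => fun i : Fin k => u i.castSucc) := tendsto_cont rfl
      have t2 : Tendsto₀ (fun u : Fin (k + 1) → Fin m → ℂ => (u (Fin.last k),
          chain (act Θ) k (fun i => u i.castSucc) 0)) :=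
        (tendsto_cont (f := fun u : Fin (k + 1) → Fin m → ℂ => u (Fin.last k)) rfl).prodMk_nhds
          ((tendsto_chain hΘ.analyticAt_act hΘ.act_apply_zero k).comp t1)
      filter_upwards [t1.eventually ih, t2.eventually hA, t2.eventually hB] with u h1 h2 h3
      have e1 : (fun i : Fin k => L (k + 1) u i.castSucc) = L k fun i => u i.castSucc := by
        funext i
        rw [hL, hL]; rfl
      change act Θ k (u (Fin.last k), chain (act Θ) k (fun i => u i.castSucc) 0) =
        F (L (k + 1) u (Fin.last k), chain (fun _ => F) k (fun i => L (k + 1) u i.castSucc) 0)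
      rw [e1, ← h1, hL, act, Fin.val_last]
      split_ifs
      · exact h2.symm
      · exact h3.symm
  have t : Tendsto₀ (L K) := (L K).tendsto_zero
  refine t.frequently ?_
  refine (hK.and_eventually ((heq K).eventually_nhds.and (t.eventually (analyticAt_chain_zero
    (fun _ => hF) (fun _ => hF0) K).eventually_analyticAt))).mono ?_
  rintro u ⟨h1, h2, h3⟩
  have d1 : HasFDerivAt (fun u => chain (fun _ => F) K (L K u) 0)
      ((fderiv ℂ (fun c => chain (fun _ => F) K c 0) (L K u)).comp (L K)) u :=
    HasFDerivAt.comp (g := fun c => chain (fun _ => F) K c 0) u h3.hasFDerivAt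
      (L K).hasFDerivAt
  rw [(d1.congr_of_eventuallyEq h2).fderiv] at h1
  exact h1.trans (rk_comp_le_left _ _)

set_option maxHeartbeats 1600000 in
/-- Local reachability: near `p` the CR orbit of `p` fills the level set of the invariants. -/
lemma SegreChart.eventually_mem_crOrbit (hn : n = m + d) (hM : IsGenericSubmanifold κ M d)
    (hp : p ∈ M) {K ρ q : ℕ} (hK : ρ ≤ genericRank (segreChain C.Θ K) 0) (hq : q + ρ = 2 * m + d)
    {h : Fin q → ℂ^n → ℂ} (hh : ∀ i, AnalyticAt ℂ (h i) p)
    (hreal : ∀ᶠ t in 𝓝 p, t ∈ M → ∀ i, h i t = star (h i t))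
    (hhli : LinearIndependent ℂ fun i => fderiv ℂ (h i) p) {V : Set ℂ^n} (hV : V ∈ 𝓝 p) :
    ∀ᶠ t in 𝓝 p, t ∈ M → (∀ i, h i t = h i p) → t ∈ crOrbit (M ∩ V) p := by
  have hΘ := C.isReflexive hn hM.1 hp
  obtain ⟨F, hF, hF0, hA, hB, hstep⟩ := C.exists_crFlow hn hM.1 hp
  obtain ⟨r, hr, hrli, hrM⟩ := hM.1 p hp
  -- The generic rank of the chain of `F` is attained arbitrarily near `0` at conjugate pairs of
  -- directions, where the chain follows CR curves in `M`.
  have hrank := frequently_rk_realForm (realDirections m K) exists_realDirections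
    (analyticAt_chain_zero (fun _ => hF) (fun _ => hF0) K) (frequently_rk_chain hΘ hF hF0 hA hB hK)
  let g : Fin d ⊕ Fin q → ℂ^n → ℝ := Sum.elim r fun i t => (h i t).re
  have hg : ∀ s, AnalyticAt ℝ (g s) p := by
    rintro (j | i)
    · exact (hr j).1
    · exact (reCLM.analyticAt _).fun_comp (hh i).restrictScalars
  have hgli := linearIndependent_real (fun j => (hr j).1) hrli hrM (hM.2 p hp) hh hreal hhli
  obtain ⟨O, hO, hOo, hpO⟩ := eventually_nhds_iff.1 ((eventually_all.2 fun i =>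
    (hh i).eventually_analyticAt).and (hreal.and (eventually_mem_nhds_iff.2 hV)))
  have hOV : O ⊆ V := fun t ht => mem_of_mem_nhds (hO t ht).2.2
  have hsub : ∀ x ∈ M ∩ O, crOrbit (M ∩ O) x ⊆ M ∩ O := fun x hx => crOrbit_subset hx
  have hconst : ∀ x ∈ M ∩ O, ∀ y ∈ crOrbit (M ∩ O) x, ∀ i, h i y = h i x := fun x hx y hy i =>
    eq_of_mem_crOrbit (fun t ht => (hO t ht.2).1 i) (fun t ht => (hO t ht.2).2.1 ht.1 i) hy
  let Y : (k : ℕ) → (Fin k → ℂ^m) × ℂ^n → GraphSpace m d := fun k q =>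
    chain (fun _ => F) k (realDirections m k q.1) (C.emb q.2)
  have hembs : ∀ k, Tendsto (fun q : (Fin k → ℂ^m) × ℂ^n =>
      (realDirections m k q.1, C.emb q.2)) (𝓝 (0, p)) (𝓝 0) := fun k => by
    have e1 : Tendsto (fun q : (Fin k → ℂ^m) × ℂ^n => realDirections m k q.1)
        (𝓝 (0, p)) (𝓝 0) := tendsto_cont (map_zero _)
    exact e1.prodMk_nhds (C.tendsto_emb.comp (continuousAt_snd (p := ((0 : Fin k → ℂ^m), p))))
  have hchain : ∀ k, AnalyticAt ℂ (fun q : (Fin k → ℂ^m × ℂ^m) × GraphSpace m d =>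
      chain (fun _ => F) k q.1 q.2) 0 := fun k => analyticAt_chain (fun _ => hF) (fun _ => hF0) k
  have hY : ∀ k, Tendsto (Y k) (𝓝 (0, p)) (𝓝 0) := fun k => by
    have e1 := (hchain k).continuousAt.tendsto.comp (hembs k)
    have e2 : chain (fun _ => F) k 0 0 = 0 := chain_zero_zero (fun _ => hF0) k
    change Tendsto (Y k) (𝓝 (0, p)) (𝓝 (chain (fun _ => F) k 0 0)) at e1
    rwa [e2] at e1
  have hpt : ∀ k, Tendsto (fun q : (Fin k → ℂ^m) × ℂ^n => q.2) (𝓝 (0, p)) (𝓝 p) :=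
    fun k => continuousAt_snd (p := ((0 : Fin k → ℂ^m), p))
  have hrun : ∀ k, ∀ᶠ q : (Fin k → ℂ^m) × ℂ^n in 𝓝 (0, p), q.2 ∈ M →
      C.emb (C.proj (Y k q)) = Y k q ∧ C.proj (Y k q) ∈ crOrbit (M ∩ O) q.2 := by
    intro k
    induction k with
    | zero =>
      refine .of_forall fun q _ => ?_
      change C.emb (C.proj (C.emb q.2)) = C.emb q.2 ∧ C.proj (C.emb q.2) ∈ _
      rw [C.proj_emb]
      exact ⟨rfl, .refl⟩
    | succ k ih =>
      have t1 : Tendsto (fun q : (Fin (k + 1) → ℂ^m) × ℂ^n =>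
          (((fun i : Fin k => q.1 i.castSucc), q.2) : (Fin k → ℂ^m) × ℂ^n))
          (𝓝 (0, p)) (𝓝 (0, p)) := tendsto_cont rfl
      have t2 : Tendsto (fun q : (Fin (k + 1) → ℂ^m) × ℂ^n =>
          (q.1 (Fin.last k), C.proj (Y k ((fun i : Fin k => q.1 i.castSucc), q.2))))
          (𝓝 (0, p)) (𝓝 (0, p)) :=
        (Continuous.tendsto' (f := fun q : (Fin (k + 1) → ℂ^m) × ℂ^n =>
          q.1 (Fin.last k)) (by fun_prop) _ _ rfl).prodMk_nhds
          (C.tendsto_proj.comp ((hY k).comp t1))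
      filter_upwards [t1.eventually ih, t2.eventually (hstep O (hOo.mem_nhds hpO)),
        (hpt (k + 1)).eventually (hOo.mem_nhds hpO)] with q h1 h2 h3 hqM
      obtain ⟨h4, h5⟩ := h1 hqM
      obtain ⟨h6, h7⟩ := h2 (hsub _ ⟨hqM, h3⟩ h5).1
      simp only [h4] at h6 h7
      exact ⟨h6, .tail h5 h7⟩
  have hup : Tendsto (fun u : Fin K → Fin m → ℂ => (u, p)) (𝓝 0) (𝓝 (0, p)) := tendsto_cont rfl
  have hφp : Tendsto (fun u : Fin K → Fin m → ℂ => C.proj (Y K (u, p))) (𝓝 0) (𝓝 p) :=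
    C.tendsto_proj.comp ((hY K).comp hup)
  obtain ⟨u, hurank, hugood, huan, hur, hus, huM⟩ := (hrank.and_eventually
    ((hup.eventually (hrun K).eventually_nhds).and
      ((hup.eventually ((hembs K).eventually (hchain K).eventually_analyticAt)).and
      ((hφp.eventually (eventually_all.2 fun s => (hg s).eventually_analyticAt)).and
      ((hφp.eventually (eventually_surjective_fderiv hg hgli)).and
        (hφp.eventually hrM.eventually_nhds)))))).exists
  let φ : (Fin K → ℂ^m) → ℂ^n := fun u => C.proj (Y K (u, p))
  let T : (Fin K → ℂ^m × ℂ^m) →L[ℂ] GraphSpace m d :=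
    fderiv ℂ (fun c => chain (fun _ => F) K c 0) (realDirections m K u)
  have hemb0 := C.emb_base
  rw [hemb0] at huan
  have han : AnalyticAt ℂ (fun c => chain (fun _ => F) K c 0) (realDirections m K u) :=
    huan.fun_comp (f := fun c => (c, (0 : GraphSpace m d))) (analyticAt_id.prod analyticAt_const)
  have hYd : HasStrictFDerivAt (fun u => Y K (u, p)) ((T.restrictScalars ℝ).comp (realDirections m K))
      u := by
    have e : (fun u => Y K (u, p)) = fun u => chain (fun _ => F) K (realDirections m K u) 0 := by
      funext u; simp only [Y, hemb0]
    rw [e]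
    exact HasStrictFDerivAt.comp (g := fun c => chain (fun _ => F) K c 0) u
      (han.hasStrictFDerivAt.restrictScalars ℝ) (realDirections m K).hasStrictFDerivAt
  let P : GraphSpace m d →L[ℝ] ℂ^n := ((C.coord.symm : ℂ^m × ℂ^d →L[ℂ] ℂ^n).restrictScalars ℝ).comp
      ((fst ℝ _ _).prod ((fst ℝ _ _).comp (snd ℝ _ _)))
  let φ' := P.comp ((T.restrictScalars ℝ).comp (realDirections m K))
  have hφd : HasStrictFDerivAt φ φ' u :=
    (HasStrictFDerivAt.comp (g := P) u P.hasStrictFDerivAt hYd).const_add p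
  have hugood' : ∀ᶠ v in 𝓝 u, C.emb (φ v) = Y K (v, p) ∧ φ v ∈ crOrbit (M ∩ O) p := by
    have t : Tendsto (fun v : Fin K → Fin m → ℂ => (v, p)) (𝓝 u) (𝓝 (u, p)) := tendsto_cont rfl
    filter_upwards [t.eventually hugood] with v hv
    exact hv hp
  have hTj : (T.restrictScalars ℝ).comp (realDirections m K) = (realGraph C.coord).comp φ' := by
    have d1 : HasFDerivAt (fun v => C.emb (φ v)) ((realGraph C.coord).comp φ') u :=
      HasFDerivAt.comp (g := realGraph C.coord) u (realGraph C.coord).hasFDerivAt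
        (hφd.hasFDerivAt.sub_const p)
    exact hYd.hasFDerivAt.unique (d1.congr_of_eventuallyEq (hugood'.mono fun v hv => hv.1.symm))
  have hlevel : ∀ x ∈ crOrbit (M ∩ O) p, (∀ j, r j x = 0) → (fun s => g s x) =
      Sum.elim (fun _ => 0) fun i => (h i p).re := fun x hx hx0 => by
    funext s
    rcases s with j | i
    · exact hx0 j
    · exact congrArg Complex.re (hconst p ⟨hp, hpO⟩ x hx i)
  let G : ℂ^n → (Fin d ⊕ Fin q → ℝ) := fun t s => g s t
  let G' : ℂ^n →L[ℝ] (Fin d ⊕ Fin q → ℝ) := ContinuousLinearMap.pi fun s => fderiv ℝ (g s) (φ u)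
  have hGd : HasStrictFDerivAt G G' (φ u) :=
    hasStrictFDerivAt_pi.2 fun s => (hur s).hasStrictFDerivAt
  have hφM : ∀ᶠ v in 𝓝 u, G (φ v) = Sum.elim (fun _ => 0) fun i => (h i p).re := by
    filter_upwards [hugood', hφd.continuousAt.eventually huM] with v h1 h2
    exact hlevel _ h1.2 (h2.1 (hsub _ ⟨hp, hpO⟩ h1.2).1)
  have hGφ : G'.comp φ' = 0 := by
    refine (HasFDerivAt.comp (g := G) u hGd.hasFDerivAt hφd.hasFDerivAt).unique ?_
    exact (hasFDerivAt_const _ u).congr_of_eventuallyEq hφM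
  -- The range lies in the kernel because the invariants are constant along CR curves. The kernel
  -- has real dimension `2n - d - q = ρ`, and the range has at least this dimension because a
  -- complex rank is bounded by the real rank on a real form.
  have hker : LinearMap.range φ'.toLinearMap = LinearMap.ker G'.toLinearMap := by
    refine Submodule.eq_of_le_of_finrank_le ?_ ?_
    · rintro _ ⟨e, rfl⟩
      exact DFunLike.congr_fun hGφ e
    · have e1 := LinearMap.finrank_range_add_finrank_ker G'.toLinearMap
      rw [LinearMap.range_eq_top.2 (show Surjective G'.toLinearMap from hus), finrank_top,
        Module.finrank_pi, Fintype.card_sum, Fintype.card_fin, Fintype.card_fin] at e1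
      have e2 : finrank ℝ ℂ^n = 2 * n := by
        rw [Module.finrank_pi_fintype]; simp [Complex.finrank_real_complex, mul_comm]
      have e3 := hurank.trans (rk_le_finrank_range T (realDirections m K) exists_realDirections)
      rw [hTj] at e3
      have e4 : LinearMap.range ((realGraph C.coord).comp φ').toLinearMap =
          (LinearMap.range φ'.toLinearMap).map (realGraph C.coord).toLinearMap := by
        rw [← LinearMap.range_comp]; rfl
      rw [e4] at e3
      have e5 := e3.trans (Submodule.finrank_map_le _ _)
      omega
  have hcover := eventually_mem_image_of_level hφd hGd hus (fun v hv => by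
    have : v ∈ LinearMap.ker G'.toLinearMap := hv
    rw [← hker] at this
    exact this) (hφM.mono fun v hv => hv.trans hφM.self_of_nhds.symm)
    (W := {v | φ v ∈ crOrbit (M ∩ O) p}) (hugood'.mono fun v hv => hv.2)
  -- The level set is covered near `φ u`, not yet near `p`. A point `t` near `p` on the level of `p`
  -- is carried by the same directions `u` to a point near `φ u` on that level, which is also
  -- reached from `p`; reversing the curves from `t` joins `p` to `t`.
  have hback : Tendsto (fun t => C.proj (Y K (u, t))) (𝓝 p) (𝓝 (φ u)) := by
    refine C.continuous_proj.continuousAt.tendsto.comp ?_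
    have e1 : ContinuousAt (fun t => (realDirections m K u, C.emb t)) p :=
      continuousAt_const.prodMk C.continuous_emb.continuousAt
    exact ContinuousAt.comp (g := fun q : (Fin K → ℂ^m × ℂ^m) × GraphSpace m d =>
      chain (fun _ => F) K q.1 q.2) (f := fun t => (realDirections m K u, C.emb t))
      (by rw [hemb0]; exact huan.continuousAt) e1
  have hut : Tendsto (fun t => (u, t)) (𝓝 p) (𝓝 (u, p)) := tendsto_cont rfl
  filter_upwards [hback.eventually hcover, hback.eventually huM, hut.eventually hugood,
    hOo.mem_nhds hpO] with t h1 h2 h3 h4 htM hth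
  have h5 := (h3 htM).2
  have h6 : G (C.proj (Y K (u, t))) = G (φ u) := by
    rw [hφM.self_of_nhds]
    funext s
    rcases s with j | i
    · exact h2.1 (hsub _ ⟨htM, h4⟩ h5).1 j
    · exact congrArg Complex.re ((hconst t ⟨htM, h4⟩ _ h5 i).trans (hth i))
  obtain ⟨v, hv, hvt⟩ := h1 h6
  have h7 : C.proj (Y K (u, t)) ∈ crOrbit (M ∩ O) p := hvt ▸ hv
  exact crOrbit_mono (inter_subset_inter_right M hOV) _
    (Relation.ReflTransGen.trans h7 (mem_crOrbit_symm h5))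

/-- A submersion has small neighbourhoods whose intersections with its level sets are connected. -/
lemma exists_preconnected_levels {X Z : Type} [NormedAddCommGroup X] [NormedSpace ℝ X]
    [NormedAddCommGroup Z] [NormedSpace ℝ Z] [CompleteSpace X] [FiniteDimensional ℝ Z] {G : X → Z}
    {G' : X →L[ℝ] Z} {p : X} (hG : HasStrictFDerivAt G G' p) (hs : Surjective G')
    {O : Set X} (hO : O ∈ 𝓝 p) :
    ∃ U, IsOpen U ∧ p ∈ U ∧ U ⊆ O ∧ ∀ z, IsPreconnected {t | t ∈ U ∧ G t = z} := by
  let e := hG.implicitToOpenPartialHomeomorph G G' (LinearMap.range_eq_top.2 hs)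
  have hp : p ∈ e.source := hG.mem_implicitToOpenPartialHomeomorph_source _
  have hfst : ∀ t, (e t).1 = G t := fun t => rfl
  have hnhds : e.target ∩ e.symm ⁻¹' O ∈ 𝓝 (e p) := by
    refine inter_mem (e.open_target.mem_nhds (e.map_source hp)) ?_
    have h1 := e.continuousAt_symm (e.map_source hp)
    rw [ContinuousAt, e.left_inv hp] at h1
    exact h1 hO
  obtain ⟨ε, hε, hball⟩ := Metric.mem_nhds_iff.1 hnhds
  -- In the chart of the implicit function theorem `G` is the first projection, so the levels in a
  -- product of balls are slices, empty or homeomorphic to a ball.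
  have hbox : ball (e p) ε = ball (e p).1 ε ×ˢ ball (e p).2 ε := (ball_prod_same _ _ _).symm
  refine ⟨e.source ∩ e ⁻¹' ball (e p) ε, e.isOpen_inter_preimage isOpen_ball,
    ⟨hp, Metric.mem_ball_self hε⟩, fun t ht => ?_, fun z => ?_⟩
  · have := (hball ht.2).2
    rwa [mem_preimage, e.left_inv ht.1] at this
  · have h2 : {t | t ∈ e.source ∩ e ⁻¹' ball (e p) ε ∧ G t = z} =
        e.symm '' (({z} ∩ ball (e p).1 ε) ×ˢ ball (e p).2 ε) := by
      ext t
      constructor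
      · rintro ⟨⟨h3, h4⟩, rfl⟩
        rw [mem_preimage, hbox] at h4
        exact ⟨e t, ⟨⟨rfl, h4.1⟩, h4.2⟩, e.left_inv h3⟩
      · rintro ⟨⟨a, b⟩, ⟨⟨rfl, h3⟩, h4⟩, rfl⟩
        have h5 : (a, b) ∈ ball (e p) ε := hbox ▸ ⟨h3, h4⟩
        have h6 := (hball h5).1
        refine ⟨⟨e.map_target h6, ?_⟩, ?_⟩
        · rwa [mem_preimage, e.right_inv h6]
        · rw [← hfst, e.right_inv h6]
    rw [h2]
    refine IsPreconnected.image ?_ _ (e.continuousOn_symm.mono fun y hy => (hball ?_).1)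
    · refine IsPreconnected.prod ?_ (convex_ball _ _).isPreconnected
      exact (subsingleton_singleton.anti inter_subset_left).isPreconnected
    · rw [hbox]
      exact ⟨hy.1.2, hy.2⟩

/-! ### Level sets of the invariants as CR orbits. -/

variable {n m d q : ℕ} {M : Set ℂ^n} {κ : Regularity}

/-- If the invariants locally describe the orbits, then connected level sets are orbits. -/
lemma level_eq_crOrbit {h : Fin q → ℂ^n → ℂ} {U : Set ℂ^n} (hU : IsOpen U)
    (hh : ∀ t ∈ U, ∀ i, AnalyticAt ℂ (h i) t) (hreal : ∀ t ∈ M ∩ U, ∀ i, h i t = star (h i t))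
    (hreach : ∀ y ∈ M ∩ U, ∀ V ∈ 𝓝 y, ∀ᶠ t in 𝓝 y, t ∈ M → (∀ i, h i t = h i y) →
      t ∈ crOrbit (M ∩ V) y) {x : ℂ^n} (hx : x ∈ M ∩ U)
    (hpre : IsPreconnected {t ∈ M ∩ U | ∀ i, h i t = h i x}) :
    {t ∈ M ∩ U | ∀ i, h i t = h i x} = crOrbit (M ∩ U) x := by
  refine Subset.antisymm (fun y hy => ?_) fun y hy => ⟨crOrbit_subset hx hy, fun i =>
    eq_of_mem_crOrbit (fun t ht => hh t ht.2 i) (fun t ht => hreal t ht i) hy⟩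
  -- Being in the same orbit is an equivalence relation whose classes are open in the level set by
  -- local reachability; a connected level set is a single class.
  refine hpre.induction₂ (fun x y => y ∈ crOrbit (M ∩ U) x) (fun a ha => ?_)
    (fun a b c _ _ _ hab hbc => Relation.ReflTransGen.trans hab hbc)
    (fun a b _ _ hab => mem_crOrbit_symm hab) ⟨hx, fun _ => rfl⟩ hy
  rw [eventually_nhdsWithin_iff]
  filter_upwards [hreach a ha.1 U (hU.mem_nhds ha.1.2)] with t ht htl
  exact ht htl.1.1 fun i => (htl.2 i).trans (ha.2 i).symm

lemma eventually_mem_crOrbit_of_rank (hn : n = m + d) (hM : IsGenericSubmanifold κ M d)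
    {E : Set ℂ^n} {a : ℕ → ℕ} (ha : ∀ p ∈ M \ E, ∀ (C : SegreChart M p m d) k,
      genericRank (segreChain C.Θ k) 0 = a k) {μ : ℕ} (hq : q + a μ = 2 * m + d) {p : ℂ^n}
    (hp : p ∈ M \ E) {h : Fin q → ℂ^n → ℂ} (hh : ∀ i, AnalyticAt ℂ (h i) p)
    (hreal : ∀ᶠ t in 𝓝 p, t ∈ M → ∀ i, h i t = star (h i t))
    (hhli : LinearIndependent ℂ fun i => fderiv ℂ (h i) p) {V : Set ℂ^n} (hV : V ∈ 𝓝 p) :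
    ∀ᶠ t in 𝓝 p, t ∈ M → (∀ i, h i t = h i p) → t ∈ crOrbit (M ∩ V) p := by
  obtain ⟨C, -⟩ := exists_segreChart hn hM hp.1
  exact C.eventually_mem_crOrbit hn hM hp.1 (ha p hp C μ).ge hq hh hreal hhli hV

/-- One of the local equations is nonzero at `p`, hence nearby. Thus the constancy of the ranks
outside `E` holds at all points of `M` near `p`. -/
lemma IsProperSubvariety.eventually_not_mem {E : Set ℂ^n} (hE : IsProperSubvariety κ M E)
    {p : ℂ^n} (hp : p ∈ M \ E) : ∀ᶠ t in 𝓝 p, t ∉ E := by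
  obtain ⟨N, f, hf, hfE⟩ := hE.2 p hp.1
  have h1 : ¬ ∀ i, f i p = 0 := fun h => hp.2 (hfE.self_of_nhds.2 ⟨hp.1, h⟩)
  push Not at h1
  obtain ⟨i, hi⟩ := h1
  filter_upwards [hfE, (hf i).1.continuousAt.eventually_ne hi] with t h2 h3 h4
  exact h3 ((h2.1 h4).2 i)

/-- The local structure of the CR orbits at points where the ranks of the Segre chains are locally
constant. -/
lemma exists_foliation (hn : n = m + d) (hM : IsGenericSubmanifold κ M d)
    {E : Set ℂ^n} (hE : IsProperSubvariety κ M E) {a : ℕ → ℕ}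
    (ha : ∀ p ∈ M \ E, ∀ (C : SegreChart M p m d) k, genericRank (segreChain C.Θ k) 0 = a k) {μ : ℕ}
    (hmax : ∀ k, a k ≤ a μ) (hmono : a μ ≤ a (2 * μ)) (hq : q + a μ = 2 * m + d) {p : ℂ^n}
    (hp : p ∈ M \ E) : HasCROrbitDim κ M p (a μ) ∧
      ∃ (U : Set ℂ^n) (h : Fin q → ℂ^n → ℂ), IsOpen U ∧ p ∈ U ∧
        (∀ i, ∀ x ∈ U, IsComplexRegularAt κ (h i) x) ∧
        (∀ x ∈ U, LinearIndependent ℂ (fun i => fderiv ℂ (h i) x)) ∧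
        (∀ x ∈ M ∩ U, ∀ i, h i x = star (h i x)) ∧
        ∀ c : Fin q → ℝ, ∀ q ∈ {x ∈ M ∩ U | ∀ i, h i x = (c i : ℂ)},
          {x ∈ M ∩ U | ∀ i, h i x = (c i : ℂ)} = crOrbit (M ∩ U) q ∧
          IsLocalCROrbit M q {x ∈ M ∩ U | ∀ i, h i x = (c i : ℂ)} := by
  have hEp := hE.eventually_not_mem hp
  obtain ⟨C, hC⟩ := exists_segreChart hn hM hp.1
  -- All points of `M` near `p` avoid `E`, so the ranks of their chains are at most `a μ`. The bound
  -- is attained by the chain of length `2μ`, whose evenness lets it be written through triples.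
  obtain ⟨q', hq', f, hf, hfr, hfs, hfA, hfB⟩ := C.exists_first_integrals hC hn hM.1 hp.1
    (ρ := a μ) (K := μ) (by
      filter_upwards [hEp] with t ht htM C' k
      exact (ha t ⟨htM, ht⟩ C' k).trans_le (hmax k)) (by rw [ha p hp]; exact hmono)
  obtain rfl : q' = q := by omega
  obtain ⟨h, hh, hhr, hhli, hreal⟩ := C.exists_real_invariants hC hp.1 hf hfr hfs hfA hfB
  obtain ⟨r, hr, hrli, hrM⟩ := hM.1 p hp.1
  let g : Fin d ⊕ Fin q' → ℂ^n → ℝ := Sum.elim r fun i t => (h i t).re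
  have hgr : ∀ s, RegAt κ (g s) p := by
    rintro (j | i)
    · exact isRealRegularAt_iff.1 (hr j)
    · exact (hhr i).clm_comp reCLM
  have hgli : LinearIndependent ℝ fun s => fderiv ℝ (g s) p :=
    linearIndependent_real (fun j => (hr j).1) hrli hrM (hM.2 p hp.1) hh hreal hhli
  obtain ⟨O, hO, hOo, hpO⟩ := eventually_nhds_iff.1 (((eventually_all.2 fun i =>
    (hh i).eventually_analyticAt).and (eventually_all.2 fun i => (hhr i).eventually)).and
    ((hreal.and hrM).and (hEp.and (((continuousAt_pi.2 fun i =>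
      (hh i).fderiv.continuousAt).eventually (LinearIndependent.eventually hhli)).and
      ((eventually_all.2 fun s => (hgr s).eventually).and
        ((continuousAt_pi.2 fun s => (hgr s).1.fderiv.continuousAt).eventually
          (LinearIndependent.eventually hgli)))))))
  have hbox : ∀ x ∈ O, ∀ V ∈ 𝓝 x, ∃ U, IsOpen U ∧ x ∈ U ∧ U ⊆ O ∩ V ∧
      ∀ z, IsPreconnected {t | t ∈ U ∧ (fun s => g s t) = z} := fun x hx V hV =>
    exists_preconnected_levels (hasStrictFDerivAt_pi.2 fun s =>
      ((hO x hx).2.2.2.2.1 s).1.hasStrictFDerivAt)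
      (linearIndependent_iff_surjective.1 (hO x hx).2.2.2.2.2)
      (inter_mem (hOo.mem_nhds hx) hV)
  have hlevel : ∀ U ⊆ O, IsOpen U → (∀ z, IsPreconnected {t | t ∈ U ∧ (fun s => g s t) = z}) →
      ∀ x ∈ M ∩ U, {t ∈ M ∩ U | ∀ i, h i t = h i x} = crOrbit (M ∩ U) x := by
    intro U hUO hU hpre x hx
    refine level_eq_crOrbit hU (fun t ht => (hO t (hUO ht)).1.1)
      (fun t ht => (hO t (hUO ht.2)).2.1.1 ht.1) (fun y hy V hV => ?_) hx ?_
    · have hyO := hUO hy.2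
      refine eventually_mem_crOrbit_of_rank hn hM ha hq ⟨hy.1, (hO y hyO).2.2.1⟩ (hO y hyO).1.1 ?_
        (hO y hyO).2.2.2.1 hV
      filter_upwards [hOo.mem_nhds hyO] with t ht
      exact (hO t ht).2.1.1
    -- Inside the box, a level set of the invariants in `M` is a level set of the defining functions
    -- together with the real parts of the invariants, because their imaginary parts vanish on `M`.
    · convert hpre (fun s => g s x) using 1
      ext t
      constructor
      · rintro ⟨⟨h1, h2⟩, h3⟩
        refine ⟨h2, funext ?_⟩
        rintro (j | i)
        · exact ((hO t (hUO h2)).2.1.2.1 h1 j).trans ((hO x (hUO hx.2)).2.1.2.1 hx.1 j).symm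
        · exact congrArg Complex.re (h3 i)
      · rintro ⟨h1, h2⟩
        have h3 : t ∈ M := (hO t (hUO h1)).2.1.2.2 fun j =>
          (congrFun h2 (Sum.inl j)).trans ((hO x (hUO hx.2)).2.1.2.1 hx.1 j)
        refine ⟨⟨h3, h1⟩, fun i => Complex.ext (congrFun h2 (Sum.inr i)) ?_⟩
        rw [conj_eq_iff_im.1 ((hO t (hUO h1)).2.1.1 h3 i).symm,
          conj_eq_iff_im.1 ((hO x (hUO hx.2)).2.1.1 hx.1 i).symm]
  obtain ⟨U, hU, hpU, hUO, hpre⟩ := hbox p hpO univ univ_mem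
  have hUO' : U ⊆ O := fun t ht => (hUO ht).1
  have hlocal : ∀ x ∈ M ∩ U, IsLocalCROrbit M x {t ∈ M ∩ U | ∀ i, h i t = h i x} := by
    intro x hx V hV
    -- In a smaller box around `x` the level set is again connected, hence equal to the orbit of `x`
    -- there; this is what representing the local orbit requires.
    obtain ⟨U', hU', hxU', hU'O, hpre'⟩ := hbox x (hUO' hx.2) (U ∩ V)
      (inter_mem (hU.mem_nhds hx.2) hV)
    refine ⟨U', hU', hxU', fun t ht => (hU'O ht).2.2, ?_⟩
    rw [← hlevel U' (fun t ht => (hU'O ht).1) hU' hpre' x ⟨hx.1, hxU'⟩]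
    ext t
    exact ⟨fun ht => ⟨⟨ht.1.1.1, ht.2⟩, ht.1.2⟩,
      fun ht => ⟨⟨⟨ht.1.1, (hU'O ht.1.2).2.1⟩, ht.2⟩, ht.1.2⟩⟩
  refine ⟨⟨{t ∈ M ∩ U | ∀ i, h i t = h i p}, d + q', by omega, fun x hx => ?_,
    hlocal p ⟨hp.1, hpU⟩⟩, U, h, hU, hpU,
    fun i x hx => isComplexRegularAt_of_regAt ((hO x (hUO' hx)).1.1 i) ((hO x (hUO' hx)).1.2 i),
    fun x hx => (hO x (hUO' hx)).2.2.2.1, fun x hx => (hO x (hUO' hx.2)).2.1.1 hx.1,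
    fun c x hx => ?_⟩
  · obtain ⟨⟨hxM, hxU⟩, hxh⟩ := hx
    have hxO := hUO' hxU
    have hfd : ∀ s, fderiv ℝ (fun t => g s t - g s x) x = fderiv ℝ (g s) x := fun s => fderiv_sub_const _
    refine ⟨fun s t => g (finSumFinEquiv.symm s) t - g (finSumFinEquiv.symm s) x, fun s => ?_, ?_, ?_⟩
    · exact isRealRegularAt_iff.2 (((hO x hxO).2.2.2.2.1 _).sub (regAt_const _ _))
    · simp only [hfd]
      exact (hO x hxO).2.2.2.2.2.comp _ finSumFinEquiv.symm.injective
    · filter_upwards [hU.mem_nhds hxU] with t ht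
      have htO := hUO' ht
      have e1 : (∀ s : Fin (d + q'), g (finSumFinEquiv.symm s) t - g (finSumFinEquiv.symm s) x = 0) ↔
          ∀ s, g s t = g s x := by
        rw [finSumFinEquiv.symm.surjective.forall]
        simp only [sub_eq_zero]
      rw [e1, Sum.forall]
      have e2 : ∀ j, r j x = 0 := (hO x hxO).2.1.2.1 hxM
      constructor
      · rintro ⟨⟨h1, -⟩, h3⟩
        exact ⟨fun j => ((hO t htO).2.1.2.1 h1 j).trans (e2 j).symm,
          fun i => congrArg Complex.re ((h3 i).trans (hxh i).symm)⟩
      · rintro ⟨h1, h2⟩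
        have h3 : t ∈ M := (hO t htO).2.1.2.2 fun j => (h1 j).trans (e2 j)
        refine ⟨⟨h3, ht⟩, fun i => (Complex.ext (h2 i) ?_).trans (hxh i)⟩
        rw [conj_eq_iff_im.1 ((hO t htO).2.1.1 h3 i).symm,
          conj_eq_iff_im.1 ((hO x hxO).2.1.1 hxM i).symm]
  · have e : {t ∈ M ∩ U | ∀ i, h i t = (c i : ℂ)} = {t ∈ M ∩ U | ∀ i, h i t = h i x} := by
      simp only [hx.2]
    rw [e]
    exact ⟨hlevel U hUO' hU hpre x hx.1, hlocal x hx.1⟩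

end SegreCR

end

theorem corollary2p8p5 (κ : SegreCR.Regularity) (n m d : ℕ) (hn : n = m + d) (hm : 1 ≤ m)
    (hd : 1 ≤ d) (M : Set (Fin n → ℂ)) (hconn : IsConnected M)
    (hM : SegreCR.IsGenericSubmanifold κ M d) :
    ∃ (E : Set (Fin n → ℂ)) (ν μ : ℕ) (e : ℕ → ℕ) (dM d₂ : ℕ),
      SegreCR.IsProperSubvariety κ M E ∧
      μ = ν + 1 ∧ ν ≤ d + 1 ∧
      dM = ∑ i ∈ Finset.Icc 3 μ, e i ∧ dM + d₂ = d ∧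
      ∀ p ∈ M \ E,
        SegreCR.HasComplexifiedSegreMultitype M p m d μ e ∧
        SegreCR.HasSegreMultitype M p m d ν (fun k => if k ≤ 1 then m else e (k + 1)) ∧
        SegreCR.HasCROrbitDim κ M p (2 * m + dM) ∧
        ∃ (U : Set (Fin n → ℂ)) (h : Fin d₂ → (Fin n → ℂ) → ℂ),
          IsOpen U ∧ p ∈ U ∧
          (∀ i, ∀ x ∈ U, SegreCR.IsComplexRegularAt κ (h i) x) ∧
          (∀ x ∈ U, LinearIndependent ℂ (fun i => fderiv ℂ (h i) x)) ∧
          (∀ x ∈ M ∩ U, ∀ i, h i x = star (h i x)) ∧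
          ∀ c : Fin d₂ → ℝ, ∀ q ∈ {x ∈ M ∩ U | ∀ i, h i x = (c i : ℂ)},
            {x ∈ M ∩ U | ∀ i, h i x = (c i : ℂ)} = SegreCR.crOrbit (M ∩ U) q ∧
            SegreCR.IsLocalCROrbit M q {x ∈ M ∩ U | ∀ i, h i x = (c i : ℂ)} := by
  obtain ⟨E, a, hE, ⟨p₀, hp₀, C₀, ha₀⟩, ha⟩ := SegreCR.exists_generic_ranks hn hM hconn.nonempty
  have hR := C₀.isReflexive hn hM.1 hp₀
  have hmono : ∀ k, a k ≤ a (k + 1) := fun k => by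
    rw [ha₀, ha₀]; exact hR.genericRank_segreChain_le_succ k
  have hle : ∀ k, a k ≤ 2 * m + d := fun k => by
    rw [ha₀]; exact hR.genericRank_segreChain_le k
  have h2 : a 2 = 2 * m := by rw [ha₀]; exact hR.genericRank_segreChain_two
  obtain ⟨μ, hμ2, hμd, hlt, hge⟩ := SegreCR.exists_stable_index hmono h2 hle fun k => by
    simp only [ha₀]; exact hR.genericRank_segreChain_stall k
  have hmono' : Monotone a := monotone_nat_of_le_succ hmono
  have hmax : ∀ k, a k ≤ a μ := fun k =>
    (le_total k μ).elim (fun h => hmono' h) fun h => (hge k h).le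
  -- The sum telescopes from `a 2 = 2m`; truncated subtraction is harmless because `a` is monotone.
  have hsum : ∀ μ, 2 ≤ μ → ∑ i ∈ Finset.Icc 3 μ, (a i - a (i - 1)) = a μ - 2 * m := by
    intro μ hμ
    induction μ, hμ using Nat.le_induction with
    | base => simp [h2]
    | succ k hk ih =>
      rw [Finset.sum_Icc_succ_top (by omega), ih, Nat.add_sub_cancel]
      have e1 := hmono k
      have e2 := hmono' hk
      omega
  have hμm : 2 * m ≤ a μ := h2 ▸ hmono' hμ2
  have hμle := hle μ
  have hdim : 2 * m + (a μ - 2 * m) = a μ := by omega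
  -- `d_M` is the excess of the final rank over `2m`. The number of invariants is the codimension
  -- `2m + d - a μ` of the orbits in the complexification.
  refine ⟨E, μ - 1, μ, fun k => a k - a (k - 1), a μ - 2 * m, d - (a μ - 2 * m), hE, by omega,
    by omega, (hsum μ hμ2).symm, by omega, fun p hp => ?_⟩
  obtain ⟨h3, h4⟩ := SegreCR.hasSegreMultitype_of_ranks hn hm hM hp.1 (ha p hp) hμ2 hlt hge
  obtain ⟨h5, h6⟩ := SegreCR.exists_foliation (q := d - (a μ - 2 * m)) hn hM hE ha hmax
    (hmono' (by omega)) (by omega) hp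
  rw [hdim]
  exact ⟨h3, h4, h5, h6⟩
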